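/- **Setting.** Fix $q\ge 0$ and $\sigma=(\sigma_0,\dots,\sigma_q)$ in the interior $\Theta^\circ$ of $\Theta=\{\sigma:\sigma_i\ge 0,\ 0\le i\le q\}$. For $k=1,2,\dots$ consider mixed ANOVA models (the index $k$ is suppressed) $$y=X\beta+\sum_{i=1}^q Z_iv_i+e,$$ with $X$ an $n\times p$ matrix of full rank $p<n$, $Z=(Z_1,\dots,Z_q)$, $v=(v_1',\dots,v_q')'$, and $v_i\sim N(0,\sigma_iI_{r_i})$, $e\sim N(0,\sigma_0I_n)$ mutually independent. Let $\mu=l'\beta+m'v$, $V_0=I_n$, $V_i=Z_iZ_i'$, $\Sigma=\sum_{i=0}^q\sigma_iV_i$, $G=\mathrm{diag}(\sigma_1I_{r_1},\dots,\sigma_qI_{r_q})$, $P=\Sigma^{-1}-\Sigma^{-1}X(X'\Sigma^{-1}X)^{-1}X'\Sigma^{-1}$, $s(\sigma)=\Sigma^{-1}ZGm$, $\tilde\beta=(X'\Sigma^{-1}X)^{-1}X'\Sigma^{-1}y$, and let $t(\sigma)=l'\tilde\beta+s(\sigma)'(y-X\tilde\beta)$ be the BLUP of $\mu$. For $T$ of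 size $n\times(n-p)$ with $\mathrm{rank}\,T=n-p$ and $T'X=0$, let $$l_R(\sigma)=-\tfrac12[\log|T'\Sigma T|+y'Py],\qquad l_P(\sigma)=-\tfrac12[\log|\Sigma|+y'Py],$$ $a_R=\partial l_R/\partial\sigma$, $a_M=\partial l_P/\partial\sigma$, $A_R=E[\partial^2l_R/\partial\sigma^2]$, $A_M=E[\partial^2l_P/\partial\sigma^2]$ (expectations under $\sigma$). Let $\|B\|_2=[\mathrm{tr}(B'B)]^{1/2}$, $d_0=\|P\|_2$, $d_i=\|Z_i'PZ_i\|_2$ for $i\ge 1$, $D=\mathrm{diag}(d_0,\dots,d_q)$ and $d_*=\min_id_i$, all at the true $\sigma$. With $A=A_R$ for REML and $A=A_M$ for ML, put $$g_1=m'(G-GZ'\Sigma^{-1}ZG)m,\quad g_2=[l-X's]'(X'\Sigma^{-1}X)^{-1}[l-X's],\quad g_3=\mathrm{tr}\{[\nabla s]'\Sigma[\nabla s](-A)^{-1}\},$$ where $\nabla s=\partial s/\partial\sigma'$, and $\eta=g_1+g_2+g_3$. Put also $g_{M0,i}=\tfrac12\mathrm{tr}[(\Sigma^{-1}-P)V_i]$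 and $g_{10}=(\partial g_1/\partial\sigma)'A_M^{-1}g_{M0}$. **Assumptions.** As $k\to\infty$: (a) $d_*\to\infty$ and $\limsup\lambda_{\max}(D^{-1}A_RD^{-1})<0$; (b) $|m|=O(1)$; (c) $g_2(\tilde\sigma)\to0$ for every $\tilde\sigma\in\Theta^\circ$; (d) for every $\tilde\sigma\in\Theta$ with $\Sigma(\tilde\sigma)$ nonsingular, $t(\tilde\sigma)=\sum_{j=1}^K\lambda_j(\tilde\sigma)W_j(y)$ with $W_j$ measurable and, for some $\alpha\ge0$, $b>2$, $\delta>0$, with $K=O(d_*^\alpha)$, with $\lambda_j$ twice continuously differentiable on $|\tilde\sigma-\sigma|\le\delta$, and with $\max_jE|W_j|^b$, $\max_j\sup_{\tilde\sigma}|\lambda_j(\tilde\sigma)|$ (over those $\tilde\sigma$), $\sum_j|\partial\lambda_j(\sigma)/\partial\sigma|$ and $\sum_j\sup_{|\tilde\sigma-\sigma|\le\delta}\|\partial^2\lambda_j(\tilde\sigma)/\partial\sigma^2\|$ bounded in $k$. **Estimators.** A REML (ML) estimator is a sequence of measurable statistics $\hat\sigma=\hat\sigma(y)\in\Theta$ with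 $\Sigma(\hat\sigma)$ nonsingular, even and translation invariant ($\hat\sigma(-y)=\hat\sigma(y)=\hat\sigma(y+Xb)$), such that for all $0<\rho<1$ and $g>0$, outside an event of probability $O(d_*^{-g})$, it satisfies $\partial l_R(\hat\sigma)/\partial\sigma=0$ (respectively $\partial l_P(\hat\sigma)/\partial\sigma=0$) and $|D(\hat\sigma-\sigma)|<d_*^{1-\rho}$. For $c_0,\lambda>0$ and $\sigma^*\in\Theta^\circ$, the truncated version of a statistic $x$ is $x$ if $|x|\le c_0d_*^\lambda$ and $\eta(\sigma^*)$ otherwise. Let $\mathrm{MSE}[t(\hat\sigma)]=E[t(\hat\sigma)-\mu]^2$. **Conclusion.** 1. (REML) $E(a_R)=0$ and REML estimators exist. For every REML estimator $\hat\sigma_R$ the MSE of $t(\hat\sigma_R)$ is finite, and for all $c_0,\lambda,\sigma^*$ the truncated version $\hat\eta_R$ of $g_1(\hat\sigma_R)+g_2(\hat\sigma_R)+2g_3(\hat\sigma_R)$ is integrable with $$E(\hat\eta_R)=\mathrm{MSE}[t(\hat\sigma_R)]+o(d_*^{-2}).$$ 2. (ML) Suppose moreover that $p$ is bounded. Then $E(a_M)=-g_{M0}$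 and ML estimators exist. For every ML estimator $\hat\sigma_M$ the MSE of $t(\hat\sigma_M)$ is finite, and for all $c_0,\lambda,\sigma^*$ the truncated version $\hat\eta_M$ of $g_1(\hat\sigma_M)+g_2(\hat\sigma_M)+2g_3(\hat\sigma_M)-g_{10}(\hat\sigma_M)$ is integrable with $$E(\hat\eta_M)=\mathrm{MSE}[t(\hat\sigma_M)]+o(d_*^{-2}),$$ while the truncated version of $g_1(\hat\sigma_M)+g_2(\hat\sigma_M)+2g_3(\hat\sigma_M)$ has expectation $\mathrm{MSE}[t(\hat\sigma_M)]+g_{10}(\sigma)+o(d_*^{-2})$. -/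

import Mathlib

open MeasureTheory ProbabilityTheory Filter Topology Asymptotics
open scoped Matrix

noncomputable section

/-- Known part of the mixed ANOVA model `y = X β + Z₁ v₁ + ⋯ + Z_q v_q + e`, where `X` is `n × p`
and `Z = (Z₁, …, Z_q)` is partitioned into blocks `Z_i` of size `n × r_i`. -/
structure AnovaDesign (q : ℕ) where
  n : ℕ
  p : ℕ
  r : Fin q → ℕ
  X : Matrix (Fin n) (Fin p) ℝ
  Z : Matrix (Fin n) (Σ i : Fin q, Fin (r i)) ℝ

/-- Dispersion parameters `σ = (σ₀, σ₁, …, σ_q)`. -/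
abbrev VarComp (q : ℕ) : Type := Fin (q + 1) → ℝ

/-- The dispersion parameter space `Θ = {σ : σ_i ≥ 0}`. -/
def paramSpace (q : ℕ) : Set (VarComp q) := {σ | ∀ i, 0 ≤ σ i}

/-- The partial derivative `∂f/∂σ_i` at `σ`. -/
def pderiv {q : ℕ} (i : Fin (q + 1)) (f : VarComp q → ℝ) (σ : VarComp q) : ℝ :=
  deriv (fun x => f (Function.update σ i x)) (σ i)

/-- The norm `‖B‖₂ = [tr(B'B)]^{1/2}`. -/
def traceNormTwo {ι κ : Type*} [Fintype ι] [Fintype κ] (B : Matrix ι κ ℝ) : ℝ :=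
  Real.sqrt (Bᵀ * B).trace

namespace AnovaDesign

variable {q : ℕ} (D : AnovaDesign q)

/-- The index set of the stacked random effects vector `v = (v₁', …, v_q')'`. -/
abbrev RE : Type := Σ i : Fin q, Fin (D.r i)

/-- The block `Z_i`. -/
def Zblock (i : Fin q) : Matrix (Fin D.n) (Fin (D.r i)) ℝ :=
  D.Z.submatrix id (fun a => ⟨i, a⟩)

/-- `V₀ = I_n` and `V_i = Z_i Z_i'` for `i ≥ 1`. -/
def V (i : Fin (q + 1)) : Matrix (Fin D.n) (Fin D.n) ℝ :=
  Fin.cases 1 (fun j => D.Zblock j * (D.Zblock j)ᵀ) i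

/-- `G = diag(σ₁ I, …, σ_q I)`. -/
def G (σ : VarComp q) : Matrix D.RE D.RE ℝ := Matrix.diagonal fun a => σ a.1.succ

/-- `Σ = ∑ σ_i V_i`, the covariance matrix of `y`. -/
def Sig (σ : VarComp q) : Matrix (Fin D.n) (Fin D.n) ℝ := ∑ i, σ i • D.V i

/-- The members of `Θ` at which `Σ` is nonsingular, so that the predictor and the
likelihoods are defined. -/
def admissible : Set (VarComp q) := {σ | σ ∈ paramSpace q ∧ (D.Sig σ).PosDef}

/-- `P = Σ⁻¹ - Σ⁻¹ X (X' Σ⁻¹ X)⁻¹ X' Σ⁻¹`. -/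
def P (σ : VarComp q) : Matrix (Fin D.n) (Fin D.n) ℝ :=
  (D.Sig σ)⁻¹ - (D.Sig σ)⁻¹ * D.X * (D.Xᵀ * (D.Sig σ)⁻¹ * D.X)⁻¹ * D.Xᵀ * (D.Sig σ)⁻¹

/-! The Gaussian model. -/

/-- The joint law of `(v, e)`: independent blocks `v_i ~ N(0, σ_i I)` and `e ~ N(0, σ₀ I)`. -/
def noise (σ : VarComp q) : Measure ((D.RE → ℝ) × (Fin D.n → ℝ)) :=
  (Measure.pi fun a : D.RE => gaussianReal 0 (σ a.1.succ).toNNReal).prod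
    (Measure.pi fun _ : Fin D.n => gaussianReal 0 (σ 0).toNNReal)

/-- The observation `y = X β + Z v + e`. -/
def obs (β : Fin D.p → ℝ) (ω : (D.RE → ℝ) × (Fin D.n → ℝ)) : Fin D.n → ℝ :=
  D.X *ᵥ β + D.Z *ᵥ ω.1 + ω.2

/-- The mixed effect `μ = l'β + m'v`. -/
def target (l : Fin D.p → ℝ) (m : D.RE → ℝ) (β : Fin D.p → ℝ)
    (ω : (D.RE → ℝ) × (Fin D.n → ℝ)) : ℝ :=
  l ⬝ᵥ β + m ⬝ᵥ ω.1

/-! The best linear unbiased predictor. -/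

/-- `β̃(σ) = (X' Σ⁻¹ X)⁻¹ X' Σ⁻¹ y`. -/
def betaTilde (σ : VarComp q) (y : Fin D.n → ℝ) : Fin D.p → ℝ :=
  ((D.Xᵀ * (D.Sig σ)⁻¹ * D.X)⁻¹ * D.Xᵀ * (D.Sig σ)⁻¹) *ᵥ y

/-- `s(σ) = Σ⁻¹ Z G m`. -/
def s (m : D.RE → ℝ) (σ : VarComp q) : Fin D.n → ℝ :=
  ((D.Sig σ)⁻¹ * D.Z * D.G σ) *ᵥ m

/-- The BLUP `t(σ, y) = l'β̃ + s(σ)'(y - X β̃)`. -/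
def blup (l : Fin D.p → ℝ) (m : D.RE → ℝ) (σ : VarComp q) (y : Fin D.n → ℝ) : ℝ :=
  l ⬝ᵥ D.betaTilde σ y + D.s m σ ⬝ᵥ (y - D.X *ᵥ D.betaTilde σ y)

/-- `MSE[t(σ̂)] = E[t(σ̂) - μ]²` at the true parameters `(β, σ)`. -/
def mse (l : Fin D.p → ℝ) (m : D.RE → ℝ) (β : Fin D.p → ℝ) (σ : VarComp q)
    (est : (Fin D.n → ℝ) → VarComp q) : ℝ :=
  ∫ ω, (D.blup l m (est (D.obs β ω)) (D.obs β ω) - D.target l m β ω) ^ 2 ∂(D.noise σ)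

/-! Likelihoods, written without their additive constants. -/

/-- The restricted loglikelihood `l_R(σ) = -(1/2) [log |T'ΣT| + y'Py]`. -/
def logLikR (T : Matrix (Fin D.n) (Fin (D.n - D.p)) ℝ) (σ : VarComp q) (y : Fin D.n → ℝ) : ℝ :=
  -(1 / 2) * (Real.log (Tᵀ * D.Sig σ * T).det + y ⬝ᵥ (D.P σ *ᵥ y))

/-- The profile loglikelihood `l_P(σ) = -(1/2) [log |Σ| + y'Py]`. -/
def logLikP (σ : VarComp q) (y : Fin D.n → ℝ) : ℝ :=
  -(1 / 2) * (Real.log (D.Sig σ).det + y ⬝ᵥ (D.P σ *ᵥ y))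

/-- `A(σ) = E[∂² l(σ)/∂σ²]`, the expectation being taken under the parameter `σ`. The loglikelihoods
above are invariant under `y ↦ y + X b`, so `A` does not depend on `β`; it is computed at
`β = 0`. -/
def expHessian (lik : VarComp q → (Fin D.n → ℝ) → ℝ) (σ : VarComp q) :
    Matrix (Fin (q + 1)) (Fin (q + 1)) ℝ :=
  Matrix.of fun i j =>
    ∫ ω, pderiv i (pderiv j fun τ => lik τ (D.obs 0 ω)) σ ∂(D.noise σ)

/-- `A_R`. -/
def AR (T : Matrix (Fin D.n) (Fin (D.n - D.p)) ℝ) (σ : VarComp q) :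
    Matrix (Fin (q + 1)) (Fin (q + 1)) ℝ := D.expHessian (D.logLikR T) σ

/-- `A_M`. -/
def AM (σ : VarComp q) : Matrix (Fin (q + 1)) (Fin (q + 1)) ℝ := D.expHessian D.logLikP σ

/-! Normalizing constants. -/

/-- `d_i = ‖Z_i' P Z_i‖₂`, with `Z₀ = I_n`. -/
def d (σ : VarComp q) (i : Fin (q + 1)) : ℝ :=
  Fin.cases (traceNormTwo (D.P σ))
    (fun j => traceNormTwo ((D.Zblock j)ᵀ * D.P σ * D.Zblock j)) i

/-- `d_* = min_i d_i`. -/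
def dstar (σ : VarComp q) : ℝ := ⨅ i, D.d σ i

/-! The terms of the MSE approximation and of its estimators. -/

/-- `g₁(σ) = m'(G - G Z' Σ⁻¹ Z G) m`. -/
def g1 (m : D.RE → ℝ) (σ : VarComp q) : ℝ :=
  m ⬝ᵥ ((D.G σ - D.G σ * D.Zᵀ * (D.Sig σ)⁻¹ * D.Z * D.G σ) *ᵥ m)

/-- `g₂(σ) = [l - X's(σ)]' (X' Σ⁻¹ X)⁻¹ [l - X's(σ)]`. -/
def g2 (l : Fin D.p → ℝ) (m : D.RE → ℝ) (σ : VarComp q) : ℝ :=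
  (l - D.Xᵀ *ᵥ D.s m σ) ⬝ᵥ ((D.Xᵀ * (D.Sig σ)⁻¹ * D.X)⁻¹ *ᵥ (l - D.Xᵀ *ᵥ D.s m σ))

/-- The `n × (q+1)` matrix `∇s(σ) = ∂s(σ)/∂σ'`. -/
def gradS (m : D.RE → ℝ) (σ : VarComp q) : Matrix (Fin D.n) (Fin (q + 1)) ℝ :=
  Matrix.of fun a i => pderiv i (fun τ => D.s m τ a) σ

/-- `g₃(σ) = tr{[∇s]' Σ [∇s] (-A)⁻¹}`, where `A = A(σ)` is the (negative definite) expected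
Hessian, so that `-A` is the information matrix. -/
def g3 (A : VarComp q → Matrix (Fin (q + 1)) (Fin (q + 1)) ℝ) (m : D.RE → ℝ)
    (σ : VarComp q) : ℝ :=
  ((D.gradS m σ)ᵀ * D.Sig σ * D.gradS m σ * (-(A σ))⁻¹).trace

/-- `g_{M0,i} = (1/2) tr[(Σ⁻¹ - P) V_i]`. -/
def gM0 (σ : VarComp q) (i : Fin (q + 1)) : ℝ :=
  (1 / 2) * (((D.Sig σ)⁻¹ - D.P σ) * D.V i).trace

/-- `g₁₀ = (∂g₁/∂σ)' A_M⁻¹ g_{M0}`. -/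
def g10 (m : D.RE → ℝ) (σ : VarComp q) : ℝ :=
  (fun i => pderiv i (D.g1 m) σ) ⬝ᵥ ((D.AM σ)⁻¹ *ᵥ D.gM0 σ)

/-- `η = g₁ + g₂ + g₃`. -/
def eta (A : VarComp q → Matrix (Fin (q + 1)) (Fin (q + 1)) ℝ) (l : Fin D.p → ℝ)
    (m : D.RE → ℝ) (σ : VarComp q) : ℝ :=
  D.g1 m σ + D.g2 l m σ + D.g3 A m σ

/-- `g₁ + g₂ + 2 g₃`. -/
def etaTwo (A : VarComp q → Matrix (Fin (q + 1)) (Fin (q + 1)) ℝ) (l : Fin D.p → ℝ)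
    (m : D.RE → ℝ) (σ : VarComp q) : ℝ :=
  D.g1 m σ + D.g2 l m σ + 2 * D.g3 A m σ

end AnovaDesign

/-- The value `x` if `|x| ≤ bound`, and the value `fallback` otherwise. -/
def truncateAt (bound fallback x : ℝ) : ℝ := if |x| ≤ bound then x else fallback

/-- The sequence `est` of statistics is a (consistent) solution of the score equations
`∂l(σ̂)/∂σ = 0` for the sequence of criterion functions `lik`: it takes values in the parameter
space, is even and translation invariant, and for all `0 < ρ < 1` and `g > 0`, outside an event of
probability `O(d_*^{-g})`, it solves the score equations and satisfies
`|D(σ̂ - σ)| < d_*^{1-ρ}`, where `D = diag(d_0, …, d_q)` and `σ` is the true parameter. -/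
structure IsScoreRoot {q : ℕ} (D : ℕ → AnovaDesign q) (β : ∀ k, Fin (D k).p → ℝ) (σ : VarComp q)
    (lik : ∀ k, VarComp q → (Fin (D k).n → ℝ) → ℝ)
    (est : ∀ k, (Fin (D k).n → ℝ) → VarComp q) : Prop where
  measurable : ∀ k, Measurable (est k)
  mem : ∀ k y, est k y ∈ (D k).admissible
  even : ∀ k y, est k (-y) = est k y
  invariant : ∀ k y (b : Fin (D k).p → ℝ), est k (y + (D k).X *ᵥ b) = est k y
  root : ∀ ρ : ℝ, 0 < ρ → ρ < 1 → ∀ g : ℝ, 0 < g → ∃ c : ℝ, ∀ᶠ k in atTop,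
    ((D k).noise σ).real {ω | ¬ ((∀ i, pderiv i (fun τ => lik k τ ((D k).obs (β k) ω))
          (est k ((D k).obs (β k) ω)) = 0) ∧
        Real.sqrt (∑ i, ((D k).d σ i * (est k ((D k).obs (β k) ω) i - σ i)) ^ 2)
          < (D k).dstar σ ^ (1 - ρ))}
      ≤ c * (D k).dstar σ ^ (-g)

/-- The predictors `t(σ)` have the form `t(σ) = ∑_{j ≤ K} coef_j(σ) W_j(y)` with `K = O(d_*^α)`,
`max_j E|W_j(y)|^b`, `max_j sup_σ |coef_j(σ)|`, `∑_j |∂coef_j(σ)/∂σ|` and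
`∑_j sup_{|σ̃ - σ| ≤ δ} ‖∂²coef_j(σ̃)/∂σ²‖` bounded, for some `α ≥ 0`, `b > 2`, `δ > 0`. -/
def HasBlupExpansion {q : ℕ} (D : ℕ → AnovaDesign q) (β : ∀ k, Fin (D k).p → ℝ) (σ : VarComp q)
    (l : ∀ k, Fin (D k).p → ℝ) (m : ∀ k, (D k).RE → ℝ) : Prop :=
  ∃ (K : ℕ → ℕ) (coef : ∀ k, Fin (K k) → VarComp q → ℝ)
    (W : ∀ k, Fin (K k) → (Fin (D k).n → ℝ) → ℝ)
    (sup2 : ∀ k, Fin (K k) → ℝ) (α b δ C : ℝ),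
    0 ≤ α ∧ 2 < b ∧ 0 < δ ∧
    ((fun k => (K k : ℝ)) =O[atTop] fun k => (D k).dstar σ ^ α) ∧
    (∀ k, ∀ τ ∈ (D k).admissible, ∀ y, (D k).blup (l k) (m k) τ y = ∑ j, coef k j τ * W k j y) ∧
    (∀ k j, Measurable (W k j)) ∧
    (∀ k j, Integrable (fun ω => |W k j ((D k).obs (β k) ω)| ^ b) ((D k).noise σ) ∧
      ∫ ω, |W k j ((D k).obs (β k) ω)| ^ b ∂((D k).noise σ) ≤ C) ∧
    (∀ k j, ∀ τ ∈ (D k).admissible, |coef k j τ| ≤ C) ∧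
    (∀ k, ∑ j, Real.sqrt (∑ i, pderiv i (coef k j) σ ^ 2) ≤ C) ∧
    (∀ k j τ, Real.sqrt (∑ i, (τ i - σ i) ^ 2) ≤ δ →
      ContDiffAt ℝ 2 (coef k j) τ ∧ ∀ i i', |pderiv i (pderiv i' (coef k j)) τ| ≤ sup2 k j) ∧
    (∀ k, ∑ j, sup2 k j ≤ C)

end

noncomputable section
open Matrix Finset Real
open scoped Matrix.Norms.L2Operator
set_option linter.unusedSectionVars false

section LinearAlgebra

variable {ι κ ν : Type*} [Fintype ι] [Fintype κ] [Fintype ν]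

/-- The Euclidean length of a vector given by its coordinates. -/
def vnorm (v : ι → ℝ) : ℝ := sqrt (v ⬝ᵥ v)

lemma dot_self_nonneg_real (v : ι → ℝ) : 0 ≤ v ⬝ᵥ v := sum_nonneg fun i _ => mul_self_nonneg (v i)

lemma vnorm_nonneg (v : ι → ℝ) : 0 ≤ vnorm v := sqrt_nonneg _

lemma vnorm_sq (v : ι → ℝ) : vnorm v ^ 2 = v ⬝ᵥ v := sq_sqrt (dot_self_nonneg_real v)

lemma vnorm_eq_norm (v : ι → ℝ) : vnorm v = ‖WithLp.toLp 2 v‖ := by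
  rw [EuclideanSpace.norm_eq, vnorm]; congr 1; simp [dotProduct, pow_two]

lemma vnorm_zero : vnorm (0 : ι → ℝ) = 0 := by simp [vnorm]

lemma vnorm_add_le (u v : ι → ℝ) : vnorm (u + v) ≤ vnorm u + vnorm v := by
  simpa only [vnorm_eq_norm, WithLp.toLp_add] using norm_add_le (WithLp.toLp 2 u) (WithLp.toLp 2 v)

lemma vnorm_neg (v : ι → ℝ) : vnorm (-v) = vnorm v := by simp [vnorm]

lemma vnorm_sub_le (u v : ι → ℝ) : vnorm (u - v) ≤ vnorm u + vnorm v := by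
  simpa [sub_eq_add_neg, vnorm_neg] using vnorm_add_le u (-v)

lemma vnorm_smul (c : ℝ) (v : ι → ℝ) : vnorm (c • v) = |c| * vnorm v := by simp [vnorm_eq_norm, norm_smul]

lemma vnorm_sum_le {α : Type*} (s : Finset α) (f : α → ι → ℝ) : vnorm (∑ k ∈ s, f k) ≤ ∑ k ∈ s, vnorm (f k) :=
  le_sum_of_subadditive vnorm vnorm_zero.le vnorm_add_le s f

lemma abs_dot_le (u v : ι → ℝ) : |u ⬝ᵥ v| ≤ vnorm u * vnorm v := by
  rw [vnorm_eq_norm, vnorm_eq_norm]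
  convert (abs_real_inner_le_norm (WithLp.toLp 2 u : EuclideanSpace ℝ ι) (WithLp.toLp 2 v)) using 2
  simp [EuclideanSpace.inner_eq_star_dotProduct, dotProduct_comm]

lemma vnorm_mulVec_le [DecidableEq κ] (A : Matrix ι κ ℝ) (v : κ → ℝ) : vnorm (A *ᵥ v) ≤ ‖A‖ * vnorm v := by
  rw [vnorm_eq_norm, vnorm_eq_norm]; exact l2_opNorm_mulVec A (WithLp.toLp 2 v)

lemma abs_dot_mulVec_le [DecidableEq κ] (u : ι → ℝ) (A : Matrix ι κ ℝ) (v : κ → ℝ) :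
    |u ⬝ᵥ A *ᵥ v| ≤ ‖A‖ * vnorm u * vnorm v :=
  (abs_dot_le _ _).trans <| by
    calc _ ≤ vnorm u * (‖A‖ * vnorm v) := mul_le_mul_of_nonneg_left (vnorm_mulVec_le A v) (vnorm_nonneg u)
      _ = _ := by ring

lemma opNorm_le_of_vnorm [DecidableEq κ] (A : Matrix ι κ ℝ) {c : ℝ} (hc : 0 ≤ c)
    (h : ∀ v, vnorm (A *ᵥ v) ≤ c * vnorm v) : ‖A‖ ≤ c := by
  rw [l2_opNorm_def]; refine ContinuousLinearMap.opNorm_le_bound _ hc fun v => ?_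
  have := h v.ofLp
  rw [vnorm_eq_norm, vnorm_eq_norm] at this; exact this

lemma opNorm_tr [DecidableEq ι] [DecidableEq κ] (A : Matrix ι κ ℝ) : ‖Aᵀ‖ = ‖A‖ := by
  rw [← conjTranspose_eq_transpose_of_trivial, l2_opNorm_conjTranspose]

lemma opNorm_one_le [DecidableEq ι] : ‖(1 : Matrix ι ι ℝ)‖ ≤ 1 := opNorm_le_of_vnorm _ zero_le_one fun v => by simp

lemma abs_entry_le_opNorm [DecidableEq κ] [DecidableEq ι] (A : Matrix ι κ ℝ) (i : ι) (j : κ) :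
    |A i j| ≤ ‖A‖ := by
  simpa [vnorm] using abs_dot_mulVec_le (Pi.single i 1) A (Pi.single j 1)

/-! The Frobenius norm. -/

lemma fro_nonneg (A : Matrix ι κ ℝ) : 0 ≤ traceNormTwo A := sqrt_nonneg _

lemma trace_tr_mul_apply (A B : Matrix ι κ ℝ) : (Aᵀ * B).trace = ∑ j, ∑ i, A i j * B i j := by aesop

lemma trace_tr_mul_self_nonneg (A : Matrix ι κ ℝ) : 0 ≤ (Aᵀ * A).trace := by
  rw [trace_tr_mul_apply]; exact sum_nonneg fun j _ => sum_nonneg fun i _ => mul_self_nonneg _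

lemma fro_sq (A : Matrix ι κ ℝ) : traceNormTwo A ^ 2 = (Aᵀ * A).trace :=
  sq_sqrt (trace_tr_mul_self_nonneg A)

lemma fro_eq_vnorm (A : Matrix ι κ ℝ) : traceNormTwo A = vnorm (fun p : κ × ι => A p.2 p.1) := by
  rw [traceNormTwo, vnorm, trace_tr_mul_apply]; simp [dotProduct, Fintype.sum_prod_type]

lemma fro_sq_eq_sum (A : Matrix ι κ ℝ) : traceNormTwo A ^ 2 = ∑ j, vnorm (fun i => A i j) ^ 2 := by
  rw [fro_sq, trace_tr_mul_apply]; simp [vnorm_sq, dotProduct]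

lemma abs_trace_tr_mul_le (A B : Matrix ι κ ℝ) :
    |(Aᵀ * B).trace| ≤ traceNormTwo A * traceNormTwo B := by
  rw [fro_eq_vnorm, fro_eq_vnorm, trace_tr_mul_apply]
  convert abs_dot_le (fun p : κ × ι => A p.2 p.1) (fun p : κ × ι => B p.2 p.1) using 2
  simp [dotProduct, Fintype.sum_prod_type]

lemma fro_tr (A : Matrix ι κ ℝ) : traceNormTwo Aᵀ = traceNormTwo A := by
  rw [traceNormTwo, traceNormTwo, transpose_transpose, trace_mul_comm]

lemma abs_trace_mul_le (A : Matrix ι κ ℝ) (B : Matrix κ ι ℝ) :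
    |(A * B).trace| ≤ traceNormTwo A * traceNormTwo B := by
  have := abs_trace_tr_mul_le Aᵀ B
  rwa [transpose_transpose, fro_tr] at this

lemma fro_add_le (A B : Matrix ι κ ℝ) : traceNormTwo (A + B) ≤ traceNormTwo A + traceNormTwo B := by
  simp only [fro_eq_vnorm]; exact vnorm_add_le _ _

lemma fro_smul (c : ℝ) (A : Matrix ι κ ℝ) : traceNormTwo (c • A) = |c| * traceNormTwo A := by
  simp only [fro_eq_vnorm]; exact vnorm_smul c _

lemma fro_zero : traceNormTwo (0 : Matrix ι κ ℝ) = 0 := by simp [traceNormTwo]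

lemma fro_sum_le {α : Type*} (s : Finset α) (f : α → Matrix ι κ ℝ) :
    traceNormTwo (∑ k ∈ s, f k) ≤ ∑ k ∈ s, traceNormTwo (f k) :=
  le_sum_of_subadditive traceNormTwo fro_zero.le fro_add_le s f

lemma fro_mul_le [DecidableEq κ] (A : Matrix ι κ ℝ) (B : Matrix κ ν ℝ) :
    traceNormTwo (A * B) ≤ ‖A‖ * traceNormTwo B := by
  refine le_of_sq_le_sq ?_ (mul_nonneg (norm_nonneg _) (fro_nonneg _))
  rw [mul_pow, fro_sq_eq_sum, fro_sq_eq_sum, mul_sum]; refine sum_le_sum fun j _ => ?_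
  rw [← mul_pow]; refine pow_le_pow_left₀ (vnorm_nonneg _) ?_ 2
  exact vnorm_mulVec_le A (fun i => B i j)

lemma fro_mul_le' [DecidableEq κ] [DecidableEq ν] (A : Matrix ι κ ℝ) (B : Matrix κ ν ℝ) :
    traceNormTwo (A * B) ≤ traceNormTwo A * ‖B‖ := by
  rw [← fro_tr (A * B), transpose_mul, mul_comm, ← opNorm_tr B, ← fro_tr A]
  exact fro_mul_le _ _

lemma opNorm_le_fro [DecidableEq κ] (A : Matrix ι κ ℝ) : ‖A‖ ≤ traceNormTwo A := by
  refine opNorm_le_of_vnorm _ (fro_nonneg _) fun v => ?_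
  refine le_of_sq_le_sq ?_ (mul_nonneg (fro_nonneg _) (vnorm_nonneg _))
  rw [mul_pow, vnorm_sq, ← fro_tr, fro_sq_eq_sum, sum_mul]; refine sum_le_sum fun i _ => ?_
  rw [← mul_pow, ← pow_two]; have h := abs_le.1 (abs_dot_le (A i) v); exact sq_le_sq' h.1 h.2

lemma vnorm_sq_mulVec_of_symm {A : Matrix ι ι ℝ} (hA : Aᵀ = A) (v : ι → ℝ) :
    vnorm (A *ᵥ v) ^ 2 = v ⬝ᵥ (A * A) *ᵥ v := by
  rw [vnorm_sq, dotProduct_mulVec, ← mulVec_transpose, hA, mulVec_mulVec, dotProduct_comm]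

lemma dot_symm {A : Matrix ι ι ℝ} (hA : Aᵀ = A) (u v : ι → ℝ) : u ⬝ᵥ A *ᵥ v = A *ᵥ u ⬝ᵥ v := by
  rw [dotProduct_mulVec, ← mulVec_transpose, hA]

/-! Inverses of small perturbations of the identity. -/

section Perturbation
variable [DecidableEq ι] {A : Matrix ι ι ℝ}

lemma isUnit_one_add_of_opNorm_le_half (hA : ‖A‖ ≤ 1 / 2) : IsUnit (1 + A) := by
  rw [← mulVec_injective_iff_isUnit]; refine (injective_iff_map_eq_zero ((1 + A).mulVecLin)).2 fun v hv => ?_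
  have hv' : v = -(A *ᵥ v) := by
    simp only [mulVecLin_apply, add_mulVec, one_mulVec] at hv; exact eq_neg_of_add_eq_zero_left hv
  have h1 : vnorm v ≤ 1 / 2 * vnorm v := by
    conv_lhs => rw [hv', vnorm_neg]
    exact (vnorm_mulVec_le A v).trans (mul_le_mul_of_nonneg_right hA (vnorm_nonneg v))
  have h3 := vnorm_sq v
  rw [le_antisymm (by linarith) (vnorm_nonneg v)] at h3; exact dotProduct_self_eq_zero.1 (by linarith)

lemma opNorm_inv_one_add_le (hA : ‖A‖ ≤ 1 / 2) : ‖(1 + A)⁻¹‖ ≤ 2 := by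
  have hu := isUnit_one_add_of_opNorm_le_half hA
  refine opNorm_le_of_vnorm _ zero_le_two fun v => ?_
  set w := (1 + A)⁻¹ *ᵥ v with hw
  have hv : v = w + A *ᵥ w := by
    have : (1 + A) *ᵥ w = v := by rw [hw, mulVec_mulVec, mul_nonsing_inv _ ((isUnit_iff_isUnit_det _).1 hu), one_mulVec]
    rw [← this, add_mulVec, one_mulVec]
  have h1 : vnorm w ≤ vnorm v + vnorm (A *ᵥ w) := by
    have := vnorm_sub_le v (A *ᵥ w)
    rwa [show v - A *ᵥ w = w by rw [hv]; abel_nf] at this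
  have h2 := (vnorm_mulVec_le A w).trans (mul_le_mul_of_nonneg_right hA (vnorm_nonneg w))
  linarith

lemma inv_one_add_eq (hA : ‖A‖ ≤ 1 / 2) : (1 + A)⁻¹ = 1 - A * (1 + A)⁻¹ := by
  have h := mul_nonsing_inv _ ((isUnit_iff_isUnit_det _).1 (isUnit_one_add_of_opNorm_le_half hA))
  rw [add_mul, one_mul] at h; exact eq_sub_of_add_eq h

lemma inv_one_add_eq' (hA : ‖A‖ ≤ 1 / 2) : (1 + A)⁻¹ = 1 - (1 + A)⁻¹ * A := by
  have h := nonsing_inv_mul _ ((isUnit_iff_isUnit_det _).1 (isUnit_one_add_of_opNorm_le_half hA))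
  rw [mul_add, mul_one] at h; exact eq_sub_of_add_eq h

lemma opNorm_inv_one_add_sub_one_le (hA : ‖A‖ ≤ 1 / 2) : ‖(1 + A)⁻¹ - 1‖ ≤ 2 * ‖A‖ := by
  have h : (1 + A)⁻¹ - 1 = -(A * (1 + A)⁻¹) := by nth_rewrite 1 [inv_one_add_eq hA]; abel
  rw [h, norm_neg]
  calc _ ≤ ‖A‖ * ‖(1 + A)⁻¹‖ := l2_opNorm_mul _ _
    _ ≤ ‖A‖ * 2 := mul_le_mul_of_nonneg_left (opNorm_inv_one_add_le hA) (norm_nonneg _)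
    _ = _ := mul_comm _ _

lemma tr_inv_of_symm {B : Matrix ι ι ℝ} (hB : Bᵀ = B) : (B⁻¹)ᵀ = B⁻¹ := by rw [transpose_nonsing_inv, hB]

lemma inv_sub_inv_matrix {B C : Matrix ι ι ℝ} (hB : IsUnit B) (hC : IsUnit C) : B⁻¹ - C⁻¹ = -(B⁻¹ * (B - C) * C⁻¹) := by
  have h2 := mul_nonsing_inv _ ((isUnit_iff_isUnit_det _).1 hC)
  rw [mul_sub, sub_mul, nonsing_inv_mul _ ((isUnit_iff_isUnit_det _).1 hB), one_mul, mul_assoc, h2, mul_one]; abel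

end Perturbation

/-! Positive semidefinite matrices. -/

lemma PosDef.exists_tr_mul_mul_eq_one [DecidableEq ι] {A : Matrix ι ι ℝ} (hA : A.PosDef) :
    ∃ S : Matrix ι ι ℝ, IsUnit S ∧ Sᵀ * A * S = 1 ∧ S * Sᵀ = A⁻¹ := by
  open scoped MatrixOrder in
  obtain ⟨B, hB⟩ := CStarAlgebra.nonneg_iff_eq_star_mul_self.mp hA.posSemidef.nonneg
  rw [star_eq_conjTranspose, conjTranspose_eq_transpose_of_trivial] at hB
  have hdet : IsUnit B.det := by
    have h := (isUnit_iff_isUnit_det _).1 hA.isUnit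
    rw [hB, det_mul] at h; exact isUnit_of_mul_isUnit_right h
  have hdet' : IsUnit Bᵀ.det := by rwa [det_transpose]
  refine ⟨B⁻¹, ?_, ?_, ?_⟩
  · rw [isUnit_iff_isUnit_det]; exact isUnit_nonsing_inv_det _ hdet
  · rw [hB, transpose_nonsing_inv, ← mul_assoc, nonsing_inv_mul _ hdet', one_mul, mul_nonsing_inv _ hdet]
  · rw [hB, Matrix.mul_inv_rev, transpose_nonsing_inv]

lemma psd_tr_mul_mul_same {A : Matrix ι ι ℝ} (hA : A.PosSemidef)
    (B : Matrix ι κ ℝ) : (Bᵀ * A * B).PosSemidef := by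
  simpa [conjTranspose_eq_transpose_of_trivial] using hA.conjTranspose_mul_mul_same B

lemma psd_dot_nonneg {A : Matrix ι ι ℝ} (hA : A.PosSemidef) (v : ι → ℝ) : 0 ≤ v ⬝ᵥ A *ᵥ v := by
  simpa using hA.dotProduct_mulVec_nonneg v

lemma trace_mul_nonneg_of_psd {A B : Matrix ι ι ℝ} (hA : A.PosSemidef)
    (hB : B.PosSemidef) : 0 ≤ (A * B).trace := by
  classical
  open scoped MatrixOrder in
  obtain ⟨C, hC⟩ := CStarAlgebra.nonneg_iff_eq_star_mul_self.mp hB.nonneg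
  rw [star_eq_conjTranspose, conjTranspose_eq_transpose_of_trivial] at hC
  rw [hC, ← mul_assoc, trace_mul_comm, ← mul_assoc]; have := (psd_tr_mul_mul_same hA Cᵀ).trace_nonneg
  positivity

lemma abs_trace_mul_le_of_psd [DecidableEq ι] {K : Matrix ι ι ℝ} (hK : K.PosSemidef)
    (M : Matrix ι ι ℝ) : |(K * M).trace| ≤ K.trace * ‖M‖ := by
  open scoped MatrixOrder in
  obtain ⟨C, hC⟩ := CStarAlgebra.nonneg_iff_eq_star_mul_self.mp hK.nonneg
  rw [star_eq_conjTranspose, conjTranspose_eq_transpose_of_trivial] at hC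
  have h1 : (K * M).trace = (Cᵀ * (C * M)).trace := by rw [hC, mul_assoc]
  rw [h1]; refine (abs_trace_tr_mul_le _ _).trans ?_
  calc _ ≤ traceNormTwo C * (traceNormTwo C * ‖M‖) :=
        mul_le_mul_of_nonneg_left (fro_mul_le' _ _) (fro_nonneg _)
    _ = traceNormTwo C ^ 2 * ‖M‖ := by ring
    _ = _ := by rw [fro_sq, hC]

end LinearAlgebra

section ScoreExpansion

variable {I n : Type*} [Fintype I] [Fintype n] [DecidableEq n] (R : I → Matrix n n ℝ)

/-- The perturbation `∑ x_i R_i` of the identity. -/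
def pert (x : I → ℝ) : Matrix n n ℝ := ∑ i, x i • R i

/-- The inverse of `1 + ∑ x_i R_i`. -/
def resolv (x : I → ℝ) : Matrix n n ℝ := (1 + pert R x)⁻¹

/-- The score of a centred Gaussian vector with covariance `1 + ∑ x_i R_i`. -/
def stdScore (x : I → ℝ) (e : n → ℝ) (i : I) : ℝ :=
  1 / 2 * (e ⬝ᵥ (resolv R x * R i * resolv R x) *ᵥ e - (resolv R x * R i).trace)

/-- Bounds on the coefficient matrices and on their values at a vector `e`. -/
structure PertBounds (θ M : ℝ) (e : n → ℝ) : Prop where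
  symm : ∀ i, (R i)ᵀ = R i
  op : ∀ i, ‖R i‖ ≤ θ
  fro : ∀ i, traceNormTwo (R i) ≤ 1
  vec : ∀ i, vnorm (R i *ᵥ e) ≤ M

variable {R}

lemma pert_tr (hR : ∀ i, (R i)ᵀ = R i) (x : I → ℝ) : (pert R x)ᵀ = pert R x := by simp [pert, transpose_sum, hR]

lemma resolv_tr (hR : ∀ i, (R i)ᵀ = R i) (x : I → ℝ) : (resolv R x)ᵀ = resolv R x :=
  tr_inv_of_symm (by rw [transpose_add, pert_tr hR, transpose_one])

lemma pert_sub (x x' : I → ℝ) : pert R (x - x') = pert R x - pert R x' := by simp [pert, sub_smul, sum_sub_distrib]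

lemma pert_zero : pert R (0 : I → ℝ) = 0 := by simp [pert]

lemma resolv_zero : resolv R (0 : I → ℝ) = 1 := by simp [resolv, pert_zero]

lemma opNorm_pert_le {θ : ℝ} (hop : ∀ i, ‖R i‖ ≤ θ) (x : I → ℝ) : ‖pert R x‖ ≤ θ * ∑ i, |x i| := by
  refine (norm_sum_le _ _).trans ?_
  rw [mul_sum]; refine sum_le_sum fun i _ => ?_
  rw [norm_smul, norm_eq_abs, mul_comm]; exact mul_le_mul_of_nonneg_right (hop i) (abs_nonneg _)

lemma fro_pert_le (hfro : ∀ i, traceNormTwo (R i) ≤ 1) (x : I → ℝ) : traceNormTwo (pert R x) ≤ ∑ i, |x i| := by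
  refine (fro_sum_le _ _).trans (sum_le_sum fun i _ => ?_)
  rw [fro_smul]; exact mul_le_of_le_one_right (abs_nonneg _) (hfro i)

lemma vnorm_pert_mulVec_le {M : ℝ} {v : n → ℝ} (h : ∀ i, vnorm (R i *ᵥ v) ≤ M) (x : I → ℝ) :
    vnorm (pert R x *ᵥ v) ≤ (∑ i, |x i|) * M := by
  rw [pert, sum_mulVec, sum_mul]; refine (vnorm_sum_le _ _).trans (sum_le_sum fun i _ => ?_)
  rw [smul_mulVec, vnorm_smul]; exact mul_le_mul_of_nonneg_left (h i) (abs_nonneg _)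

lemma abs_dot_le' {u v : n → ℝ} {a b : ℝ} (hu : vnorm u ≤ a) (hv : vnorm v ≤ b) :
    |u ⬝ᵥ v| ≤ a * b :=
  (abs_dot_le u v).trans (mul_le_mul hu hv (vnorm_nonneg _) ((vnorm_nonneg _).trans hu))

lemma vnorm_mulVec_le' {A : Matrix n n ℝ} {v : n → ℝ} {a b : ℝ} (hA : ‖A‖ ≤ a)
    (hv : vnorm v ≤ b) : vnorm (A *ᵥ v) ≤ a * b :=
  (vnorm_mulVec_le A v).trans (mul_le_mul hA hv (vnorm_nonneg _) ((norm_nonneg _).trans hA))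

lemma abs_trace_mul_le_of_le {A B : Matrix n n ℝ} {a b : ℝ} (hA : traceNormTwo A ≤ a)
    (hB : traceNormTwo B ≤ b) : |(A * B).trace| ≤ a * b := (abs_trace_mul_le A B).trans
    (mul_le_mul hA hB (fro_nonneg _) ((fro_nonneg _).trans hA))

lemma traceNormTwo_mul_le_of_le {A B : Matrix n n ℝ} {a b : ℝ} (hA : ‖A‖ ≤ a)
    (hB : traceNormTwo B ≤ b) : traceNormTwo (A * B) ≤ a * b := (fro_mul_le A B).trans
    (mul_le_mul hA hB (fro_nonneg _) ((norm_nonneg _).trans hA))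

lemma stdScore_eq (hR : ∀ i, (R i)ᵀ = R i) (x : I → ℝ) (e : n → ℝ) (i : I) :
    stdScore R x e i = 1 / 2 * (resolv R x *ᵥ e ⬝ᵥ R i *ᵥ resolv R x *ᵥ e - (resolv R x * R i).trace) := by
  rw [stdScore, ← mulVec_mulVec, ← mulVec_mulVec, dot_symm (resolv_tr hR x) e]

lemma resolv_eq {θ : ℝ} (hop : ∀ i, ‖R i‖ ≤ θ) {x : I → ℝ} (hx : θ * ∑ i, |x i| ≤ 1 / 2) :
    resolv R x = 1 - pert R x * resolv R x := inv_one_add_eq ((opNorm_pert_le hop x).trans hx)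

lemma resolv_comm {θ : ℝ} (hop : ∀ i, ‖R i‖ ≤ θ) {x : I → ℝ} (hx : θ * ∑ i, |x i| ≤ 1 / 2) :
    resolv R x * pert R x = pert R x * resolv R x := by
  have h1 := resolv_eq hop hx
  have h2 : resolv R x = 1 - resolv R x * pert R x := inv_one_add_eq' ((opNorm_pert_le hop x).trans hx)
  rw [h2] at h1; have := sub_right_injective h1; rw [← h2] at this; exact this

lemma vnorm_mulVec_resolv_sub_le {θ M : ℝ} {e : n → ℝ} (h : PertBounds R θ M e) {x : I → ℝ}
    (hx : θ * ∑ i, |x i| ≤ 1 / 2) (i : I) :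
    vnorm (R i *ᵥ resolv R x *ᵥ e - R i *ᵥ e) ≤ θ * (2 * ((∑ i, |x i|) * M)) := by
  have h1 : R i *ᵥ resolv R x *ᵥ e - R i *ᵥ e = -(R i *ᵥ resolv R x *ᵥ pert R x *ᵥ e) := by
    rw [mulVec_mulVec e (resolv R x), resolv_comm h.op hx, ← mulVec_sub, ← mulVec_neg]; congr 1
    nth_rewrite 1 [resolv_eq h.op hx]; rw [sub_mulVec, one_mulVec]; abel
  rw [h1, vnorm_neg]; refine vnorm_mulVec_le' (h.op i) (vnorm_mulVec_le' ?_ ?_)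
  · exact opNorm_inv_one_add_le ((opNorm_pert_le h.op x).trans hx)
  · exact vnorm_pert_mulVec_le h.vec x

/-- First order expansion of the difference of two values of the score. -/
lemma abs_stdScore_sub_le {θ M : ℝ} {e : n → ℝ} (h : PertBounds R θ M e)
    {x x' : I → ℝ} (hx : θ * ∑ i, |x i| ≤ 1 / 2) (hx' : θ * ∑ i, |x' i| ≤ 1 / 2) (i : I) :
    |stdScore R x e i - stdScore R x' e i + pert R (x - x') *ᵥ e ⬝ᵥ R i *ᵥ e
        - 1 / 2 * (pert R (x - x') * R i).trace|
      ≤ θ * (∑ i, |x i - x' i|) * (∑ i, |x i| + ∑ i, |x' i|) * (9 * M ^ 2 + 2) := by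
  have hop := opNorm_pert_le h.op
  set s := ∑ i, |x i|
  set s' := ∑ i, |x' i|
  set t := ∑ i, |x i - x' i|
  have hs0 : 0 ≤ s := sum_nonneg fun _ _ => abs_nonneg _
  have hs0' : 0 ≤ s' := sum_nonneg fun _ _ => abs_nonneg _
  have ht0 : 0 ≤ t := sum_nonneg fun _ _ => abs_nonneg _
  have hθ := (norm_nonneg _).trans (h.op i)
  have hM := (vnorm_nonneg _).trans (h.vec i)
  set W := resolv R x with hW
  set W' := resolv R x' with hW'
  set Γ := pert R (x - x') with hΓ
  have hWs := resolv_tr h.symm x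
  have hΓop : ‖Γ‖ ≤ θ * t := opNorm_pert_le h.op _
  have hΓf : traceNormTwo Γ ≤ t := fro_pert_le h.fro _
  have hW2 := opNorm_inv_one_add_le ((hop x).trans hx)
  have hW2' : ‖W'‖ ≤ 2 := opNorm_inv_one_add_le ((hop x').trans hx')
  have hW1 : ‖W - 1‖ ≤ 2 * (θ * s) := (opNorm_inv_one_add_sub_one_le ((hop x).trans hx)).trans
    (mul_le_mul_of_nonneg_left (hop x) zero_le_two)
  have hW1' : ‖W' - 1‖ ≤ 2 * (θ * s') := (opNorm_inv_one_add_sub_one_le ((hop x').trans hx')).trans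
    (mul_le_mul_of_nonneg_left (hop x') zero_le_two)
  have hdiff : W - W' = -(W * Γ * W') := by
    have := inv_sub_inv_matrix (isUnit_one_add_of_opNorm_le_half ((hop x).trans hx))
      (isUnit_one_add_of_opNorm_le_half ((hop x').trans hx'))
    rw [hΓ, pert_sub]; simpa [hW, hW', resolv] using this
  set g := W *ᵥ e with hg
  set g' := W' *ᵥ e with hg'
  have b1' := vnorm_mulVec_resolv_sub_le h hx'
  have b2 : vnorm (Γ *ᵥ g' - Γ *ᵥ e) ≤ t * (θ * (2 * (s' * M))) := by
    rw [← mulVec_sub]; exact vnorm_pert_mulVec_le (fun k => by rw [mulVec_sub]; exact b1' k) _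
  have b3 : vnorm (Γ *ᵥ e) ≤ t * M := vnorm_pert_mulVec_le h.vec _
  have b4 : vnorm (Γ *ᵥ g') ≤ t * (2 * M) := by
    have := vnorm_add_le (Γ *ᵥ e) (Γ *ᵥ g' - Γ *ᵥ e)
    rw [add_sub_cancel] at this
    have h5 : t * (θ * (2 * (s' * M))) ≤ t * M := mul_le_mul_of_nonneg_left (by nlinarith) ht0
    linarith
  set e1 := (Γ *ᵥ g' - Γ *ᵥ e) + (W - 1) *ᵥ Γ *ᵥ g' with he1
  set e2 := (R i *ᵥ g - R i *ᵥ e) + (R i *ᵥ g' - R i *ᵥ e) with he2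
  have c2 := (vnorm_add_le _ _).trans (add_le_add (vnorm_mulVec_resolv_sub_le h hx i) (b1' i))
  have c3 : vnorm ((2 : ℝ) • (R i *ᵥ e) + e2) ≤ 4 * M := by
    have h1 := vnorm_add_le ((2 : ℝ) • (R i *ᵥ e)) e2
    rw [vnorm_smul, abs_two] at h1; have h2 := h.vec i
    have : θ * (2 * (s * M)) + θ * (2 * (s' * M)) ≤ 2 * M := by nlinarith
    linarith
  have q1 : g ⬝ᵥ R i *ᵥ g - g' ⬝ᵥ R i *ᵥ g' = -((Γ *ᵥ e + e1) ⬝ᵥ ((2 : ℝ) • (R i *ᵥ e) + e2)) := by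
    have h1 : Γ *ᵥ e + e1 = -(g - g') := by
      rw [hg, hg', ← sub_mulVec, hdiff, neg_mulVec, neg_neg, he1, hg',
        sub_mulVec, one_mulVec, mul_assoc, ← mulVec_mulVec, ← mulVec_mulVec]
      abel
    have h2 : (2 : ℝ) • (R i *ᵥ e) + e2 = R i *ᵥ (g + g') := by rw [he2, mulVec_add, two_smul]; abel
    rw [h1, h2, neg_dotProduct, neg_neg, mulVec_add, dotProduct_add, sub_dotProduct,
      sub_dotProduct, dot_symm (h.symm i) g' g, dotProduct_comm (R i *ᵥ g') g]
    ring
  have q2 : |g ⬝ᵥ R i *ᵥ g - g' ⬝ᵥ R i *ᵥ g' + 2 * (Γ *ᵥ e ⬝ᵥ R i *ᵥ e)| ≤ θ * t * (s + s') * (18 * M ^ 2) := by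
    have : g ⬝ᵥ R i *ᵥ g - g' ⬝ᵥ R i *ᵥ g' + 2 * Γ *ᵥ e ⬝ᵥ R i *ᵥ e
        = -(Γ *ᵥ e ⬝ᵥ e2 + e1 ⬝ᵥ ((2 : ℝ) • (R i *ᵥ e) + e2)) := by
      rw [q1]; simp only [add_dotProduct, dotProduct_add, dotProduct_smul, smul_eq_mul]; ring
    rw [this, abs_neg]; have h1 := abs_dot_le' b3 c2
    have h2 := abs_dot_le' ((vnorm_add_le _ _).trans (add_le_add b2 (vnorm_mulVec_le' hW1 b4))) c3
    have h3 : t * M * (θ * (2 * (s * M)) + θ * (2 * (s' * M)))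
        + (t * (θ * (2 * (s' * M))) + 2 * (θ * s) * (t * (2 * M))) * (4 * M)
        = θ * t * (18 * s + 10 * s') * M ^ 2 := by ring
    have h4 : θ * t * (18 * s + 10 * s') * M ^ 2 ≤ θ * t * (s + s') * (18 * M ^ 2) := by
      have : 0 ≤ θ * t * s' * M ^ 2 := by positivity
      nlinarith
    exact (abs_add_le _ _).trans (by linarith)
  have t1 : (W * R i).trace - (W' * R i).trace + (Γ * R i).trace
      = -(((W - 1) * Γ * (W' * R i)).trace + (Γ * ((W' - 1) * R i)).trace) := by
    rw [← trace_sub, ← sub_mul, hdiff, ← trace_add, ← trace_add, ← trace_neg]; congr 1; noncomm_ring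
  have t2 : |(W * R i).trace - (W' * R i).trace + (Γ * R i).trace| ≤ θ * t * (s + s') * 4 := by
    rw [t1, abs_neg]
    have h1 := abs_trace_mul_le_of_le (traceNormTwo_mul_le_of_le hW1 hΓf) (traceNormTwo_mul_le_of_le hW2' (h.fro i))
    have h2 := abs_trace_mul_le_of_le hΓf (traceNormTwo_mul_le_of_le hW1' (h.fro i))
    have : 0 ≤ θ * t * s' := by positivity
    exact (abs_add_le _ _).trans (by nlinarith)
  rw [stdScore_eq h.symm, stdScore_eq h.symm]
  have key : 1 / 2 * (g ⬝ᵥ R i *ᵥ g - (W * R i).trace)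
      - 1 / 2 * (g' ⬝ᵥ R i *ᵥ g' - (W' * R i).trace) + Γ *ᵥ e ⬝ᵥ R i *ᵥ e - 1 / 2 * (Γ * R i).trace
      = 1 / 2 * (g ⬝ᵥ R i *ᵥ g - g' ⬝ᵥ R i *ᵥ g' + 2 * Γ *ᵥ e ⬝ᵥ R i *ᵥ e)
        - 1 / 2 * ((W * R i).trace - (W' * R i).trace + (Γ * R i).trace) := by ring
  rw [key]; refine (abs_sub _ _).trans ?_
  rw [abs_mul, abs_mul, abs_of_pos (by norm_num)]; linarith

set_option maxHeartbeats 800000 in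
/-- Second order expansion of the score at the origin. -/
lemma abs_stdScore_sub_quadratic_le {θ M : ℝ} {e : n → ℝ} (h : PertBounds R θ M e)
    {x : I → ℝ} (hx : θ * ∑ i, |x i| ≤ 1 / 2) (i : I) :
    |stdScore R x e i - (stdScore R 0 e i - (pert R x *ᵥ e ⬝ᵥ R i *ᵥ e - 1 / 2 * (pert R x * R i).trace)
        + (pert R x *ᵥ pert R x *ᵥ e ⬝ᵥ R i *ᵥ e + 1 / 2 * pert R x *ᵥ e ⬝ᵥ R i *ᵥ pert R x *ᵥ e
          - 1 / 2 * (pert R x * (pert R x * R i)).trace))| ≤ θ ^ 2 * (∑ i, |x i|) ^ 3 * (5 * M ^ 2 + 1) := by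
  have hop := opNorm_pert_le h.op x
  set s := ∑ i, |x i|
  have hs0 : 0 ≤ s := sum_nonneg fun _ _ => abs_nonneg _
  have hθ := (norm_nonneg _).trans (h.op i)
  have hM := (vnorm_nonneg _).trans (h.vec i)
  have hu : 0 ≤ θ * s := by positivity
  set W := resolv R x
  set A := pert R x
  have hW2 := opNorm_inv_one_add_le (hop.trans hx)
  have hAf : traceNormTwo A ≤ s := fro_pert_le h.fro _
  have hW1 : W = 1 - A * W := resolv_eq h.op hx
  have hcomm := resolv_comm h.op hx
  have hW3 : W = 1 - A + A * A - A * A * W * A := by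
    rw [mul_assoc (A * A), hcomm]; have h2 : A * W = A - A * (A * W) := by nth_rewrite 1 [hW1]; noncomm_ring
    have h3 : A * (A * W) = A * A - A * (A * (A * W)) := by nth_rewrite 1 [h2]; noncomm_ring
    have h4 : A * A * (A * W) = A * (A * (A * W)) := by noncomm_ring
    rw [h4]; nth_rewrite 1 [hW1]; nth_rewrite 1 [h2]; nth_rewrite 1 [h3]; abel
  set p := A *ᵥ e with hp
  set q := A *ᵥ p with hq
  set r := A *ᵥ A *ᵥ W *ᵥ p with hr
  have hg : W *ᵥ e = e - p + q - r := by
    nth_rewrite 1 [hW3]; simp only [sub_mulVec, add_mulVec, one_mulVec, hp, hq, hr, mulVec_mulVec, mul_assoc]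
  have bp : vnorm p ≤ s * M := vnorm_pert_mulVec_le h.vec _
  have bq := vnorm_mulVec_le' hop bp
  have br : vnorm r ≤ θ * s * (θ * s * (2 * (s * M))) :=
    vnorm_mulVec_le' hop (vnorm_mulVec_le' hop (vnorm_mulVec_le' hW2 bp))
  have quad : (W *ᵥ e) ⬝ᵥ R i *ᵥ W *ᵥ e
      = e ⬝ᵥ R i *ᵥ e - 2 * p ⬝ᵥ R i *ᵥ e + 2 * q ⬝ᵥ R i *ᵥ e + p ⬝ᵥ R i *ᵥ p
        + (-2 * r ⬝ᵥ R i *ᵥ e - 2 * p ⬝ᵥ R i *ᵥ q + 2 * p ⬝ᵥ R i *ᵥ r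
          + q ⬝ᵥ R i *ᵥ q - 2 * q ⬝ᵥ R i *ᵥ r + r ⬝ᵥ R i *ᵥ r) := by
    rw [hg]; simp only [mulVec_sub, mulVec_add, dotProduct_sub, dotProduct_add, sub_dotProduct, add_dotProduct]
    have s1 : ∀ u v : n → ℝ, u ⬝ᵥ R i *ᵥ v = v ⬝ᵥ R i *ᵥ u := fun u v => by
      rw [(dot_symm (h.symm i)) u v, dotProduct_comm]
    rw [s1 e p, s1 e q, s1 e r, s1 q p, s1 r p, s1 r q]; ring
  have tr : (W * R i).trace = (R i).trace - (A * R i).trace + (A * (A * R i)).trace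
      - (A * A * A * (W * R i)).trace := by
    nth_rewrite 1 [hW3]; rw [← trace_sub, ← trace_add, ← trace_sub, mul_assoc (A * A) W, hcomm]; congr 1; noncomm_ring
  have z0 : stdScore R 0 e i = 1 / 2 * (e ⬝ᵥ R i *ᵥ e - (R i).trace) := by simp [stdScore, resolv_zero]
  rw [stdScore_eq h.symm, z0, quad, tr]; have hRi := h.op i; have k1 := abs_dot_le' br (h.vec i)
  have k2 := abs_dot_le' bp (vnorm_mulVec_le' hRi bq)
  have k3 := abs_dot_le' bp (vnorm_mulVec_le' hRi br)
  have k4 := abs_dot_le' bq (vnorm_mulVec_le' hRi bq)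
  have k5 := abs_dot_le' bq (vnorm_mulVec_le' hRi br)
  have k6 := abs_dot_le' br (vnorm_mulVec_le' hRi br)
  have k7 : |(A * A * A * (W * R i)).trace| ≤ (θ * s) * ((θ * s) * s) * (2 * 1) := by
    refine abs_trace_mul_le_of_le ?_ (traceNormTwo_mul_le_of_le hW2 (h.fro i))
    rw [mul_assoc]; exact traceNormTwo_mul_le_of_le hop (traceNormTwo_mul_le_of_le hop hAf)
  set u := θ * s with hu_def
  have hsu := hs0
  have B : 0 ≤ u ^ 2 * s * M ^ 2 := by positivity
  have e1 : u * (u * (2 * (s * M))) * M = 2 * (u ^ 2 * s * M ^ 2) := by ring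
  have e2 : s * M * (θ * (u * (s * M))) = u ^ 2 * s * M ^ 2 := by rw [hu_def]; ring
  have e3 : s * M * (θ * (u * (u * (2 * (s * M))))) = 2 * u * (u ^ 2 * s * M ^ 2) := by rw [hu_def]; ring
  have e4 : u * (s * M) * (θ * (u * (s * M))) = u * (u ^ 2 * s * M ^ 2) := by rw [hu_def]; ring
  have e5 : u * (s * M) * (θ * (u * (u * (2 * (s * M))))) = 2 * u ^ 2 * (u ^ 2 * s * M ^ 2) := by rw [hu_def]; ring
  have e6 : u * (u * (2 * (s * M))) * (θ * (u * (u * (2 * (s * M)))))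
      = 4 * u ^ 3 * (u ^ 2 * s * M ^ 2) := by rw [hu_def]; ring
  have f3 := mul_le_mul_of_nonneg_right (by linarith) B
  have f4 : u * (u ^ 2 * s * M ^ 2) ≤ 1 / 2 * (u ^ 2 * s * M ^ 2) := mul_le_mul_of_nonneg_right (by linarith) B
  have f5 : 2 * u ^ 2 * (u ^ 2 * s * M ^ 2) ≤ 1 / 2 * (u ^ 2 * s * M ^ 2) := mul_le_mul_of_nonneg_right (by nlinarith) B
  have f6 : 4 * u ^ 3 * (u ^ 2 * s * M ^ 2) ≤ 1 / 2 * (u ^ 2 * s * M ^ 2) :=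
    mul_le_mul_of_nonneg_right (by nlinarith [mul_nonneg hu hu]) B
  have e7 : θ ^ 2 * s ^ 3 * (5 * M ^ 2 + 1) = 5 * (u ^ 2 * s * M ^ 2) + u * (u * s) := by rw [hu_def]; ring
  rw [e7, abs_le]; rw [abs_le] at k1 k2 k3 k4 k5 k6 k7
  constructor <;> linarith

end ScoreExpansion

section Contraction

variable {I : Type*} [Fintype I] [DecidableEq I]

lemma norm_mulVec_le_card {J : Matrix I I ℝ} {c : ℝ} (hJ : ∀ i j, |J i j| ≤ c) (v : I → ℝ) :
    ‖J *ᵥ v‖ ≤ Fintype.card I * c * ‖v‖ := by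
  rcases isEmpty_or_nonempty I with h | ⟨⟨i₀⟩⟩
  · simp [Subsingleton.elim (J *ᵥ v) 0]
  have hc := (abs_nonneg _).trans (hJ i₀ i₀)
  refine (pi_norm_le_iff_of_nonneg (by positivity)).2 fun i => ?_
  rw [mulVec, dotProduct, norm_eq_abs]; refine (abs_sum_le_sum_abs _ _).trans ?_
  calc _ ≤ ∑ _j : I, c * ‖v‖ := sum_le_sum fun j _ => by
        rw [abs_mul]; exact mul_le_mul (hJ i j) (norm_le_pi_norm v j) (abs_nonneg _) hc
    _ = _ := by simp [mul_assoc]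

/-- A quasi-Newton iteration started at the origin converges to a root. -/
lemma exists_tendsto_quasiNewton {f : (I → ℝ) → I → ℝ} {J L : Matrix I I ℝ} {c η r : ℝ}
    (hJL : J * L = 1) (hLJ : L * J = 1) (hJ : ∀ i j, |J i j| ≤ c) (hr : 0 ≤ r)
    (hf : ∀ x x' : I → ℝ, ‖x‖ ≤ r → ‖x'‖ ≤ r → ‖f x - f x' + L *ᵥ (x - x')‖ ≤ η * ‖x - x'‖)
    (hη : Fintype.card I * c * η ≤ 1 / 2) (hc : 0 ≤ Fintype.card I * c) (h0 : Fintype.card I * c * ‖f 0‖ ≤ r / 2) :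
    ∃ x, Tendsto (fun j => (fun x => x + J *ᵥ f x)^[j] 0) atTop (𝓝 x) ∧ f x = 0 ∧
      ‖x‖ ≤ 2 * (Fintype.card I * c * ‖f 0‖) := by
  set Φ : (I → ℝ) → I → ℝ := fun x => x + J *ᵥ f x with hΦ
  set s := Metric.closedBall (0 : I → ℝ) r with hs
  have hlip : ∀ x ∈ s, ∀ x' ∈ s, ‖Φ x - Φ x'‖ ≤ 1 / 2 * ‖x - x'‖ := by
    intro x hx x' hx'
    have h1 : Φ x - Φ x' = J *ᵥ (f x - f x' + L *ᵥ (x - x')) := by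
      rw [mulVec_add, mulVec_mulVec, hJL, one_mulVec, mulVec_sub]; simp only [hΦ]; abel
    rw [h1]; refine (norm_mulVec_le_card hJ _).trans ?_
    have := hf x x' (by simpa [hs] using hx) (by simpa [hs] using hx')
    calc _ ≤ Fintype.card I * c * (η * ‖x - x'‖) := mul_le_mul_of_nonneg_left this hc
      _ = (Fintype.card I * c * η) * ‖x - x'‖ := by ring
      _ ≤ _ := mul_le_mul_of_nonneg_right hη (norm_nonneg _)
  have h0s : 0 ∈ s := by simp [hs, hr]
  have hΦ0 : ‖Φ 0‖ ≤ Fintype.card I * c * ‖f 0‖ := by simpa [hΦ] using norm_mulVec_le_card hJ (f 0)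
  have hbd : ∀ x ∈ s, ‖Φ x‖ ≤ 1 / 2 * ‖x‖ + Fintype.card I * c * ‖f 0‖ := by
    intro x hx; have h1 := hlip x hx 0 h0s; have h2 := norm_add_le (Φ x - Φ 0) (Φ 0); rw [sub_add_cancel] at h2
    rw [sub_zero] at h1; linarith
  have hmaps : Set.MapsTo Φ s s := by
    intro x hx; have h1 := hbd x hx; have h2 : ‖x‖ ≤ r := by simpa [hs] using hx
    have : ‖Φ x‖ ≤ r := by linarith
    simpa [hs] using this
  have hcontr : ContractingWith (1 / 2) (hmaps.restrict Φ s s) := by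
    refine ⟨by rw [← NNReal.coe_lt_coe]; norm_num, LipschitzWith.of_dist_le_mul fun x y => ?_⟩
    rw [Subtype.dist_eq, Subtype.dist_eq, dist_eq_norm, dist_eq_norm]; simpa using hlip x x.2 y y.2
  obtain ⟨x, hxs, hfix, hlim, -⟩ := hcontr.exists_fixedPoint' Metric.isClosed_closedBall.isComplete
    hmaps h0s (edist_ne_top _ _)
  refine ⟨x, hlim, ?_, ?_⟩
  · have h1 : J *ᵥ f x = 0 := by
      have : x + J *ᵥ f x = x := hfix
      simpa using this
    have h2 : L *ᵥ J *ᵥ f x = f x := by rw [mulVec_mulVec, hLJ, one_mulVec]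
    rw [← h2, h1, mulVec_zero]
  · have h1 := hbd x hxs
    rw [show Φ x = x from hfix] at h1; linarith

end Contraction

section GaussianMoments

/-- The law of a vector of independent standard normal variables. -/
abbrev stdNormal (n : Type*) [Fintype n] : Measure (n → ℝ) := Measure.pi fun _ => gaussianReal 0 1

lemma integrable_pow_mul_exp_neg_half_sq (n : ℕ) : Integrable fun x : ℝ => x ^ n * exp (-(1 / 2) * x ^ 2) := by
  have := integrable_rpow_mul_exp_neg_mul_sq (b := 1 / 2) (by norm_num) (s := n)
    (by grind)
  simpa [rpow_natCast] using this

lemma integral_pow_add_two_mul_exp (n : ℕ) : ∫ x : ℝ, x ^ (n + 2) * exp (-(1 / 2) * x ^ 2)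
      = (n + 1) * ∫ x : ℝ, x ^ n * exp (-(1 / 2) * x ^ 2) := by
  have hv : ∀ x : ℝ, HasDerivAt (fun x : ℝ => exp (-(1 / 2) * x ^ 2)) (-(x * exp (-(1 / 2) * x ^ 2))) x := fun x => by
    have h1 : HasDerivAt (fun x : ℝ => -(1 / 2) * x ^ 2) (-x) x := by
      have := ((hasDerivAt_id x).pow 2).const_mul (-(1 / 2 : ℝ))
      refine this.congr_deriv ?_
      simp
    exact h1.exp.congr_deriv (by ring)
  have hu : ∀ x : ℝ, HasDerivAt (fun x : ℝ => x ^ (n + 1)) ((n + 1 : ℝ) * x ^ n) x := fun x => by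
    simpa using hasDerivAt_pow (n + 1) x
  have := integral_mul_deriv_eq_deriv_mul_of_integrable (fun x _ => hu x) (fun x _ => hv x) (by
      refine (integrable_pow_mul_exp_neg_half_sq (n + 2)).neg.congr (ae_of_all _ fun x => ?_)
      simp only [Pi.neg_apply, Pi.mul_apply]; ring)
    (by
      refine ((integrable_pow_mul_exp_neg_half_sq n).const_mul (n + 1 : ℝ)).congr (ae_of_all _ fun x => ?_)
      simp only [Pi.mul_apply]; ring)
    (by exact integrable_pow_mul_exp_neg_half_sq (n + 1))
  rw [← integral_const_mul]
  have h2 : ∫ x : ℝ, x ^ (n + 2) * exp (-(1 / 2) * x ^ 2) = -∫ x : ℝ, x ^ (n + 1) * -(x * exp (-(1 / 2) * x ^ 2)) := by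
    rw [← integral_neg]; congr 1; funext x; ring
  grind

lemma integral_gauss_std (f : ℝ → ℝ) : ∫ x, f x ∂(gaussianReal 0 1)
      = (sqrt (2 * Real.pi))⁻¹ * ∫ x, f x * exp (-(1 / 2) * x ^ 2) := by
  rw [integral_gaussianReal_eq_integral_smul one_ne_zero, ← integral_const_mul]; congr 1; funext x
  simp only [gaussianPDFReal, smul_eq_mul, NNReal.coe_one, mul_one, sub_zero]; ring

lemma integral_pow_add_two_gauss (n : ℕ) :
    ∫ x, x ^ (n + 2) ∂(gaussianReal 0 1) = (n + 1) * ∫ x, x ^ n ∂(gaussianReal 0 1) := by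
  rw [integral_gauss_std, integral_gauss_std, integral_pow_add_two_mul_exp]; ring

lemma memLp_pow_gauss (n : ℕ) (p : ENNReal) (hp : p ≠ ⊤) : MemLp (fun x : ℝ => x ^ n) p (gaussianReal 0 1) := by
  induction n generalizing p with
  | zero => simpa using memLp_const 1
  | succ n ih =>
    have h2 : MemLp (fun x : ℝ => x) (2 * p) (gaussianReal 0 1) := memLp_id_gaussianReal' (2 * p) (by finiteness)
    have : ENNReal.HolderTriple (2 * p) (2 * p) p := ⟨by
      rw [ENNReal.mul_inv (by simp) (by simp), ← add_mul, ENNReal.inv_two_add_inv_two, one_mul]⟩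
    refine (h2.mul (ih (2 * p) (by finiteness))).congr_norm (by fun_prop) (ae_of_all _ fun x => ?_)
    simp [pow_succ]

lemma integrable_pow_gauss (n : ℕ) : Integrable (fun x : ℝ => x ^ n) (gaussianReal 0 1) :=
  memLp_one_iff_integrable.1 (memLp_pow_gauss n 1 (by simp))

lemma integral_sq_gauss : ∫ x : ℝ, x ^ 2 ∂(gaussianReal 0 1) = 1 := by
  rw [show 2 = 0 + 2 from rfl, integral_pow_add_two_gauss]; simp

lemma integral_pow_four_gauss : ∫ x : ℝ, x ^ 4 ∂(gaussianReal 0 1) = 3 := by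
  rw [show 4 = 2 + 2 from rfl, integral_pow_add_two_gauss, integral_sq_gauss]; norm_num

lemma integral_pow_six_gauss : ∫ x : ℝ, x ^ 6 ∂(gaussianReal 0 1) = 15 := by
  rw [show 6 = 4 + 2 from rfl, integral_pow_add_two_gauss, integral_pow_four_gauss]; norm_num

lemma memLp_sq_sub_one_gauss (p : ENNReal) (hp : p ≠ ⊤) : MemLp (fun x : ℝ => x ^ 2 - 1) p (gaussianReal 0 1) :=
  (memLp_pow_gauss 2 p hp).sub (memLp_const 1)

lemma integral_sq_sub_one : ∫ x : ℝ, (x ^ 2 - 1) ∂(gaussianReal 0 1) = 0 := by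
  rw [integral_sub (integrable_pow_gauss 2) (by simp), integral_sq_gauss]; simp

lemma integral_sq_sub_one_sq : ∫ x : ℝ, (x ^ 2 - 1) ^ 2 ∂(gaussianReal 0 1) = 2 := by
  have h : (fun x : ℝ => (x ^ 2 - 1) ^ 2) = fun x => x ^ 4 - 2 * x ^ 2 + 1 := by funext x; ring
  have i4 := integrable_pow_gauss 4
  have i2 := (integrable_pow_gauss 2).const_mul 2
  have i42 : Integrable (fun x : ℝ => x ^ 4 - 2 * x ^ 2) (gaussianReal 0 1) := i4.sub i2
  rw [h, integral_add i42 (by simp), integral_sub i4 i2, integral_const_mul,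
    integral_pow_four_gauss, integral_sq_gauss]
  simp; norm_num

lemma integral_sq_sub_one_cube : ∫ x : ℝ, (x ^ 2 - 1) ^ 3 ∂(gaussianReal 0 1) = 8 := by
  have h : (fun x : ℝ => (x ^ 2 - 1) ^ 3) = fun x => x ^ 6 - 3 * x ^ 4 + 3 * x ^ 2 - 1 := by funext x; ring
  have i6 := integrable_pow_gauss 6
  have i4 := (integrable_pow_gauss 4).const_mul 3
  have i2 := (integrable_pow_gauss 2).const_mul 3
  have i64 : Integrable (fun x : ℝ => x ^ 6 - 3 * x ^ 4) (gaussianReal 0 1) := i6.sub i4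
  rw [h, integral_sub (i64.fun_add i2) (by simp), integral_add i64 i2,
    integral_sub i6 i4, integral_const_mul, integral_const_mul, integral_pow_six_gauss,
    integral_pow_four_gauss, integral_sq_gauss]
  simp; norm_num

lemma integral_exp_mul_sq_sub_one_le {t : ℝ} (ht : |t| ≤ 1 / 4) :
    Integrable (fun x : ℝ => exp (t * (x ^ 2 - 1))) (gaussianReal 0 1) ∧
    ∫ x : ℝ, exp (t * (x ^ 2 - 1)) ∂(gaussianReal 0 1) ≤ exp (4 * t ^ 2) := by
  rw [abs_le] at ht; have hb : 0 < 1 / 2 - t := by linarith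
  have heq : ∀ x : ℝ, exp (t * (x ^ 2 - 1)) * exp (-(1 / 2) * x ^ 2)
      = exp (-t) * exp (-(1 / 2 - t) * x ^ 2) := fun x => by
    rw [← exp_add, ← exp_add]; congr 1; ring
  constructor
  · rw [gaussianReal_of_var_ne_zero _ one_ne_zero,
      integrable_withDensity_iff_integrable_smul' (measurable_gaussianPDF 0 1)
        (ae_of_all _ fun x => gaussianPDF_lt_top)]
    have := ((integrable_exp_neg_mul_sq hb).const_mul (exp (-t))).const_mul (sqrt (2 * Real.pi))⁻¹
    refine this.congr (ae_of_all _ fun x => ?_)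
    simp only [toReal_gaussianPDF, gaussianPDFReal, smul_eq_mul, NNReal.coe_one, mul_one, sub_zero]
    rw [← heq, show -x ^ 2 / 2 = -(1 / 2) * x ^ 2 by ring]
    ring
  · rw [integral_gauss_std]; simp_rw [heq]; rw [integral_const_mul, integral_gaussian]
    have h1 : (sqrt (2 * Real.pi))⁻¹ * (exp (-t) * sqrt (Real.pi / (1 / 2 - t)))
        = exp (-t) * sqrt (1 / (1 - 2 * t)) := by
      have : Real.pi / (1 / 2 - t) = (2 * Real.pi) * (1 / (1 - 2 * t)) := by field_simp
      rw [this, sqrt_mul (x := 2 * Real.pi) (by positivity)]; have : sqrt (2 * Real.pi) ≠ 0 := by positivity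
      rw [mul_left_comm, inv_mul_cancel_left₀ this]
    rw [h1]
    have h2 : sqrt (1 / (1 - 2 * t)) ≤ exp (t + 4 * t ^ 2) := by
      rw [show exp (t + 4 * t ^ 2) = sqrt (exp (2 * t + 8 * t ^ 2)) by
        rw [show 2 * t + 8 * t ^ 2 = (t + 4 * t ^ 2) + (t + 4 * t ^ 2) by ring, exp_add (t + 4 * t ^ 2),
          sqrt_mul_self (exp_pos _).le]]
      refine sqrt_le_sqrt ?_
      rw [div_le_iff₀ (by linarith)]
      have h4 : 1 ≤ (2 * t + 8 * t ^ 2 + 1) * (1 - 2 * t) := by nlinarith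
      exact h4.trans (mul_le_mul_of_nonneg_right (add_one_le_exp (2 * t + 8 * t ^ 2)) (by linarith))
    calc _ ≤ exp (-t) * exp (t + 4 * t ^ 2) := mul_le_mul_of_nonneg_left h2 (exp_pos _).le
      _ = _ := by rw [← exp_add]; congr 1; ring

/-! Diagonal quadratic forms. -/

variable {n : Type*} [Fintype n] (c : n → ℝ)

/-- The centred diagonal quadratic form with coefficients `c`. -/
def diagForm (z : n → ℝ) : ℝ := ∑ i, c i * (z i ^ 2 - 1)

lemma memLp_eval_sq_sub_one (i : n) (p : ENNReal) (hp : p ≠ ⊤) : MemLp (fun z : n → ℝ => z i ^ 2 - 1) p (stdNormal n) :=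
  (memLp_sq_sub_one_gauss p hp).comp_measurePreserving (measurePreserving_eval _ i)

lemma integral_eval_stdGauss (i : n) {f : ℝ → ℝ} (hf : AEStronglyMeasurable f (gaussianReal 0 1)) :
    ∫ z : n → ℝ, f (z i) ∂(stdNormal n) = ∫ x, f x ∂(gaussianReal 0 1) := by
  have h := (measurePreserving_eval (fun _ : n => gaussianReal 0 1) i).map_eq
  conv_rhs => rw [← h, integral_map (measurable_pi_apply i).aemeasurable (by grind)]

lemma diagForm_partial_moments (s : Finset n) : (∫ z, (∑ i ∈ s, c i * (z i ^ 2 - 1)) ∂(stdNormal n) = 0) ∧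
    (∫ z, (∑ i ∈ s, c i * (z i ^ 2 - 1)) ^ 2 ∂(stdNormal n) = 2 * ∑ i ∈ s, c i ^ 2) ∧
    (∫ z, (∑ i ∈ s, c i * (z i ^ 2 - 1)) ^ 3 ∂(stdNormal n) = 8 * ∑ i ∈ s, c i ^ 3) := by
  classical
  have hL : ∀ t k,
      Integrable (fun z : n → ℝ => (∑ i ∈ t, c i * (z i ^ 2 - 1)) ^ k) (stdNormal n) := by
    intro t k
    have h : MemLp (fun z : n → ℝ => ∑ i ∈ t, c i * (z i ^ 2 - 1)) k (stdNormal n) :=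
      memLp_finsetSum _ fun i _ => (memLp_eval_sq_sub_one i k (by simp)).const_mul (c i)
    have := h.integrable_norm_pow'
    have hm : Measurable fun z : n → ℝ => ∑ i ∈ t, c i * (z i ^ 2 - 1) :=
      Finset.measurable_fun_sum _ fun i _ => by fun_prop
    refine this.mono' (hm.pow_const k).aestronglyMeasurable (ae_of_all _ fun z => ?_)
    simp
  induction s using Finset.induction_on with
  | empty => simp
  | insert a s ha ih =>
    obtain ⟨h1, h2, h3⟩ := ih
    set S := fun z : n → ℝ => ∑ i ∈ s, c i * (z i ^ 2 - 1) with hS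
    set Y := fun z : n → ℝ => c a * (z a ^ 2 - 1) with hY
    have hind : IndepFun S Y (stdNormal n) := by
      have hi : iIndepFun (fun (i : n) z => c i * (z i ^ 2 - 1)) (stdNormal n) :=
        iIndepFun_pi (X := fun i x => c i * (x ^ 2 - 1)) fun i => by fun_prop
      have := hi.indepFun_finsetSum_of_notMem (fun i => by fun_prop) ha
      convert this using 1
      funext z; simp [hS]
    have hprod : ∀ j k : ℕ, ∫ z, S z ^ j * Y z ^ k ∂(stdNormal n)
        = (∫ z, S z ^ j ∂(stdNormal n)) * ∫ z, Y z ^ k ∂(stdNormal n) := fun j k =>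
      (hind.comp (φ := fun x => x ^ j) (ψ := fun x => x ^ k) (by fun_prop)
        (by fun_prop)).integral_fun_mul_eq_mul_integral (by fun_prop) (by fun_prop)
    have hY1 : ∫ z, Y z ∂(stdNormal n) = 0 := by
      rw [integral_const_mul, integral_eval_stdGauss a (f := fun x => x ^ 2 - 1) (by fun_prop),
        integral_sq_sub_one, mul_zero]
    have hY2 : ∫ z, Y z ^ 2 ∂(stdNormal n) = 2 * c a ^ 2 := by
      simp_rw [hY, mul_pow]
      rw [integral_const_mul, integral_eval_stdGauss a (f := fun x => (x ^ 2 - 1) ^ 2)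
        (by fun_prop), integral_sq_sub_one_sq, mul_comm]
    have hY3 : ∫ z, Y z ^ 3 ∂(stdNormal n) = 8 * c a ^ 3 := by
      simp_rw [hY, mul_pow]
      rw [integral_const_mul, integral_eval_stdGauss a (f := fun x => (x ^ 2 - 1) ^ 3)
        (by fun_prop), integral_sq_sub_one_cube, mul_comm]
    have iS := hL s
    have iY : ∀ k : ℕ, Integrable (fun z => Y z ^ k) (stdNormal n) := fun k => by simpa [hY] using hL {a} k
    have iSY : ∀ j k : ℕ, Integrable (fun z => S z ^ j * Y z ^ k) (stdNormal n) := fun j k =>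
      (hind.comp (φ := fun x => x ^ j) (ψ := fun x => x ^ k) (by fun_prop) (by fun_prop)).integrable_mul (iS j) (iY k)
    have hsum : ∀ z : n → ℝ, ∑ i ∈ insert a s, c i * (z i ^ 2 - 1) = S z + Y z := fun z => by grind
    simp_rw [hsum, sum_insert ha]; refine ⟨?_, ?_, ?_⟩
    · rw [integral_add (by simpa using iS 1) (by simpa using iY 1), h1, hY1, add_zero]
    · have : ∀ z, (S z + Y z) ^ 2 = S z ^ 2 + 2 * (S z ^ 1 * Y z ^ 1) + Y z ^ 2 := fun z => by ring
      simp_rw [this]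
      rw [integral_add ((iS 2).fun_add ((iSY 1 1).const_mul 2)) (iY 2),
        integral_add (iS 2) ((iSY 1 1).const_mul 2), integral_const_mul, hprod]
      simp only [pow_one]; rw [h1, h2, hY1, hY2]; ring
    · have : ∀ z, (S z + Y z) ^ 3
          = S z ^ 3 + 3 * (S z ^ 2 * Y z ^ 1) + 3 * (S z ^ 1 * Y z ^ 2) + Y z ^ 3 := fun z => by ring
      simp_rw [this]
      rw [integral_add (((iS 3).fun_add ((iSY 2 1).const_mul 3)).fun_add ((iSY 1 2).const_mul 3)) (iY 3),
        integral_add ((iS 3).fun_add ((iSY 2 1).const_mul 3)) ((iSY 1 2).const_mul 3),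
        integral_add (iS 3) ((iSY 2 1).const_mul 3), integral_const_mul, integral_const_mul, hprod, hprod]
      simp only [pow_one]; rw [h1, h3, hY1, hY3]; ring

lemma integral_diagForm : ∫ z, diagForm c z ∂(stdNormal n) = 0 := (diagForm_partial_moments c univ).1

lemma integral_diagForm_sq : ∫ z, diagForm c z ^ 2 ∂(stdNormal n) = 2 * ∑ i, c i ^ 2 :=
  (diagForm_partial_moments c univ).2.1

lemma integral_diagForm_cube : ∫ z, diagForm c z ^ 3 ∂(stdNormal n) = 8 * ∑ i, c i ^ 3 :=
  (diagForm_partial_moments c univ).2.2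

lemma integral_exp_diagForm_le (hc : ∑ i, c i ^ 2 ≤ 1) {t : ℝ} (ht : |t| ≤ 1 / 4) :
    Integrable (fun z => exp (t * diagForm c z)) (stdNormal n) ∧
    ∫ z, exp (t * diagForm c z) ∂(stdNormal n) ≤ exp (1 / 4) := by
  have hci : ∀ i, |t * c i| ≤ 1 / 4 := fun i => by
    have h1 := (single_le_sum (fun j _ => sq_nonneg (c j)) (mem_univ i)).trans hc
    rw [abs_mul]; have h2 : |c i| ≤ 1 := by aesop
    calc _ ≤ 1 / 4 * 1 := mul_le_mul ht h2 (abs_nonneg _) (by norm_num)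
      _ = _ := by norm_num
  have heq : (fun z : n → ℝ => exp (t * diagForm c z)) = fun z => ∏ i, exp (t * c i * (z i ^ 2 - 1)) := by
    funext z; rw [diagForm, mul_sum, exp_sum]; simp_rw [mul_assoc]
  rw [heq]
  constructor
  · exact Integrable.fintype_prod fun i => (integral_exp_mul_sq_sub_one_le (hci i)).1
  · rw [integral_fintype_prod_eq_prod (fun i x => exp (t * c i * (x ^ 2 - 1)))]
    calc _ ≤ ∏ i, exp (4 * (t * c i) ^ 2) := Finset.prod_le_prod (fun i _ => integral_nonneg fun x => (exp_pos _).le)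
            fun i _ => (integral_exp_mul_sq_sub_one_le (hci i)).2
      _ = exp (4 * t ^ 2 * ∑ i, c i ^ 2) := by rw [← exp_sum, mul_sum]; congr 1; exact sum_congr rfl fun i _ => by ring
      _ ≤ _ := by
          refine exp_le_exp.2 ?_
          have h3 := sq_le_sq' (by grind) (abs_le.1 ht).2
          nlinarith

lemma integral_abs_diagForm_pow_le (hc : ∑ i, c i ^ 2 ≤ 1) (p : ℕ) :
    Integrable (fun z => |diagForm c z| ^ p) (stdNormal n) ∧
    ∫ z, |diagForm c z| ^ p ∂(stdNormal n) ≤ 4 ^ p * p.factorial * (2 * exp (1 / 4)) := by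
  have h1 := integral_exp_diagForm_le c hc (t := 1 / 4) (by simp)
  have h2 := integral_exp_diagForm_le c hc (t := -(1 / 4)) (by simp)
  have hm : Measurable (diagForm c) := by unfold diagForm; fun_prop
  have hb : ∀ z, |diagForm c z| ^ p ≤ 4 ^ p * p.factorial *
      (exp (1 / 4 * diagForm c z) + exp (-(1 / 4) * diagForm c z)) := fun z => by
    have h4 : exp (1 / 4 * |diagForm c z|) ≤ exp (1 / 4 * diagForm c z) + exp (-(1 / 4) * diagForm c z) := by
      rcases abs_cases (diagForm c z) with ⟨h, _⟩ | ⟨h, _⟩ <;> rw [h]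
      · linarith [exp_pos (-(1 / 4) * diagForm c z)]
      · rw [show 1 / 4 * -diagForm c z = -(1 / 4) * diagForm c z by ring]
        linarith [exp_pos (1 / 4 * diagForm c z)]
    have h5 := (pow_div_factorial_le_exp (x := 1 / 4 * |diagForm c z|) (by positivity) p).trans h4
    rw [div_le_iff₀ (by positivity), mul_pow] at h5
    have h6 : |diagForm c z| ^ p = 4 ^ p * ((1 / 4) ^ p * |diagForm c z| ^ p) := by simp
    rw [h6, mul_assoc, mul_comm (p.factorial : ℝ)]; exact mul_le_mul_of_nonneg_left h5 (by positivity)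
  have hi := (h1.1.add h2.1).const_mul (4 ^ p * p.factorial : ℝ)
  have hi' : Integrable (fun z => |diagForm c z| ^ p) (stdNormal n) := hi.mono' (by fun_prop) (ae_of_all _ fun z => by aesop)
  refine ⟨hi', (integral_mono hi' hi hb).trans ?_⟩
  simp only [Pi.add_apply]; rw [integral_const_mul, integral_add h1.1 h2.1]
  refine mul_le_mul_of_nonneg_left ?_ (by positivity)
  linarith [h1.2, h2.2]

end GaussianMoments

section GaussianQuadraticForms

variable {n : Type*} [Fintype n]

lemma map_dot_pi_gauss (v : n → NNReal) (c : n → ℝ) :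
    (Measure.pi fun i => gaussianReal 0 (v i)).map (fun z => c ⬝ᵥ z)
      = gaussianReal 0 (∑ i, (c i ^ 2).toNNReal * v i) := by
  have hm : Measurable fun z : n → ℝ => c ⬝ᵥ z := by fun_prop
  refine Measure.ext_of_charFun (funext fun t => ?_)
  rw [charFun_apply_real, integral_map hm.aemeasurable (by fun_prop)]
  have h1 : ∀ z : n → ℝ, Complex.exp (t * (c ⬝ᵥ z : ℝ) * Complex.I)
      = ∏ i, Complex.exp ((t * c i : ℝ) * z i * Complex.I) := fun z => by
    rw [← Complex.exp_sum]; congr 1; simp only [dotProduct, Complex.ofReal_sum, Complex.ofReal_mul, mul_sum, sum_mul]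
    grind
  simp_rw [h1]; rw [integral_fintype_prod_eq_prod (f := fun i (x : ℝ) => Complex.exp ((t * c i : ℝ) * x * Complex.I))]
  simp_rw [← charFun_apply_real, charFun_gaussianReal]; rw [← Complex.exp_sum]; congr 1
  simp only [Complex.ofReal_zero, mul_zero, zero_mul, zero_sub, NNReal.coe_sum, NNReal.coe_mul,
    Complex.ofReal_sum, Complex.ofReal_mul, sum_neg_distrib, sum_mul, sum_div]
  congr 1; refine sum_congr rfl fun i _ => ?_
  rw [coe_toNNReal _ (sq_nonneg _)]; push_cast; ring

lemma map_dot_stdGauss (c : n → ℝ) :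
    (stdNormal n).map (fun z => c ⬝ᵥ z) = gaussianReal 0 (c ⬝ᵥ c).toNNReal := by
  rw [map_dot_pi_gauss]; simp only [mul_one]; rw [← toNNReal_sum_of_nonneg fun i _ => sq_nonneg _]
  simp [dotProduct, pow_two]

/-- A random vector is standard normal if its linear functionals have the right laws. -/
lemma map_eq_stdGauss_of_linear {Ω : Type*} [MeasurableSpace Ω] {P : Measure Ω}
    [IsProbabilityMeasure P] {Y : Ω → n → ℝ} (hY : Measurable Y)
    (h : ∀ c : n → ℝ, P.map (fun ω => c ⬝ᵥ Y ω) = gaussianReal 0 (c ⬝ᵥ c).toNNReal) : P.map Y = stdNormal n := by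
  classical
  refine Measure.ext_of_charFunDual (funext fun L => ?_)
  have hL : ∀ z, L z = (fun i => L (Pi.single i 1)) ⬝ᵥ z := fun z => by
    conv_lhs => rw [← univ_sum_single z]
    rw [map_sum, dotProduct]; refine sum_congr rfl fun i _ => ?_
    rw [show Pi.single i (z i) = z i • (Pi.single i 1 : n → ℝ) by rw [← Pi.single_smul]; simp]
    rw [map_smul, smul_eq_mul, mul_comm]
  set c : n → ℝ := fun i => L (Pi.single i 1)
  have key : ∀ (ν : Measure (n → ℝ)), ν.map (fun z => c ⬝ᵥ z) = gaussianReal 0 (c ⬝ᵥ c).toNNReal →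
      charFunDual ν L = charFun (gaussianReal 0 (c ⬝ᵥ c).toNNReal) 1 := fun ν hν => by
    have hm : Measurable fun z : n → ℝ => c ⬝ᵥ z := by fun_prop
    rw [← hν, charFunDual_apply, charFun_apply_real, integral_map hm.aemeasurable (by fun_prop)]; simp [hL]
  rw [key _ (map_dot_stdGauss c), key]; rw [Measure.map_map (by fun_prop) hY]; exact h c

lemma meas_mulVec {m : Type*} [Fintype m] (A : Matrix m n ℝ) : Measurable fun z : n → ℝ => A *ᵥ z := by fun_prop

lemma map_mulVec_stdGauss [DecidableEq n] {Q : Matrix n n ℝ} (hQ : Q * Qᵀ = 1) :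
    (stdNormal n).map (fun z => Q *ᵥ z) = stdNormal n := by
  refine map_eq_stdGauss_of_linear (meas_mulVec Q) fun c => ?_
  simp_rw [dotProduct_mulVec]; rw [map_dot_stdGauss]
  rw [← mulVec_transpose, dotProduct_mulVec, vecMul_transpose, mulVec_mulVec, hQ, one_mulVec]

/-- The centred quadratic form of a matrix. -/
def qform (A : Matrix n n ℝ) (z : n → ℝ) : ℝ := z ⬝ᵥ A *ᵥ z - A.trace

lemma meas_qform (A : Matrix n n ℝ) : Measurable (qform A) := by unfold qform mulVec dotProduct; fun_prop

lemma qform_add (A B : Matrix n n ℝ) (z : n → ℝ) : qform (A + B) z = qform A z + qform B z := by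
  simp only [qform, add_mulVec, dotProduct_add, trace_add]; ring

lemma qform_smul (c : ℝ) (A : Matrix n n ℝ) (z : n → ℝ) : qform (c • A) z = c * qform A z := by
  simp only [qform, smul_mulVec, dotProduct_smul, trace_smul, smul_eq_mul]; ring

lemma qform_tr (A : Matrix n n ℝ) (z : n → ℝ) : qform Aᵀ z = qform A z := by
  rw [qform, qform, trace_transpose, mulVec_transpose, dotProduct_comm, dotProduct_mulVec]

lemma meas_diagForm (c : n → ℝ) : Measurable (diagForm c) := Finset.measurable_fun_sum _ fun i _ => by fun_prop

lemma exists_map_qform_eq_diagForm {A : Matrix n n ℝ} (hA : Aᵀ = A) :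
    ∃ c : n → ℝ, (stdNormal n).map (qform A) = (stdNormal n).map (diagForm c) ∧
      ∑ i, c i ^ 2 = (A * A).trace ∧ ∑ i, c i ^ 3 = (A * A * A).trace := by
  classical
  have hH : A.IsHermitian := by aesop
  set U : Matrix n n ℝ := (hH.eigenvectorUnitary : Matrix n n ℝ)
  have hst : ((star hH.eigenvectorUnitary : unitaryGroup n ℝ) : Matrix n n ℝ) = Uᵀ := by aesop
  have hU2 : Uᵀ * U = 1 := by
    have := Unitary.star_mul_self hH.eigenvectorUnitary
    rw [← hst]; exact congrArg Subtype.val this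
  set c := hH.eigenvalues
  have hsp : A = U * diagonal c * Uᵀ := by
    have := hH.spectral_theorem
    rw [← hst]; exact this
  have htr : ∀ B C : Matrix n n ℝ, (U * B * Uᵀ) * (U * C * Uᵀ) = U * (B * C) * Uᵀ := fun B C => by grind
  have htr1 : ∀ B : Matrix n n ℝ, (U * B * Uᵀ).trace = B.trace := fun B => by
    rw [trace_mul_comm, ← mul_assoc, hU2, one_mul]
  refine ⟨c, ?_, ?_, ?_⟩
  · conv_rhs => rw [← map_mulVec_stdGauss (by rwa [transpose_transpose])]
    rw [Measure.map_map (meas_diagForm c) (meas_mulVec _)]; congr 1; funext z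
    simp only [Function.comp, qform, diagForm]
    conv_lhs => rw [hsp, htr1, trace_diagonal, ← mulVec_mulVec, ← mulVec_mulVec, dotProduct_mulVec, ← mulVec_transpose]
    simp only [dotProduct, mulVec_diagonal, ← sum_sub_distrib]; exact sum_congr rfl fun i _ => by ring
  · rw [hsp, htr, htr1, diagonal_mul_diagonal, trace_diagonal]; exact sum_congr rfl fun i _ => by ring
  · rw [hsp, htr, htr, htr1, diagonal_mul_diagonal, diagonal_mul_diagonal, trace_diagonal]
    exact sum_congr rfl fun i _ => by ring

lemma integral_comp_qform {A : Matrix n n ℝ} {c : n → ℝ}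
    (h : (stdNormal n).map (qform A) = (stdNormal n).map (diagForm c)) {f : ℝ → ℝ} (hf : Measurable f) :
    ∫ z, f (qform A z) ∂(stdNormal n) = ∫ z, f (diagForm c z) ∂(stdNormal n) := by
  rw [← integral_map (meas_qform A).aemeasurable hf.aestronglyMeasurable, h,
    integral_map (meas_diagForm c).aemeasurable hf.aestronglyMeasurable]

lemma integral_qform_of_symm {A : Matrix n n ℝ} (hA : Aᵀ = A) : ∫ z, qform A z ∂(stdNormal n) = 0 := by
  obtain ⟨c, h, -, -⟩ := exists_map_qform_eq_diagForm hA
  rw [integral_comp_qform h (f := fun x => x) measurable_id, integral_diagForm]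

lemma integral_qform_sq {A : Matrix n n ℝ} (hA : Aᵀ = A) : ∫ z, qform A z ^ 2 ∂(stdNormal n) = 2 * (A * A).trace := by
  obtain ⟨c, h, h2, -⟩ := exists_map_qform_eq_diagForm hA
  rw [integral_comp_qform h (f := fun x => x ^ 2) (by fun_prop), integral_diagForm_sq, h2]

lemma integral_qform_cube {A : Matrix n n ℝ} (hA : Aᵀ = A) :
    ∫ z, qform A z ^ 3 ∂(stdNormal n) = 8 * (A * A * A).trace := by
  obtain ⟨c, h, -, h3⟩ := exists_map_qform_eq_diagForm hA
  rw [integral_comp_qform h (f := fun x => x ^ 3) (by fun_prop), integral_diagForm_cube, h3]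

lemma memLp_eval_stdGauss (i : n) (p : ENNReal) (hp : p ≠ ⊤) : MemLp (fun z : n → ℝ => z i) p (stdNormal n) :=
  (memLp_id_gaussianReal' p hp).comp_measurePreserving (measurePreserving_eval _ i)

lemma memLp_qform (A : Matrix n n ℝ) (p : ENNReal) (hp : p ≠ ⊤) : MemLp (qform A) p (stdNormal n) := by
  refine MemLp.sub ?_ (memLp_const _)
  simp only [mulVec, dotProduct, mul_sum]; refine memLp_finsetSum _ fun i _ => memLp_finsetSum _ fun j _ => ?_
  have : ENNReal.HolderTriple (2 * p) (2 * p) p := ⟨by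
    rw [ENNReal.mul_inv (by simp) (by simp), ← add_mul, ENNReal.inv_two_add_inv_two, one_mul]⟩
  have h3 := ((memLp_eval_stdGauss j (2 * p) (by finiteness)).const_mul (A i j)).mul (r := p)
    (memLp_eval_stdGauss i (2 * p) (by finiteness))
  exact h3

lemma integrable_qform_mul (A B : Matrix n n ℝ) : Integrable (fun z => qform A z * qform B z) (stdNormal n) :=
  (memLp_qform A 2 (by simp)).integrable_mul (memLp_qform B 2 (by simp))

lemma integrable_qform_mul_mul (A B C : Matrix n n ℝ) :
    Integrable (fun z => qform A z * qform B z * qform C z) (stdNormal n) := by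
  have : ENNReal.HolderTriple (2 * 2) (2 * 2) 2 := ⟨by
    rw [ENNReal.mul_inv (by simp) (by simp), ← add_mul, ENNReal.inv_two_add_inv_two, one_mul]⟩
  have h := (memLp_qform B (2 * 2) (by finiteness)).mul (r := 2) (memLp_qform A (2 * 2) (by finiteness))
  exact h.integrable_mul (memLp_qform C 2 (by simp))

lemma integral_qform_mul {A B : Matrix n n ℝ} (hA : Aᵀ = A) (hB : Bᵀ = B) :
    ∫ z, qform A z * qform B z ∂(stdNormal n) = 2 * (A * B).trace := by
  have h := integral_qform_sq (A := A + B) (by aesop)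
  have e : ∀ z, qform (A + B) z ^ 2 = qform A z ^ 2 + qform B z ^ 2 + 2 * (qform A z * qform B z) := fun z => by
    rw [qform_add]; ring
  have i2 : ∀ C : Matrix n n ℝ, Integrable (fun z => qform C z ^ 2) (stdNormal n) := fun C => by
    simpa [pow_two] using integrable_qform_mul C C
  simp_rw [e] at h
  rw [integral_add ((i2 A).fun_add (i2 B)) ((integrable_qform_mul A B).const_mul 2),
    integral_add (i2 A) (i2 B), integral_const_mul, integral_qform_sq hA, integral_qform_sq hB,
    add_mul, mul_add, mul_add, trace_add, trace_add, trace_add, trace_mul_comm B A] at h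
  linarith

lemma integral_qform_mul_mul {A B C : Matrix n n ℝ} (hA : Aᵀ = A) (hB : Bᵀ = B) (hC : Cᵀ = C) :
    ∫ z, qform A z * qform B z * qform C z ∂(stdNormal n) = 8 * (A * B * C).trace := by
  have i3 : ∀ A : Matrix n n ℝ, Integrable (fun z => qform A z ^ 3) (stdNormal n) := fun A => by
    have := integrable_qform_mul_mul A A A
    refine this.congr (ae_of_all _ fun z => ?_)
    ring
  have e : ∀ z, qform A z * qform B z * qform C z
      = 1 / 6 * (qform (A + B + C) z ^ 3 - qform (A + B) z ^ 3 - qform (A + C) z ^ 3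
        - qform (B + C) z ^ 3 + qform A z ^ 3 + qform B z ^ 3 + qform C z ^ 3) := fun z => by
    simp only [qform_add]; ring
  have sAB : (A + B)ᵀ = A + B := by aesop
  have sAC : (A + C)ᵀ = A + C := by aesop
  have sBC : (B + C)ᵀ = B + C := by aesop
  have sABC : (A + B + C)ᵀ = A + B + C := by aesop
  have j1 : Integrable (fun z => qform (A + B + C) z ^ 3 - qform (A + B) z ^ 3) (stdNormal n) := (i3 _).sub (i3 _)
  have j2 : Integrable (fun z => qform (A + B + C) z ^ 3 - qform (A + B) z ^ 3
      - qform (A + C) z ^ 3) (stdNormal n) := j1.sub (i3 _)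
  have j3 : Integrable (fun z => qform (A + B + C) z ^ 3 - qform (A + B) z ^ 3
      - qform (A + C) z ^ 3 - qform (B + C) z ^ 3) (stdNormal n) := j2.sub (i3 _)
  simp_rw [e]
  rw [integral_const_mul, integral_add ((j3.fun_add (i3 A)).fun_add (i3 B)) (i3 C),
    integral_add (j3.fun_add (i3 A)) (i3 B), integral_add j3 (i3 A), integral_sub j2 (i3 _),
    integral_sub j1 (i3 _), integral_sub (i3 _) (i3 _), integral_qform_cube sABC,
    integral_qform_cube sAB, integral_qform_cube sAC, integral_qform_cube sBC,
    integral_qform_cube hA, integral_qform_cube hB, integral_qform_cube hC]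
  have c1 : ∀ X Y Z : Matrix n n ℝ, (X * Y * Z).trace = (Y * Z * X).trace := fun X Y Z => by
    rw [mul_assoc, trace_mul_comm]
  have c2 : (A * C * B).trace = (A * B * C).trace := by
    rw [← trace_transpose (A * C * B)]; simp only [transpose_mul, hA, hB, hC]; rw [← mul_assoc, c1, c1]
  simp only [add_mul, mul_add, trace_add]; rw [c1 B C A, c1 C A B, c1 B A C, c2, c1 C B A, c1 B A C, c2]; ring

/-! Moment bounds. -/

lemma integral_abs_qform_pow_le_of_symm {A : Matrix n n ℝ} (hA : Aᵀ = A) (p : ℕ) : ∫ z, |qform A z| ^ p ∂(stdNormal n)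
      ≤ 4 ^ p * p.factorial * (2 * exp (1 / 4)) * traceNormTwo A ^ p := by
  rcases (fro_nonneg A).eq_or_lt' with h0 | h0
  · have hA0 : A = 0 := by
      have h1 := fro_sq A
      rw [h0] at h1; have := trace_conjTranspose_mul_self_eq_zero_iff (A := A)
      rw [conjTranspose_eq_transpose_of_trivial] at this; exact this.1 (by rw [← h1]; norm_num)
    rw [h0, hA0]
    rcases Nat.eq_zero_or_pos p with rfl | hp
    · simp only [pow_zero, integral_const, probReal_univ, smul_eq_mul, mul_one, Nat.factorial_zero,
        Nat.cast_one, one_mul]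
      have := add_one_le_exp (1 / 4)
      linarith
    · simp [qform, hp.ne']
  · set B := (traceNormTwo A)⁻¹ • A with hB
    have hBs : Bᵀ = B := by aesop
    obtain ⟨c, h, h2, -⟩ := exists_map_qform_eq_diagForm hBs
    have hB1 : (B * B).trace = 1 := by
      rw [hB, smul_mul, Matrix.mul_smul, trace_smul, trace_smul]; have h1 := fro_sq A; rw [hA] at h1
      rw [← h1, smul_eq_mul, smul_eq_mul]; field_simp
    have h4 : ∀ z, |qform A z| ^ p = traceNormTwo A ^ p * |qform B z| ^ p := fun z => by
      have : qform A z = traceNormTwo A * qform B z := by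
        rw [hB, qform_smul, ← mul_assoc, mul_inv_cancel₀ h0.ne', one_mul]
      rw [this, abs_mul, abs_of_pos h0, mul_pow]
    simp_rw [h4]; rw [integral_const_mul, integral_comp_qform h (f := fun x => |x| ^ p) (by fun_prop), mul_comm]
    exact mul_le_mul_of_nonneg_right (integral_abs_diagForm_pow_le c (by rw [h2, hB1]) p).2 (by positivity)

lemma qform_eq_symm_part (A : Matrix n n ℝ) (z : n → ℝ) : qform A z = qform ((1 / 2 : ℝ) • (A + Aᵀ)) z := by
  rw [qform_smul, qform_add, qform_tr]; ring

lemma symm_part_tr (A : Matrix n n ℝ) : ((1 / 2 : ℝ) • (A + Aᵀ))ᵀ = (1 / 2 : ℝ) • (A + Aᵀ) := by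
  rw [transpose_smul, transpose_add, transpose_transpose, add_comm]

lemma integral_qform (A : Matrix n n ℝ) : ∫ z, qform A z ∂(stdNormal n) = 0 := by
  simp_rw [qform_eq_symm_part A]; exact integral_qform_of_symm (symm_part_tr A)

lemma integral_abs_qform_pow_le (A : Matrix n n ℝ) (p : ℕ) : ∫ z, |qform A z| ^ p ∂(stdNormal n)
      ≤ 4 ^ p * p.factorial * (2 * exp (1 / 4)) * traceNormTwo A ^ p := by
  simp_rw [qform_eq_symm_part A]; refine (integral_abs_qform_pow_le_of_symm (symm_part_tr A) p).trans ?_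
  refine mul_le_mul_of_nonneg_left (pow_le_pow_left₀ (fro_nonneg _) ?_ p) (by positivity)
  rw [fro_smul, abs_of_pos (by simp)]; have := fro_add_le A Aᵀ; rw [fro_tr] at this
  linarith

end GaussianQuadraticForms

section StochasticOrder

variable {Ω : ℕ → Type*} [∀ k, MeasurableSpace (Ω k)]

/-- All `L^p` norms of the sequence `Z` are of order `θ ^ r`. -/
structure StochO (μ : ∀ k, Measure (Ω k)) (θ : ℕ → ℝ) (r : ℝ) (Z : ∀ k, Ω k → ℝ) : Prop where
  meas : ∀ k, AEStronglyMeasurable (Z k) (μ k)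
  bound : ∀ p : ℕ, ∃ C : ℝ, 0 ≤ C ∧ ∀ᶠ k in atTop, eLpNorm (Z k) p (μ k) ≤ ENNReal.ofReal (C * θ k ^ r)

/-- A positive sequence tending to zero. -/
structure SmallScale (θ : ℕ → ℝ) : Prop where
  pos : ∀ᶠ k in atTop, 0 < θ k
  tendsto : Tendsto θ atTop (𝓝 0)

variable {μ : ∀ k, Measure (Ω k)} [∀ k, IsProbabilityMeasure (μ k)] {θ : ℕ → ℝ}

lemma SmallScale.le (hθ : SmallScale θ) {c : ℝ} (hc : 0 < c) : ∀ᶠ k in atTop, θ k ≤ c :=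
  (hθ.tendsto.eventually (gt_mem_nhds hc)).mono fun _ h => h.le

lemma SmallScale.rpow_tendsto (hθ : SmallScale θ) {r : ℝ} (hr : 0 < r) : Tendsto (fun k => θ k ^ r) atTop (𝓝 0) := by
  have := hθ.tendsto.rpow_const (Or.inr hr.le)
  rwa [zero_rpow hr.ne'] at this

lemma SmallScale.rpow_le (hθ : SmallScale θ) {r c : ℝ} (hr : 0 < r) (hc : 0 < c) : ∀ᶠ k in atTop, θ k ^ r ≤ c :=
  ((hθ.rpow_tendsto hr).eventually (gt_mem_nhds hc)).mono fun _ h => h.le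

namespace StochO

variable {r s : ℝ} {Z Y : ∀ k, Ω k → ℝ}

lemma mono_exp (hθ : SmallScale θ) (h : StochO μ θ r Z) (hs : s ≤ r) : StochO μ θ s Z := by
  refine ⟨h.meas, fun p => ?_⟩
  obtain ⟨C, hC0, hC⟩ := h.bound p
  refine ⟨C, hC0, ?_⟩
  filter_upwards [hC, hθ.pos, hθ.le one_pos] with k h1 h2 h3
  exact h1.trans (ENNReal.ofReal_le_ofReal (mul_le_mul_of_nonneg_left (rpow_le_rpow_of_exponent_ge h2 h3 hs) hC0))

lemma of_le (hY : StochO μ θ r Y) (hZ : ∀ k, AEStronglyMeasurable (Z k) (μ k))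
    (h : ∀ᶠ k in atTop, ∀ ω, |Z k ω| ≤ |Y k ω|) : StochO μ θ r Z := by
  refine ⟨hZ, fun p => ?_⟩
  obtain ⟨C, hC0, hC⟩ := hY.bound p
  refine ⟨C, hC0, ?_⟩
  filter_upwards [hC, h] with k h1 h2
  exact (eLpNorm_mono fun ω => by simpa using h2 ω).trans h1

lemma add (hθ : SmallScale θ) (hZ : StochO μ θ r Z) (hY : StochO μ θ r Y) :
    StochO μ θ r fun k ω => Z k ω + Y k ω := by
  refine ⟨fun k => (hZ.meas k).add (hY.meas k), fun p => ?_⟩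
  rcases Nat.eq_zero_or_pos p with rfl | hp
  · exact ⟨0, le_rfl, by simp⟩
  obtain ⟨C, hC0, hC⟩ := hZ.bound p
  obtain ⟨C', hC0', hC'⟩ := hY.bound p
  refine ⟨C + C', by positivity, ?_⟩
  filter_upwards [hC, hC', hθ.pos] with k h1 h2 h3
  refine (eLpNorm_add_le (hZ.meas k) (hY.meas k) (by exact_mod_cast hp)).trans ?_
  rw [add_mul, ENNReal.ofReal_add (by positivity) (by positivity)]; exact add_le_add h1 h2

lemma abs (hZ : StochO μ θ r Z) : StochO μ θ r fun k ω => |Z k ω| :=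
  hZ.of_le (fun k => (hZ.meas k).norm) (by simp)

lemma const (hθ : SmallScale θ) {c : ℕ → ℝ} {C : ℝ} (h : ∀ᶠ k in atTop, |c k| ≤ C * θ k ^ r) :
    StochO μ θ r fun k _ => c k := by
  refine ⟨fun k => aestronglyMeasurable_const, fun p => ⟨|C|, abs_nonneg C, ?_⟩⟩
  filter_upwards [h, hθ.pos] with k h1 h2
  rcases Nat.eq_zero_or_pos p with rfl | hp
  · simp
  rw [eLpNorm_const _ (by exact_mod_cast hp.ne') (IsProbabilityMeasure.ne_zero _)]
  simp only [measure_univ, ENNReal.one_rpow, mul_one]; rw [enorm_eq_ofReal_abs]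
  exact ENNReal.ofReal_le_ofReal (h1.trans (mul_le_mul_of_nonneg_right (le_abs_self C) (by positivity)))

lemma const_zero (hθ : SmallScale θ) (c : ℝ) : StochO μ θ 0 fun _ _ => c :=
  const hθ (C := |c|) (by simp)

lemma zero (hθ : SmallScale θ) : StochO μ θ r fun _ _ => (0 : ℝ) :=
  const hθ (C := 0) (by simp)

lemma sum (hθ : SmallScale θ) {ι : Type*} (t : Finset ι) {F : ι → ∀ k, Ω k → ℝ}
    (h : ∀ i ∈ t, StochO μ θ r (F i)) : StochO μ θ r fun k ω => ∑ i ∈ t, F i k ω := by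
  classical
  induction t using Finset.induction_on with
  | empty => simpa using zero hθ
  | insert a t ha ih =>
    simp_rw [sum_insert ha]; exact (h a (by simp)).add hθ (ih fun i hi => h i (mem_insert_of_mem hi))

lemma mul (hθ : SmallScale θ) (hZ : StochO μ θ r Z) (hY : StochO μ θ s Y) :
    StochO μ θ (r + s) fun k ω => Z k ω * Y k ω := by
  refine ⟨fun k => (hZ.meas k).mul (hY.meas k), fun p => ?_⟩
  obtain ⟨C, hC0, hC⟩ := hZ.bound (2 * p)
  obtain ⟨C', hC0', hC'⟩ := hY.bound (2 * p)
  refine ⟨C * C', by positivity, ?_⟩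
  filter_upwards [hC, hC', hθ.pos] with k h1 h2 h3
  have : ENNReal.HolderTriple ((2 * p : ℕ) : ENNReal) ((2 * p : ℕ) : ENNReal) p := ⟨by
    push_cast; rw [ENNReal.mul_inv (by simp) (by simp), ← add_mul, ENNReal.inv_two_add_inv_two, one_mul]⟩
  have h4 := eLpNorm_smul_le_mul_eLpNorm (p := ((2 * p : ℕ) : ENNReal))
    (q := ((2 * p : ℕ) : ENNReal)) (r := p) (hY.meas k) (hZ.meas k)
  refine h4.trans ((mul_le_mul' h1 h2).trans ?_)
  rw [← ENNReal.ofReal_mul (by positivity)]; refine ENNReal.ofReal_le_ofReal (le_of_eq ?_)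
  rw [rpow_add h3]; ring

lemma const_mul (hθ : SmallScale θ) (c : ℝ) (hZ : StochO μ θ r Z) : StochO μ θ r fun k ω => c * Z k ω := by
  simpa using (const_zero hθ c).mul hθ hZ

lemma bdd_mul (hθ : SmallScale θ) {c : ℕ → ℝ} {C : ℝ} (hc : ∀ᶠ k in atTop, |c k| ≤ C)
    (hZ : StochO μ θ r Z) : StochO μ θ r fun k ω => c k * Z k ω := by
  simpa using (const (r := 0) hθ (by simpa using hc)).mul hθ hZ

lemma sq (hθ : SmallScale θ) (hZ : StochO μ θ r Z) : StochO μ θ (2 * r) fun k ω => Z k ω ^ 2 := by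
  simpa only [two_mul, pow_two] using hZ.mul hθ hZ

lemma memLp (hZ : StochO μ θ r Z) (p : ℕ) : ∀ᶠ k in atTop, MemLp (Z k) p (μ k) := by
  obtain ⟨C, -, hC⟩ := hZ.bound p
  filter_upwards [hC] with k h
  exact ⟨hZ.meas k, h.trans_lt ENNReal.ofReal_lt_top⟩

lemma integrable (hZ : StochO μ θ r Z) : ∀ᶠ k in atTop, Integrable (Z k) (μ k) :=
  (hZ.memLp 1).mono fun k h => memLp_one_iff_integrable.1 (by simpa using h)

lemma integral_le (hθ : SmallScale θ) (hZ : StochO μ θ r Z) :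
    ∃ C : ℝ, 0 ≤ C ∧ ∀ᶠ k in atTop, |∫ ω, Z k ω ∂(μ k)| ≤ C * θ k ^ r := by
  obtain ⟨C, hC0, hC⟩ := hZ.bound 1
  refine ⟨C, hC0, ?_⟩
  filter_upwards [hC, hθ.pos] with k h h3
  rw [← norm_eq_abs]; refine (norm_integral_le_lintegral_norm _).trans ?_
  refine ENNReal.toReal_le_of_le_ofReal (by positivity) ?_
  simp only [Nat.cast_one, eLpNorm_one_eq_lintegral_enorm] at h; simp_rw [ofReal_norm]; exact h

lemma integral_isLittleO (hθ : SmallScale θ) (hZ : StochO μ θ r Z) (hs : s < r) :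
    (fun k => ∫ ω, Z k ω ∂(μ k)) =o[atTop] fun k => θ k ^ s := by
  obtain ⟨C, hC0, hC⟩ := hZ.integral_le hθ
  refine IsLittleO.of_bound fun c hc => ?_
  filter_upwards [hC, hθ.pos, hθ.rpow_le (r := r - s) (c := c / (C + 1)) (by linarith) (by positivity)] with k h1 h3 h4
  rw [norm_eq_abs, norm_of_nonneg (by positivity)]; refine h1.trans ?_
  have h5 : θ k ^ r = θ k ^ (r - s) * θ k ^ s := by rw [← rpow_add h3]; congr 1; ring
  have h6 : 0 ≤ θ k ^ s := rpow_nonneg h3.le _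
  rw [h5, ← mul_assoc]; refine mul_le_mul_of_nonneg_right ?_ h6
  calc C * θ k ^ (r - s) ≤ (C + 1) * (c / (C + 1)) := mul_le_mul (by linarith) h4 (rpow_nonneg h3.le _) (by positivity)
    _ = c := by field_simp

/-- Markov's inequality: large deviations have probability of arbitrarily high order. -/
lemma measure_le (hθ : SmallScale θ) (hZ : StochO μ θ r Z) (hs : s < r) (g : ℝ) :
    ∃ c : ℝ, 0 ≤ c ∧ ∀ᶠ k in atTop, (μ k).real {ω | θ k ^ s ≤ |Z k ω|} ≤ c * θ k ^ g := by
  obtain ⟨p, hp⟩ := exists_nat_gt (max 0 (g / (r - s)))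
  have hp0 : 0 < p := by aesop
  have hpg : g ≤ p * (r - s) := by
    have := (le_max_right 0 (g / (r - s))).trans hp.le
    rwa [div_le_iff₀ (by linarith)] at this
  obtain ⟨C, hC0, hC⟩ := hZ.bound p
  refine ⟨C ^ p, by positivity, ?_⟩
  filter_upwards [hC, hθ.pos, hθ.le one_pos] with k h1 h3 h4
  have hs0 : 0 < θ k ^ s := rpow_pos_of_pos h3 _
  have h5 := mul_meas_ge_le_pow_eLpNorm' (μ k) (p := p) (by exact_mod_cast hp0.ne') (by simp)
    (hZ.meas k) (ENNReal.ofReal (θ k ^ s))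
  have hset : {ω | ENNReal.ofReal (θ k ^ s) ≤ ‖Z k ω‖ₑ} = {ω | θ k ^ s ≤ |Z k ω|} := by
    ext ω; simp only [Set.mem_ofPred_eq, enorm_eq_ofReal_abs]; exact ENNReal.ofReal_le_ofReal_iff (abs_nonneg _)
  rw [hset] at h5; simp only [ENNReal.toReal_natCast, ENNReal.rpow_natCast] at h5
  have h6 := h5.trans (pow_le_pow_left' h1 p)
  rw [← ENNReal.ofReal_pow hs0.le, ← ENNReal.ofReal_pow (by positivity)] at h6
  have h7 := ENNReal.toReal_mono ENNReal.ofReal_ne_top h6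
  rw [ENNReal.toReal_mul, ENNReal.toReal_ofReal (by positivity), ENNReal.toReal_ofReal (by positivity)] at h7
  have h8 : (C * θ k ^ r) ^ p = (θ k ^ s) ^ p * (C ^ p * θ k ^ (p * (r - s))) := by
    rw [mul_pow, ← rpow_natCast (θ k ^ r), ← rpow_natCast (θ k ^ s),
      ← rpow_mul h3.le, ← rpow_mul h3.le, mul_left_comm, ← rpow_add h3]
    congr 2; ring
  rw [h8] at h7; refine (le_of_mul_le_mul_left h7 (by positivity)).trans ?_
  exact mul_le_mul_of_nonneg_left (rpow_le_rpow_of_exponent_ge h3 h4 hpg) (by positivity)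

lemma indicator_of_measure_le (hθ : SmallScale θ) {B : ∀ k, Set (Ω k)} (hB : ∀ k, MeasurableSet (B k))
    (h : ∀ g : ℝ, 0 < g → ∃ c : ℝ, ∀ᶠ k in atTop, (μ k).real (B k) ≤ c * θ k ^ g) (r : ℝ) :
    StochO μ θ r fun k => (B k).indicator fun _ => (1 : ℝ) := by
  refine ⟨fun k => (measurable_const.indicator (hB k)).aestronglyMeasurable, fun p => ?_⟩
  rcases Nat.eq_zero_or_pos p with rfl | hp
  · exact ⟨0, le_rfl, by simp⟩
  obtain ⟨c, hc⟩ := h (p * (|r| + 1)) (by positivity)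
  refine ⟨(|c| + 1), by positivity, ?_⟩
  filter_upwards [hc, hθ.pos, hθ.le one_pos] with k h1 h3 h4
  rw [eLpNorm_indicator_const (hB k) (by exact_mod_cast hp.ne') (by simp)]
  simp only [enorm_one, one_mul, ENNReal.toReal_natCast]
  have h5 : μ k (B k) ≤ ENNReal.ofReal (((|c| + 1) * θ k ^ r) ^ p) := by
    rw [← ENNReal.ofReal_toReal (measure_ne_top (μ k) (B k))]; refine ENNReal.ofReal_le_ofReal (h1.trans ?_)
    have h6 : θ k ^ (p * (|r| + 1)) ≤ (θ k ^ r) ^ p := by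
      rw [← rpow_natCast (θ k ^ r), ← rpow_mul h3.le]; refine rpow_le_rpow_of_exponent_ge h3 h4 ?_
      nlinarith [le_abs_self r]
    have h7 := (le_abs_self c).trans ((by linarith : |c| ≤ |c| + 1).trans
        (le_self_pow₀ (by simp) hp.ne'))
    rw [mul_pow]; exact mul_le_mul h7 h6 (by positivity) (by positivity)
  calc _ ≤ (ENNReal.ofReal (((|c| + 1) * θ k ^ r) ^ p)) ^ (1 / (p : ℝ)) := ENNReal.rpow_le_rpow h5 (by positivity)
    _ = _ := by
      rw [ENNReal.ofReal_pow (by positivity),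
        ← ENNReal.rpow_natCast, ← ENNReal.rpow_mul, mul_one_div_cancel (by positivity), ENNReal.rpow_one]

lemma of_integral_abs_pow_le (hθ : SmallScale θ) {c : ℕ → ℝ} (hm : ∀ k, AEStronglyMeasurable (Z k) (μ k))
    (hi : ∀ (p : ℕ) k, Integrable (fun ω => |Z k ω| ^ p) (μ k)) {K : ℕ → ℝ}
    (hK : ∀ (p : ℕ) k, ∫ ω, |Z k ω| ^ p ∂(μ k) ≤ K p * c k ^ p) {C : ℝ}
    (hc : ∀ᶠ k in atTop, 0 ≤ c k ∧ c k ≤ C * θ k ^ r) : StochO μ θ r Z := by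
  refine ⟨hm, fun p => ?_⟩
  rcases Nat.eq_zero_or_pos p with rfl | hp
  · exact ⟨0, le_rfl, by simp⟩
  refine ⟨(|K p| + 1) * |C|, by positivity, ?_⟩
  filter_upwards [hc, hθ.pos] with k ⟨h1, h2⟩ h0
  have hK1 : 1 ≤ |K p| + 1 := by simp
  have h3 : ∫ ω, |Z k ω| ^ p ∂(μ k) ≤ ((|K p| + 1) * c k) ^ p := by
    refine (hK p k).trans ?_
    rw [mul_pow]; refine mul_le_mul_of_nonneg_right ?_ (by positivity)
    exact (le_abs_self _).trans ((by linarith : |K p| ≤ |K p| + 1).trans (le_self_pow₀ hK1 hp.ne'))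
  rw [eLpNorm_eq_lintegral_rpow_enorm_toReal (by exact_mod_cast hp.ne') (by simp)]
  simp only [ENNReal.toReal_natCast, ENNReal.rpow_natCast]
  have h4 : ∫⁻ ω, ‖Z k ω‖ₑ ^ p ∂(μ k) = ENNReal.ofReal (∫ ω, |Z k ω| ^ p ∂(μ k)) := by
    rw [ofReal_integral_eq_lintegral_ofReal (hi p k) (ae_of_all _ fun ω => by positivity)]
    refine lintegral_congr fun ω => ?_
    rw [enorm_eq_ofReal_abs, ENNReal.ofReal_pow (abs_nonneg _)]
  rw [h4]
  calc _ ≤ (ENNReal.ofReal (((|K p| + 1) * c k) ^ p)) ^ (1 / (p : ℝ)) :=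
        ENNReal.rpow_le_rpow (by gcongr) (by positivity)
    _ = ENNReal.ofReal ((|K p| + 1) * c k) := by
      rw [ENNReal.ofReal_pow (by positivity),
        ← ENNReal.rpow_natCast, ← ENNReal.rpow_mul, mul_one_div_cancel (by positivity), ENNReal.rpow_one]
    _ ≤ _ := by
      refine ENNReal.ofReal_le_ofReal ?_
      rw [mul_assoc]; refine mul_le_mul_of_nonneg_left ?_ (by positivity)
      exact h2.trans (mul_le_mul_of_nonneg_right (le_abs_self C) (by positivity))

lemma of_sq (hθ : SmallScale θ) (hm : ∀ k, AEStronglyMeasurable (Z k) (μ k))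
    (h : StochO μ θ (2 * r) fun k ω => Z k ω ^ 2) : StochO μ θ r Z := by
  refine ⟨hm, fun p => ?_⟩
  obtain ⟨C, hC0, hC⟩ := h.bound p
  refine ⟨sqrt C, sqrt_nonneg C, ?_⟩
  filter_upwards [hC, hθ.pos] with k h1 h2
  have h3 : eLpNorm (Z k) (p * ENNReal.ofReal 2) (μ k) ^ (2 : ℝ) ≤ ENNReal.ofReal (C * θ k ^ (2 * r)) := by
    rw [← eLpNorm_norm_rpow _ (by norm_num)]; refine (le_of_eq ?_).trans h1
    simp
  have h4 : eLpNorm (Z k) p (μ k) ≤ eLpNorm (Z k) (p * ENNReal.ofReal 2) (μ k) := by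
    refine eLpNorm_le_eLpNorm_of_exponent_le ?_ (hm k)
    have : 1 ≤ ENNReal.ofReal 2 := by norm_num
    calc (p : ENNReal) = p * 1 := (mul_one _).symm
      _ ≤ _ := by gcongr
  have h5 : ENNReal.ofReal (C * θ k ^ (2 * r)) = ENNReal.ofReal (sqrt C * θ k ^ r) ^ (2 : ℝ) := by
    rw [ENNReal.ofReal_rpow_of_nonneg (by positivity) zero_le_two]
    rw [rpow_two, mul_pow, sq_sqrt hC0, mul_comm 2 r, rpow_mul h2.le, rpow_two]
  rw [h5] at h3; exact h4.trans ((ENNReal.rpow_le_rpow_iff zero_lt_two).1 h3)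

end StochO

/-! Quadratic and linear forms of standard normal vectors. -/

variable {N : ℕ → Type*} [∀ k, Fintype (N k)] {ε : ∀ k, Ω k → N k → ℝ}

/-- `ε k` is a measurable standard normal vector for every `k`. -/
structure StdNormalSeq (μ : ∀ k, Measure (Ω k)) (ε : ∀ k, Ω k → N k → ℝ) : Prop where
  meas : ∀ k, Measurable (ε k)
  law : ∀ k, (μ k).map (ε k) = stdNormal (N k)

namespace StdNormalSeq

variable {r : ℝ} (hε : StdNormalSeq μ ε)
include hε

lemma integral_comp (k : ℕ) {f : (N k → ℝ) → ℝ} (hf : Measurable f) :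
    ∫ ω, f (ε k ω) ∂(μ k) = ∫ z, f z ∂(stdNormal (N k)) := by
  rw [← hε.law k, integral_map (hε.meas k).aemeasurable hf.aestronglyMeasurable]

lemma integrable_comp (k : ℕ) {f : (N k → ℝ) → ℝ} (hf : Measurable f)
    (h : Integrable f (stdNormal (N k))) : Integrable (fun ω => f (ε k ω)) (μ k) := by
  rw [← hε.law k] at h; exact (integrable_map_measure hf.aestronglyMeasurable (hε.meas k).aemeasurable).1 h

lemma order_qform (hθ : SmallScale θ) {A : ∀ k, Matrix (N k) (N k) ℝ} {C : ℝ}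
    (hA : ∀ᶠ k in atTop, traceNormTwo (A k) ≤ C * θ k ^ r) : StochO μ θ r fun k ω => qform (A k) (ε k ω) := by
  refine StochO.of_integral_abs_pow_le hθ
    (K := fun p => 4 ^ p * p.factorial * (2 * exp (1 / 4)))
    (fun k => ((meas_qform _).comp (hε.meas k)).aestronglyMeasurable) ?_ ?_
    (hA.mono fun k h => ⟨fro_nonneg _, h⟩)
  · intro p k
    refine hε.integrable_comp k ((meas_qform (A k)).abs.pow_const p) ?_
    have := (memLp_qform (A k) p (by simp)).integrable_norm_pow'
    simpa using this
  · intro p k; rw [hε.integral_comp k ((meas_qform (A k)).abs.pow_const p)]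
    exact integral_abs_qform_pow_le (A k) p

lemma order_vnorm (hθ : SmallScale θ) [∀ k, DecidableEq (N k)]
    {A : ∀ k, Matrix (N k) (N k) ℝ} (hs : ∀ k, (A k)ᵀ = A k) {C : ℝ}
    (hA : ∀ᶠ k in atTop, traceNormTwo (A k) ≤ C * θ k ^ r) : StochO μ θ r fun k ω => vnorm (A k *ᵥ ε k ω) := by
  have hm : ∀ k, Measurable fun ω => vnorm (A k *ᵥ ε k ω) := fun k => by
    have := (meas_mulVec (A k)).comp (hε.meas k)
    have h2 i := (measurable_pi_apply i).comp this
    exact (Finset.measurable_fun_sum _ fun i _ => (h2 i).mul (h2 i)).sqrt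
  refine StochO.of_sq hθ (fun k => (hm k).aestronglyMeasurable) ?_
  have h1 : ∀ k ω, vnorm (A k *ᵥ ε k ω) ^ 2 = qform (A k * A k) (ε k ω) + traceNormTwo (A k) ^ 2 := fun k ω => by
    rw [vnorm_sq_mulVec_of_symm (hs k), qform, fro_sq, hs k]; ring
  simp_rw [h1]
  have h2 : ∀ᶠ k in atTop, traceNormTwo (A k) ^ 2 ≤ C ^ 2 * θ k ^ (2 * r) := by
    filter_upwards [hA, hθ.pos] with k h h0
    have := pow_le_pow_left₀ (fro_nonneg _) h 2
    refine this.trans (le_of_eq ?_)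
    rw [mul_pow, mul_comm 2 r, rpow_mul h0.le, rpow_two]
  refine StochO.add hθ (hε.order_qform hθ (C := C ^ 2) ?_) (StochO.const hθ (C := C ^ 2) ?_)
  · filter_upwards [h2] with k h
    refine le_trans ?_ h
    open scoped Matrix.Norms.L2Operator in
    refine (fro_mul_le _ _).trans ?_
    rw [pow_two]; exact mul_le_mul_of_nonneg_right (opNorm_le_fro _) (fro_nonneg _)
  · filter_upwards [h2] with k h
    rwa [abs_of_nonneg (sq_nonneg _)]

lemma order_dot (hθ : SmallScale θ) {u : ∀ k, N k → ℝ} {C : ℝ}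
    (hu : ∀ᶠ k in atTop, vnorm (u k) ≤ C * θ k ^ r) : StochO μ θ r fun k ω => u k ⬝ᵥ ε k ω := by
  have hm : ∀ k, Measurable fun ω => u k ⬝ᵥ ε k ω := fun k => by
    have h2 i := (measurable_pi_apply i).comp (hε.meas k)
    exact Finset.measurable_fun_sum _ fun i _ => (h2 i).const_mul _
  refine StochO.of_sq hθ (fun k => (hm k).aestronglyMeasurable) ?_
  have h1 : ∀ k ω, (u k ⬝ᵥ ε k ω) ^ 2 = qform (vecMulVec (u k) (u k)) (ε k ω) + vnorm (u k) ^ 2 := fun k ω => by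
    rw [qform, trace_vecMulVec, vecMulVec_mulVec, vnorm_sq]; simp [dotProduct_comm (ε k ω), pow_two]
  simp_rw [h1]
  have h2 : ∀ᶠ k in atTop, vnorm (u k) ^ 2 ≤ C ^ 2 * θ k ^ (2 * r) := by
    filter_upwards [hu, hθ.pos] with k h h0
    have := pow_le_pow_left₀ (vnorm_nonneg _) h 2
    refine this.trans (le_of_eq ?_)
    rw [mul_pow, mul_comm 2 r, rpow_mul h0.le, rpow_two]
  refine StochO.add hθ (hε.order_qform hθ (C := C ^ 2) ?_) (StochO.const hθ (C := C ^ 2) ?_)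
  · filter_upwards [h2] with k h
    refine le_trans (le_of_eq ?_) h
    rw [traceNormTwo, transpose_vecMulVec, vecMulVec_mul_vecMulVec,
      trace_vecMulVec, dotProduct_smul, ← vnorm_sq, smul_eq_mul, ← pow_two, sqrt_sq (sq_nonneg _)]
  · filter_upwards [h2] with k h
    rwa [abs_of_nonneg (sq_nonneg _)]

end StdNormalSeq
end StochasticOrder

section MeasurableMatrix

variable {Ω n : Type*} [MeasurableSpace Ω] [Fintype n] [DecidableEq n]

lemma meas_matrix_det {A : Ω → Matrix n n ℝ} (h : ∀ i j, Measurable fun ω => A ω i j) :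
    Measurable fun ω => (A ω).det := by
  simp only [det_apply']
  exact Finset.measurable_fun_sum _ fun σ _ =>
    (Finset.measurable_fun_prod _ fun i _ => h _ _).const_mul _

lemma meas_matrix_inv {A : Ω → Matrix n n ℝ} (h : ∀ i j, Measurable fun ω => A ω i j)
    (i j : n) : Measurable fun ω => (A ω)⁻¹ i j := by
  simp only [Matrix.inv_def, Matrix.smul_apply, smul_eq_mul, Ring.inverse_eq_inv']
  refine (meas_matrix_det h).inv.mul ?_
  simp only [adjugate_apply]; refine meas_matrix_det fun a b => ?_
  by_cases ha : a = j
  · subst ha; simp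
  · simpa [updateRow_ne ha] using h a b

lemma meas_matrix_mul {l m : Type*} {A : Ω → Matrix l n ℝ} {B : Ω → Matrix n m ℝ}
    (hA : ∀ i j, Measurable fun ω => A ω i j) (hB : ∀ i j, Measurable fun ω => B ω i j)
    (i : l) (j : m) : Measurable fun ω => (A ω * B ω) i j := by
  exact Finset.measurable_fun_sum _ fun k _ => (hA i k).mul (hB k j)

lemma meas_matrix_mulVec {l : Type*} {A : Ω → Matrix l n ℝ} {v : Ω → n → ℝ}
    (hA : ∀ i j, Measurable fun ω => A ω i j) (hv : ∀ j, Measurable fun ω => v ω j)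
    (i : l) : Measurable fun ω => (A ω *ᵥ v ω) i := Finset.measurable_fun_sum _ fun k _ => (hA i k).mul (hv k)

lemma meas_dot {u v : Ω → n → ℝ}
    (hu : ∀ j, Measurable fun ω => u ω j) (hv : ∀ j, Measurable fun ω => v ω j) : Measurable fun ω => u ω ⬝ᵥ v ω :=
  Finset.measurable_fun_sum _ fun k _ => (hu k).mul (hv k)

lemma meas_resolv {I : Type*} [Fintype I] (R : I → Matrix n n ℝ) {X : Ω → I → ℝ}
    (hX : ∀ i, Measurable fun ω => X ω i) (a b : n) : Measurable fun ω => resolv R (X ω) a b := by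
  refine meas_matrix_inv (fun i j => ?_) a b
  simp only [Matrix.add_apply, pert, Matrix.sum_apply, Matrix.smul_apply, smul_eq_mul]
  exact (Finset.measurable_fun_sum _ fun l _ => (hX l).mul_const _).const_add _

end MeasurableMatrix

section CanonicalModel

lemma integral_qform_mul_left_symm {n : Type*} [Fintype n] {A B : Matrix n n ℝ} (hA : Aᵀ = A) :
    ∫ z, qform A z * qform B z ∂(stdNormal n) = 2 * (A * B).trace := by
  simp_rw [qform_eq_symm_part B]
  rw [integral_qform_mul hA (symm_part_tr B), Matrix.mul_smul, Matrix.mul_add, trace_smul, trace_add]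
  have : (A * Bᵀ).trace = (A * B).trace := by
    rw [← trace_transpose, transpose_mul, transpose_transpose, hA, trace_mul_comm]
  rw [this, smul_eq_mul]; ring

lemma abs_integral_qform_mul_mul_le {n : Type*} [Fintype n] [DecidableEq n] {A B D : Matrix n n ℝ}
    (hA : Aᵀ = A) (hB : Bᵀ = B) :
    |∫ z, qform A z * qform B z * qform D z ∂(stdNormal n)| ≤ 8 * (traceNormTwo (A * B) * traceNormTwo D) := by
  simp_rw [qform_eq_symm_part D]
  rw [integral_qform_mul_mul hA hB (symm_part_tr D), abs_mul, abs_of_pos (by simp)]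
  refine mul_le_mul_of_nonneg_left (abs_trace_mul_le_of_le le_rfl ?_) (by norm_num)
  rw [fro_smul, abs_of_pos (by simp)]; have := fro_add_le D Dᵀ; rw [fro_tr] at this
  linarith

lemma fro_vecMulVec {n : Type*} [Fintype n] [DecidableEq n] (u v : n → ℝ) :
    traceNormTwo (vecMulVec u v) = vnorm u * vnorm v := by
  rw [traceNormTwo, transpose_vecMulVec, vecMulVec_mul_vecMulVec,
    trace_vecMulVec, dotProduct_smul, ← vnorm_sq, ← vnorm_sq, smul_eq_mul, ← mul_pow,
    sqrt_sq (mul_nonneg (vnorm_nonneg _) (vnorm_nonneg _))]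

lemma dot_mul_dot_eq {n : Type*} [Fintype n] (u v z : n → ℝ) :
    (u ⬝ᵥ z) * v ⬝ᵥ z = qform (vecMulVec u v) z + u ⬝ᵥ v := by
  rw [qform, trace_vecMulVec, vecMulVec_mulVec]; simp [dotProduct_comm z, mul_comm]

section Deterministic
variable {I n : Type*} [Fintype I] [DecidableEq I] [Fintype n] [DecidableEq n] {R : I → Matrix n n ℝ}

/-- The information matrix of the parameters `x` at the origin. -/
def infoMat (R : I → Matrix n n ℝ) : Matrix I I ℝ := of fun i j => 1 / 2 * (R i * R j).trace

lemma infoMat_tr (R : I → Matrix n n ℝ) : (infoMat R)ᵀ = infoMat R := by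
  ext i j; simp [infoMat, trace_mul_comm (R i)]

lemma tr_eq_of_mul_infoMat {J : Matrix I I ℝ} (h : J * infoMat R = 1) : Jᵀ = J := by
  have h3 : infoMat R * Jᵀ = 1 := by rw [← transpose_one, ← h, transpose_mul, infoMat_tr]
  calc Jᵀ = J * (infoMat R * Jᵀ) := by rw [← mul_assoc, h, one_mul]
    _ = J := by rw [h3, mul_one]

lemma qform_mul_eq (hR : ∀ i, (R i)ᵀ = R i) (i k : I) (e : n → ℝ) :
    (R k *ᵥ e) ⬝ᵥ R i *ᵥ e = qform (R k * R i) e + (R k * R i).trace := by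
  rw [qform, ← mulVec_mulVec, dot_symm (hR k)]; ring

lemma stdScore_zero (e : n → ℝ) (i : I) : stdScore R 0 e i = 1 / 2 * qform (R i) e := by
  simp [stdScore, resolv_zero, qform]

lemma infoMat_mulVec (x : I → ℝ) (i : I) : (infoMat R *ᵥ x) i = ∑ k, 1 / 2 * (R i * R k).trace * x k := rfl

lemma linear_term_eq (hR : ∀ i, (R i)ᵀ = R i) (x : I → ℝ) (e : n → ℝ) (i : I) :
    (pert R x *ᵥ e) ⬝ᵥ R i *ᵥ e - 1 / 2 * (pert R x * R i).trace
      = ∑ k, x k * qform (R k * R i) e + (infoMat R *ᵥ x) i := by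
  simp only [pert, sum_mulVec, sum_dotProduct, smul_mulVec, smul_dotProduct,
    qform_mul_eq hR, Matrix.sum_mul, trace_sum, smul_mul, trace_smul, smul_eq_mul, infoMat_mulVec, mul_sum]
  rw [← sum_sub_distrib, ← sum_add_distrib]; refine sum_congr rfl fun k _ => ?_
  rw [trace_mul_comm (R i) (R k)]; ring

lemma trace_three_swap (hR : ∀ i, (R i)ᵀ = R i) (i k l : I) : (R l * R k * R i).trace = (R k * R l * R i).trace := by
  rw [← trace_transpose]; simp only [transpose_mul, hR]; rw [trace_mul_comm, mul_assoc]

lemma quadratic_term_eq (hR : ∀ i, (R i)ᵀ = R i) (x : I → ℝ) (e : n → ℝ) (i : I) :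
    (pert R x *ᵥ pert R x *ᵥ e) ⬝ᵥ R i *ᵥ e + 1 / 2 * pert R x *ᵥ e ⬝ᵥ R i *ᵥ pert R x *ᵥ e
        - 1 / 2 * (pert R x * (pert R x * R i)).trace = ∑ k, ∑ l, x k * x l * (R k * R l * R i).trace
        + ∑ k, ∑ l, x k * x l * (qform (R l * R k * R i) e + 1 / 2 * qform (R k * R i * R l) e) := by
  have h1 : ∀ k l, R k *ᵥ R l *ᵥ e ⬝ᵥ R i *ᵥ e
      = qform (R l * R k * R i) e + (R k * R l * R i).trace := fun k l => by
    rw [qform, trace_three_swap hR, ← mulVec_mulVec, ← mulVec_mulVec,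
      dot_symm (hR l), dot_symm (hR k)]
    ring
  have h2 : ∀ k l, R k *ᵥ e ⬝ᵥ R i *ᵥ R l *ᵥ e
      = qform (R k * R i * R l) e + (R k * R l * R i).trace := fun k l => by
    rw [qform, mul_assoc, trace_mul_comm, mul_assoc, trace_mul_comm (R i), trace_three_swap hR,
      ← mulVec_mulVec, ← mulVec_mulVec, dot_symm (hR k)]
    ring
  have e1 : (pert R x *ᵥ pert R x *ᵥ e) ⬝ᵥ R i *ᵥ e
      = ∑ k, ∑ l, x k * x l * (qform (R l * R k * R i) e + (R k * R l * R i).trace) := by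
    simp only [pert, sum_mulVec, mulVec_sum, sum_dotProduct, smul_mulVec,
      mulVec_smul, smul_dotProduct, h1, smul_eq_mul, mul_sum]
    rw [sum_comm]; refine sum_congr rfl fun k _ => sum_congr rfl fun l _ => by ring
  have e2 : (pert R x *ᵥ e) ⬝ᵥ R i *ᵥ pert R x *ᵥ e
      = ∑ k, ∑ l, x k * x l * (qform (R k * R i * R l) e + (R k * R l * R i).trace) := by
    simp only [pert, sum_mulVec, mulVec_sum, sum_dotProduct, dotProduct_sum,
      smul_mulVec, mulVec_smul, smul_dotProduct, dotProduct_smul, h2, smul_eq_mul, mul_sum]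
    try rw [sum_comm]
    refine sum_congr rfl fun k _ => sum_congr rfl fun l _ => by ring
  have e3 : (pert R x * (pert R x * R i)).trace = ∑ k, ∑ l, x k * x l * (R k * R l * R i).trace := by
    simp only [pert, Matrix.sum_mul, trace_sum, smul_mul,
      Matrix.mul_smul, trace_smul, smul_eq_mul, mul_sum, ← mul_assoc]
    try rw [sum_comm]
    refine sum_congr rfl fun k _ => sum_congr rfl fun l _ => by ring
  rw [e1, e2, e3]; simp only [mul_sum, ← sum_add_distrib, ← sum_sub_distrib]
  refine sum_congr rfl fun k _ => sum_congr rfl fun l _ => by ring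

lemma resolv_mulVec_dot {θ M : ℝ} {e : n → ℝ} (h : PertBounds R θ M e) {x : I → ℝ} (hx : θ * ∑ i, |x i| ≤ 1 / 2) (w : n → ℝ) :
    w ⬝ᵥ resolv R x *ᵥ e = w ⬝ᵥ e - pert R x *ᵥ w ⬝ᵥ e + pert R x *ᵥ w ⬝ᵥ resolv R x *ᵥ pert R x *ᵥ e := by
  have e1 : resolv R x *ᵥ e = e - resolv R x *ᵥ pert R x *ᵥ e := by
    rw [mulVec_mulVec, resolv_comm h.op hx]; nth_rewrite 1 [resolv_eq h.op hx]; rw [sub_mulVec, one_mulVec]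
  have e2 : w ⬝ᵥ resolv R x *ᵥ e = w ⬝ᵥ e - pert R x *ᵥ w ⬝ᵥ resolv R x *ᵥ e := by
    rw [← dot_symm (pert_tr h.symm x)]; nth_rewrite 1 [resolv_eq h.op hx]
    rw [sub_mulVec, one_mulVec, dotProduct_sub, mulVec_mulVec]
  rw [e2]; nth_rewrite 1 [e1]; rw [dotProduct_sub]; ring

end Deterministic

variable {I : Type*} [Fintype I] [DecidableEq I] {N : ℕ → Type*} [∀ k, Fintype (N k)]
  [∀ k, DecidableEq (N k)] {Ω : ℕ → Type*} [∀ k, MeasurableSpace (Ω k)]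
  {μ : ∀ k, Measure (Ω k)} [∀ k, IsProbabilityMeasure (μ k)] {θ : ℕ → ℝ}
  {ε : ∀ k, Ω k → N k → ℝ} {R : ∀ k, I → Matrix (N k) (N k) ℝ} {J : ℕ → Matrix I I ℝ}

/-- A sequence of Gaussian covariance models in normalized coordinates. -/
structure CanonicalModel (μ : ∀ k, Measure (Ω k)) (θ : ℕ → ℝ) (ε : ∀ k, Ω k → N k → ℝ)
    (R : ∀ k, I → Matrix (N k) (N k) ℝ) (J : ℕ → Matrix I I ℝ) (C : ℝ) : Prop where
  scale : SmallScale θ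
  normal : StdNormalSeq μ ε
  nonneg : 0 ≤ C
  symm : ∀ k i, (R k i)ᵀ = R k i
  op : ∀ᶠ k in atTop, ∀ i, ‖R k i‖ ≤ C * θ k
  fro : ∀ᶠ k in atTop, ∀ i, traceNormTwo (R k i) ≤ 1
  J_mul : ∀ᶠ k in atTop, J k * infoMat (R k) = 1
  J_bound : ∀ᶠ k in atTop, ∀ i j, |J k i j| ≤ C

/-- `X` solves the score equations with bias `bX` on the likely event `G` and vanishes elsewhere. -/
structure LocalRoot (μ : ∀ k, Measure (Ω k)) (θ : ℕ → ℝ) (ε : ∀ k, Ω k → N k → ℝ)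
    (R : ∀ k, I → Matrix (N k) (N k) ℝ) (C : ℝ) (G : ∀ k, Set (Ω k)) (X : ∀ k, Ω k → I → ℝ) (b : ℕ → I → ℝ) : Prop where
  measX : ∀ k, Measurable (X k)
  measG : ∀ k, MeasurableSet (G k)
  prob : ∀ g : ℝ, 0 < g → ∃ c : ℝ, ∀ᶠ k in atTop, (μ k).real (G k)ᶜ ≤ c * θ k ^ g
  zero : ∀ k, ∀ ω ∉ G k, X k ω = 0
  small : ∀ᶠ k in atTop, ∀ ω ∈ G k, ∀ i, |X k ω i| ≤ θ k ^ (-(1 / 40) : ℝ)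
  bias_le : ∀ᶠ k in atTop, ∀ i, |b k i| ≤ C * θ k
  root : ∀ δ : ℝ, 0 < δ → ∀ᶠ k in atTop, ∀ ω ∈ G k, ∀ i,
    |stdScore (R k) (X k ω) (ε k ω) i - b k i| ≤ δ * θ k

namespace CanonicalModel

variable {C : ℝ} (h : CanonicalModel μ θ ε R J C)

/-- A dominating random variable for the vectors `R_i ε`. -/
def domin (ε : ∀ k, Ω k → N k → ℝ) (R : ∀ k, I → Matrix (N k) (N k) ℝ) (k : ℕ) (ω : Ω k) : ℝ :=
  ∑ i, vnorm (R k i *ᵥ ε k ω)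

include h

lemma order_domin : StochO μ θ 0 (domin ε R) := by
  refine StochO.sum h.scale _ fun i _ => ?_
  refine h.normal.order_vnorm h.scale (fun k => h.symm k i) (C := 1) ?_
  filter_upwards [h.fro] with k hk
  simpa using hk i

lemma pertBounds : ∀ᶠ k in atTop, ∀ ω, PertBounds (R k) (C * θ k) (domin ε R k ω) (ε k ω) := by
  filter_upwards [h.op, h.fro] with k h1 h2 ω
  exact ⟨h.symm k, h1, h2, fun i =>
    single_le_sum (f := fun i => vnorm (R k i *ᵥ ε k ω)) (fun _ _ => vnorm_nonneg _) (mem_univ i)⟩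

lemma order_score (i : I) : StochO μ θ 0 fun k ω => 1 / 2 * qform (R k i) (ε k ω) := by
  refine StochO.const_mul h.scale _ (h.normal.order_qform h.scale (C := 1) ?_)
  filter_upwards [h.fro] with k hk
  simpa using hk i

lemma fro_mul : ∀ᶠ k in atTop, ∀ i j, traceNormTwo (R k i * R k j) ≤ C * θ k := by
  filter_upwards [h.op, h.fro] with k h1 h2 i j
  simpa using traceNormTwo_mul_le_of_le (h1 i) (h2 j)

lemma fro_mul_mul : ∀ᶠ k in atTop, ∀ i j l, traceNormTwo (R k i * R k j * R k l) ≤ C ^ 2 * θ k ^ 2 := by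
  filter_upwards [h.op, h.fro_mul] with k h1 h2 i j l
  rw [mul_assoc]; refine (traceNormTwo_mul_le_of_le (h1 i) (h2 j l)).trans (le_of_eq (by ring))

lemma abs_trace_mul_mul : ∀ᶠ k in atTop, ∀ i j l, |(R k i * R k j * R k l).trace| ≤ C * θ k := by
  filter_upwards [h.fro_mul, h.fro] with k h1 h2 i j l
  simpa using abs_trace_mul_le_of_le (h1 i j) (h2 l)

lemma order_info (i j : I) : StochO μ θ 1 fun k ω => qform (R k i * R k j) (ε k ω) := by
  refine h.normal.order_qform h.scale (C := C) ?_
  filter_upwards [h.fro_mul] with k hk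
  simpa using hk i j

lemma order_third (i j l : I) : StochO μ θ 2 fun k ω => qform (R k i * R k j * R k l) (ε k ω) := by
  refine h.normal.order_qform h.scale (C := C ^ 2) ?_
  filter_upwards [h.fro_mul_mul] with k hk
  simpa using hk i j l

lemma J_symm : ∀ᶠ k in atTop, (J k)ᵀ = J k := by filter_upwards [h.J_mul] with k hk using tr_eq_of_mul_infoMat hk

lemma op_small {r : ℝ} (hr : r < 1) (D : ℝ) :
    ∀ᶠ k in atTop, ∀ x : I → ℝ, (∑ i, |x i| ≤ D * θ k ^ (-r)) → C * θ k * ∑ i, |x i| ≤ 1 / 2 := by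
  have h2 := h.scale.rpow_le (r := 1 - r) (c := 1 / (2 * (C * |D| + 1))) (by linarith) (by have := h.nonneg; positivity)
  filter_upwards [h2, h.scale.pos] with k h2 h3 x hx
  have hC := h.nonneg
  have h4 : C * θ k * ∑ i, |x i| ≤ C * θ k * (|D| * θ k ^ (-r)) := by
    refine mul_le_mul_of_nonneg_left (hx.trans ?_) (by positivity)
    exact mul_le_mul_of_nonneg_right (le_abs_self D) (by positivity)
  refine h4.trans ?_
  have h5 : θ k * θ k ^ (-r) = θ k ^ (1 - r) := by nth_rewrite 1 [← rpow_one (θ k)]; rw [← rpow_add h3]; congr 1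
  calc C * θ k * (|D| * θ k ^ (-r)) = C * |D| * (θ k * θ k ^ (-r)) := by ring
    _ = C * |D| * θ k ^ (1 - r) := by rw [h5]
    _ ≤ (C * |D| + 1) * (1 / (2 * (C * |D| + 1))) := by
      refine mul_le_mul (by linarith) h2 (by positivity) (by positivity)
    _ = 1 / 2 := by field_simp

lemma lipschitz_score {b : ℕ → (I → ℝ) → I → ℝ} {C' : ℝ}
    (hb : ∀ᶠ k in atTop, ∀ x x' : I → ℝ, ‖x‖ ≤ θ k ^ (-(1 / 4) : ℝ) → ‖x'‖ ≤ θ k ^ (-(1 / 4) : ℝ) →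
      ∀ i, |b k x i - b k x' i| ≤ C' * θ k * ‖x - x'‖) : ∀ᶠ k in atTop, ∀ ω,
      ∑ p : I × I, |qform (R k p.1 * R k p.2) (ε k ω)| < θ k ^ (1 / 2 : ℝ) →
      |domin ε R k ω| < θ k ^ (-(1 / 20) : ℝ) →
      ∀ x x' : I → ℝ, ‖x‖ ≤ θ k ^ (-(1 / 4) : ℝ) → ‖x'‖ ≤ θ k ^ (-(1 / 4) : ℝ) →
      ‖(fun i => stdScore (R k) x (ε k ω) i - b k x i)
          - (fun i => stdScore (R k) x' (ε k ω) i - b k x' i) + infoMat (R k) *ᵥ (x - x')‖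
        ≤ (22 * C * Fintype.card I ^ 2 * θ k ^ (13 / 20 : ℝ) + θ k ^ (1 / 2 : ℝ) + |C'| * θ k) * ‖x - x'‖ := by
  have hC := h.nonneg
  filter_upwards [hb, h.pertBounds, h.scale.pos, h.scale.le one_pos,
    h.op_small (r := 1 / 4) (by norm_num) (Fintype.card I)] with k hb h1 hk hk1 hsm ω hH hM x x' hx hx'
  have ns : ∀ x : I → ℝ, ∑ i, |x i| ≤ Fintype.card I * ‖x‖ := fun x => by
    simpa using sum_le_sum fun i (_ : i ∈ univ) => norm_le_pi_norm x i
  have hn : (0 : ℝ) ≤ Fintype.card I := Nat.cast_nonneg _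
  set r := θ k ^ (-(1 / 4) : ℝ)
  have nx := (ns x).trans (mul_le_mul_of_nonneg_left hx hn)
  have nx' := (ns x').trans (mul_le_mul_of_nonneg_left hx' hn)
  refine (pi_norm_le_iff_of_nonneg (by positivity)).2 fun i => ?_
  have e1 := abs_stdScore_sub_le (h1 ω) (hsm x nx) (hsm x' nx') i
  rw [add_sub_assoc, linear_term_eq (h.symm k) (x - x') (ε k ω) i] at e1
  have e2 : |∑ j, (x - x') j * qform (R k j * R k i) (ε k ω)| ≤ ‖x - x'‖ * θ k ^ (1 / 2 : ℝ) := by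
    refine le_trans ?_ (mul_le_mul_of_nonneg_left hH.le (norm_nonneg _))
    refine (abs_sum_le_sum_abs _ _).trans ?_
    calc _ ≤ ∑ j, ‖x - x'‖ * |qform (R k j * R k i) (ε k ω)| := sum_le_sum fun j _ => by
          rw [abs_mul]; exact mul_le_mul_of_nonneg_right (norm_le_pi_norm (x - x') j) (abs_nonneg _)
      _ = ‖x - x'‖ * ∑ j, |qform (R k j * R k i) (ε k ω)| := by rw [mul_sum]
      _ ≤ _ := by
        refine mul_le_mul_of_nonneg_left ?_ (norm_nonneg _)
        rw [Fintype.sum_prod_type]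
        exact sum_le_sum fun j _ => single_le_sum
          (f := fun i => |qform (R k j * R k i) (ε k ω)|) (fun _ _ => abs_nonneg _) (mem_univ i)
  have e3 := (hb x x' hx hx' i).trans
    (mul_le_mul_of_nonneg_right (mul_le_mul_of_nonneg_right (le_abs_self _) hk.le) (norm_nonneg _))
  have e4 : C * θ k * (∑ i, |x i - x' i|) * (∑ i, |x i| + ∑ i, |x' i|) * (9 * domin ε R k ω ^ 2 + 2)
      ≤ 22 * C * Fintype.card I ^ 2 * θ k ^ (13 / 20 : ℝ) * ‖x - x'‖ := by
    have q1 : θ k * r * θ k ^ (-(1 / 10) : ℝ) = θ k ^ (13 / 20 : ℝ) := by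
      nth_rewrite 1 [← rpow_one (θ k)]; rw [← rpow_add hk, ← rpow_add hk]; norm_num
    have q2 : domin ε R k ω ^ 2 ≤ θ k ^ (-(1 / 10) : ℝ) := by
      rw [← sq_abs]; refine (pow_le_pow_left₀ (abs_nonneg _) hM.le 2).trans (le_of_eq ?_)
      rw [← rpow_natCast, ← rpow_mul hk.le]; norm_num
    have q3 : 1 ≤ θ k ^ (-(1 / 10) : ℝ) := one_le_rpow_of_pos_of_le_one_of_nonpos hk hk1 (by norm_num)
    have q4 : 9 * domin ε R k ω ^ 2 + 2 ≤ 11 * θ k ^ (-(1 / 10) : ℝ) := by linarith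
    have q5 : ∑ i, |x i - x' i| ≤ Fintype.card I * ‖x - x'‖ := ns (x - x')
    have q6 : ∑ i, |x i| + ∑ i, |x' i| ≤ 2 * Fintype.card I * r := by linarith
    calc _ ≤ C * θ k * (Fintype.card I * ‖x - x'‖) * (2 * Fintype.card I * r)
            * (11 * θ k ^ (-(1 / 10) : ℝ)) := by gcongr
      _ = 22 * C * Fintype.card I ^ 2 * (θ k * r * θ k ^ (-(1 / 10) : ℝ)) * ‖x - x'‖ := by ring
      _ = _ := by rw [q1]
  have e5 := e1.trans e4
  rw [norm_eq_abs]; simp only [Pi.add_apply, Pi.sub_apply] at e2 ⊢; rw [abs_le] at *; simp only [Pi.sub_apply] at e5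
  constructor <;> nlinarith

/-- With high probability the quasi-Newton iterations started at the origin converge to a root of
the score equations. -/
lemma exists_root {b : ℕ → (I → ℝ) → I → ℝ} {C' : ℝ} (hb0 : ∀ᶠ k in atTop, ∀ i, |b k 0 i| ≤ C' * θ k)
    (hb : ∀ᶠ k in atTop, ∀ x x' : I → ℝ, ‖x‖ ≤ θ k ^ (-(1 / 4) : ℝ) → ‖x'‖ ≤ θ k ^ (-(1 / 4) : ℝ) →
      ∀ i, |b k x i - b k x' i| ≤ C' * θ k * ‖x - x'‖) {η : ℝ} (hη : 0 < η) (g : ℝ) :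
    ∃ c : ℝ, 0 ≤ c ∧ ∀ᶠ k in atTop, (μ k).real {ω | ¬ ∃ x : I → ℝ,
      Tendsto (fun j => (fun x => x + J k *ᵥ fun i => stdScore (R k) x (ε k ω) i - b k x i)^[j] 0)
        atTop (𝓝 x) ∧ (∀ i, stdScore (R k) x (ε k ω) i = b k x i) ∧ ‖x‖ < θ k ^ (-η)} ≤ c * θ k ^ g := by
  have hC := h.nonneg
  set ρ := min (η / 2) (1 / 8)
  have hρ0 : 0 < ρ := lt_min (by positivity) (by norm_num)
  have hρη : ρ < η := (min_le_left _ _).trans_lt (by linarith)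
  have hρ4 : ρ < 1 / 4 := (min_le_right _ _).trans_lt (by norm_num)
  have hHo : StochO μ θ 1 fun k ω => ∑ p : I × I, |qform (R k p.1 * R k p.2) (ε k ω)| :=
    StochO.sum h.scale _ fun p _ => (h.order_info p.1 p.2).abs
  have hAo : StochO μ θ 0 fun k ω => ∑ i, |1 / 2 * qform (R k i) (ε k ω)| :=
    StochO.sum h.scale _ fun p _ => (h.order_score p).abs
  obtain ⟨c1, hc1, m1⟩ := hHo.measure_le h.scale (s := 1 / 2) (by norm_num) g
  obtain ⟨c2, hc2, m2⟩ := h.order_domin.measure_le h.scale (s := -(1 / 20)) (by norm_num) g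
  obtain ⟨c3, hc3, m3⟩ := hAo.measure_le h.scale (s := -ρ) (by linarith) g
  set n : ℝ := (Fintype.card I : ℝ)
  have hT : Tendsto (fun k => n * C * (22 * C * n ^ 2 * θ k ^ (13 / 20 : ℝ) + θ k ^ (1 / 2 : ℝ)
      + |C'| * θ k)) atTop (𝓝 (n * C * (22 * C * n ^ 2 * 0 + 0 + |C'| * 0))) :=
    ((((h.scale.rpow_tendsto (by norm_num)).const_mul _).add
      (h.scale.rpow_tendsto (by norm_num))).add (h.scale.tendsto.const_mul _)).const_mul _
  simp only [mul_zero, add_zero] at hT; set c0 := 2 * (n * C) * (1 + |C'|) with hc0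
  have hc00 : 0 ≤ c0 := by positivity
  refine ⟨c1 + c2 + c3, by positivity, ?_⟩
  filter_upwards [m1, m2, m3, hT.eventually (gt_mem_nhds (by norm_num : (0 : ℝ) < 1 / 2)),
    h.lipschitz_score hb, hb0, h.scale.pos, h.scale.le one_pos, h.J_mul, h.J_bound,
    h.scale.rpow_le (r := η - ρ) (c := 1 / (c0 + 1)) (by linarith) (by positivity),
    h.scale.rpow_le (r := 1 / 4 - ρ) (c := 1 / (c0 + 1)) (by linarith) (by positivity)]
    with k m1 m2 m3 hT hL hb0 hk hk1 hJ hJb hs1 hs2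
  rw [add_mul, add_mul]; refine le_trans ?_ (add_le_add (add_le_add m1 m2) m3)
  refine le_trans ?_ ((measureReal_union_le _ _).trans (add_le_add (measureReal_union_le _ _) le_rfl))
  refine measureReal_mono fun ω hω => ?_
  by_contra hcon
  simp only [Set.mem_union, Set.mem_ofPred_eq, not_or, not_le] at hcon; obtain ⟨⟨g1, g2⟩, g3⟩ := hcon; refine hω ?_
  rw [abs_of_nonneg (sum_nonneg fun _ _ => abs_nonneg _)] at g1 g3
  have hf0 : ‖fun i => stdScore (R k) 0 (ε k ω) i - b k 0 i‖ ≤ (1 + |C'|) * θ k ^ (-ρ) := by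
    refine (pi_norm_le_iff_of_nonneg (by positivity)).2 fun i => ?_
    rw [norm_eq_abs, stdScore_zero]
    have s1 := (single_le_sum
      (fun _ _ => abs_nonneg _) (mem_univ i)).trans g3.le
    have s2 : |b k 0 i| ≤ |C'| * θ k ^ (-ρ) := by
      refine (hb0 i).trans (mul_le_mul (le_abs_self _) ?_ hk.le (abs_nonneg _))
      exact hk1.trans (one_le_rpow_of_pos_of_le_one_of_nonpos hk hk1 (by linarith))
    have := abs_sub (1 / 2 * qform (R k i) (ε k ω)) (b k 0 i)
    linarith
  have big : ∀ τ : ℝ, θ k ^ (τ - ρ) ≤ 1 / (c0 + 1) → c0 * θ k ^ (-ρ) < θ k ^ (-τ) := fun τ hτ => by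
    have e : θ k ^ (-ρ) = θ k ^ (τ - ρ) * θ k ^ (-τ) := by rw [← rpow_add hk]; congr 1; ring
    have : c0 * θ k ^ (τ - ρ) < 1 := by
      refine (mul_le_mul_of_nonneg_left hτ hc00).trans_lt ?_
      rw [mul_one_div, div_lt_one (by positivity)]; linarith
    rw [e, ← mul_assoc]; exact mul_lt_of_lt_one_left (rpow_pos_of_pos hk _) this
  have hf1 : 2 * (n * C * ‖fun i => stdScore (R k) 0 (ε k ω) i - b k 0 i‖) ≤ c0 * θ k ^ (-ρ) := by
    calc _ ≤ 2 * (n * C * ((1 + |C'|) * θ k ^ (-ρ))) := by gcongr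
      _ = _ := by rw [hc0]; ring
  obtain ⟨x, hx1, hx2, hx3⟩ := exists_tendsto_quasiNewton
   
    hJ (mul_eq_one_comm.1 hJ) hJb (rpow_nonneg hk.le _) (hL ω g1 g2) hT.le (by positivity)
    (by grind)
  exact ⟨x, hx1, fun i => sub_eq_zero.1 (congrFun hx2 i), (hx3.trans hf1).trans_lt (big η hs1)⟩

end CanonicalModel

namespace LocalRoot

variable {C C' : ℝ} {G : ∀ k, Set (Ω k)} {X : ∀ k, Ω k → I → ℝ} {b : ℕ → I → ℝ} {w : ∀ k, I → N k → ℝ} {B : ℝ}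
  (h : CanonicalModel μ θ ε R J C) (hX : LocalRoot μ θ ε R C' G X b)
  (hw : ∀ᶠ k in atTop, ∀ i, vnorm (w k i) ≤ B * θ k)

/-- The first order approximation of the root. -/
def lin (ε : ∀ k, Ω k → N k → ℝ) (R : ∀ k, I → Matrix (N k) (N k) ℝ) (J : ℕ → Matrix I I ℝ)
    (i : I) (k : ℕ) (ω : Ω k) : ℝ := ∑ j, J k i j * (1 / 2 * qform (R k j) (ε k ω))

/-- The centred observed information. -/
def obsInfo (ε : ∀ k, Ω k → N k → ℝ) (R : ∀ k, I → Matrix (N k) (N k) ℝ)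
    (X : ∀ k, Ω k → I → ℝ) (i : I) (k : ℕ) (ω : Ω k) : ℝ := ∑ j, X k ω j * qform (R k j * R k i) (ε k ω)

lemma meas_predictor (hX : LocalRoot μ θ ε R C' G X b) (hε : StdNormalSeq μ ε) (k : ℕ) (i : I) :
    Measurable fun ω => w k i ⬝ᵥ resolv (R k) (X k ω) *ᵥ ε k ω :=
  meas_dot (fun _ => measurable_const) (meas_matrix_mulVec
    (meas_resolv _ fun i => (measurable_pi_apply i).comp (hX.measX k))
    fun j => (measurable_pi_apply j).comp (hε.meas k))

section Lin
include h

lemma order_lin (i : I) : StochO μ θ 0 (lin ε R J i) :=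
  StochO.sum h.scale _ fun j _ => StochO.bdd_mul h.scale
    (h.J_bound.mono fun _ hk => hk i j) (h.order_score j)

lemma integral_lin_mul_qform (i : I) (k : ℕ) (B : Matrix (N k) (N k) ℝ) :
    ∫ ω, lin ε R J i k ω * qform B (ε k ω) ∂(μ k) = ∑ j, J k i j * (R k j * B).trace := by
  have hm : ∀ j, Measurable fun z => qform (R k j) z * qform B z := fun j =>
    (meas_qform _).mul (meas_qform _)
  have e : ∀ ω, lin ε R J i k ω * qform B (ε k ω)
      = ∑ j, (J k i j * (1 / 2)) * (qform (R k j) (ε k ω) * qform B (ε k ω)) := fun ω => by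
    rw [lin, sum_mul]; exact sum_congr rfl fun j _ => by ring
  simp_rw [e]
  rw [integral_finsetSum _ fun j _ => (h.normal.integrable_comp k (hm j) (integrable_qform_mul _ _)).const_mul _]
  refine sum_congr rfl fun j _ => ?_
  rw [integral_const_mul, h.normal.integral_comp k (hm j), integral_qform_mul_left_symm (h.symm k j)]; ring

lemma integral_lin_mul_lin (i j : I) : ∀ᶠ k in atTop, ∫ ω, lin ε R J i k ω * lin ε R J j k ω ∂(μ k) = J k i j := by
  filter_upwards [h.J_mul, h.J_symm, ((order_lin h i).mul h.scale (h.order_score j)).integrable]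
    with k h1 h2 _
  have e : ∀ ω, lin ε R J i k ω * lin ε R J j k ω
      = ∑ l, (J k j l * (1 / 2)) * (lin ε R J i k ω * qform (R k l) (ε k ω)) := fun ω => by
    rw [lin.eq_def ε R J j, mul_sum]; exact sum_congr rfl fun j _ => by ring
  have hint : ∀ l, Integrable (fun ω => lin ε R J i k ω * qform (R k l) (ε k ω)) (μ k) := fun l => by
    have e : ∀ ω, lin ε R J i k ω * qform (R k l) (ε k ω)
      = ∑ j, (J k i j * (1 / 2)) * (qform (R k j) (ε k ω) * qform (R k l) (ε k ω)) := fun ω => by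
      rw [lin, sum_mul]; exact sum_congr rfl fun j _ => by ring
    simp_rw [e]
    exact integrable_finsetSum _ fun j _ => (h.normal.integrable_comp k
     
      ((meas_qform _).mul (meas_qform _)) (integrable_qform_mul _ _)).const_mul _
  simp_rw [e]; rw [integral_finsetSum _ fun l _ => (hint l).const_mul _]
  simp_rw [integral_const_mul, integral_lin_mul_qform h]
  have h3 : (J k * infoMat (R k) * (J k)ᵀ) i j = J k i j := by rw [h1, one_mul, h2]
  rw [← h3, Matrix.mul_apply]; refine sum_congr rfl fun l _ => ?_
  rw [Matrix.mul_apply, sum_mul, mul_sum]; refine sum_congr rfl fun r _ => ?_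
  rw [transpose_apply, infoMat, of_apply]; ring

end Lin

section
include h hw

lemma order_weight (i : I) : StochO μ θ 1 fun k ω => w k i ⬝ᵥ ε k ω :=
  h.normal.order_dot h.scale (hw.mono fun k hk => by simpa using hk i)

lemma order_mulVec_weight (i j : I) : StochO μ θ 2 fun k ω => R k j *ᵥ w k i ⬝ᵥ ε k ω := by
  refine h.normal.order_dot h.scale (C := C * B) ?_
  filter_upwards [hw, h.op] with k h1 h2
  refine (vnorm_mulVec_le' (h2 j) (h1 i)).trans (le_of_eq ?_)
  rw [rpow_two]; ring

end

include h hX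

lemma meas_apply (k : ℕ) (i : I) : Measurable fun ω => X k ω i := (measurable_pi_apply i).comp (hX.measX k)

lemma apply_le : ∀ᶠ k in atTop, ∀ ω i, |X k ω i| ≤ θ k ^ (-(1 / 40) : ℝ) := by
  filter_upwards [hX.small, h.scale.pos] with k h1 h2 ω i
  by_cases hω : ω ∈ G k
  · grind
  · rw [hX.zero k ω hω]; simpa using rpow_nonneg h2.le _

lemma sum_abs_le : ∀ᶠ k in atTop, ∀ ω, ∑ i, |X k ω i| ≤ Fintype.card I * θ k ^ (-(1 / 40) : ℝ) := by
  filter_upwards [apply_le h hX] with k h1 ω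
  simpa using sum_le_sum fun i (_ : i ∈ univ) => h1 ω i

lemma stochOrder (i : I) : StochO μ θ (-(1 / 40)) fun k ω => X k ω i := by
  refine StochO.of_le (StochO.const (c := fun k => θ k ^ (-(1 / 40) : ℝ)) (C := 1) h.scale ?_)
    (fun k => (hX.meas_apply h k i).aestronglyMeasurable) ?_
  · filter_upwards [h.scale.pos] with k hk
    rw [abs_of_nonneg (by positivity), one_mul]
  · filter_upwards [apply_le h hX, h.scale.pos] with k h1 hk ω
    grind

lemma order_sum_abs : StochO μ θ (-(1 / 40)) fun k ω => ∑ i, |X k ω i| :=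
  StochO.sum h.scale _ fun i _ => (stochOrder h hX i).abs

lemma order_bad (r : ℝ) : StochO μ θ r fun k => ((G k)ᶜ).indicator fun _ => (1 : ℝ) :=
  StochO.indicator_of_measure_le h.scale (fun k => (hX.measG k).compl) hX.prob r

lemma theta_mul {r : ℝ} {Z : ∀ k, Ω k → ℝ} (hZ : StochO μ θ r Z) :
    StochO μ θ (1 + r) fun k ω => θ k * Z k ω := by
  refine (StochO.const (C := 1) h.scale ?_).mul h.scale hZ
  filter_upwards [h.scale.pos] with k hk
  rw [abs_of_pos hk]; simp

lemma order_obsInfo (i : I) : StochO μ θ (39 / 40) (obsInfo ε R X i) := by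
  refine StochO.sum h.scale _ fun j _ => ?_
  exact ((stochOrder h hX j).mul h.scale (h.order_info j i)).mono_exp h.scale (by norm_num)

lemma theta_le : ∀ᶠ k in atTop, ∀ ω, C * θ k * ∑ i, |X k ω i| ≤ 1 / 2 := by
  filter_upwards [h.op_small (r := 1 / 40) (by norm_num) (Fintype.card I), sum_abs_le h hX] with k h1 h2 ω
  exact h1 _ (h2 ω)

/-- The residual of the linearized score equations. -/
lemma order_residual (i : I) : StochO μ θ (19 / 20) fun k ω =>
    (infoMat (R k) *ᵥ X k ω) i - 1 / 2 * qform (R k i) (ε k ω) := by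
  have hC := h.nonneg
  set F : ∀ k, Ω k → ℝ := fun k ω =>
    C * (θ k * ((∑ i, |X k ω i|) * (∑ i, |X k ω i|) * (9 * CanonicalModel.domin ε R k ω ^ 2 + 2)))
      + (C' + 1) * θ k + ((G k)ᶜ.indicator fun _ => 1) ω * |1 / 2 * qform (R k i) (ε k ω)|
      + |obsInfo ε R X i k ω| with hF
  have hFo : StochO μ θ (19 / 20) F := by
    refine StochO.add h.scale (StochO.add h.scale (StochO.add h.scale ?_ ?_) ?_) ?_
    · refine StochO.const_mul h.scale _ ?_
      refine (theta_mul h hX (((order_sum_abs h hX).mul h.scale (order_sum_abs h hX)).mul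
        h.scale (((h.order_domin.sq h.scale).const_mul h.scale 9).add h.scale ?_))).mono_exp h.scale (by norm_num)
      simpa using StochO.const_zero h.scale 2
    · refine (StochO.const (r := 1) (C := |C' + 1|) h.scale ?_).mono_exp h.scale (by norm_num)
      filter_upwards [h.scale.pos] with k hk
      rw [abs_mul, abs_of_pos hk, rpow_one]
    · exact ((order_bad h hX 1).mul h.scale (h.order_score i).abs).mono_exp h.scale (by norm_num)
    · exact (order_obsInfo h hX i).abs.mono_exp h.scale (by norm_num)
  refine hFo.of_le (fun k => ?_) ?_
  · have h1 : Measurable fun ω => (infoMat (R k) *ᵥ X k ω) i :=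
      (measurable_pi_apply i).comp ((meas_mulVec _).comp (hX.measX k))
    exact (h1.aestronglyMeasurable).sub ((h.order_score i).meas k)
  · filter_upwards [h.pertBounds, theta_le h hX, hX.root 1 one_pos, hX.bias_le, h.scale.pos] with k h1 h2 h3 h4 hk ω
    have hFn : 0 ≤ C * (θ k * ((∑ i, |X k ω i|) * (∑ i, |X k ω i|) * (9 * CanonicalModel.domin ε R k ω ^ 2 + 2))) := by
      positivity
    have hF0 : 0 ≤ (C' + 1) * θ k := by
      have := (abs_nonneg _).trans (h4 i)
      nlinarith
    refine le_trans ?_ (le_abs_self _)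
    by_cases hω : ω ∈ G k
    · have hS := abs_stdScore_sub_le (h1 ω) (x' := 0) (h2 ω) (by simp) i
      simp only [sub_zero, stdScore_zero, Pi.zero_apply, abs_zero, sum_const_zero, add_zero] at hS
      rw [add_sub_assoc, linear_term_eq (h.symm k) (X k ω) (ε k ω) i] at hS; have hr := h3 ω hω i; have hb := h4 i
      simp only [hF, Set.indicator_of_notMem (show ω ∉ (G k)ᶜ from fun h => h hω), zero_mul, add_zero]
      have ho : obsInfo ε R X i k ω = ∑ k_1, X k ω k_1 * qform (R k k_1 * R k i) (ε k ω) := rfl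
      rw [ho]; set A := ∑ j, X k ω j * qform (R k j * R k i) (ε k ω); rw [abs_le] at hS hr hb ⊢
      have hA := neg_abs_le A
      have hA' := le_abs_self A
      constructor <;> nlinarith
    · have h0 := hX.zero k ω hω
      have : (infoMat (R k) *ᵥ X k ω) i = 0 := by rw [h0]; simp
      rw [this, zero_sub, abs_neg]; simp only [hF, Set.indicator_of_mem (show ω ∈ (G k)ᶜ from hω), one_mul]
      have := abs_nonneg (obsInfo ε R X i k ω)
      linarith

/-- The root is asymptotically linear. -/
lemma order_sub_lin (i : I) : StochO μ θ (19 / 20) fun k ω => X k ω i - lin ε R J i k ω := by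
  have h1 : StochO μ θ (19 / 20) fun k ω => ∑ j, J k i j *
      ((infoMat (R k) *ᵥ X k ω) j - 1 / 2 * qform (R k j) (ε k ω)) :=
    StochO.sum h.scale _ fun j _ => StochO.bdd_mul h.scale
      (h.J_bound.mono fun k hk => hk i j) (order_residual h hX j)
  refine h1.of_le (fun k => ?_) ?_
  · refine ((meas_apply h hX k i).aestronglyMeasurable).sub ?_
    exact aestronglyMeasurable_fun_sum _ fun j _ => ((h.order_score j).meas k |>.const_mul _)
  · filter_upwards [h.J_mul] with k hk ω
    have e : X k ω i = ∑ j, J k i j * (infoMat (R k) *ᵥ X k ω) j := by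
      have : (J k *ᵥ infoMat (R k) *ᵥ X k ω) i = X k ω i := by aesop
      rw [← this]; rfl
    refine le_of_eq (congrArg _ ?_)
    rw [lin]; nth_rewrite 1 [e]; rw [← sum_sub_distrib]; exact sum_congr rfl fun j _ => by ring

lemma order_mul_sub (i j : I) : StochO μ θ (1 / 2) fun k ω =>
    X k ω i * X k ω j - lin ε R J i k ω * lin ε R J j k ω := by
  have e : ∀ k ω, X k ω i * X k ω j - lin ε R J i k ω * lin ε R J j k ω
      = (X k ω i - lin ε R J i k ω) * X k ω j + lin ε R J i k ω * (X k ω j - lin ε R J j k ω) := fun k ω => by ring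
  simp_rw [e]
  exact (((order_sub_lin h hX i).mul h.scale (stochOrder h hX j)).mono_exp h.scale
    (by norm_num)).add h.scale (((order_lin h i).mul h.scale
      (order_sub_lin h hX j)).mono_exp h.scale (by norm_num))

/-- Second moments of the root. -/
lemma integral_mul (i j : I) : ∃ c : ℝ, 0 ≤ c ∧ ∀ᶠ k in atTop,
    |∫ ω, X k ω i * X k ω j ∂(μ k) - J k i j| ≤ c * θ k ^ (1 / 2 : ℝ) := by
  obtain ⟨c, hc, hk⟩ := (order_mul_sub h hX i j).integral_le h.scale
  refine ⟨c, hc, ?_⟩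
  filter_upwards [hk, integral_lin_mul_lin h i j, ((stochOrder h hX i).mul h.scale (stochOrder h hX j)).integrable,
    ((order_lin h i).mul h.scale (order_lin h j)).integrable] with k h1 h2 i1 i2
  rwa [integral_sub i1 i2, h2] at h1

/-- The remainder in the second order expansion of the score equations. -/
lemma exists_abs_second_order_le (i : I) : ∃ W : ∀ k, Ω k → ℝ, StochO μ θ (3 / 2) W ∧
    ∀ δ : ℝ, 0 < δ → ∀ᶠ k in atTop, ∀ ω,
      |(infoMat (R k) *ᵥ X k ω) i - 1 / 2 * qform (R k i) (ε k ω) + obsInfo ε R X i k ω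
        - ∑ j, ∑ l, X k ω j * X k ω l * (R k j * R k l * R k i).trace + b k i| ≤ δ * θ k + W k ω := by
  set S : ∀ k, Ω k → ℝ := fun k ω => ∑ i, |X k ω i|
  have hSo := order_sum_abs h hX
  set κ : I → I → ∀ k, Ω k → ℝ := fun j l k ω => X k ω j * X k ω l *
    (qform (R k l * R k j * R k i) (ε k ω) + 1 / 2 * qform (R k j * R k i * R k l) (ε k ω)) with hκ
  refine ⟨fun k ω => C ^ 2 * (θ k * (θ k * (S k ω * S k ω * S k ω * (5 * CanonicalModel.domin ε R k ω ^ 2 + 1))))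
    + ∑ j, ∑ l, |κ j l k ω|
    + ((G k)ᶜ.indicator fun _ => 1) ω * (|1 / 2 * qform (R k i) (ε k ω)| + C' * θ k), ?_, ?_⟩
  · refine StochO.add h.scale (StochO.add h.scale ?_ ?_) ?_
    · refine StochO.const_mul h.scale _ ?_
      refine (theta_mul h hX (theta_mul h hX (((hSo.mul h.scale hSo).mul h.scale hSo).mul
        h.scale (((h.order_domin.sq h.scale).const_mul h.scale 5).add h.scale ?_)))).mono_exp h.scale (by norm_num)
      simpa using StochO.const_zero h.scale 1
    · refine StochO.sum h.scale _ fun j _ => StochO.sum h.scale _ fun l _ => ?_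
      refine (((stochOrder h hX j).mul h.scale (stochOrder h hX l)).mul h.scale ((h.order_third l j i).add h.scale
          ((h.order_third j i l).const_mul h.scale _))).abs.mono_exp h.scale (by norm_num)
    · refine ((order_bad h hX 2).mul h.scale ((h.order_score i).abs.add h.scale
        ((StochO.const (C := |C'|) h.scale ?_).mono_exp
          h.scale zero_le_one))).mono_exp h.scale (by norm_num)
      filter_upwards [h.scale.pos] with k hk
      rw [abs_mul, abs_of_pos hk, rpow_one]
  · intro δ hδ
    filter_upwards [h.pertBounds, theta_le h hX, hX.root δ hδ, hX.bias_le, h.scale.pos] with k h1 h2 h3 h4 hk ω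
    have hn1 : 0 ≤ C ^ 2 * (θ k * (θ k * (S k ω * S k ω * S k ω
      * (5 * CanonicalModel.domin ε R k ω ^ 2 + 1)))) := by positivity
    have hn2 : 0 ≤ ∑ j, ∑ l, |κ j l k ω| := sum_nonneg fun _ _ => sum_nonneg fun _ _ => abs_nonneg _
    by_cases hω : ω ∈ G k
    · have hS2 := abs_stdScore_sub_quadratic_le (h1 ω) (h2 ω) i
      rw [linear_term_eq (h.symm k) (X k ω) (ε k ω) i,
        quadratic_term_eq (h.symm k) (X k ω) (ε k ω) i, stdScore_zero] at hS2
      have hr := h3 ω hω i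
      simp only [Set.indicator_of_notMem (show ω ∉ (G k)ᶜ from fun h => h hω), zero_mul, add_zero]
      have hκ1 : |∑ j, ∑ l, κ j l k ω| ≤ ∑ j, ∑ l, |κ j l k ω| := (abs_sum_le_sum_abs _ _).trans
          (sum_le_sum fun j _ => abs_sum_le_sum_abs _ _)
      have ho : obsInfo ε R X i k ω = ∑ j, X k ω j * qform (R k j * R k i) (ε k ω) := rfl
      rw [_root_.abs_le] at hS2 hr hκ1 ⊢
      constructor <;> linarith
    · have h0 := hX.zero k ω hω
      simp only [Set.indicator_of_mem (show ω ∈ (G k)ᶜ from hω), one_mul, obsInfo, h0,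
        mulVec_zero, Pi.zero_apply, zero_mul, sum_const_zero, zero_sub, add_zero, sub_zero]
      have := h4 i
      have h6 : |-(1 / 2 * qform (R k i) (ε k ω)) + b k i| ≤ |1 / 2 * qform (R k i) (ε k ω)| + |b k i| := by grind
      have : 0 ≤ δ * θ k := by positivity
      linarith

/-- Second order terms of the score equations, in mean. -/
lemma integral_lin_second_order (i : I) : ∀ᶠ k in atTop, ∫ ω, (∑ j, lin ε R J j k ω * qform (R k j * R k i) (ε k ω)
      - ∑ j, ∑ l, lin ε R J j k ω * lin ε R J l k ω * (R k j * R k l * R k i).trace) ∂(μ k) = 0 := by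
  have i1 := eventually_all.2 fun j => ((order_lin h j).mul h.scale (h.order_info j i)).integrable
  have i2 := eventually_all.2 fun j => eventually_all.2 fun l =>
      ((order_lin h j).mul h.scale (order_lin h l)).integrable
  have i3 := eventually_all.2 fun j => eventually_all.2 fun l => integral_lin_mul_lin h j l
  filter_upwards [i1, i2, i3] with k h1 h2 h3
  rw [integral_sub (integrable_finsetSum _ fun j _ => h1 j) (integrable_finsetSum _ fun j _ =>
      integrable_finsetSum _ fun l _ => (h2 j l).mul_const _),
    integral_finsetSum _ fun j _ => h1 j,
    integral_finsetSum _ fun j _ => integrable_finsetSum _ fun l _ => (h2 j l).mul_const _,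
    sub_eq_zero]
  refine sum_congr rfl fun j _ => ?_
  rw [integral_lin_mul_qform h, integral_finsetSum _ fun l _ => (h2 j l).mul_const _]
  refine sum_congr rfl fun l _ => ?_
  rw [integral_mul_const, h3, ← mul_assoc, trace_three_swap (h.symm k)]

lemma exists_abs_centred_le (i : I) : ∃ W : ∀ k, Ω k → ℝ, StochO μ θ (3 / 2) W ∧
    ∀ δ : ℝ, 0 < δ → ∀ᶠ k in atTop, ∀ ω,
      |(infoMat (R k) *ᵥ X k ω) i - 1 / 2 * qform (R k i) (ε k ω) +
        (∑ j, lin ε R J j k ω * qform (R k j * R k i) (ε k ω)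
        - ∑ j, ∑ l, lin ε R J j k ω * lin ε R J l k ω * (R k j * R k l * R k i).trace) + b k i| ≤ δ * θ k + W k ω := by
  obtain ⟨W, hW, hW2⟩ := exists_abs_second_order_le h hX i
  set U : ∀ k, Ω k → ℝ := fun k ω =>
    ∑ j, (X k ω j - lin ε R J j k ω) * qform (R k j * R k i) (ε k ω) with hU
  have hUo : StochO μ θ (3 / 2) U := StochO.sum h.scale _ fun j _ =>
    ((order_sub_lin h hX j).mul h.scale (h.order_info j i)).mono_exp h.scale (by norm_num)
  set U' : ∀ k, Ω k → ℝ := fun k ω => ∑ j, ∑ l, (X k ω j * X k ω l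
    - lin ε R J j k ω * lin ε R J l k ω) * (R k j * R k l * R k i).trace with hU'
  have hUo' : StochO μ θ (3 / 2) U' := by
    refine StochO.sum h.scale _ fun j _ => StochO.sum h.scale _ fun l _ => ?_
    refine ((order_mul_sub h hX j l).mul h.scale
      (StochO.const (r := 1) (C := C) h.scale ?_)).mono_exp h.scale (by norm_num)
    filter_upwards [h.abs_trace_mul_mul] with k hk
    simpa using hk j l i
  refine ⟨fun k ω => W k ω + (|U k ω| + |U' k ω|), hW.add h.scale (hUo.abs.add h.scale hUo'.abs), fun δ hδ => ?_⟩
  filter_upwards [hW2 δ hδ] with k hk ω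
  have h1 := hk ω
  have e1 : U k ω = obsInfo ε R X i k ω - ∑ j, lin ε R J j k ω * qform (R k j * R k i) (ε k ω) := by
    simp only [hU, sub_mul, sum_sub_distrib, obsInfo]
  have e2 : U' k ω = ∑ j, ∑ l, X k ω j * X k ω l * (R k j * R k l * R k i).trace
      - ∑ j, ∑ l, lin ε R J j k ω * lin ε R J l k ω * (R k j * R k l * R k i).trace := by
    simp only [hU', sub_mul, sum_sub_distrib]
  have a1 := neg_abs_le (U k ω)
  have a2 := le_abs_self (U k ω)
  have a3 := neg_abs_le (U' k ω)
  have a4 := le_abs_self (U' k ω)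
  rw [_root_.abs_le] at h1 ⊢
  constructor <;> linarith

lemma infoMat_mulVec_integral (i : I) :
    (fun k => (infoMat (R k) *ᵥ fun j => ∫ ω, X k ω j ∂(μ k)) i + b k i) =o[atTop] θ := by
  obtain ⟨W, hW, hW2⟩ := exists_abs_centred_le h hX i
  have hi := eventually_all.2 fun j => (stochOrder h hX j).integrable
  have i1 := eventually_all.2 fun j => ((order_lin h j).mul h.scale (h.order_info j i)).integrable
  have i2 := eventually_all.2 fun j => eventually_all.2 fun l =>
      ((order_lin h j).mul h.scale (order_lin h l)).integrable
  obtain ⟨c, hc0, hc⟩ := hW.integral_le h.scale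
  refine IsLittleO.of_bound fun δ hδ => ?_
  filter_upwards [hW2 (δ / 2) (by positivity), hi, i1, i2, integral_lin_second_order h hX i,
    (h.order_score i).integrable, hW.integrable, hc, h.scale.pos,
    h.scale.rpow_le (r := 1 / 2) (c := δ / (2 * (c + 1))) (by norm_num) (by positivity)]
    with k h1 h2 h3 h4 h5 h6 h7 h8 hk h9
  have e1 : ∫ ω, ((infoMat (R k) *ᵥ X k ω) i - 1 / 2 * qform (R k i) (ε k ω) +
        (∑ j, lin ε R J j k ω * qform (R k j * R k i) (ε k ω)
        - ∑ j, ∑ l, lin ε R J j k ω * lin ε R J l k ω * (R k j * R k l * R k i).trace) + b k i) ∂(μ k)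
      = (infoMat (R k) *ᵥ fun j => ∫ ω, X k ω j ∂(μ k)) i + b k i := by
    have i5 : Integrable (fun ω => (infoMat (R k) *ᵥ X k ω) i) (μ k) := by
      exact integrable_finsetSum _ fun j _ => (h2 j).const_mul _
    have i6 : Integrable (fun ω => ∑ j, lin ε R J j k ω * qform (R k j * R k i) (ε k ω)
        - ∑ j, ∑ l, lin ε R J j k ω * lin ε R J l k ω * (R k j * R k l * R k i).trace) (μ k) :=
      (integrable_finsetSum _ fun j _ => h3 j).sub (integrable_finsetSum _ fun j _ =>
        integrable_finsetSum _ fun l _ => (h4 j l).mul_const _)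
    have i7 : Integrable (fun ω => (infoMat (R k) *ᵥ X k ω) i - 1 / 2 * qform (R k i) (ε k ω)) (μ k) := i5.sub h6
    rw [integral_add (i7.fun_add i6) (integrable_const _), integral_add i7 i6, h5,
      integral_sub i5 h6, integral_const_mul,
      h.normal.integral_comp k (meas_qform _), integral_qform, integral_const]
    simp only [infoMat_mulVec, probReal_univ, one_smul, mul_zero, sub_zero, add_zero]
    rw [integral_finsetSum _ fun j _ => (h2 j).const_mul _]; simp_rw [integral_const_mul]
  rw [← e1, norm_of_nonneg hk.le]
  refine (norm_integral_le_of_norm_le (g := fun ω => δ / 2 * θ k + W k ω)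
    ((integrable_const _).add h7) (ae_of_all _ fun ω => h1 ω)).trans ?_
  rw [integral_add (integrable_const _) h7, integral_const]; simp only [probReal_univ, one_smul]
  have h10 := (_root_.abs_le.1 h8).2
  have h11 : θ k ^ (3 / 2 : ℝ) = θ k ^ (1 / 2 : ℝ) * θ k := by
    nth_rewrite 3 [← rpow_one (θ k)]; rw [← rpow_add hk]; norm_num
  rw [h11, ← mul_assoc] at h10
  have h12 : c * θ k ^ (1 / 2 : ℝ) ≤ δ / 2 := by
    calc c * θ k ^ (1 / 2 : ℝ) ≤ (c + 1) * (δ / (2 * (c + 1))) :=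
          mul_le_mul (by linarith) h9 (rpow_nonneg hk.le _) (by positivity)
      _ = δ / 2 := by field_simp
  have := mul_le_mul_of_nonneg_right h12 hk.le
  linarith

/-- Mean of the root. -/
lemma integral_apply (i : I) : (fun k => ∫ ω, X k ω i ∂(μ k) + (J k *ᵥ b k) i) =o[atTop] θ := by
  have h1 : ∀ j, (fun k => J k i j *
      ((infoMat (R k) *ᵥ fun j => ∫ ω, X k ω j ∂(μ k)) j + b k j)) =o[atTop] θ := fun j => by
    have hb : (fun k => J k i j) =O[atTop] fun _ => (1 : ℝ) :=
      IsBigO.of_bound C (h.J_bound.mono fun k hk => by simpa using hk i j)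
    simpa using hb.mul_isLittleO (infoMat_mulVec_integral h hX j)
  refine (IsLittleO.fun_sum fun j (_ : j ∈ univ) => h1 j).congr' ?_ EventuallyEq.rfl
  filter_upwards [h.J_mul] with k hk
  simp only [mul_add, sum_add_distrib]
  have : (J k *ᵥ (infoMat (R k) *ᵥ fun j => ∫ ω, X k ω j ∂(μ k))) i = ∫ ω, X k ω i ∂(μ k) := by aesop
  rw [← this]; rfl

include hw

/-- Linearization of the predictor shift. -/
lemma order_predictor_sub (i : I) : StochO μ θ (19 / 10) fun k ω =>
    w k i ⬝ᵥ resolv (R k) (X k ω) *ᵥ ε k ω - w k i ⬝ᵥ ε k ω := by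
  set S : ∀ k, Ω k → ℝ := fun k ω => ∑ i, |X k ω i|
  have hSo := order_sum_abs h hX
  refine StochO.of_le (Y := fun k ω => ∑ j, |X k ω j * (R k j *ᵥ w k i ⬝ᵥ ε k ω)|
    + 2 * C * B * (θ k * (θ k * (S k ω * S k ω * CanonicalModel.domin ε R k ω))))
    (StochO.add h.scale ?_ ?_) (fun k => ?_) ?_
  · exact StochO.sum h.scale _ fun j _ => (((stochOrder h hX j).mul h.scale
      (order_mulVec_weight h hw i j)).mono_exp h.scale (by norm_num)).abs
  · exact ((theta_mul h hX (theta_mul h hX ((hSo.mul h.scale hSo).mul h.scale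
      h.order_domin))).mono_exp h.scale (by norm_num)).const_mul h.scale _
  · exact ((meas_predictor hX h.normal k i).aestronglyMeasurable).sub ((order_weight h hw i).meas k)
  · filter_upwards [h.pertBounds, theta_le h hX, hw, h.scale.pos] with k h1 h2 h3 hk ω
    refine le_trans ?_ (le_abs_self _)
    rw [resolv_mulVec_dot (h1 ω) (h2 ω)]
    have e1 : |(pert (R k) (X k ω) *ᵥ w k i) ⬝ᵥ ε k ω| ≤ ∑ j, |X k ω j * (R k j *ᵥ w k i ⬝ᵥ ε k ω)| := by
      rw [pert, sum_mulVec, sum_dotProduct]; refine (abs_sum_le_sum_abs _ _).trans (le_of_eq ?_)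
      refine sum_congr rfl fun j _ => ?_
      rw [smul_mulVec, smul_dotProduct, smul_eq_mul]
    have n1 : vnorm (pert (R k) (X k ω) *ᵥ w k i) ≤ (C * θ k * S k ω) * (B * θ k) :=
      vnorm_mulVec_le' (opNorm_pert_le (h1 ω).op _) (h3 i)
    have n2 : vnorm (resolv (R k) (X k ω) *ᵥ pert (R k) (X k ω) *ᵥ ε k ω)
        ≤ 2 * (S k ω * CanonicalModel.domin ε R k ω) :=
      vnorm_mulVec_le' (opNorm_inv_one_add_le ((opNorm_pert_le (h1 ω).op _).trans (h2 ω)))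
        (vnorm_pert_mulVec_le (h1 ω).vec _)
    have e2 := abs_dot_le' n1 n2
    rw [_root_.abs_le] at *
    constructor <;> nlinarith

/-- The shift of the predictor caused by the root. -/
lemma order_shift : StochO μ θ (39 / 40) fun k ω =>
    ∑ i, X k ω i * w k i ⬝ᵥ resolv (R k) (X k ω) *ᵥ ε k ω := by
  refine StochO.sum h.scale _ fun i _ => ?_
  have h1 : StochO μ θ 1 fun k ω => w k i ⬝ᵥ resolv (R k) (X k ω) *ᵥ ε k ω := by
    have := ((order_predictor_sub h hX hw i).mono_exp h.scale (by norm_num)).add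
      h.scale (order_weight h hw i)
    grind
  exact ((stochOrder h hX i).mul h.scale h1).mono_exp h.scale (by norm_num)

lemma abs_integral_lin_mul_lin_mul_qform_le (i j : I) : ∃ c : ℝ, ∀ᶠ k in atTop,
    |∫ ω, lin ε R J i k ω * lin ε R J j k ω * qform (vecMulVec (w k i) (w k j)) (ε k ω) ∂(μ k)|
      ≤ c * θ k ^ (3 : ℝ) := by
  refine ⟨∑ _a : I, ∑ _b : I, C * C * (1 / 4) * (8 * (C * B ^ 2)), ?_⟩
  filter_upwards [h.J_bound, h.fro_mul, hw, h.scale.pos] with k hJ hT hw hk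
  have hC := h.nonneg
  have hm : ∀ (a b : I) (D : Matrix (N k) (N k) ℝ), Measurable fun z =>
      qform (R k a) z * qform (R k b) z * qform D z := fun a b D =>
    ((meas_qform _).mul (meas_qform _)).mul (meas_qform _)
  have e : ∀ ω, lin ε R J i k ω * lin ε R J j k ω * qform (vecMulVec (w k i) (w k j)) (ε k ω)
      = ∑ a, ∑ b, (J k i a * J k j b * (1 / 4)) * (qform (R k a) (ε k ω) * qform (R k b) (ε k ω)
        * qform (vecMulVec (w k i) (w k j)) (ε k ω)) := fun ω => by
    rw [lin, lin, sum_mul_sum, sum_mul]; refine sum_congr rfl fun a _ => ?_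
    rw [sum_mul]; exact sum_congr rfl fun b _ => by ring
  have hi : ∀ a b, Integrable (fun ω => (J k i a * J k j b * (1 / 4)) * (qform (R k a) (ε k ω)
      * qform (R k b) (ε k ω) * qform (vecMulVec (w k i) (w k j)) (ε k ω))) (μ k) :=
    fun a b => (h.normal.integrable_comp k (hm a b _) (integrable_qform_mul_mul _ _ _)).const_mul _
  simp_rw [e]; rw [integral_finsetSum _ fun a _ => integrable_finsetSum _ fun b _ => hi a b, sum_mul]
  refine (abs_sum_le_sum_abs _ _).trans (sum_le_sum fun a _ => ?_)
  rw [integral_finsetSum _ fun b _ => hi a b, sum_mul]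
  refine (abs_sum_le_sum_abs _ _).trans (sum_le_sum fun b _ => ?_)
  rw [integral_const_mul, h.normal.integral_comp k (hm a b _), abs_mul]
  have h1 := abs_integral_qform_mul_mul_le (D := vecMulVec (w k i) (w k j)) (h.symm k a) (h.symm k b)
  have h2 : traceNormTwo (R k a * R k b) * traceNormTwo (vecMulVec (w k i) (w k j))
      ≤ (C * θ k) * ((B * θ k) * (B * θ k)) := by
    rw [fro_vecMulVec]
    exact mul_le_mul (hT a b) (mul_le_mul (hw i) (hw j) (vnorm_nonneg _) ((vnorm_nonneg _).trans (hw i)))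
      (mul_nonneg (vnorm_nonneg _) (vnorm_nonneg _)) (by positivity)
  have h3 : |J k i a * J k j b * (1 / 4)| ≤ C * C * (1 / 4) := by
    rw [abs_mul, abs_mul, abs_of_pos (by norm_num : (0 : ℝ) < 1 / 4)]
    exact mul_le_mul_of_nonneg_right (mul_le_mul (hJ i a) (hJ j b) (abs_nonneg _) hC) (by norm_num)
  refine (mul_le_mul h3 (h1.trans (mul_le_mul_of_nonneg_left h2 (by norm_num))) (abs_nonneg _)
    (by positivity)).trans (le_of_eq ?_)
  rw [show (3 : ℝ) = (3 : ℕ) by norm_num, rpow_natCast]; ring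

lemma order_isLittleO_integral {Z : ∀ k, Ω k → ℝ} {r : ℝ} (hZ : StochO μ θ r Z)
    (hr : 2 < r) : (fun k => ∫ ω, Z k ω ∂(μ k)) =o[atTop] fun k => θ k ^ 2 := by
  simpa using hZ.integral_isLittleO h.scale hr

lemma integral_mul_weight (i j : I) : (fun k => ∫ ω, (X k ω i * w k i ⬝ᵥ ε k ω) * (X k ω j * w k j ⬝ᵥ ε k ω) ∂(μ k)
      - w k i ⬝ᵥ w k j * J k i j) =o[atTop] fun k => θ k ^ 2 := by
  have h1 : StochO μ θ (5 / 2) fun k ω => (X k ω i * X k ω j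
      - lin ε R J i k ω * lin ε R J j k ω) * (w k i ⬝ᵥ ε k ω * w k j ⬝ᵥ ε k ω) :=
    ((order_mul_sub h hX i j).mul h.scale ((order_weight h hw i).mul h.scale
      (order_weight h hw j))).mono_exp h.scale (by norm_num)
  obtain ⟨c, hc⟩ := abs_integral_lin_mul_lin_mul_qform_le h hX hw i j
  have h2 : (fun k => ∫ ω, lin ε R J i k ω * lin ε R J j k ω *
      qform (vecMulVec (w k i) (w k j)) (ε k ω) ∂(μ k)) =o[atTop] fun k => θ k ^ 2 := by
    have : (fun k => θ k ^ (3 : ℝ)) =o[atTop] fun k => θ k ^ 2 := by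
      refine IsLittleO.of_bound fun δ hδ => ?_
      filter_upwards [h.scale.pos, h.scale.le hδ] with k hk h2
      rw [show (3 : ℝ) = (3 : ℕ) by norm_num, rpow_natCast, norm_of_nonneg (by positivity),
        norm_of_nonneg (by positivity), pow_succ, mul_comm]
      gcongr
    refine (IsBigO.of_bound c ?_).trans_isLittleO this
    filter_upwards [hc, h.scale.pos] with k h1 hk
    rwa [norm_eq_abs, norm_of_nonneg (by positivity)]
  have hq : StochO μ θ 2 fun k ω => qform (vecMulVec (w k i) (w k j)) (ε k ω) := by
    refine h.normal.order_qform h.scale (C := B ^ 2) ?_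
    filter_upwards [hw] with k hk
    rw [fro_vecMulVec]
    refine (mul_le_mul (hk i) (hk j) (vnorm_nonneg _) ((vnorm_nonneg _).trans (hk i))).trans (le_of_eq ?_)
    rw [rpow_two]; ring
  have hll := (order_lin h i).mul h.scale (order_lin h j)
  refine ((order_isLittleO_integral h hX hw h1 (by norm_num)).add h2).congr' ?_ EventuallyEq.rfl
  filter_upwards [h1.integrable, hll.integrable, (hll.mul h.scale hq).integrable,
    integral_lin_mul_lin h i j] with k i1 i2 i3 e1
  rw [← integral_add i1 i3, ← e1, ← integral_const_mul, ← integral_sub ?_ (i2.const_mul _)]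
  · refine integral_congr_ae (ae_of_all _ fun ω => ?_)
    simp only []; rw [dot_mul_dot_eq]; have := dot_mul_dot_eq (w k i) (w k j) (ε k ω)
    linear_combination (-(X k ω i * X k ω j)) * this
  · have : Integrable (fun ω => ((X k ω i * X k ω j - lin ε R J i k ω * lin ε R J j k ω) *
        (w k i ⬝ᵥ ε k ω * w k j ⬝ᵥ ε k ω) + lin ε R J i k ω * lin ε R J j k ω *
        qform (vecMulVec (w k i) (w k j)) (ε k ω)) + (w k i ⬝ᵥ w k j) *
        (lin ε R J i k ω * lin ε R J j k ω)) (μ k) := (i1.fun_add i3).fun_add (i2.const_mul _)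
    refine this.congr (ae_of_all _ fun ω => ?_)
    have := dot_mul_dot_eq (w k i) (w k j) (ε k ω)
    linear_combination (-(lin ε R J i k ω * lin ε R J j k ω)) * this

/-- Mean square of the shift of the predictor. -/
lemma integral_shift_sq : (fun k => ∫ ω, (∑ i, X k ω i * w k i ⬝ᵥ resolv (R k) (X k ω) *ᵥ ε k ω) ^ 2 ∂(μ k)
      - ∑ i, ∑ j, w k i ⬝ᵥ w k j * J k i j) =o[atTop] fun k => θ k ^ 2 := by
  have h1 : StochO μ θ (37 / 20) fun k ω =>
      ∑ i, X k ω i * (w k i ⬝ᵥ resolv (R k) (X k ω) *ᵥ ε k ω - w k i ⬝ᵥ ε k ω) :=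
    StochO.sum h.scale _ fun i _ => ((stochOrder h hX i).mul h.scale
      (order_predictor_sub h hX hw i)).mono_exp h.scale (by norm_num)
  have hx : ∀ i, StochO μ θ (39 / 40) fun k ω => X k ω i * w k i ⬝ᵥ ε k ω := fun i =>
    ((stochOrder h hX i).mul h.scale (order_weight h hw i)).mono_exp h.scale (by norm_num)
  have h2 : StochO μ θ (39 / 40) fun k ω => ∑ i, X k ω i * w k i ⬝ᵥ ε k ω :=
    StochO.sum h.scale _ fun i _ => hx i
  have h3 := (h1.mul h.scale ((order_shift h hX hw).add h.scale h2)).mono_exp h.scale (s := 5 / 2) (by norm_num)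
  have h4 := IsLittleO.fun_sum fun i (_ : i ∈ univ) =>
    IsLittleO.fun_sum fun j (_ : j ∈ univ) => integral_mul_weight h hX hw i j
  have hi := eventually_all.2 fun i => eventually_all.2 fun j =>
    ((hx i).mul h.scale (hx j)).integrable
  refine ((order_isLittleO_integral h hX hw h3 (by norm_num)).add h4).congr' ?_ EventuallyEq.rfl
  filter_upwards [h3.integrable, hi] with k i3 hi
  simp_rw [sum_sub_distrib]; rw [← add_sub_assoc]; congr 1
  have e : ∀ i, ∑ j, ∫ ω, (X k ω i * w k i ⬝ᵥ ε k ω) * (X k ω j * w k j ⬝ᵥ ε k ω) ∂(μ k)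
      = ∫ ω, ∑ j, (X k ω i * w k i ⬝ᵥ ε k ω) * (X k ω j * w k j ⬝ᵥ ε k ω) ∂(μ k) := fun i =>
    (integral_finsetSum _ fun j _ => hi i j).symm
  simp_rw [e]
  rw [← integral_finsetSum _ fun i _ => integrable_finsetSum _ fun j _ => hi i j,
    ← integral_add i3 (integrable_finsetSum _ fun i _ => integrable_finsetSum _ fun j _ => hi i j)]
  refine integral_congr_ae (ae_of_all _ fun ω => ?_)
  simp only []; rw [← sum_mul_sum]; simp only [mul_sub, sum_sub_distrib]; ring

lemma isLittleO_mul_integral (i j : I) :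
    (fun k => w k i ⬝ᵥ w k j * ∫ ω, X k ω i * X k ω j ∂(μ k) - w k i ⬝ᵥ w k j * J k i j)
      =o[atTop] fun k => θ k ^ 2 := by
  obtain ⟨c, hc0, hc⟩ := integral_mul h hX i j
  have h1 : (fun k => ∫ ω, X k ω i * X k ω j ∂(μ k) - J k i j) =o[atTop] fun _ => (1 : ℝ) := by
    refine (isLittleO_one_iff ℝ).2 ?_
    have h2 := (h.scale.rpow_tendsto (r := 1 / 2) (by norm_num)).const_mul c
    rw [mul_zero] at h2; exact squeeze_zero_norm' (hc.mono fun k hk => by rwa [norm_eq_abs]) h2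
  have h2 : (fun k => w k i ⬝ᵥ w k j) =O[atTop] fun k => θ k ^ 2 := by
    refine IsBigO.of_bound (B ^ 2) ?_
    filter_upwards [hw] with k hk
    refine (abs_dot_le' (hk i) (hk j)).trans (le_of_eq ?_)
    rw [norm_pow, norm_eq_abs, sq_abs]; ring
  refine (h2.mul_isLittleO h1).congr (fun k => by ring) fun k => by ring

/-- The quadratic correction of the leading terms. -/
lemma order_quadratic_sub : StochO μ θ (5 / 2) fun k ω =>
    (∑ i, X k ω i • w k i) ⬝ᵥ resolv (R k) (X k ω) *ᵥ (∑ i, X k ω i • w k i)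
      - ∑ i, ∑ j, w k i ⬝ᵥ w k j * (X k ω i * X k ω j) := by
  set S : ∀ k, Ω k → ℝ := fun k ω => ∑ i, |X k ω i| with hS
  have hSo := order_sum_abs h hX
  have hu : ∀ k j, Measurable fun ω => (∑ i, X k ω i • w k i) j := fun k j => by
    simp only [Finset.sum_apply, Pi.smul_apply, smul_eq_mul]
    exact Finset.measurable_fun_sum _ fun i _ => (meas_apply h hX k i).mul_const _
  refine StochO.of_le (Y := fun k ω =>
    2 * C * B ^ 2 * (θ k * (θ k * (θ k * (S k ω * S k ω * S k ω))))) ?_ (fun k => ?_) ?_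
  · exact ((theta_mul h hX (theta_mul h hX (theta_mul h hX ((hSo.mul h.scale hSo).mul h.scale
      hSo)))).mono_exp h.scale (by norm_num)).const_mul h.scale _
  · refine Measurable.aestronglyMeasurable (Measurable.sub ?_ ?_)
    · exact meas_dot (hu k) (meas_matrix_mulVec
        (meas_resolv _ fun i => meas_apply h hX k i) (hu k))
    · exact Finset.measurable_fun_sum _ fun i _ => Finset.measurable_fun_sum _ fun j _ =>
        ((meas_apply h hX k i).mul (meas_apply h hX k j)).const_mul _
  · filter_upwards [h.pertBounds, theta_le h hX, hw, h.scale.pos] with k h1 h2 h3 hk ω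
    refine le_trans ?_ (le_abs_self _)
    set u := ∑ i, X k ω i • w k i with hu
    have n0 : vnorm u ≤ S k ω * (B * θ k) := by
      rw [hu, hS, sum_mul]; refine (vnorm_sum_le _ _).trans (sum_le_sum fun i _ => ?_)
      rw [vnorm_smul]; exact mul_le_mul_of_nonneg_left (h3 i) (abs_nonneg _)
    have e0 : ∑ i, ∑ j, w k i ⬝ᵥ w k j * (X k ω i * X k ω j) = u ⬝ᵥ u := by
      simp only [hu, sum_dotProduct, dotProduct_sum, smul_dotProduct, dotProduct_smul, smul_eq_mul]; rw [sum_comm]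
      refine sum_congr rfl fun i _ => ?_
      rw [mul_sum]; exact sum_congr rfl fun j _ => by ring
    have e1 : u ⬝ᵥ resolv (R k) (X k ω) *ᵥ u - u ⬝ᵥ u
        = -(pert (R k) (X k ω) *ᵥ u ⬝ᵥ resolv (R k) (X k ω) *ᵥ u) := by
      rw [← dot_symm (pert_tr (h.symm k) _)]; nth_rewrite 1 [resolv_eq (h1 ω).op (h2 ω)]
      rw [sub_mulVec, one_mulVec, dotProduct_sub, mulVec_mulVec]; ring
    rw [e0, e1, abs_neg]; have n1 := vnorm_mulVec_le' (opNorm_pert_le (h1 ω).op (X k ω)) n0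
    have n2 := vnorm_mulVec_le' (opNorm_inv_one_add_le ((opNorm_pert_le (h1 ω).op (X k ω)).trans (h2 ω))) n0
    refine (abs_dot_le' n1 n2).trans (le_of_eq ?_)
    rw [hS]; ring

/-- Mean of the quadratic correction. -/
lemma integral_quadratic_correction :
    (fun k => ∫ ω, (∑ i, X k ω i • w k i) ⬝ᵥ resolv (R k) (X k ω) *ᵥ (∑ i, X k ω i • w k i) ∂(μ k)
      - ∑ i, ∑ j, w k i ⬝ᵥ w k j * J k i j) =o[atTop] fun k => θ k ^ 2 := by
  have h1 := order_quadratic_sub h hX hw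
  have h4 := IsLittleO.fun_sum fun i (_ : i ∈ univ) =>
    IsLittleO.fun_sum fun j (_ : j ∈ univ) => isLittleO_mul_integral h hX hw i j
  have hi := eventually_all.2 fun i => eventually_all.2 fun j =>
      ((stochOrder h hX i).mul h.scale (stochOrder h hX j)).integrable
  refine ((order_isLittleO_integral h hX hw h1 (by norm_num)).add h4).congr' ?_ EventuallyEq.rfl
  filter_upwards [h1.integrable, hi] with k i1 hi
  simp_rw [sum_sub_distrib]; rw [← add_sub_assoc]; simp_rw [← integral_const_mul]
  have e : ∀ i, ∑ j, ∫ ω, w k i ⬝ᵥ w k j * (X k ω i * X k ω j) ∂(μ k)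
      = ∫ ω, ∑ j, w k i ⬝ᵥ w k j * (X k ω i * X k ω j) ∂(μ k) := fun i =>
    (integral_finsetSum _ fun j _ => (hi i j).const_mul _).symm
  simp_rw [e]
  have i2 : ∀ i, Integrable (fun ω => ∑ j, w k i ⬝ᵥ w k j * (X k ω i * X k ω j)) (μ k) := fun i =>
    integrable_finsetSum _ fun j _ => (hi i j).const_mul _
  rw [← integral_finsetSum _ fun i _ => i2 i, ← integral_add i1 (integrable_finsetSum _ fun i _ => i2 i)]; simp

end LocalRoot
end CanonicalModel

section PosDefReal

variable {ι κ : Type*} [Fintype ι] [Fintype κ] [DecidableEq ι] [DecidableEq κ]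

lemma PosDef.tr_eq {A : Matrix ι ι ℝ} (hA : A.PosDef) : Aᵀ = A := by
  rw [← conjTranspose_eq_transpose_of_trivial]; exact hA.isHermitian

lemma PosSemidef.tr_eq {A : Matrix ι ι ℝ} (hA : A.PosSemidef) : Aᵀ = A := by
  rw [← conjTranspose_eq_transpose_of_trivial]; exact hA.isHermitian

lemma PosDef.inv_mul_self {A : Matrix ι ι ℝ} (hA : A.PosDef) : A⁻¹ * A = 1 :=
  nonsing_inv_mul _ ((isUnit_iff_isUnit_det _).1 hA.isUnit)

lemma PosDef.mul_inv_self {A : Matrix ι ι ℝ} (hA : A.PosDef) : A * A⁻¹ = 1 :=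
  mul_nonsing_inv _ ((isUnit_iff_isUnit_det _).1 hA.isUnit)

lemma PosDef.inv_tr {A : Matrix ι ι ℝ} (hA : A.PosDef) : (A⁻¹)ᵀ = A⁻¹ :=
  tr_inv_of_symm (PosDef.tr_eq hA)

lemma posDef_of_tr {A : Matrix ι ι ℝ} (h1 : Aᵀ = A) (h2 : ∀ x, x ≠ 0 → 0 < x ⬝ᵥ A *ᵥ x) : A.PosDef :=
  PosDef.of_dotProduct_mulVec_pos (by aesop)
    fun x hx => by simpa using h2 x hx

lemma PosDef.dot_pos {A : Matrix ι ι ℝ} (hA : A.PosDef) {x : ι → ℝ} (hx : x ≠ 0) : 0 < x ⬝ᵥ A *ᵥ x := by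
  simpa using hA.dotProduct_mulVec_pos hx

lemma PosDef.tr_mul_mul_same {A : Matrix ι ι ℝ} (hA : A.PosDef) {B : Matrix ι κ ℝ}
    (hB : Function.Injective B.mulVec) : (Bᵀ * A * B).PosDef := by
  have := hA.conjTranspose_mul_mul_same hB
  rwa [conjTranspose_eq_transpose_of_trivial] at this

lemma mulVec_injective_of_rank {A : Matrix ι κ ℝ} (h : A.rank = Fintype.card κ) : Function.Injective A.mulVec := by
  rw [mulVec_injective_iff, linearIndependent_iff_card_eq_finrank_span, Set.finrank, ← rank_eq_finrank_span_cols, h]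

lemma eq_of_forall_mulVec {A B : Matrix ι κ ℝ} (h : ∀ v, A *ᵥ v = B *ᵥ v) : A = B := ext_of_mulVec_single fun _ => h _

end PosDefReal

section MatrixCalculus
variable {n : Type*} [Fintype n] [DecidableEq n]

lemma hasDerivAt_matrix_inv {A : Matrix n n ℝ} (hA : IsUnit A) (B : Matrix n n ℝ) (t : ℝ) (φ : Matrix n n ℝ →ₗ[ℝ] ℝ) :
    HasDerivAt (fun x => φ (A + (x - t) • B)⁻¹) (-φ (A⁻¹ * B * A⁻¹)) t := by
  obtain ⟨u, rfl⟩ := hA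
  have h1 : HasDerivAt (fun x : ℝ => u + (x - t) • B) B t := by
    simpa using (((hasDerivAt_id t).sub_const t).smul_const B).const_add (u : Matrix n n ℝ)
  have h3 : HasFDerivAt Ring.inverse (-ContinuousLinearMap.mulLeftRight ℝ (Matrix n n ℝ) ↑u⁻¹ ↑u⁻¹)
      (u + (t - t) • B) := by simpa using hasFDerivAt_ringInverse u
  have h5 := φ.toContinuousLinearMap.hasFDerivAt.comp_hasDerivAt t (h3.comp_hasDerivAt t h1)
  have e : φ.toContinuousLinearMap ((-ContinuousLinearMap.mulLeftRight ℝ (Matrix n n ℝ) ↑u⁻¹ ↑u⁻¹) B)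
      = -φ ((u : Matrix n n ℝ)⁻¹ * B * (u : Matrix n n ℝ)⁻¹) := by
    simp [ContinuousLinearMap.mulLeftRight_apply, coe_units_inv]
  rw [e] at h5; refine h5.congr_of_eventuallyEq (Eventually.of_forall fun x => ?_)
  simp [nonsing_inv_eq_ringInverse]

lemma hasDerivAt_log_det {A : Matrix n n ℝ} (hA : IsUnit A) (B : Matrix n n ℝ) (t : ℝ) :
    HasDerivAt (fun x => Real.log (A + (x - t) • B).det) (A⁻¹ * B).trace t := by
  have hdet := (isUnit_iff_isUnit_det _).1 hA
  have e : ∀ x : ℝ, (A + (x - t) • B).det = A.det * (1 + (x - t) • (A⁻¹ * B)).det := fun x => by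
    rw [← det_mul, mul_add, mul_one, Matrix.mul_smul, ← mul_assoc, mul_nonsing_inv _ hdet, one_mul]
  obtain ⟨p, hp⟩ : ∃ p : Polynomial ℝ, ∀ r : ℝ, (1 + r • (A⁻¹ * B)).det = 1 + (A⁻¹ * B).trace * r + p.eval r * r ^ 2 :=
    ⟨_, fun r => det_one_add_smul r _⟩
  simp_rw [e, hp]
  have h1 : HasDerivAt (fun x : ℝ => A.det * (1 + (A⁻¹ * B).trace * (x - t)
      + p.eval (x - t) * (x - t) ^ 2)) (A.det * (A⁻¹ * B).trace) t := by
    have hx := (hasDerivAt_id t).sub_const t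
    have hp := HasDerivAt.comp t (p.hasDerivAt _) hx
    have := (((hx.const_mul (A⁻¹ * B).trace).const_add 1).fun_add (hp.fun_mul (hx.fun_pow 2))).const_mul A.det
    simpa using this
  refine (h1.log (by aesop)).congr_deriv ?_
  have := hdet.ne_zero
  simp; field_simp

lemma posDef_one_add_of_opNorm_lt {E : Matrix n n ℝ} (hE : Eᵀ = E) (h : ‖E‖ < 1) : (1 + E).PosDef := by
  refine posDef_of_tr (by aesop) fun x hx => ?_
  rw [add_mulVec, one_mulVec, dotProduct_add]
  have h2 : 0 < vnorm x ^ 2 := by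
    have := PosDef.dot_pos (PosDef.one : (1 : Matrix n n ℝ).PosDef) hx
    rw [vnorm_sq]; simpa using this
  have h3 := (abs_le.1 (abs_dot_mulVec_le x E x)).1
  rw [← vnorm_sq]; nlinarith

lemma eventually_posDef {A B : Matrix n n ℝ} (hA : A.PosDef) (hB : Bᵀ = B) (t : ℝ) :
    ∀ᶠ x in 𝓝 t, (A + (x - t) • B).PosDef := by
  obtain ⟨S, hS, h1, -⟩ := PosDef.exists_tr_mul_mul_eq_one hA
  have hdet := (isUnit_iff_isUnit_det _).1 hS
  have hc : Tendsto (fun x : ℝ => ‖(x - t) • (Sᵀ * B * S)‖) (𝓝 t) (𝓝 0) := by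
    have : Continuous fun x : ℝ => ‖(x - t) • (Sᵀ * B * S)‖ := by fun_prop
    simpa using this.tendsto t
  filter_upwards [hc.eventually (gt_mem_nhds one_pos)] with x hx
  have h2 := posDef_one_add_of_opNorm_lt (by
    simp [transpose_mul, hB, mul_assoc]) hx
  have hinj : Function.Injective (S⁻¹).mulVec := by
    rw [mulVec_injective_iff_isUnit]; exact (isUnit_nonsing_inv_iff).2 hS
  convert (PosDef.tr_mul_mul_same h2 hinj) using 1
  have h4 : (S⁻¹)ᵀ * Sᵀ = 1 := by rw [← transpose_mul, mul_nonsing_inv _ hdet, transpose_one]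
  have key : ∀ M : Matrix n n ℝ, (S⁻¹)ᵀ * (Sᵀ * M * S) * S⁻¹ = M := fun M => by
    calc _ = ((S⁻¹)ᵀ * Sᵀ) * M * (S * S⁻¹) := by simp only [mul_assoc]
      _ = M := by aesop
  rw [mul_add, add_mul, Matrix.mul_smul, smul_mul, key, ← h1, key]

lemma hasDerivAt_dot_mulVec {u : ℝ → n → ℝ} {u' : n → ℝ} {t : ℝ} (V : Matrix n n ℝ)
    (hu : ∀ a, HasDerivAt (fun x => u x a) (u' a) t) :
    HasDerivAt (fun x => u x ⬝ᵥ V *ᵥ u x) (u' ⬝ᵥ V *ᵥ u t + u t ⬝ᵥ V *ᵥ u') t := by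
  have h1 : ∀ a, HasDerivAt (fun x => (V *ᵥ u x) a) ((V *ᵥ u') a) t := fun a =>
    HasDerivAt.fun_sum fun b _ => (hu b).const_mul _
  have := HasDerivAt.fun_sum fun a (_ : a ∈ univ) => (hu a).fun_mul (h1 a)
  refine this.congr_deriv ?_
  rw [sum_add_distrib]; rfl

/-- The linear functional `M ↦ u'Mv`. -/
def bilinForm {l : Type*} [Fintype l] (u : n → ℝ) (v : l → ℝ) : Matrix n l ℝ →ₗ[ℝ] ℝ where
  toFun M := u ⬝ᵥ M *ᵥ v
  map_add' M N := by rw [add_mulVec, dotProduct_add]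
  map_smul' c M := by rw [smul_mulVec, dotProduct_smul]; rfl

/-- The linear functional `M ↦ tr (M B)`. -/
def traceFunctional (B : Matrix n n ℝ) : Matrix n n ℝ →ₗ[ℝ] ℝ where
  toFun M := (M * B).trace
  map_add' M N := by rw [Matrix.add_mul, trace_add]
  map_smul' c M := by rw [smul_mul, trace_smul]; rfl

/-- The linear map `M ↦ A M B`. -/
def sandwich {l : Type*} [Fintype l] (A : Matrix l n ℝ) (B : Matrix n l ℝ) : Matrix n n ℝ →ₗ[ℝ] Matrix l l ℝ where
  toFun M := A * M * B
  map_add' M N := by rw [Matrix.mul_add, Matrix.add_mul]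
  map_smul' c M := by rw [Matrix.mul_smul, smul_mul]; rfl

/-- The Cauchy–Schwarz inequality for a positive semidefinite form. -/
lemma psd_dot_sq_le {A : Matrix n n ℝ} (hA : A.PosSemidef) (u v : n → ℝ) :
    (u ⬝ᵥ A *ᵥ v) ^ 2 ≤ u ⬝ᵥ A *ᵥ u * v ⬝ᵥ A *ᵥ v := by
  have h : ∀ t : ℝ, 0 ≤ v ⬝ᵥ A *ᵥ v * (t * t) + 2 * u ⬝ᵥ A *ᵥ v * t + u ⬝ᵥ A *ᵥ u := fun t => by
    have h1 := psd_dot_nonneg hA (u + t • v)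
    have h2 : v ⬝ᵥ A *ᵥ u = u ⬝ᵥ A *ᵥ v := by rw [dot_symm (PosSemidef.tr_eq hA), dotProduct_comm]
    simp only [mulVec_add, mulVec_smul, dotProduct_add, add_dotProduct,
      dotProduct_smul, smul_dotProduct, smul_eq_mul, h2] at h1
    linarith
  have := discrim_le_zero h
  rw [discrim] at this; nlinarith

lemma opNorm_le_of_psd {A : Matrix n n ℝ} (hA : A.PosSemidef) {c : ℝ} (hc : 0 ≤ c)
    (h : ∀ x, x ⬝ᵥ A *ᵥ x ≤ c * x ⬝ᵥ x) : ‖A‖ ≤ c := by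
  refine opNorm_le_of_vnorm _ hc fun v => ?_
  have h1 := psd_dot_sq_le hA (A *ᵥ v) v
  have h2 := h (A *ᵥ v)
  have h3 := h v
  rw [← vnorm_sq] at h1 h2 h3
  rcases (vnorm_nonneg (A *ᵥ v)).eq_or_lt' with h0 | h0
  · rw [h0]; exact mul_nonneg hc (vnorm_nonneg v)
  have h6 : vnorm (A *ᵥ v) ^ 2 ≤ (c * vnorm v) ^ 2 := by
    have h7 : 0 < vnorm (A *ᵥ v) ^ 2 := by positivity
    refine le_of_mul_le_mul_left ?_ h7
    calc _ = (vnorm (A *ᵥ v) ^ 2) ^ 2 := by ring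
      _ ≤ _ := h1.trans (mul_le_mul h2 h3 (psd_dot_nonneg hA v) (by positivity))
      _ = _ := by ring
  exact abs_le_of_sq_le_sq' h6 (mul_nonneg hc (vnorm_nonneg v)) |>.2

lemma inv_sub_psd {W : Matrix n n ℝ} (hW : W.PosDef) {c : ℝ} (hc : 0 < c)
    (hle : ∀ x, x ⬝ᵥ W *ᵥ x ≤ c * x ⬝ᵥ x) : (W⁻¹ - c⁻¹ • (1 : Matrix n n ℝ)).PosSemidef := by
  refine PosSemidef.of_dotProduct_mulVec_nonneg ?_ fun x => ?_
  · have h1 := PosDef.inv_tr hW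
    rw [IsHermitian, conjTranspose_eq_transpose_of_trivial, transpose_sub, h1, transpose_smul, transpose_one]
  have h1 := psd_dot_sq_le hW.inv.posSemidef x (W *ᵥ x)
  rw [mulVec_mulVec, PosDef.inv_mul_self hW, one_mulVec] at h1
  have h2 := psd_dot_nonneg hW.inv.posSemidef x
  have h5 : (W *ᵥ x) ⬝ᵥ x = x ⬝ᵥ W *ᵥ x := dotProduct_comm _ _
  rw [sub_mulVec, smul_mulVec, one_mulVec, dotProduct_sub, dotProduct_smul,
    smul_eq_mul, star_trivial, sub_nonneg, inv_mul_le_iff₀ hc]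
  rcases (dot_self_nonneg_real x).eq_or_lt' with h0 | h0
  · rw [h0]; positivity
  · refine le_of_mul_le_mul_left ?_ h0
    nlinarith [mul_le_mul_of_nonneg_left (hle x) h2]

lemma trace_inv_mul_ge {W M : Matrix n n ℝ} (hW : W.PosDef) (hM : Mᵀ = M) {c : ℝ} (hc : 0 < c)
    (hle : ∀ x, x ⬝ᵥ W *ᵥ x ≤ c * x ⬝ᵥ x) : c⁻¹ ^ 2 * (M * M).trace ≤ (W⁻¹ * M * W⁻¹ * M).trace := by
  have hp := inv_sub_psd hW hc hle
  have h1 : (M * W⁻¹ * M).PosSemidef := by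
    have := psd_tr_mul_mul_same hW.inv.posSemidef M
    rwa [hM] at this
  have h2 : (M * M).PosSemidef := by
    have := psd_tr_mul_mul_same (PosSemidef.one (R := ℝ)) M
    rwa [hM, Matrix.mul_one] at this
  have t1 := trace_mul_nonneg_of_psd hp h1
  have t2 := trace_mul_nonneg_of_psd hp h2
  rw [Matrix.sub_mul, trace_sub, smul_mul, Matrix.one_mul, trace_smul, smul_eq_mul] at t1 t2
  have e : (M * W⁻¹ * M).trace = (W⁻¹ * (M * M)).trace := by rw [Matrix.mul_assoc, trace_mul_comm, Matrix.mul_assoc]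
  have e2 : W⁻¹ * (M * W⁻¹ * M) = W⁻¹ * M * W⁻¹ * M := by grind
  rw [e2, e] at t1; have := mul_le_mul_of_nonneg_left (sub_nonneg.1 t2) (inv_nonneg.2 hc.le); linarith

lemma matrix_inv_neg (M : Matrix n n ℝ) : (-M)⁻¹ = -M⁻¹ := by
  by_cases hM : IsUnit M.det
  · refine inv_eq_right_inv ?_
    rw [neg_mul_neg, mul_nonsing_inv _ hM]
  · have hM' : ¬IsUnit (-M).det := by rw [det_neg]; exact fun h => hM (isUnit_of_mul_isUnit_right h)
    rw [nonsing_inv_apply_not_isUnit _ hM, nonsing_inv_apply_not_isUnit _ hM', neg_zero]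

lemma stdScore_neg {I : Type*} [Fintype I]
    (R : I → Matrix n n ℝ) (x : I → ℝ) (e : n → ℝ) : stdScore R x (-e) = stdScore R x e := by
  funext i; rw [stdScore, stdScore, mulVec_neg, neg_dotProduct_neg]

end MatrixCalculus

section IndepGaussian
variable {n : Type*} [Fintype n]

lemma strongDual_pi_eq_dot (L : (n → ℝ) →L[ℝ] ℝ) : ∃ c : n → ℝ, ∀ z, L z = c ⬝ᵥ z := by
  classical
  refine ⟨fun i => L (Pi.single i 1), fun z => ?_⟩
  conv_lhs => rw [← univ_sum_single z]
  rw [map_sum, dotProduct]; refine sum_congr rfl fun i _ => ?_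
  rw [show Pi.single i (z i) = z i • (Pi.single i 1 : n → ℝ) by rw [← Pi.single_smul]; simp]
  rw [map_smul, smul_eq_mul, mul_comm]

lemma meas_dot_left (c : n → ℝ) : Measurable fun z : n → ℝ => c ⬝ᵥ z := by fun_prop

/-- A Gaussian variable uncorrelated with a standard normal vector is independent of it. -/
lemma indepFun_of_linear {Ω : Type*} [MeasurableSpace Ω] {P : Measure Ω} [IsProbabilityMeasure P]
    {F : Ω → ℝ} {Y : Ω → n → ℝ} (hF : Measurable F) (hY : Measurable Y) {v : ℝ} (hv : 0 ≤ v)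
    (h : ∀ (a : ℝ) (c : n → ℝ), P.map (fun ω => a * F ω + c ⬝ᵥ Y ω)
      = gaussianReal 0 (a ^ 2 * v + c ⬝ᵥ c).toNNReal) : IndepFun F Y P := by
  rw [indepFun_iff_charFunDual_prod hF.aemeasurable hY.aemeasurable]; intro L
  obtain ⟨c, hc⟩ := strongDual_pi_eq_dot (L.comp (.inr ℝ ℝ (n → ℝ)))
  set a := L (1, 0)
  have hcc : ∀ c : n → ℝ, 0 ≤ c ⬝ᵥ c := fun c => sum_nonneg fun i _ => mul_self_nonneg _
  have hL : ∀ x y, L (x, y) = a * x + c ⬝ᵥ y := fun x y => by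
    have h1 : (x, y) = x • (1, 0) + (0, y) := by simp
    rw [h1, map_add, map_smul, smul_eq_mul, mul_comm, ← hc y]; rfl
  have key : ∀ a c, ∫ ω, Complex.exp (((a * F ω + c ⬝ᵥ Y ω : ℝ) : ℂ) * Complex.I) ∂P
      = Complex.exp (-((a ^ 2 * v + c ⬝ᵥ c : ℝ) : ℂ) / 2) := fun a c => by
    have hm : Measurable fun ω => a * F ω + c ⬝ᵥ Y ω := (hF.const_mul a).add ((meas_dot_left c).comp hY)
    have h1 := charFun_gaussianReal (μ := 0) (v := (a ^ 2 * v + c ⬝ᵥ c).toNNReal) 1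
    rw [← h a c, charFun_apply_real, integral_map hm.aemeasurable (by fun_prop)] at h1
    simp only [Complex.ofReal_one, one_mul] at h1; rw [h1, coe_toNNReal _ (by have := hcc c; positivity)]
    push_cast; ring
  rw [charFunDual_apply, charFunDual_apply, charFunDual_apply, integral_map (hF.prodMk hY).aemeasurable (by fun_prop),
    integral_map hF.aemeasurable (by fun_prop), integral_map hY.aemeasurable (by fun_prop)]
  have e1 : ∀ ω, L (F ω, Y ω) = a * F ω + c ⬝ᵥ Y ω := fun ω => hL _ _
  have e2 : ∀ ω, (L.comp (.inl ℝ ℝ (n → ℝ))) (F ω) = a * F ω + 0 ⬝ᵥ Y ω := fun ω => by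
    have := hL (F ω) 0
    simpa using this
  have e3 : ∀ ω, (L.comp (.inr ℝ ℝ (n → ℝ))) (Y ω) = 0 * F ω + c ⬝ᵥ Y ω := fun ω => by grind
  simp_rw [e1, e2, e3, key]; rw [← Complex.exp_add]; simp; ring

end IndepGaussian

section VaryingDimension

variable {α : Type*} {F : Filter α} {n : α → Type*} [∀ a, Fintype (n a)] [∀ a, DecidableEq (n a)]
  {u v u' v' : ∀ a, n a → ℝ}

/-- Boundedness of a family of vectors of varying dimension. -/
def VecBdd (F : Filter α) (v : ∀ a, n a → ℝ) : Prop := ∃ C : ℝ, 0 ≤ C ∧ ∀ᶠ a in F, vnorm (v a) ≤ C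

/-- Convergence to zero of a family of vectors of varying dimension. -/
def VecNull (F : Filter α) (v : ∀ a, n a → ℝ) : Prop := Tendsto (fun a => vnorm (v a)) F (𝓝 0)

/-- Boundedness of a family of square matrices of varying size. -/
def MatBdd (F : Filter α) (A : ∀ a, Matrix (n a) (n a) ℝ) : Prop := ∃ C : ℝ, 0 ≤ C ∧ ∀ᶠ a in F, ‖A a‖ ≤ C

namespace VecNull

lemma of_le {f : α → ℝ} (h : ∀ᶠ a in F, vnorm (v a) ≤ f a) (hf : Tendsto f F (𝓝 0)) : VecNull F v :=
  squeeze_zero' (Eventually.of_forall fun _ => vnorm_nonneg _) h hf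

lemma bdd (h : VecNull F v) : VecBdd F v :=
  ⟨1, zero_le_one, (h.eventually (gt_mem_nhds one_pos)).mono fun _ ha => ha.le⟩

lemma add (hu : VecNull F u) (hv : VecNull F v) : VecNull F fun a => u a + v a :=
  of_le (Eventually.of_forall fun _ => vnorm_add_le _ _) (by simpa using Tendsto.add hu hv)

lemma sub (hu : VecNull F u) (hv : VecNull F v) : VecNull F fun a => u a - v a :=
  of_le (Eventually.of_forall fun _ => vnorm_sub_le _ _) (by simpa using Tendsto.add hu hv)

lemma sum {ι : Type*} (s : Finset ι) {f : ι → ∀ a, n a → ℝ} (h : ∀ i, VecNull F (f i)) :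
    VecNull F fun a => ∑ i ∈ s, f i a := of_le (Eventually.of_forall fun _ => vnorm_sum_le _ _)
    (by simpa using tendsto_finsetSum s fun i _ => h i)

lemma smul {c : α → ℝ} (hc : Tendsto c F (𝓝 0)) (hv : VecBdd F v) : VecNull F fun a => c a • v a := by
  obtain ⟨C, hC0, hC⟩ := hv
  refine of_le ?_ (by simpa using hc.abs.mul_const C)
  filter_upwards [hC] with a ha
  rw [vnorm_smul]; exact mul_le_mul_of_nonneg_left ha (abs_nonneg _)

lemma dotProduct (hu : VecNull F u) (hv : VecBdd F v) : Tendsto (fun a => u a ⬝ᵥ v a) F (𝓝 0) := by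
  obtain ⟨C, hC0, hC⟩ := hv
  refine squeeze_zero_norm' ?_ (by simpa using Tendsto.mul_const C hu)
  filter_upwards [hC] with a ha
  exact (abs_dot_le _ _).trans (mul_le_mul_of_nonneg_left ha (vnorm_nonneg _))

lemma dotProduct_sub (hu : VecNull F fun a => u a - u' a) (hv : VecNull F fun a => v a - v' a)
    (bu : VecBdd F u) (bv : VecBdd F v') : Tendsto (fun a => u a ⬝ᵥ v a - u' a ⬝ᵥ v' a) F (𝓝 0) := by
  have := (hv.dotProduct bu).add (hu.dotProduct bv)
  rw [add_zero] at this; refine this.congr fun a => ?_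
  rw [dotProduct_comm _ (u a), _root_.dotProduct_sub, sub_dotProduct]; ring

end VecNull

namespace VecBdd

lemma add (hu : VecBdd F u) (hv : VecBdd F v) : VecBdd F fun a => u a + v a := by
  obtain ⟨C, hC0, hC⟩ := hu
  obtain ⟨C', hC0', hC'⟩ := hv
  exact ⟨C + C', add_nonneg hC0 hC0', by
    filter_upwards [hC, hC'] with a h1 h2 using (vnorm_add_le _ _).trans (add_le_add h1 h2)⟩

lemma sub (hu : VecBdd F u) (hv : VecBdd F v) : VecBdd F fun a => u a - v a := by
  obtain ⟨C, hC0, hC⟩ := hu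
  obtain ⟨C', hC0', hC'⟩ := hv
  exact ⟨C + C', add_nonneg hC0 hC0', by
    filter_upwards [hC, hC'] with a h1 h2 using (vnorm_sub_le _ _).trans (add_le_add h1 h2)⟩

lemma const_smul (c : ℝ) (hv : VecBdd F v) : VecBdd F fun a => c • v a := by
  obtain ⟨C, hC0, hC⟩ := hv
  exact ⟨|c| * C, by positivity, hC.mono fun a ha => by
    rw [vnorm_smul]; exact mul_le_mul_of_nonneg_left ha (abs_nonneg _)⟩

lemma zero : VecBdd F fun a => (0 : n a → ℝ) := ⟨0, le_rfl, Eventually.of_forall fun _ => by rw [vnorm_zero]⟩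

lemma sum {ι : Type*} (s : Finset ι) {f : ι → ∀ a, n a → ℝ} (h : ∀ i, VecBdd F (f i)) :
    VecBdd F fun a => ∑ i ∈ s, f i a := by
  classical
  induction s using Finset.induction_on with
  | empty => simpa using zero
  | insert i s hi ih => simp_rw [sum_insert hi]; exact (h i).add ih

lemma of_sub (h : VecNull F fun a => u a - v a) (hv : VecBdd F v) : VecBdd F u := by simpa using h.bdd.add hv

lemma dotProduct (hu : VecBdd F u) (hv : VecBdd F v) : ∃ C : ℝ, ∀ᶠ a in F, |u a ⬝ᵥ v a| ≤ C := by
  obtain ⟨C, hC0, hC⟩ := hu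
  obtain ⟨C', hC0', hC'⟩ := hv
  exact ⟨C * C', by filter_upwards [hC, hC'] with a h1 h2 using abs_dot_le' h1 h2⟩

end VecBdd

namespace MatBdd
variable {A : ∀ a, Matrix (n a) (n a) ℝ}

lemma mulVec (hA : MatBdd F A) (hv : VecBdd F v) : VecBdd F fun a => A a *ᵥ v a := by
  obtain ⟨C, hC0, hC⟩ := hA
  obtain ⟨C', hC0', hC'⟩ := hv
  exact ⟨C * C', by positivity, by filter_upwards [hC, hC'] with a h1 h2 using vnorm_mulVec_le' h1 h2⟩

lemma mulVec_null (hA : MatBdd F A) (hv : VecNull F v) : VecNull F fun a => A a *ᵥ v a := by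
  obtain ⟨C, hC0, hC⟩ := hA
  refine VecNull.of_le ?_ (by simpa using Tendsto.const_mul C hv)
  filter_upwards [hC] with a h1 using vnorm_mulVec_le' h1 le_rfl

end MatBdd

variable {I : Type*} [Fintype I] {R : ∀ a, I → Matrix (n a) (n a) ℝ} {x : α → I → ℝ}

lemma tendsto_norm_pert (hR : ∀ i, MatBdd F fun a => R a i) (hx : ∀ i, Tendsto (fun a => x a i) F (𝓝 0)) :
    Tendsto (fun a => ‖pert (R a) (x a)‖) F (𝓝 0) := by
  choose C hC0 hC using hR
  refine squeeze_zero' (g := fun a => ∑ i, |x a i| * C i) (by simp) ?_ ?_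
  · filter_upwards [eventually_all.2 hC] with a ha
    refine (norm_sum_le _ _).trans (sum_le_sum fun i _ => ?_)
    rw [norm_smul]; exact mul_le_mul_of_nonneg_left (ha i) (norm_nonneg _)
  · simpa using tendsto_finsetSum univ fun i _ => ((hx i).abs.mul_const (C i))

lemma tendsto_norm_resolv_sub_one (hR : ∀ i, MatBdd F fun a => R a i) (hx : ∀ i, Tendsto (fun a => x a i) F (𝓝 0)) :
    Tendsto (fun a => ‖resolv (R a) (x a) - 1‖) F (𝓝 0) := by
  have h1 := tendsto_norm_pert hR hx
  refine squeeze_zero' (by simp)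
    ?_ (by simpa using h1.const_mul 2)
  filter_upwards [h1.eventually (gt_mem_nhds (by norm_num : (0 : ℝ) < 1 / 2))] with a ha
  exact opNorm_inv_one_add_sub_one_le ha.le

lemma vecNull_resolv_mulVec_sub (hR : ∀ i, MatBdd F fun a => R a i)
    (hx : ∀ i, Tendsto (fun a => x a i) F (𝓝 0)) (hv : VecBdd F v) :
    VecNull F fun a => resolv (R a) (x a) *ᵥ v a - v a := by
  obtain ⟨C, hC0, hC⟩ := hv
  refine VecNull.of_le ?_
    (by simpa using (tendsto_norm_resolv_sub_one hR hx).mul_const C)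
  filter_upwards [hC] with a ha
  have h1 : resolv (R a) (x a) *ᵥ v a - v a = (resolv (R a) (x a) - 1) *ᵥ v a := by rw [sub_mulVec, one_mulVec]
  rw [h1]; exact vnorm_mulVec_le' le_rfl ha

end VaryingDimension

section PosDefBound
variable {I : Type*} [Fintype I] [DecidableEq I] {L : Matrix I I ℝ} {κ : ℝ}

/-- A coercive matrix has a bounded inverse. -/
lemma coercive_inv (hκ : 0 < κ) (h : ∀ x, κ * x ⬝ᵥ x ≤ x ⬝ᵥ L *ᵥ x) : IsUnit L ∧ ∀ i j, |L⁻¹ i j| ≤ κ⁻¹ := by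
  have hL : IsUnit L := by
    refine mulVec_injective_iff_isUnit.1 fun u v huv => sub_eq_zero.1 ?_
    have h1 := h (u - v)
    rw [mulVec_sub, sub_eq_zero.2 huv, dotProduct_zero] at h1
    exact dotProduct_self_eq_zero.1 (le_antisymm (by nlinarith) (dot_self_nonneg_real _))
  refine ⟨hL, fun i j => (abs_entry_le_opNorm _ i j).trans (opNorm_le_of_vnorm _ (by positivity) fun v => ?_)⟩
  set u := L⁻¹ *ᵥ v with hu
  have h1 := h u
  have h2 : L *ᵥ u = v := by rw [hu, mulVec_mulVec, mul_nonsing_inv _ ((isUnit_iff_isUnit_det _).1 hL), one_mulVec]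
  rw [h2, ← vnorm_sq] at h1; have h3 := (le_abs_self _).trans (abs_dot_le u v)
  rw [← div_eq_inv_mul, le_div_iff₀ hκ]
  rcases (vnorm_nonneg u).eq_or_lt' with h0 | h0
  · rw [h0, zero_mul]; exact vnorm_nonneg v
  · refine le_of_mul_le_mul_left ?_ h0
    nlinarith

lemma coercive_of_psd_sub (h : (L - κ • (1 : Matrix I I ℝ)).PosSemidef) (x : I → ℝ) :
    κ * x ⬝ᵥ x ≤ x ⬝ᵥ L *ᵥ x := by
  have h1 := psd_dot_nonneg h x
  rw [sub_mulVec, smul_mulVec, one_mulVec, dotProduct_sub, dotProduct_smul, smul_eq_mul] at h1; linarith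

variable {α : Type*} {F : Filter α}

lemma fro_sq_eq_sum_sq (E : Matrix I I ℝ) : traceNormTwo E ^ 2 = ∑ j, ∑ i, E i j ^ 2 := by
  rw [fro_sq, trace_tr_mul_apply]; simp only [pow_two]

lemma tendsto_norm_of_entries {E : α → Matrix I I ℝ} (h : ∀ i j, Tendsto (fun a => E a i j) F (𝓝 0)) :
    Tendsto (fun a => ‖E a‖) F (𝓝 0) := by
  have h1 : Tendsto (fun a => sqrt (∑ j, ∑ i, E a i j ^ 2)) F (𝓝 0) := by
    have := (tendsto_finsetSum univ fun j _ =>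
      tendsto_finsetSum univ fun i _ => (h i j).pow 2).sqrt
    simpa using this
  refine squeeze_zero (fun _ => norm_nonneg _) (fun a => (opNorm_le_fro _).trans (le_of_eq ?_)) h1
  rw [← sqrt_sq (fro_nonneg _), fro_sq_eq_sum_sq]

lemma tendsto_inv_sub_inv {M L : α → Matrix I I ℝ} {C : ℝ}
    (hML : ∀ i j, Tendsto (fun a => M a i j - L a i j) F (𝓝 0)) (hL : ∀ᶠ a in F, IsUnit (L a))
    (hC : ∀ᶠ a in F, ‖(L a)⁻¹‖ ≤ C) (i j : I) : Tendsto (fun a => (M a)⁻¹ i j - (L a)⁻¹ i j) F (𝓝 0) := by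
  have h1 : Tendsto (fun a => ‖M a - L a‖) F (𝓝 0) := tendsto_norm_of_entries fun i j => by simpa using hML i j
  have h2 : Tendsto (fun a => ‖(L a)⁻¹ * (M a - L a)‖) F (𝓝 0) := by
    refine squeeze_zero' (by simp) ?_
      (by simpa using h1.const_mul C)
    filter_upwards [hC] with a ha
    exact (l2_opNorm_mul _ _).trans (by gcongr)
  refine squeeze_zero_norm' ?_
    (by simpa using (h2.const_mul 2).mul_const C)
  filter_upwards [hL, hC, h2.eventually (gt_mem_nhds (by norm_num : (0 : ℝ) < 1 / 2))] with a u1 c1 s1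
  set E := (L a)⁻¹ * (M a - L a) with hE
  have hM : M a = L a * (1 + E) := by
    rw [hE, Matrix.mul_add, Matrix.mul_one, ← Matrix.mul_assoc,
      mul_nonsing_inv _ ((isUnit_iff_isUnit_det _).1 u1), Matrix.one_mul]
    abel
  have h3 : (M a)⁻¹ - (L a)⁻¹ = ((1 + E)⁻¹ - 1) * (L a)⁻¹ := by
    rw [hM, Matrix.mul_inv_rev, Matrix.sub_mul, Matrix.one_mul]
  rw [← Matrix.sub_apply, h3]; refine (abs_entry_le_opNorm _ i j).trans ((l2_opNorm_mul _ _).trans ?_)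
  exact mul_le_mul (opNorm_inv_one_add_sub_one_le s1.le) c1 (norm_nonneg _) (by positivity)

end PosDefBound

lemma meas_const_coord {Ω a : Type*} [MeasurableSpace Ω] (v : a → ℝ) (i : a) :
    Measurable fun _ : Ω => v i := measurable_const

lemma meas_stdScore {Ω n I : Type*} [MeasurableSpace Ω] [Fintype n] [DecidableEq n] [Fintype I]
    (R : I → Matrix n n ℝ) {X : Ω → I → ℝ} {e : Ω → n → ℝ} (hX : Measurable X) (he : Measurable e) (i : I) :
    Measurable fun ω => stdScore R (X ω) (e ω) i := by
  have hW := meas_resolv R fun i => (measurable_pi_apply i).comp hX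
  have he' a := (measurable_pi_apply a).comp he
  have h1 := meas_matrix_mul (B := fun _ => R i) hW (by simp)
  have h2 := meas_dot he' (meas_matrix_mulVec (meas_matrix_mul h1 hW) he')
  have h3 : Measurable fun ω => (resolv R (X ω) * R i).trace := Finset.measurable_fun_sum _ fun a _ => h1 a a
  exact (h2.sub h3).const_mul (1 / 2)

lemma sq_le_sq_add_rpow {b c : ℝ} (hb : 2 < b) (hc : 0 < c) (w : ℝ) : w ^ 2 ≤ c ^ 2 + |w| ^ b * c ^ (2 - b) := by
  rcases le_or_gt |w| c with h | h
  · rw [← sq_abs]; have := pow_le_pow_left₀ (abs_nonneg w) h 2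
    have := mul_nonneg (rpow_nonneg (abs_nonneg w) b) (rpow_nonneg hc.le (2 - b))
    linarith
  · have h0 := hc.trans h
    have h1 : |w| ^ (2 - b) ≤ c ^ (2 - b) := rpow_le_rpow_of_nonpos hc h.le (by linarith)
    have h2 : w ^ 2 = |w| ^ b * |w| ^ (2 - b) := by rw [← rpow_add h0, add_sub_cancel, rpow_two, sq_abs]
    have := mul_le_mul_of_nonneg_left h1 (rpow_nonneg h0.le b)
    have := sq_nonneg c
    linarith

section Envelope

variable {Ω J : Type*} [MeasurableSpace Ω] {μ : Measure Ω} [IsProbabilityMeasure μ] [Fintype J]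
  {W : J → Ω → ℝ} {b C : ℝ}

lemma memLp_two_of_integrable_rpow {w : Ω → ℝ} (hb : 2 < b) (hm : Measurable w)
    (hi : Integrable (fun ω => |w ω| ^ b) μ) : MemLp w 2 μ := by
  refine (memLp_two_iff_integrable_sq hm.aestronglyMeasurable).2
    (((integrable_const 1).add hi).mono' (hm.pow_const 2).aestronglyMeasurable (ae_of_all _ fun ω => ?_))
  have := sq_le_sq_add_rpow hb one_pos (w ω)
  simpa using this

lemma setIntegral_sq_sum_abs_le (hb : 2 < b) (hm : ∀ j, Measurable (W j))
    (hi : ∀ j, Integrable (fun ω => |W j ω| ^ b) μ) (hC : ∀ j, ∫ ω, |W j ω| ^ b ∂μ ≤ C)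
    {B : Set Ω} {c : ℝ} (hc : 0 < c) :
    ∫ ω in B, (∑ j, |W j ω|) ^ 2 ∂μ ≤ (Fintype.card J : ℝ) ^ 2 * (c ^ 2 * μ.real B + |C| * c ^ (2 - b)) := by
  have h2 j := (memLp_two_of_integrable_rpow hb (hm j) (hi j)).integrable_sq
  have h3 : ∀ j, ∫ ω in B, W j ω ^ 2 ∂μ ≤ c ^ 2 * μ.real B + |C| * c ^ (2 - b) := fun j => by
    calc ∫ ω in B, W j ω ^ 2 ∂μ ≤ ∫ ω in B, (c ^ 2 + |W j ω| ^ b * c ^ (2 - b)) ∂μ :=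
          integral_mono (h2 j).integrableOn ((integrable_const _).add ((hi j).mul_const _).integrableOn)
            fun ω => sq_le_sq_add_rpow hb hc (W j ω)
      _ = c ^ 2 * μ.real B + (∫ ω in B, |W j ω| ^ b ∂μ) * c ^ (2 - b) := by
          rw [integral_add (integrable_const _) ((hi j).mul_const _).integrableOn, integral_mul_const]
          simp [mul_comm]
      _ ≤ _ := by
          refine add_le_add le_rfl (mul_le_mul_of_nonneg_right ?_ (rpow_nonneg hc.le _))
          refine (setIntegral_le_integral (hi j) (ae_of_all _ fun ω => rpow_nonneg (abs_nonneg _) _)).trans ?_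
          exact (hC j).trans (le_abs_self C)
  have hsum : Integrable (fun ω => ∑ j, W j ω ^ 2) μ := integrable_finsetSum _ fun j _ => h2 j
  calc ∫ ω in B, (∑ j, |W j ω|) ^ 2 ∂μ ≤ ∫ ω in B, (Fintype.card J : ℝ) * ∑ j, W j ω ^ 2 ∂μ := by
        refine integral_mono_of_nonneg (ae_of_all _ fun ω => sq_nonneg _) (hsum.const_mul _).integrableOn
          (ae_of_all _ fun ω => ?_)
        have := sq_sum_le_card_mul_sum_sq (s := univ) (f := fun j => |W j ω|)
        simpa only [card_univ, sq_abs] using this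
    _ = (Fintype.card J : ℝ) * ∑ j, ∫ ω in B, W j ω ^ 2 ∂μ := by
        rw [integral_const_mul, integral_finsetSum _ fun j _ => (h2 j).integrableOn]
    _ ≤ (Fintype.card J : ℝ) * ∑ _j : J, (c ^ 2 * μ.real B + |C| * c ^ (2 - b)) :=
        mul_le_mul_of_nonneg_left (sum_le_sum fun j _ => h3 j) (Nat.cast_nonneg _)
    _ = _ := by rw [sum_const, card_univ, nsmul_eq_mul]; ring

end Envelope

lemma abs_truncateAt_le (b f x : ℝ) : |truncateAt b f x| ≤ |b| + |f| := by
  rw [truncateAt]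
  grind

lemma meas_truncateAt (b f : ℝ) : Measurable (truncateAt b f) :=
  Measurable.ite (measurableSet_le measurable_id.norm measurable_const) measurable_id measurable_const

variable {q : ℕ}

lemma mem_interior_paramSpace {σ : VarComp q} : σ ∈ interior (paramSpace q) ↔ ∀ i, 0 < σ i := by
  have h : paramSpace q = Set.univ.pi fun _ => Set.Ici 0 := by aesop
  rw [h, interior_pi_set Set.finite_univ]; simp

namespace AnovaDesign
variable (D : AnovaDesign q) {τ σ : VarComp q} (l : Fin D.p → ℝ) (m : D.RE → ℝ)

lemma V_zero : D.V 0 = 1 := rfl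

lemma V_succ (j : Fin q) : D.V j.succ = D.Zblock j * (D.Zblock j)ᵀ := rfl

lemma V_psd (i : Fin (q + 1)) : (D.V i).PosSemidef := by
  refine Fin.cases ?_ (fun j => ?_) i
  · exact PosSemidef.one
  · rw [V_succ, ← conjTranspose_eq_transpose_of_trivial]; exact posSemidef_self_mul_conjTranspose _

lemma V_tr (i : Fin (q + 1)) : (D.V i)ᵀ = D.V i := PosSemidef.tr_eq (D.V_psd i)

lemma Sig_tr (τ : VarComp q) : (D.Sig τ)ᵀ = D.Sig τ := by simp [Sig, transpose_sum, V_tr]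

lemma Sig_eq_add (σ τ : VarComp q) : D.Sig τ = D.Sig σ + ∑ i, (τ i - σ i) • D.V i := by
  simp [Sig, sub_smul, sum_sub_distrib]

lemma Sig_update (τ : VarComp q) (i : Fin (q + 1)) (x : ℝ) :
    D.Sig (Function.update τ i x) = D.Sig τ + (x - τ i) • D.V i := by
  rw [D.Sig_eq_add τ (Function.update τ i x), sum_eq_single i]
  · simp
  · intro j _ hj; simp [Function.update_of_ne hj]
  · simp

lemma dot_Sig (τ : VarComp q) (x : Fin D.n → ℝ) : x ⬝ᵥ D.Sig τ *ᵥ x = ∑ i, τ i * x ⬝ᵥ D.V i *ᵥ x := by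
  simp [Sig, sum_mulVec, dotProduct_sum, smul_mulVec]

lemma posDef_Sig (h0 : 0 < τ 0) (h : ∀ i, 0 ≤ τ i) : (D.Sig τ).PosDef := by
  refine posDef_of_tr (D.Sig_tr τ) fun x hx => ?_
  rw [dot_Sig]
  refine sum_pos' (fun i _ => mul_nonneg (h i) (psd_dot_nonneg (D.V_psd i) x))
    ⟨0, mem_univ _, mul_pos h0 ?_⟩
  rw [V_zero, one_mulVec]
  exact (PosDef.one : (1 : Matrix (Fin D.n) (Fin D.n) ℝ).PosDef) |> fun hh => by simpa using PosDef.dot_pos hh hx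

lemma mul_G_mul_tr (τ : VarComp q) : D.Z * D.G τ * D.Zᵀ = ∑ j : Fin q, τ j.succ • D.V j.succ := by
  ext a b; rw [Matrix.mul_apply, Fintype.sum_sigma]
  simp only [G, mul_diagonal, transpose_apply, Matrix.sum_apply, Matrix.smul_apply]
  simp only [V_succ, Matrix.mul_apply, transpose_apply, Zblock, submatrix_apply, smul_eq_mul, id, mul_sum]
  grind

lemma Sig_eq (τ : VarComp q) : D.Sig τ = τ 0 • 1 + D.Z * D.G τ * D.Zᵀ := by
  rw [mul_G_mul_tr, Sig, Fin.sum_univ_succ, V_zero]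

/-- The coordinates of `m` in the `i`-th block of random effects. -/
def blockPart (m : D.RE → ℝ) (i : Fin (q + 1)) : D.RE → ℝ := fun a => if a.1.succ = i then m a else 0

/-- The image of the `i`-th block of `m`. -/
def zvec (m : D.RE → ℝ) (i : Fin (q + 1)) : Fin D.n → ℝ := D.Z *ᵥ D.blockPart m i

lemma G_mulVec (m : D.RE → ℝ) (τ : VarComp q) : D.G τ *ᵥ m = ∑ i, τ i • D.blockPart m i := by
  ext a; simp [G, mulVec_diagonal, blockPart, Finset.sum_apply]

lemma Z_mul_G_mulVec (m : D.RE → ℝ) (τ : VarComp q) : (D.Z * D.G τ) *ᵥ m = ∑ i, τ i • D.zvec m i := by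
  rw [← mulVec_mulVec, G_mulVec, mulVec_sum]; simp [zvec, mulVec_smul]

lemma s_eq (m : D.RE → ℝ) (τ : VarComp q) : D.s m τ = (D.Sig τ)⁻¹ *ᵥ ∑ i, τ i • D.zvec m i := by
  rw [s, Matrix.mul_assoc, ← mulVec_mulVec, Z_mul_G_mulVec]

/-- The information matrix of the fixed effects. -/
def Q (τ : VarComp q) : Matrix (Fin D.p) (Fin D.p) ℝ := D.Xᵀ * (D.Sig τ)⁻¹ * D.X

section Projection

variable (hX : Function.Injective D.X.mulVec) (hτ : (D.Sig τ).PosDef)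
include hX hτ

lemma posDef_Q : (D.Q τ).PosDef := PosDef.tr_mul_mul_same hτ.inv hX

lemma P_eq : D.P τ = (D.Sig τ)⁻¹ - (D.Sig τ)⁻¹ * D.X * (D.Q τ)⁻¹ * D.Xᵀ * (D.Sig τ)⁻¹ := rfl

lemma P_tr : (D.P τ)ᵀ = D.P τ := by
  simp only [P_eq D hX hτ, transpose_sub, transpose_mul, PosDef.inv_tr hτ,
    PosDef.inv_tr (D.posDef_Q hX hτ), transpose_transpose, Matrix.mul_assoc]

lemma P_mul_Sig : D.P τ * D.Sig τ = 1 - (D.Sig τ)⁻¹ * D.X * (D.Q τ)⁻¹ * D.Xᵀ := by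
  rw [P_eq D hX hτ, Matrix.sub_mul, PosDef.inv_mul_self hτ, Matrix.mul_assoc _ (D.Sig τ)⁻¹,
    PosDef.inv_mul_self hτ, Matrix.mul_one]

lemma P_mul_X : D.P τ * D.X = 0 := by
  rw [P_eq D hX hτ, Matrix.sub_mul, Matrix.mul_assoc _ (D.Sig τ)⁻¹ D.X, Matrix.mul_assoc _ D.Xᵀ,
    ← Matrix.mul_assoc D.Xᵀ, ← Q, Matrix.mul_assoc _ (D.Q τ)⁻¹, PosDef.inv_mul_self (D.posDef_Q hX hτ),
    Matrix.mul_one, sub_self]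

lemma X_tr_mul_P : D.Xᵀ * D.P τ = 0 := by
  rw [← transpose_transpose (D.Xᵀ * D.P τ), transpose_mul, transpose_transpose,
    D.P_tr hX hτ, D.P_mul_X hX hτ, transpose_zero]

lemma P_mul_Sig_mul {m : Type*} {B : Matrix (Fin D.n) m ℝ} (hB : D.Xᵀ * B = 0) : D.P τ * D.Sig τ * B = B := by
  rw [D.P_mul_Sig hX hτ, Matrix.sub_mul, Matrix.one_mul, Matrix.mul_assoc _ D.Xᵀ, hB, Matrix.mul_zero, sub_zero]

lemma P_mul_Sig_mul_P : D.P τ * D.Sig τ * D.P τ = D.P τ := D.P_mul_Sig_mul hX hτ (D.X_tr_mul_P hX hτ)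

lemma P_mul_Sig_mulVec {v : Fin D.n → ℝ} (hv : D.Xᵀ *ᵥ v = 0) : D.P τ *ᵥ D.Sig τ *ᵥ v = v := by
  rw [mulVec_mulVec, D.P_mul_Sig hX hτ, sub_mulVec, one_mulVec, ← mulVec_mulVec, hv, mulVec_zero, sub_zero]

/-- `P` in terms of a full set of error contrasts. -/
lemma P_eq_contrasts {t : Type*} [Fintype t] [DecidableEq t] {T : Matrix (Fin D.n) t ℝ}
    (hT : Function.Injective T.mulVec) (hTX : Tᵀ * D.X = 0) (hc : Fintype.card t + D.p = D.n) :
    D.P τ = T * (Tᵀ * D.Sig τ * T)⁻¹ * Tᵀ := by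
  have hW := PosDef.tr_mul_mul_same hτ hT
  have hXT : D.Xᵀ * T = 0 := by
    rw [← transpose_transpose (D.Xᵀ * T), transpose_mul, transpose_transpose, hTX, transpose_zero]
  set K := D.P τ - T * (Tᵀ * D.Sig τ * T)⁻¹ * Tᵀ with hK
  have k1 : K * D.X = 0 := by
    rw [hK, Matrix.sub_mul, D.P_mul_X hX hτ, Matrix.mul_assoc _ Tᵀ, hTX, Matrix.mul_zero, sub_zero]
  have k2 : K * (D.Sig τ * T) = 0 := by
    rw [hK, Matrix.sub_mul, ← Matrix.mul_assoc, D.P_mul_Sig_mul hX hτ hXT, Matrix.mul_assoc _ Tᵀ,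
      ← Matrix.mul_assoc Tᵀ, Matrix.mul_assoc T, PosDef.inv_mul_self hW, Matrix.mul_one, sub_self]
  let f : (t → ℝ) × (Fin D.p → ℝ) →ₗ[ℝ] (Fin D.n → ℝ) := (D.Sig τ * T).mulVecLin.coprod D.X.mulVecLin
  have hf : Function.Injective f := by
    refine (injective_iff_map_eq_zero f).2 fun ⟨a, b⟩ hab => ?_
    simp only [f, LinearMap.coprod_apply, mulVecLin_apply] at hab
    have h1 : (Tᵀ * D.Sig τ * T) *ᵥ a = 0 := by
      have := congrArg (fun v => Tᵀ *ᵥ v) hab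
      simpa [mulVec_add, mulVec_mulVec, hTX, ← Matrix.mul_assoc] using this
    have ha : a = 0 := by
      have := congrArg (fun v => (Tᵀ * D.Sig τ * T)⁻¹ *ᵥ v) h1
      simpa [mulVec_mulVec, PosDef.inv_mul_self hW] using this
    subst ha; rw [mulVec_zero, zero_add] at hab; have hb : b = 0 := hX (by rw [hab, mulVec_zero]); rw [hb]; rfl
  have hs : Function.Surjective f := by
    refine (LinearMap.injective_iff_surjective_of_finrank_eq_finrank ?_).1 hf
    simp [hc]
  refine sub_eq_zero.1 (eq_of_forall_mulVec (A := K) fun v => ?_)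
  obtain ⟨⟨a, b⟩, rfl⟩ := hs v
  simp only [f, LinearMap.coprod_apply, mulVecLin_apply, mulVec_add,
    mulVec_mulVec, k1, k2, Matrix.zero_mul, zero_mulVec, add_zero]

end Projection

/-- `X` has full column rank and the columns of `T` are a full set of error contrasts. -/
structure IsContrast {t : Type*} [Fintype t] (T : Matrix (Fin D.n) t ℝ) : Prop where
  injX : Function.Injective D.X.mulVec
  injT : Function.Injective T.mulVec
  mul_X : Tᵀ * D.X = 0
  card : Fintype.card t + D.p = D.n

lemma eventually_posDef_Sig (hτ : (D.Sig τ).PosDef) (i : Fin (q + 1)) :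
    ∀ᶠ x in 𝓝 (τ i), (D.Sig (Function.update τ i x)).PosDef := by
  simp_rw [Sig_update]; exact eventually_posDef hτ (D.V_tr i) (τ i)

lemma pderiv_eq_of_hasDerivAt {f : VarComp q → ℝ} {i : Fin (q + 1)} {c : ℝ}
    (h : HasDerivAt (fun x => f (Function.update τ i x)) c (τ i)) : pderiv i f τ = c := h.deriv

lemma hasDerivAt_Sig_inv (hτ : (D.Sig τ).PosDef) (i : Fin (q + 1)) (φ : Matrix (Fin D.n) (Fin D.n) ℝ →ₗ[ℝ] ℝ) :
    HasDerivAt (fun x => φ (D.Sig (Function.update τ i x))⁻¹) (-φ ((D.Sig τ)⁻¹ * D.V i * (D.Sig τ)⁻¹)) (τ i) := by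
  simp_rw [Sig_update]; exact hasDerivAt_matrix_inv hτ.isUnit _ _ φ

section Contrasts
variable {t : Type*} [Fintype t] [DecidableEq t] {T : Matrix (Fin D.n) t ℝ} (h : D.IsContrast T) (hτ : (D.Sig τ).PosDef)
include h hτ

lemma posDef_contrast : (Tᵀ * D.Sig τ * T).PosDef := PosDef.tr_mul_mul_same hτ h.injT

lemma hasDerivAt_P (i : Fin (q + 1)) (φ : Matrix (Fin D.n) (Fin D.n) ℝ →ₗ[ℝ] ℝ) :
    HasDerivAt (fun x => φ (D.P (Function.update τ i x))) (-φ (D.P τ * D.V i * D.P τ)) (τ i) := by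
  have h1 := hasDerivAt_matrix_inv (D.posDef_contrast h hτ).isUnit (Tᵀ * D.V i * T) (τ i) (φ ∘ₗ sandwich T Tᵀ)
  have e : (φ ∘ₗ sandwich T Tᵀ) ((Tᵀ * D.Sig τ * T)⁻¹ * (Tᵀ * D.V i * T) * (Tᵀ * D.Sig τ * T)⁻¹)
      = φ (D.P τ * D.V i * D.P τ) := by
    rw [D.P_eq_contrasts h.injX hτ h.injT h.mul_X h.card]; simp [sandwich, Matrix.mul_assoc]
  rw [e] at h1; refine h1.congr_of_eventuallyEq ?_
  filter_upwards [D.eventually_posDef_Sig hτ i] with x hx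
  rw [D.P_eq_contrasts h.injX hx h.injT h.mul_X h.card, Sig_update, Matrix.mul_add, Matrix.add_mul,
    Matrix.mul_smul, smul_mul]
  rfl

lemma hasDerivAt_quadratic_P (i : Fin (q + 1)) (y : Fin D.n → ℝ) :
    HasDerivAt (fun x => y ⬝ᵥ D.P (Function.update τ i x) *ᵥ y) (-(y ⬝ᵥ (D.P τ * D.V i * D.P τ) *ᵥ y)) (τ i) :=
  D.hasDerivAt_P h hτ i (bilinForm y y)

lemma trace_contrast_inv_mul (V : Matrix (Fin D.n) (Fin D.n) ℝ) :
    ((Tᵀ * D.Sig τ * T)⁻¹ * (Tᵀ * V * T)).trace = (D.P τ * V).trace := by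
  rw [D.P_eq_contrasts h.injX hτ h.injT h.mul_X h.card, Matrix.mul_assoc T, Matrix.mul_assoc T, trace_mul_comm T]
  simp only [Matrix.mul_assoc]

lemma hasDerivAt_second (i j : Fin (q + 1)) (y : Fin D.n → ℝ) :
    HasDerivAt (fun x => y ⬝ᵥ (D.P (Function.update τ i x) * D.V j * D.P (Function.update τ i x)) *ᵥ y)
      (-(y ⬝ᵥ (D.P τ * D.V i * D.P τ * D.V j * D.P τ) *ᵥ y
        + y ⬝ᵥ (D.P τ * D.V j * D.P τ * D.V i * D.P τ) *ᵥ y)) (τ i) := by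
  have h1 : ∀ a, HasDerivAt (fun x => (D.P (Function.update τ i x) *ᵥ y) a)
      ((-((D.P τ * D.V i * D.P τ) *ᵥ y)) a) (τ i) := fun a => by
    have := D.hasDerivAt_P h hτ i (bilinForm (Pi.single a 1) y)
    simpa [bilinForm] using this
  have h2 := hasDerivAt_dot_mulVec (D.V j) h1
  rw [Function.update_eq_self] at h2; refine (h2.congr_deriv ?_).congr_of_eventuallyEq ?_
  · have sP := D.P_tr h.injX hτ
    simp only [mulVec_neg, dotProduct_neg, neg_dotProduct, ← mulVec_mulVec,
      dot_symm sP, dot_symm (D.V_tr i)]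
    ring
  · filter_upwards [D.eventually_posDef_Sig hτ i] with x hx
    rw [← mulVec_mulVec, ← mulVec_mulVec, dot_symm (D.P_tr h.injX hx)]

lemma hasDerivAt_logLikP (i : Fin (q + 1)) (y : Fin D.n → ℝ) : HasDerivAt (fun x => D.logLikP (Function.update τ i x) y)
      (1 / 2 * (y ⬝ᵥ (D.P τ * D.V i * D.P τ) *ᵥ y - ((D.Sig τ)⁻¹ * D.V i).trace)) (τ i) := by
  have h1 := hasDerivAt_log_det hτ.isUnit (D.V i) (τ i)
  simp_rw [← Sig_update] at h1; have := ((h1.add (D.hasDerivAt_quadratic_P h hτ i y)).const_mul (-(1 / 2)))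
  exact this.congr_deriv (by ring)

lemma pderiv_pderiv_logLikP (i j : Fin (q + 1)) (y : Fin D.n → ℝ) : pderiv i (pderiv j fun τ => D.logLikP τ y) τ
      = 1 / 2 * (((D.Sig τ)⁻¹ * D.V i * (D.Sig τ)⁻¹ * D.V j).trace - y ⬝ᵥ (D.P τ * D.V i * D.P τ * D.V j * D.P τ) *ᵥ y
        - y ⬝ᵥ (D.P τ * D.V j * D.P τ * D.V i * D.P τ) *ᵥ y) := by
  refine pderiv_eq_of_hasDerivAt ?_
  have h1 := ((D.hasDerivAt_second h hτ i j y).sub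
    (D.hasDerivAt_Sig_inv hτ i (traceFunctional (D.V j)))).const_mul (1 / 2)
  refine (h1.congr_deriv ?_).congr_of_eventuallyEq ?_
  · simp only [traceFunctional, LinearMap.coe_mk, AddHom.coe_mk]; ring
  · filter_upwards [D.eventually_posDef_Sig hτ i] with x hx
    exact pderiv_eq_of_hasDerivAt (D.hasDerivAt_logLikP h hx j y)

end Contrasts

section Restricted
variable {T : Matrix (Fin D.n) (Fin (D.n - D.p)) ℝ} (h : D.IsContrast T) (hτ : (D.Sig τ).PosDef)
include h hτ

lemma hasDerivAt_logLikR (i : Fin (q + 1)) (y : Fin D.n → ℝ) :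
    HasDerivAt (fun x => D.logLikR T (Function.update τ i x) y)
      (1 / 2 * (y ⬝ᵥ (D.P τ * D.V i * D.P τ) *ᵥ y - (D.P τ * D.V i).trace)) (τ i) := by
  have h1 := hasDerivAt_log_det (D.posDef_contrast h hτ).isUnit (Tᵀ * D.V i * T) (τ i)
  have e : ∀ x, Tᵀ * D.Sig τ * T + (x - τ i) • (Tᵀ * D.V i * T) = Tᵀ * D.Sig (Function.update τ i x) * T := fun x => by
    rw [Sig_update, Matrix.mul_add, Matrix.add_mul, Matrix.mul_smul, smul_mul]
  simp_rw [e] at h1; rw [D.trace_contrast_inv_mul h hτ] at h1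
  have := ((h1.add (D.hasDerivAt_quadratic_P h hτ i y)).const_mul (-(1 / 2)))
  exact this.congr_deriv (by ring)

lemma pderiv_pderiv_logLikR (i j : Fin (q + 1)) (y : Fin D.n → ℝ) : pderiv i (pderiv j fun τ => D.logLikR T τ y) τ
      = 1 / 2 * ((D.P τ * D.V i * D.P τ * D.V j).trace - y ⬝ᵥ (D.P τ * D.V i * D.P τ * D.V j * D.P τ) *ᵥ y
        - y ⬝ᵥ (D.P τ * D.V j * D.P τ * D.V i * D.P τ) *ᵥ y) := by
  refine pderiv_eq_of_hasDerivAt ?_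
  have h1 := ((D.hasDerivAt_second h hτ i j y).sub (D.hasDerivAt_P h hτ i (traceFunctional (D.V j)))).const_mul (1 / 2)
  refine (h1.congr_deriv ?_).congr_of_eventuallyEq ?_
  · simp only [traceFunctional, LinearMap.coe_mk, AddHom.coe_mk]; ring
  · filter_upwards [D.eventually_posDef_Sig hτ i] with x hx
    exact pderiv_eq_of_hasDerivAt (D.hasDerivAt_logLikR h hx j y)

end Restricted

section Leading
variable (m : D.RE → ℝ) (hτ : (D.Sig τ).PosDef)

/-- The vector `f_i` with `∂s/∂σ_i = Σ⁻¹ f_i`. -/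
def sDir (m : D.RE → ℝ) (τ : VarComp q) (i : Fin (q + 1)) : Fin D.n → ℝ := D.zvec m i - D.V i *ᵥ D.s m τ

lemma sum_update_smul_zvec (i : Fin (q + 1)) (x : ℝ) :
    ∑ j, Function.update τ i x j • D.zvec m j = ∑ j, τ j • D.zvec m j + (x - τ i) • D.zvec m i := by
  rw [← sub_eq_iff_eq_add', ← sum_sub_distrib, sum_eq_single i]
  · simp [sub_smul]
  · intro j _ hj; simp [Function.update_of_ne hj]
  · simp

/-- Value of `g₁` through `Σ⁻¹`. -/
lemma g1_eq (τ : VarComp q) : D.g1 m τ = ∑ i, τ i * m ⬝ᵥ D.blockPart m i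
    - (∑ i, τ i • D.zvec m i) ⬝ᵥ ((D.Sig τ)⁻¹ *ᵥ ∑ i, τ i • D.zvec m i) := by
  have hG : (D.G τ)ᵀ = D.G τ := by simp [G]
  rw [g1, sub_mulVec, dotProduct_sub, G_mulVec, dotProduct_sum]; simp_rw [dotProduct_smul, smul_eq_mul]
  rw [← Z_mul_G_mulVec]; simp only [Matrix.mul_assoc, ← mulVec_mulVec]
  rw [dotProduct_mulVec, ← mulVec_transpose, hG, dotProduct_mulVec, ← mulVec_transpose, transpose_transpose]

lemma sum_update_mul (c : VarComp q) (i : Fin (q + 1)) (x : ℝ) :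
    ∑ j, Function.update τ i x j * c j = ∑ j, τ j * c j + (x - τ i) * c i := by
  rw [← sub_eq_iff_eq_add', ← sum_sub_distrib, sum_eq_single i]
  · grind
  · grind
  · simp

include hτ

lemma gradS_apply (a : Fin D.n) (i : Fin (q + 1)) : D.gradS m τ a i = ((D.Sig τ)⁻¹ *ᵥ D.sDir m τ i) a := by
  rw [gradS, of_apply]; refine pderiv_eq_of_hasDerivAt ?_
  simp_rw [s_eq, sum_update_smul_zvec, mulVec_add, mulVec_smul]
  have h1 := D.hasDerivAt_Sig_inv hτ i (bilinForm (Pi.single a 1) (∑ j, τ j • D.zvec m j))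
  have hx : HasDerivAt (fun x : ℝ => x - τ i) 1 (τ i) := (hasDerivAt_id _).sub_const _
  have h3 := h1.fun_add (hx.fun_mul (D.hasDerivAt_Sig_inv hτ i (bilinForm (Pi.single a 1) (D.zvec m i))))
  simp only [bilinForm, LinearMap.coe_mk, AddHom.coe_mk, single_dotProduct, one_mul, sub_self, zero_mul, add_zero,
    Function.update_eq_self] at h3
  refine (h3.congr_deriv ?_)
  rw [sDir, s_eq, mulVec_sub, ← mulVec_mulVec, ← mulVec_mulVec, Pi.sub_apply]; ring

lemma hasDerivAt_g1 (i : Fin (q + 1)) : HasDerivAt (fun x => D.g1 m (Function.update τ i x))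
    (m ⬝ᵥ D.blockPart m i - 2 * D.s m τ ⬝ᵥ D.zvec m i + D.s m τ ⬝ᵥ D.V i *ᵥ D.s m τ) (τ i) := by
  have sS := PosDef.inv_tr hτ
  set b := ∑ j, τ j • D.zvec m j with hb
  set z := D.zvec m i with hz
  have e : ∀ x, (b + (x - τ i) • z) ⬝ᵥ (D.Sig (Function.update τ i x))⁻¹ *ᵥ (b + (x - τ i) • z)
      = bilinForm b b (D.Sig (Function.update τ i x))⁻¹
        + (x - τ i) * (bilinForm b z (D.Sig (Function.update τ i x))⁻¹
          + bilinForm z b (D.Sig (Function.update τ i x))⁻¹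
          + (x - τ i) * bilinForm z z (D.Sig (Function.update τ i x))⁻¹) := fun x => by
    simp only [bilinForm, LinearMap.coe_mk, AddHom.coe_mk, mulVec_add,
      mulVec_smul, dotProduct_add, add_dotProduct, dotProduct_smul, smul_dotProduct, smul_eq_mul]
    ring
  simp_rw [g1_eq, sum_update_mul, sum_update_smul_zvec, ← hb, ← hz, e]
  have hx : HasDerivAt (fun x : ℝ => x - τ i) 1 (τ i) := (hasDerivAt_id _).sub_const _
  have h2 := D.hasDerivAt_Sig_inv hτ i (bilinForm b z)
  have h3 := D.hasDerivAt_Sig_inv hτ i (bilinForm z b)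
  have h4 := D.hasDerivAt_Sig_inv hτ i (bilinForm z z)
  have h5 := ((hx.mul_const (m ⬝ᵥ D.blockPart m i)).const_add (∑ j, τ j * m ⬝ᵥ D.blockPart m j)).fun_sub
    ((D.hasDerivAt_Sig_inv hτ i (bilinForm b b)).fun_add (hx.fun_mul ((h2.fun_add h3).fun_add (hx.fun_mul h4))))
  refine h5.congr_deriv ?_
  simp only [bilinForm, LinearMap.coe_mk, AddHom.coe_mk, sub_self, zero_mul, add_zero,
    Function.update_eq_self, one_mul, s_eq, ← mulVec_mulVec]
  rw [← hb, dot_symm sS b z, dotProduct_comm z, dot_symm sS b (D.V i *ᵥ _)]; ring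

end Leading

instance (τ : VarComp q) : IsProbabilityMeasure (D.noise τ) := by unfold noise; infer_instance

/-- A linear functional of the random effects and the errors. -/
def noiseForm (a : D.RE → ℝ) (c : Fin D.n → ℝ) (ω : (D.RE → ℝ) × (Fin D.n → ℝ)) : ℝ := a ⬝ᵥ ω.1 + c ⬝ᵥ ω.2

lemma meas_noiseForm (a : D.RE → ℝ) (c : Fin D.n → ℝ) : Measurable (D.noiseForm a c) :=
  ((meas_dot_left a).comp measurable_fst).add ((meas_dot_left c).comp measurable_snd)

/-- The covariance of two linear functionals. -/
def noiseCov (τ : VarComp q) (a a' : D.RE → ℝ) (c c' : Fin D.n → ℝ) : ℝ := a ⬝ᵥ D.G τ *ᵥ a' + τ 0 * c ⬝ᵥ c'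

lemma noiseForm_add (a a' : D.RE → ℝ) (c c' : Fin D.n → ℝ) (ω) :
    D.noiseForm (a + a') (c + c') ω = D.noiseForm a c ω + D.noiseForm a' c' ω := by
  simp only [noiseForm, add_dotProduct]; ring

lemma noiseForm_smul (t : ℝ) (a : D.RE → ℝ) (c : Fin D.n → ℝ) (ω) :
    D.noiseForm (t • a) (t • c) ω = t * D.noiseForm a c ω := by
  simp only [noiseForm, smul_dotProduct, smul_eq_mul]; ring

lemma noiseCov_comm (τ : VarComp q) (a a' : D.RE → ℝ) (c c' : Fin D.n → ℝ) :
    D.noiseCov τ a a' c c' = D.noiseCov τ a' a c' c := by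
  have hG : (D.G τ)ᵀ = D.G τ := by simp [G]
  rw [noiseCov, noiseCov, dot_symm hG, dotProduct_comm, dotProduct_comm c]

lemma noiseCov_add_self (τ : VarComp q) (a a' : D.RE → ℝ) (c c' : Fin D.n → ℝ) :
    D.noiseCov τ (a + a') (a + a') (c + c') (c + c')
      = D.noiseCov τ a a c c + D.noiseCov τ a' a' c' c' + 2 * D.noiseCov τ a a' c c' := by
  have := D.noiseCov_comm τ a a' c c'
  simp only [noiseCov, mulVec_add, dotProduct_add, add_dotProduct] at *; linarith

section Law
variable (hτ : τ ∈ paramSpace q)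
include hτ

lemma noiseCov_self_nonneg (a : D.RE → ℝ) (c : Fin D.n → ℝ) : 0 ≤ D.noiseCov τ a a c c := by
  simp only [noiseCov, G, mulVec_diagonal, dotProduct]
  refine add_nonneg (sum_nonneg fun i _ => ?_) (mul_nonneg (hτ 0) (sum_nonneg fun i _ => mul_self_nonneg _))
  nlinarith [mul_nonneg (hτ i.1.succ) (mul_self_nonneg (a i))]

lemma map_noiseForm (a : D.RE → ℝ) (c : Fin D.n → ℝ) :
    (D.noise τ).map (D.noiseForm a c) = gaussianReal 0 (D.noiseCov τ a a c c).toNNReal := by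
  have hi : IndepFun (fun ω : (D.RE → ℝ) × (Fin D.n → ℝ) => a ⬝ᵥ ω.1) (fun ω => c ⬝ᵥ ω.2) (D.noise τ) :=
    indepFun_prod (meas_dot_left a) (meas_dot_left c)
  have h1 : (D.noise τ).map (fun ω => a ⬝ᵥ ω.1) = gaussianReal 0 (∑ i, (a i ^ 2).toNNReal * (τ i.1.succ).toNNReal) := by
    rw [← map_dot_pi_gauss,
      ← (measurePreserving_fst (μ := Measure.pi fun a : D.RE => gaussianReal 0 (τ a.1.succ).toNNReal)
        (ν := Measure.pi fun _ : Fin D.n => gaussianReal 0 (τ 0).toNNReal)).map_eq,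
      Measure.map_map (meas_dot_left a) measurable_fst]
    rfl
  have h2 : (D.noise τ).map (fun ω => c ⬝ᵥ ω.2) = gaussianReal 0 (∑ i, (c i ^ 2).toNNReal * (τ 0).toNNReal) := by
    rw [← map_dot_pi_gauss,
      ← (measurePreserving_snd (μ := Measure.pi fun a : D.RE => gaussianReal 0 (τ a.1.succ).toNNReal)
        (ν := Measure.pi fun _ : Fin D.n => gaussianReal 0 (τ 0).toNNReal)).map_eq,
      Measure.map_map (meas_dot_left c) measurable_snd]
    rfl
  have h3 := gaussianReal_add_gaussianReal_of_indepFun hi h1 h2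
  rw [add_zero] at h3
  have e : D.noiseForm a c = (fun ω : (D.RE → ℝ) × (Fin D.n → ℝ) => a ⬝ᵥ ω.1) + fun ω => c ⬝ᵥ ω.2 := rfl
  rw [e, h3]; congr 1; rw [← NNReal.coe_inj, coe_toNNReal _ (D.noiseCov_self_nonneg hτ a c)]
  simp only [NNReal.coe_add, NNReal.coe_sum, NNReal.coe_mul, coe_toNNReal _ (sq_nonneg _),
    coe_toNNReal _ (hτ _), noiseCov, G, mulVec_diagonal, dotProduct, mul_sum]
  congr 1
  · exact sum_congr rfl fun i _ => by ring
  · exact sum_congr rfl fun i _ => by ring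

lemma memLp_noiseForm (a : D.RE → ℝ) (c : Fin D.n → ℝ) : MemLp (D.noiseForm a c) 2 (D.noise τ) := by
  have h := memLp_id_gaussianReal' (μ := 0) (v := (D.noiseCov τ a a c c).toNNReal) 2 (by simp)
  rw [← D.map_noiseForm hτ a c] at h
  exact (memLp_map_measure_iff h.aestronglyMeasurable (D.meas_noiseForm a c).aemeasurable).1 h

lemma integral_noiseForm (a : D.RE → ℝ) (c : Fin D.n → ℝ) : ∫ ω, D.noiseForm a c ω ∂(D.noise τ) = 0 := by
  have h := integral_map (μ := D.noise τ) (D.meas_noiseForm a c).aemeasurable (f := fun x : ℝ => x) (by fun_prop)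
  rw [D.map_noiseForm hτ, integral_id_gaussianReal] at h; exact h.symm

lemma integral_noiseForm_sq (a : D.RE → ℝ) (c : Fin D.n → ℝ) :
    ∫ ω, D.noiseForm a c ω ^ 2 ∂(D.noise τ) = D.noiseCov τ a a c c := by
  have h := variance_id_gaussianReal (μ := 0) (v := (D.noiseCov τ a a c c).toNNReal)
  rw [← D.map_noiseForm hτ, variance_map (by fun_prop) (D.meas_noiseForm a c).aemeasurable] at h
  rw [variance_of_integral_eq_zero
    (measurable_id.comp (D.meas_noiseForm a c)).aemeasurable (by simpa using D.integral_noiseForm hτ a c)] at h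
  rw [coe_toNNReal _ (D.noiseCov_self_nonneg hτ a c)] at h; simpa using h

lemma integrable_noiseForm_mul (a a' : D.RE → ℝ) (c c' : Fin D.n → ℝ) :
    Integrable (fun ω => D.noiseForm a c ω * D.noiseForm a' c' ω) (D.noise τ) :=
  (D.memLp_noiseForm hτ a c).integrable_mul (D.memLp_noiseForm hτ a' c')

lemma integral_noiseForm_mul (a a' : D.RE → ℝ) (c c' : Fin D.n → ℝ) :
    ∫ ω, D.noiseForm a c ω * D.noiseForm a' c' ω ∂(D.noise τ) = D.noiseCov τ a a' c c' := by
  have h := D.integral_noiseForm_sq hτ (a + a') (c + c')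
  have e : ∀ ω, D.noiseForm (a + a') (c + c') ω ^ 2 = D.noiseForm a c ω ^ 2
      + D.noiseForm a' c' ω ^ 2 + 2 * (D.noiseForm a c ω * D.noiseForm a' c' ω) := fun ω => by
    rw [noiseForm_add]; ring
  simp_rw [e] at h; have i1 := (D.memLp_noiseForm hτ a c).integrable_sq
  have i2 := (D.memLp_noiseForm hτ a' c').integrable_sq
  rw [integral_add (i1.fun_add i2) ((D.integrable_noiseForm_mul hτ a a' c c').const_mul 2),
    integral_add i1 i2, integral_const_mul, D.integral_noiseForm_sq hτ, D.integral_noiseForm_sq hτ,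
    noiseCov_add_self] at h
  linarith

end Law

/-! The centred observation. -/

/-- The centred observation `y - Xβ`. -/
def resid (ω : (D.RE → ℝ) × (Fin D.n → ℝ)) : Fin D.n → ℝ := D.Z *ᵥ ω.1 + ω.2

lemma obs_eq (β : Fin D.p → ℝ) (ω) : D.obs β ω = D.X *ᵥ β + D.resid ω := by rw [obs, resid, add_assoc]

lemma meas_resid : Measurable D.resid := ((meas_mulVec D.Z).comp measurable_fst).add measurable_snd

lemma meas_obs (β : Fin D.p → ℝ) : Measurable (D.obs β) := by
  have : D.obs β = fun ω => D.X *ᵥ β + D.resid ω := funext fun ω => D.obs_eq β ω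
  rw [this]; exact D.meas_resid.const_add _

lemma dot_resid (u : Fin D.n → ℝ) (ω) : u ⬝ᵥ D.resid ω = D.noiseForm (D.Zᵀ *ᵥ u) u ω := by
  rw [resid, noiseForm, dotProduct_add, dotProduct_mulVec, mulVec_transpose]

lemma noiseCov_resid (τ : VarComp q) (a : D.RE → ℝ) (c u : Fin D.n → ℝ) :
    D.noiseCov τ (D.Zᵀ *ᵥ u) a u c = u ⬝ᵥ (D.Z * D.G τ) *ᵥ a + τ 0 * u ⬝ᵥ c := by
  rw [noiseCov, mulVec_transpose, ← dotProduct_mulVec, mulVec_mulVec]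

lemma noiseCov_resid_resid (τ : VarComp q) (u u' : Fin D.n → ℝ) :
    D.noiseCov τ (D.Zᵀ *ᵥ u) (D.Zᵀ *ᵥ u') u u' = u ⬝ᵥ D.Sig τ *ᵥ u' := by
  rw [noiseCov_resid, Sig_eq, add_mulVec, dotProduct_add, mulVec_mulVec,
    smul_mulVec, one_mulVec, dotProduct_smul, smul_eq_mul, add_comm]

lemma integral_resid_mul (hτ : τ ∈ paramSpace q) (M : Matrix (Fin D.n) (Fin D.n) ℝ) :
    Integrable (fun ω => D.resid ω ⬝ᵥ M *ᵥ D.resid ω) (D.noise τ) ∧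
    ∫ ω, D.resid ω ⬝ᵥ M *ᵥ D.resid ω ∂(D.noise τ) = (M * D.Sig τ).trace := by
  have h0 : ∀ a ω, D.resid ω a = D.noiseForm (D.Zᵀ *ᵥ Pi.single a 1) (Pi.single a 1) ω := fun a ω => by
    rw [← dot_resid, single_one_dotProduct]
  have e : ∀ ω, D.resid ω ⬝ᵥ M *ᵥ D.resid ω = ∑ a, ∑ b, M a b *
      (D.noiseForm (D.Zᵀ *ᵥ Pi.single a 1) (Pi.single a 1) ω *
        D.noiseForm (D.Zᵀ *ᵥ Pi.single b 1) (Pi.single b 1) ω) := fun ω => by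
    simp_rw [← h0]; simp only [dotProduct, mulVec, mul_sum]
    grind
  have i1 : ∀ a b, Integrable (fun ω => M a b * (D.noiseForm (D.Zᵀ *ᵥ Pi.single a 1) (Pi.single a 1) ω *
        D.noiseForm (D.Zᵀ *ᵥ Pi.single b 1) (Pi.single b 1) ω)) (D.noise τ) := fun a b =>
    (D.integrable_noiseForm_mul hτ _ _ _ _).const_mul _
  simp_rw [e]; refine ⟨integrable_finsetSum _ fun a _ => integrable_finsetSum _ fun b _ => i1 a b, ?_⟩
  rw [integral_finsetSum _ fun a _ => integrable_finsetSum _ fun b _ => i1 a b]; refine sum_congr rfl fun a _ => ?_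
  rw [integral_finsetSum _ fun b _ => i1 a b, diag_apply, Matrix.mul_apply]; refine sum_congr rfl fun b _ => ?_
  rw [integral_const_mul, D.integral_noiseForm_mul hτ, noiseCov_resid_resid, single_one_dotProduct]
  rw [← D.Sig_tr τ]; simp [D.Sig_tr]

section Information
variable {t : Type*} [Fintype t] [DecidableEq t] {T : Matrix (Fin D.n) t ℝ} (h : D.IsContrast T) (hτ : τ ∈ D.admissible)
include h hτ

lemma integral_quadratic_P (M : Matrix (Fin D.n) (Fin D.n) ℝ) :
    Integrable (fun ω => D.resid ω ⬝ᵥ (D.P τ * M * D.P τ) *ᵥ D.resid ω) (D.noise τ) ∧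
    ∫ ω, D.resid ω ⬝ᵥ (D.P τ * M * D.P τ) *ᵥ D.resid ω ∂(D.noise τ) = (D.P τ * M).trace := by
  obtain ⟨h1, h2⟩ := D.integral_resid_mul hτ.1 (D.P τ * M * D.P τ)
  refine ⟨h1, h2.trans ?_⟩
  rw [Matrix.mul_assoc, Matrix.mul_assoc, trace_mul_comm, Matrix.mul_assoc, Matrix.mul_assoc,
    ← Matrix.mul_assoc (D.P τ) (D.Sig τ), D.P_mul_Sig_mul_P h.injX hτ.2, trace_mul_comm]

lemma P_mulVec_obs (β : Fin D.p → ℝ) (ω) : D.P τ *ᵥ D.obs β ω = D.P τ *ᵥ D.resid ω := by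
  rw [obs_eq, mulVec_add, mulVec_mulVec, D.P_mul_X h.injX hτ.2, zero_mulVec, zero_add]

lemma quadratic_P_obs (β : Fin D.p → ℝ) (M : Matrix (Fin D.n) (Fin D.n) ℝ) (ω) :
    D.obs β ω ⬝ᵥ (D.P τ * M * D.P τ) *ᵥ D.obs β ω = D.resid ω ⬝ᵥ (D.P τ * M * D.P τ) *ᵥ D.resid ω := by
  rw [← mulVec_mulVec, ← mulVec_mulVec, dot_symm (D.P_tr h.injX hτ.2),
    D.P_mulVec_obs h hτ, ← mulVec_mulVec, ← mulVec_mulVec, dot_symm (D.P_tr h.injX hτ.2)]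

lemma integral_second (i j : Fin (q + 1)) (c : ℝ) :
    ∫ ω, 1 / 2 * (c - D.obs 0 ω ⬝ᵥ (D.P τ * D.V i * D.P τ * D.V j * D.P τ) *ᵥ D.obs 0 ω
        - D.obs 0 ω ⬝ᵥ (D.P τ * D.V j * D.P τ * D.V i * D.P τ) *ᵥ D.obs 0 ω) ∂(D.noise τ)
      = 1 / 2 * c - (D.P τ * D.V i * D.P τ * D.V j).trace := by
  have e : ∀ i j, D.P τ * D.V i * D.P τ * D.V j * D.P τ
      = D.P τ * (D.V i * D.P τ * D.V j) * D.P τ := fun i j => by grind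
  simp_rw [e, D.quadratic_P_obs h hτ]; obtain ⟨h1, h2⟩ := D.integral_quadratic_P h hτ (D.V i * D.P τ * D.V j)
  obtain ⟨h3, h4⟩ := D.integral_quadratic_P h hτ (D.V j * D.P τ * D.V i)
  have h5 : Integrable (fun ω => c - D.resid ω ⬝ᵥ ((D.P τ * (D.V i * D.P τ * D.V j) * D.P τ) *ᵥ
      D.resid ω)) (D.noise τ) := (integrable_const c).sub h1
  rw [integral_const_mul, integral_sub h5 h3, integral_sub (by simp) h1, h2, h4, integral_const]
  have e2 : (D.P τ * (D.V j * D.P τ * D.V i)).trace = (D.P τ * (D.V i * D.P τ * D.V j)).trace := by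
    rw [← trace_transpose]; simp only [transpose_mul, D.V_tr, D.P_tr h.injX hτ.2]
    rw [trace_mul_comm, Matrix.mul_assoc]
  rw [e2]; simp only [probReal_univ, one_smul, Matrix.mul_assoc]; ring

lemma AM_apply (i j : Fin (q + 1)) : D.AM τ i j = 1 / 2 * ((D.Sig τ)⁻¹ * D.V i * (D.Sig τ)⁻¹ * D.V j).trace
      - (D.P τ * D.V i * D.P τ * D.V j).trace := by
  rw [AM, expHessian, of_apply]; simp_rw [D.pderiv_pderiv_logLikP h hτ.2]; exact D.integral_second h hτ i j _

lemma integral_scoreP (β : Fin D.p → ℝ) (i : Fin (q + 1)) :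
    Integrable (fun ω => pderiv i (fun τ => D.logLikP τ (D.obs β ω)) τ) (D.noise τ) ∧
    ∫ ω, pderiv i (fun τ => D.logLikP τ (D.obs β ω)) τ ∂(D.noise τ) = -D.gM0 τ i := by
  have e : ∀ ω, pderiv i (fun τ => D.logLikP τ (D.obs β ω)) τ = 1 / 2 *
      (D.resid ω ⬝ᵥ (D.P τ * D.V i * D.P τ) *ᵥ D.resid ω - ((D.Sig τ)⁻¹ * D.V i).trace) := fun ω => by
    rw [← D.quadratic_P_obs h hτ β]; exact pderiv_eq_of_hasDerivAt (D.hasDerivAt_logLikP h hτ.2 i _)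
  simp_rw [e]; obtain ⟨h1, h2⟩ := D.integral_quadratic_P h hτ (D.V i)
  refine ⟨(h1.sub (by simp)).const_mul _, ?_⟩
  rw [integral_const_mul, integral_sub h1 (integrable_const _), h2, integral_const, gM0, Matrix.sub_mul, trace_sub]
  simp only [probReal_univ, one_smul]; ring

end Information

section InformationR
variable {T : Matrix (Fin D.n) (Fin (D.n - D.p)) ℝ} (h : D.IsContrast T) (hτ : τ ∈ D.admissible)
include h hτ

lemma AR_apply (i j : Fin (q + 1)) : D.AR T τ i j = -(1 / 2 * (D.P τ * D.V i * D.P τ * D.V j).trace) := by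
  rw [AR, expHessian, of_apply]; simp_rw [D.pderiv_pderiv_logLikR h hτ.2]; rw [D.integral_second h hτ i j]; ring

lemma integral_scoreR (β : Fin D.p → ℝ) (i : Fin (q + 1)) :
    Integrable (fun ω => pderiv i (fun τ => D.logLikR T τ (D.obs β ω)) τ) (D.noise τ) ∧
    ∫ ω, pderiv i (fun τ => D.logLikR T τ (D.obs β ω)) τ ∂(D.noise τ) = 0 := by
  have e : ∀ ω, pderiv i (fun τ => D.logLikR T τ (D.obs β ω)) τ = 1 / 2 *
      (D.resid ω ⬝ᵥ (D.P τ * D.V i * D.P τ) *ᵥ D.resid ω - (D.P τ * D.V i).trace) := fun ω => by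
    rw [← D.quadratic_P_obs h hτ β]; exact pderiv_eq_of_hasDerivAt (D.hasDerivAt_logLikR h hτ.2 i _)
  simp_rw [e]; obtain ⟨h1, h2⟩ := D.integral_quadratic_P h hτ (D.V i)
  refine ⟨(h1.sub (by simp)).const_mul _, ?_⟩
  rw [integral_const_mul, integral_sub h1 (integrable_const _), h2, integral_const]; simp

end InformationR

/-- The covariance of the observation with `m'v`. -/
def covVec (m : D.RE → ℝ) (τ : VarComp q) : Fin D.n → ℝ := ∑ i, τ i • D.zvec m i

lemma covVec_eq_add (σ τ : VarComp q) : D.covVec m τ = D.covVec m σ + ∑ i, (τ i - σ i) • D.zvec m i := by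
  simp [covVec, sub_smul, sum_sub_distrib]

/-- The multiplier `Q⁻¹ (l - X's)` of the unbiasedness constraint. -/
def multiplier (τ : VarComp q) : Fin D.p → ℝ := (D.Q τ)⁻¹ *ᵥ (l - D.Xᵀ *ᵥ D.s m τ)

/-- The part of the coefficient vector due to the estimation of the fixed effects. -/
def fixPart (τ : VarComp q) : Fin D.n → ℝ := (D.Sig τ)⁻¹ *ᵥ D.X *ᵥ D.multiplier l m τ

/-- The coefficient vector of the BLUP. -/
def blupCoef (τ : VarComp q) : Fin D.n → ℝ := D.s m τ + D.fixPart l m τ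

/-- The sensitivity of the estimating equations of the BLUP to the `i`-th component. -/
def blupDir (σ : VarComp q) (i : Fin (q + 1)) : Fin D.n → ℝ := D.V i *ᵥ D.blupCoef l m σ - D.zvec m i

/-- The derivative of the MSE of a fixed linear predictor with respect to the `i`-th component. -/
def mseSlope (σ : VarComp q) (i : Fin (q + 1)) : ℝ := m ⬝ᵥ D.blockPart m i - 2 * D.blupCoef l m σ ⬝ᵥ D.zvec m i
    + D.blupCoef l m σ ⬝ᵥ D.V i *ᵥ D.blupCoef l m σ

/-- The MSE of the linear predictor with coefficient vector `c`. -/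
def linMse (c : Fin D.n → ℝ) (τ : VarComp q) : ℝ :=
  c ⬝ᵥ D.Sig τ *ᵥ c - 2 * c ⬝ᵥ D.covVec m τ + ∑ i, τ i * m ⬝ᵥ D.blockPart m i

lemma Sig_mulVec_eq_add (σ τ : VarComp q) (c : Fin D.n → ℝ) :
    D.Sig τ *ᵥ c = D.Sig σ *ᵥ c + ∑ i, (τ i - σ i) • (D.V i *ᵥ c) := by
  rw [D.Sig_eq_add σ τ, add_mulVec, sum_mulVec]; simp [smul_mulVec]

lemma linMse_eq_add (c : Fin D.n → ℝ) (σ τ : VarComp q) : D.linMse m c τ = D.linMse m c σ + ∑ i, (τ i - σ i) *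
      (m ⬝ᵥ D.blockPart m i - 2 * c ⬝ᵥ D.zvec m i + c ⬝ᵥ D.V i *ᵥ c) := by
  have e : ∀ i, (τ i - σ i) * (m ⬝ᵥ D.blockPart m i - 2 * c ⬝ᵥ D.zvec m i + c ⬝ᵥ D.V i *ᵥ c)
      = (τ i - σ i) * m ⬝ᵥ D.blockPart m i - 2 * ((τ i - σ i) * c ⬝ᵥ D.zvec m i)
        + (τ i - σ i) * c ⬝ᵥ D.V i *ᵥ c := fun i => by ring
  simp_rw [e, sum_add_distrib, sum_sub_distrib, ← mul_sum]
  rw [linMse, linMse, D.Sig_mulVec_eq_add σ τ, D.covVec_eq_add m σ τ, dotProduct_add, dotProduct_add,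
    dotProduct_sum, dotProduct_sum]
  simp_rw [dotProduct_smul, smul_eq_mul, sub_mul, sum_sub_distrib]; ring

section Identities
variable (hX : Function.Injective D.X.mulVec) (hτ : (D.Sig τ).PosDef)

include hτ in
lemma Sig_mulVec_s : D.Sig τ *ᵥ D.s m τ = D.covVec m τ := by
  rw [s_eq, mulVec_mulVec, PosDef.mul_inv_self hτ, one_mulVec]; rfl

include hτ in
lemma Sig_mulVec_fixPart : D.Sig τ *ᵥ D.fixPart l m τ = D.X *ᵥ D.multiplier l m τ := by
  rw [fixPart, mulVec_mulVec, PosDef.mul_inv_self hτ, one_mulVec]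

include hτ in
lemma Sig_mulVec_blupCoef : D.Sig τ *ᵥ D.blupCoef l m τ = D.covVec m τ + D.X *ᵥ D.multiplier l m τ := by
  rw [blupCoef, mulVec_add, D.Sig_mulVec_s m hτ, D.Sig_mulVec_fixPart l m hτ]

include hX hτ

lemma X_tr_mulVec_fixPart : D.Xᵀ *ᵥ D.fixPart l m τ = l - D.Xᵀ *ᵥ D.s m τ := by
  rw [fixPart, multiplier, mulVec_mulVec, mulVec_mulVec, mulVec_mulVec,
    ← Q, PosDef.mul_inv_self (D.posDef_Q hX hτ), one_mulVec]

lemma X_tr_mulVec_blupCoef : D.Xᵀ *ᵥ D.blupCoef l m τ = l := by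
  rw [blupCoef, mulVec_add, D.X_tr_mulVec_fixPart l m hX hτ]; abel

lemma blup_eq (y : Fin D.n → ℝ) : D.blup l m τ y = D.blupCoef l m τ ⬝ᵥ y := by
  have sQ := PosDef.inv_tr (D.posDef_Q hX hτ)
  have h1 : D.fixPart l m τ ⬝ᵥ y = (l - D.Xᵀ *ᵥ D.s m τ) ⬝ᵥ D.betaTilde τ y := by
    rw [fixPart, ← dot_symm (PosDef.inv_tr hτ), dotProduct_comm, dotProduct_mulVec,
      ← mulVec_transpose, dotProduct_comm, multiplier, ← dot_symm sQ, betaTilde, ← Q]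
    simp only [mulVec_mulVec, Matrix.mul_assoc]
  rw [blup, blupCoef, add_dotProduct, h1, sub_dotProduct, dotProduct_sub, mulVec_transpose, ← dotProduct_mulVec]; ring

lemma g2_eq : D.g2 l m τ = D.fixPart l m τ ⬝ᵥ D.Sig τ *ᵥ D.fixPart l m τ := by
  rw [D.Sig_mulVec_fixPart l m hτ, dotProduct_mulVec, ← mulVec_transpose, D.X_tr_mulVec_fixPart l m hX hτ]; rfl

lemma g1_add_g2 : D.g1 m τ + D.g2 l m τ = D.linMse m (D.blupCoef l m τ) τ := by
  have e1 : D.blupCoef l m τ ⬝ᵥ D.X *ᵥ D.multiplier l m τ = l ⬝ᵥ D.multiplier l m τ := by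
    rw [dotProduct_mulVec, ← mulVec_transpose, D.X_tr_mulVec_blupCoef l m hX hτ]
  have e2 : D.fixPart l m τ ⬝ᵥ D.covVec m τ = D.Xᵀ *ᵥ D.s m τ ⬝ᵥ D.multiplier l m τ := by
    rw [← D.Sig_mulVec_s m hτ, dot_symm (D.Sig_tr τ),
      D.Sig_mulVec_fixPart l m hτ, mulVec_transpose, ← dotProduct_mulVec, dotProduct_comm]
  have e3 : D.g2 l m τ = (l - D.Xᵀ *ᵥ D.s m τ) ⬝ᵥ D.multiplier l m τ := rfl
  have e4 : D.g1 m τ = ∑ i, τ i * m ⬝ᵥ D.blockPart m i - D.s m τ ⬝ᵥ D.covVec m τ := by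
    rw [g1_eq, s_eq, dotProduct_comm ((D.Sig τ)⁻¹ *ᵥ _)]; rfl
  rw [linMse, D.Sig_mulVec_blupCoef l m hτ, dotProduct_add, e1, e3, e4, blupCoef, add_dotProduct, e2, sub_dotProduct]
  ring

section Expansion
variable (hσ : (D.Sig σ).PosDef)
include hσ

lemma Sig_mulVec_blupCoef_sub : D.Sig τ *ᵥ D.blupCoef l m σ - D.covVec m τ
    = D.X *ᵥ D.multiplier l m σ + ∑ i, (τ i - σ i) • D.blupDir l m σ i := by
  rw [D.Sig_mulVec_eq_add σ τ, D.Sig_mulVec_blupCoef l m hσ, D.covVec_eq_add m σ τ]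
  simp only [blupDir, smul_sub, sum_sub_distrib]; abel

lemma P_mulVec_sub : D.P τ *ᵥ (D.Sig τ *ᵥ D.blupCoef l m σ - D.covVec m τ)
    = D.P τ *ᵥ ∑ i, (τ i - σ i) • D.blupDir l m σ i := by
  rw [D.Sig_mulVec_blupCoef_sub l m hX hτ hσ, mulVec_add, mulVec_mulVec, D.P_mul_X hX hτ, zero_mulVec, zero_add]

lemma blupCoef_eq : D.blupCoef l m τ = D.blupCoef l m σ - D.P τ *ᵥ ∑ i, (τ i - σ i) • D.blupDir l m σ i := by
  have h1 : D.Xᵀ *ᵥ (D.blupCoef l m τ - D.blupCoef l m σ) = 0 := by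
    rw [mulVec_sub, D.X_tr_mulVec_blupCoef l m hX hτ, D.X_tr_mulVec_blupCoef l m hX hσ, sub_self]
  have h2 := D.P_mul_Sig_mulVec hX hτ h1
  rw [mulVec_sub, D.Sig_mulVec_blupCoef l m hτ] at h2
  have h3 : D.covVec m τ + D.X *ᵥ D.multiplier l m τ - D.Sig τ *ᵥ D.blupCoef l m σ
      = D.X *ᵥ D.multiplier l m τ - (D.Sig τ *ᵥ D.blupCoef l m σ - D.covVec m τ) := by abel
  rw [h3, mulVec_sub, mulVec_mulVec, D.P_mul_X hX hτ, zero_mulVec, zero_sub, D.P_mulVec_sub l m hX hτ hσ] at h2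
  rw [sub_eq_iff_eq_add.1 h2.symm]; abel

lemma blup_sub_blup (y : Fin D.n → ℝ) : D.blup l m τ y - D.blup l m σ y
    = -((D.P τ *ᵥ ∑ i, (τ i - σ i) • D.blupDir l m σ i) ⬝ᵥ y) := by
  rw [D.blup_eq l m hX hτ, D.blup_eq l m hX hσ, D.blupCoef_eq l m hX hτ hσ, sub_dotProduct]; ring

lemma g1_add_g2_eq : D.g1 m τ + D.g2 l m τ = D.g1 m σ + D.g2 l m σ + ∑ i, (τ i - σ i) * D.mseSlope l m σ i
    - (∑ i, (τ i - σ i) • D.blupDir l m σ i) ⬝ᵥ (D.P τ *ᵥ ∑ i, (τ i - σ i) • D.blupDir l m σ i) := by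
  rw [D.g1_add_g2 l m hX hτ, D.g1_add_g2 l m hX hσ]; simp only [mseSlope]; rw [← D.linMse_eq_add m _ σ τ]
  set g := ∑ i, (τ i - σ i) • D.blupDir l m σ i
  set c := D.blupCoef l m σ
  rw [D.blupCoef_eq l m hX hτ hσ, linMse, linMse]; have sP := D.P_tr hX hτ
  have e1 : (D.P τ *ᵥ g) ⬝ᵥ D.Sig τ *ᵥ D.P τ *ᵥ g = g ⬝ᵥ D.P τ *ᵥ g := by
    rw [← dot_symm sP, mulVec_mulVec, mulVec_mulVec, D.P_mul_Sig_mul_P hX hτ]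
  have e2 : c ⬝ᵥ D.Sig τ *ᵥ D.P τ *ᵥ g = D.P τ *ᵥ g ⬝ᵥ D.Sig τ *ᵥ c := by
    rw [dot_symm (D.Sig_tr τ), dotProduct_comm]
  have e3 : (D.P τ *ᵥ g) ⬝ᵥ D.Sig τ *ᵥ c - D.P τ *ᵥ g ⬝ᵥ D.covVec m τ = g ⬝ᵥ D.P τ *ᵥ g := by
    rw [← dotProduct_sub, ← dot_symm sP, D.P_mulVec_sub l m hX hτ hσ]
  simp only [mulVec_sub, dotProduct_sub, sub_dotProduct, e1, e2]; linarith

end Expansion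

/-! The prediction error at the true parameters. -/

lemma blup_sub_target (β : Fin D.p → ℝ) (ω) : D.blup l m τ (D.obs β ω) - D.target l m β ω
    = D.noiseForm (D.Zᵀ *ᵥ D.blupCoef l m τ - m) (D.blupCoef l m τ) ω := by
  rw [D.blup_eq l m hX hτ, obs_eq, dotProduct_add, dot_resid, dotProduct_mulVec,
    ← mulVec_transpose, D.X_tr_mulVec_blupCoef l m hX hτ, target, noiseForm, noiseForm, sub_dotProduct]
  ring

lemma noiseCov_error : D.noiseCov τ (D.Zᵀ *ᵥ D.blupCoef l m τ - m) (D.Zᵀ *ᵥ D.blupCoef l m τ - m)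
    (D.blupCoef l m τ) (D.blupCoef l m τ) = D.g1 m τ + D.g2 l m τ := by
  rw [D.g1_add_g2 l m hX hτ, linMse, ← noiseCov_resid_resid]; set c := D.blupCoef l m τ
  have e1 : m ⬝ᵥ D.G τ *ᵥ m = ∑ i, τ i * m ⬝ᵥ D.blockPart m i := by
    rw [G_mulVec, dotProduct_sum]; simp_rw [dotProduct_smul, smul_eq_mul]
  have e2 : (D.Zᵀ *ᵥ c) ⬝ᵥ D.G τ *ᵥ m = c ⬝ᵥ D.covVec m τ := by
    rw [mulVec_transpose, ← dotProduct_mulVec, mulVec_mulVec, Z_mul_G_mulVec]; rfl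
  have e3 : m ⬝ᵥ D.G τ *ᵥ D.Zᵀ *ᵥ c = c ⬝ᵥ D.covVec m τ := by
    rw [← e2, dot_symm (by simp [G]), dotProduct_comm]
  rw [← e1]; simp only [noiseCov, mulVec_sub, dotProduct_sub, sub_dotProduct, e2, e3]; ring

lemma noiseCov_error_contrast {u : Fin D.n → ℝ} (hu : D.Xᵀ *ᵥ u = 0) :
    D.noiseCov τ (D.Zᵀ *ᵥ u) (D.Zᵀ *ᵥ D.blupCoef l m τ - m) u (D.blupCoef l m τ) = 0 := by
  rw [noiseCov_resid, mulVec_sub, dotProduct_sub, D.Z_mul_G_mulVec m τ]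
  have h1 := noiseCov_resid_resid D τ u (D.blupCoef l m τ)
  rw [noiseCov_resid, D.Sig_mulVec_blupCoef l m hτ, dotProduct_add, dotProduct_mulVec u D.X,
    ← mulVec_transpose, hu, zero_dotProduct, add_zero] at h1
  change _ - u ⬝ᵥ D.covVec m τ + _ = 0
  linarith

end Identities

open Classical in
/-- A matrix `S` with `S'ΣS = 1`. -/
def whit (σ : VarComp q) : Matrix (Fin D.n) (Fin D.n) ℝ :=
  if h : (D.Sig σ).PosDef then (PosDef.exists_tr_mul_mul_eq_one h).choose else 1

/-- The whitened variance matrix of the `i`-th component. -/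
def whV (σ : VarComp q) (i : Fin (q + 1)) : Matrix (Fin D.n) (Fin D.n) ℝ := (D.whit σ)ᵀ * D.V i * D.whit σ

/-- The whitened image of the `i`-th block of `m`. -/
def whz (σ : VarComp q) (i : Fin (q + 1)) : Fin D.n → ℝ := (D.whit σ)ᵀ *ᵥ D.zvec m i

/-- The whitened covariance vector. -/
def whb (σ : VarComp q) : Fin D.n → ℝ := (D.whit σ)ᵀ *ᵥ D.covVec m σ

/-- The whitened contribution of the fixed effects. -/
def whfix (σ : VarComp q) : Fin D.n → ℝ := (D.whit σ)ᵀ *ᵥ D.X *ᵥ D.multiplier l m σ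

/-- The whitened `Σ⁻¹ - P`, a projection. -/
def whK (σ : VarComp q) : Matrix (Fin D.n) (Fin D.n) ℝ := (D.whit σ)ᵀ * D.X * (D.Q σ)⁻¹ * D.Xᵀ * D.whit σ

section Basic
variable (hσ : (D.Sig σ).PosDef)
include hσ

lemma whit_spec : IsUnit (D.whit σ) ∧
    (D.whit σ)ᵀ * D.Sig σ * D.whit σ = 1 ∧ D.whit σ * (D.whit σ)ᵀ = (D.Sig σ)⁻¹ := by
  rw [whit, dif_pos hσ]; exact (PosDef.exists_tr_mul_mul_eq_one hσ).choose_spec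

lemma whV_psd (i : Fin (q + 1)) : (D.whV σ i).PosSemidef :=
  psd_tr_mul_mul_same (D.V_psd i) _

lemma dot_whV (i : Fin (q + 1)) (x : Fin D.n → ℝ) :
    x ⬝ᵥ D.whV σ i *ᵥ x = D.whit σ *ᵥ x ⬝ᵥ D.V i *ᵥ D.whit σ *ᵥ x := by
  rw [whV, Matrix.mul_assoc, ← mulVec_mulVec, dotProduct_mulVec, vecMul_transpose, mulVec_mulVec]

lemma sum_dot_whV (x : Fin D.n → ℝ) : ∑ i, σ i * x ⬝ᵥ D.whV σ i *ᵥ x = x ⬝ᵥ x := by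
  simp_rw [D.dot_whV hσ]
  rw [← dot_Sig, mulVec_mulVec, ← vecMul_transpose, ← dotProduct_mulVec,
    mulVec_mulVec, ← Matrix.mul_assoc, (D.whit_spec hσ).2.1, one_mulVec]

lemma mul_dot_V_le (hpos : ∀ i, 0 ≤ σ i) (i : Fin (q + 1)) (x : Fin D.n → ℝ) :
    σ i * x ⬝ᵥ D.V i *ᵥ x ≤ x ⬝ᵥ D.Sig σ *ᵥ x := by
  rw [dot_Sig]
  exact single_le_sum (fun j _ => mul_nonneg (hpos j)
    (psd_dot_nonneg (D.V_psd j) x)) (mem_univ i)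

lemma opNorm_whV_le (hpos : ∀ i, 0 < σ i) (i : Fin (q + 1)) : ‖D.whV σ i‖ ≤ (σ i)⁻¹ := by
  refine opNorm_le_of_psd (D.whV_psd hσ i) (inv_nonneg.2 (hpos i).le) fun x => ?_
  rw [le_inv_mul_iff₀ (hpos i), ← D.sum_dot_whV hσ x]
  exact single_le_sum (fun j _ => mul_nonneg (hpos j).le
    (psd_dot_nonneg (D.whV_psd hσ j) x)) (mem_univ i)

lemma dot_whit_tr (u v : Fin D.n → ℝ) :
    ((D.whit σ)ᵀ *ᵥ u) ⬝ᵥ (D.whit σ)ᵀ *ᵥ v = u ⬝ᵥ (D.Sig σ)⁻¹ *ᵥ v := by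
  rw [← (D.whit_spec hσ).2.2, ← mulVec_mulVec, dotProduct_mulVec u, ← mulVec_transpose]

lemma zvec_zero : D.zvec m 0 = 0 := by
  have : D.blockPart m 0 = 0 := by aesop
  rw [zvec, this, mulVec_zero]

lemma zvec_succ (j : Fin q) : D.zvec m j.succ = D.Zblock j *ᵥ fun a => m ⟨j, a⟩ := by
  ext b; simp only [zvec, mulVec, dotProduct, blockPart, Zblock, submatrix_apply, id]
  rw [Fintype.sum_sigma, sum_eq_single j]
  · simp
  · intro i _ hi; simp [hi]
  · simp

lemma vnorm_whz_sq_le (hpos : ∀ i, 0 < σ i) (i : Fin (q + 1)) :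
    vnorm (D.whz m σ i) ^ 2 ≤ (∑ a, m a ^ 2) * (σ i)⁻¹ := by
  have hm0 : 0 ≤ ∑ a, m a ^ 2 := sum_nonneg fun _ _ => sq_nonneg _
  refine Fin.cases ?_ (fun j => ?_) i
  · rw [whz, D.zvec_zero m hσ, mulVec_zero, vnorm_zero]; have := mul_nonneg hm0 (inv_nonneg.2 (hpos 0).le)
    simpa using this
  rw [vnorm_sq, whz, D.dot_whit_tr hσ]; set c := (D.Sig σ)⁻¹ *ᵥ D.zvec m j.succ with hc
  set z := D.zvec m j.succ ⬝ᵥ c with hz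
  have h1 : c ⬝ᵥ D.Sig σ *ᵥ c = z := by
    rw [hc, mulVec_mulVec (D.zvec m j.succ), PosDef.mul_inv_self hσ, one_mulVec, dotProduct_comm]
  have h2 := D.mul_dot_V_le hσ (fun i => (hpos i).le) j.succ c
  have h3 : c ⬝ᵥ D.V j.succ *ᵥ c = vnorm ((D.Zblock j)ᵀ *ᵥ c) ^ 2 := by
    rw [V_succ, ← mulVec_mulVec, dotProduct_mulVec, ← mulVec_transpose, vnorm_sq]
  have h4 : z = (fun a => m ⟨j, a⟩) ⬝ᵥ (D.Zblock j)ᵀ *ᵥ c := by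
    rw [hz, D.zvec_succ m hσ, mulVec_transpose, dotProduct_comm _ c, dotProduct_comm _ (c ᵥ* _), ← dotProduct_mulVec]
  have h5 : z ^ 2 ≤ vnorm (fun a => m ⟨j, a⟩) ^ 2 * vnorm ((D.Zblock j)ᵀ *ᵥ c) ^ 2 := by
    rw [← mul_pow, ← sq_abs, h4]; exact pow_le_pow_left₀ (abs_nonneg _) (abs_dot_le _ _) 2
  have h6 : vnorm (fun a => m ⟨j, a⟩) ^ 2 ≤ ∑ a, m a ^ 2 := by
    rw [vnorm_sq, Fintype.sum_sigma]
    refine le_trans (le_of_eq ?_) (single_le_sum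
      (fun _ _ => sum_nonneg fun _ _ => sq_nonneg _) (mem_univ j))
    simp [dotProduct, pow_two]
  have hs := hpos j.succ
  rw [h1, h3] at h2; have hz0 : 0 ≤ z := by rw [← h1]; exact psd_dot_nonneg hσ.posSemidef c
  rcases hz0.eq_or_lt' with h0 | h0
  · rw [h0]; exact mul_nonneg hm0 (inv_nonneg.2 hs.le)
  rw [← div_eq_mul_inv, le_div_iff₀ hs]; refine le_of_mul_le_mul_left ?_ h0
  calc z * (z * σ j.succ) = σ j.succ * z ^ 2 := by ring
    _ ≤ σ j.succ * ((∑ a, m a ^ 2) * vnorm ((D.Zblock j)ᵀ *ᵥ c) ^ 2) := by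
      exact mul_le_mul_of_nonneg_left (h5.trans (mul_le_mul_of_nonneg_right h6 (sq_nonneg _))) hs.le
    _ = (∑ a, m a ^ 2) * (σ j.succ * vnorm ((D.Zblock j)ᵀ *ᵥ c) ^ 2) := by ring
    _ ≤ (∑ a, m a ^ 2) * z := mul_le_mul_of_nonneg_left h2 hm0
    _ = z * ∑ a, m a ^ 2 := mul_comm _ _

lemma whb_eq : D.whb m σ = ∑ i, σ i • D.whz m σ i := by rw [whb, covVec, mulVec_sum]; simp [whz, mulVec_smul]

lemma whit_mulVec_whb : D.whit σ *ᵥ D.whb m σ = D.s m σ := by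
  rw [whb, mulVec_mulVec, (D.whit_spec hσ).2.2, s_eq]; rfl

lemma whit_mulVec_whfix : D.whit σ *ᵥ D.whfix l m σ = D.fixPart l m σ := by
  rw [whfix, mulVec_mulVec, (D.whit_spec hσ).2.2, fixPart]

lemma vnorm_whit_inv_sq (c : Fin D.n → ℝ) : vnorm ((D.whit σ)⁻¹ *ᵥ c) ^ 2 = c ⬝ᵥ D.Sig σ *ᵥ c := by
  obtain ⟨h1, h2, h3⟩ := D.whit_spec hσ
  have hdet := (isUnit_iff_isUnit_det _).1 h1
  have e : D.Sig σ = ((D.whit σ)⁻¹)ᵀ * (D.whit σ)⁻¹ := by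
    have h4 : ((D.whit σ)⁻¹)ᵀ * (D.whit σ)ᵀ = 1 := by
      rw [← transpose_mul, mul_nonsing_inv _ hdet, transpose_one]
    calc D.Sig σ = (((D.whit σ)⁻¹)ᵀ * (D.whit σ)ᵀ) * D.Sig σ * (D.whit σ * (D.whit σ)⁻¹) := by
          rw [h4, mul_nonsing_inv _ hdet, Matrix.one_mul, Matrix.mul_one]
      _ = ((D.whit σ)⁻¹)ᵀ * ((D.whit σ)ᵀ * D.Sig σ * D.whit σ) * (D.whit σ)⁻¹ := by grind
      _ = _ := by grind
  rw [vnorm_sq]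
  conv_rhs => rw [e, ← mulVec_mulVec, dotProduct_mulVec c, vecMul_transpose]

section FullRank
variable (hX : Function.Injective D.X.mulVec)
include hX

lemma vnorm_whfix_sq : vnorm (D.whfix l m σ) ^ 2 = D.g2 l m σ := by
  rw [vnorm_sq, whfix, D.dot_whit_tr hσ, D.g2_eq l m hX hσ,
    D.Sig_mulVec_fixPart l m hσ, dotProduct_comm]
  rfl

lemma whitened_P : D.whit σ * (1 - D.whK σ) * (D.whit σ)ᵀ = D.P σ := by
  rw [D.P_eq hX hσ, ← (D.whit_spec hσ).2.2, Matrix.mul_sub, Matrix.sub_mul, Matrix.mul_one, whK]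
  simp only [Matrix.mul_assoc]

lemma Q_eq_whitened : D.Xᵀ * D.whit σ * ((D.whit σ)ᵀ * D.X) = D.Q σ := by
  rw [Q, ← (D.whit_spec hσ).2.2]; simp only [Matrix.mul_assoc]

lemma whK_tr : (D.whK σ)ᵀ = D.whK σ := by
  simp only [whK, transpose_mul, transpose_transpose, PosDef.inv_tr (D.posDef_Q hX hσ), Matrix.mul_assoc]

lemma whK_mul_self : D.whK σ * D.whK σ = D.whK σ := by
  calc D.whK σ * D.whK σ = (D.whit σ)ᵀ * D.X * ((D.Q σ)⁻¹ *
        (D.Xᵀ * D.whit σ * ((D.whit σ)ᵀ * D.X)) * (D.Q σ)⁻¹) * D.Xᵀ * D.whit σ := by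
        simp only [whK, Matrix.mul_assoc]
    _ = _ := by rw [D.Q_eq_whitened hσ hX, PosDef.inv_mul_self (D.posDef_Q hX hσ), Matrix.one_mul]; rfl

lemma whK_psd : (D.whK σ).PosSemidef := by
  have := psd_tr_mul_mul_same (PosSemidef.one) (D.whK σ)
  rwa [D.whK_tr hσ hX, Matrix.mul_one, D.whK_mul_self hσ hX] at this

lemma trace_whK : (D.whK σ).trace = D.p := by
  have h1 : D.whK σ = ((D.whit σ)ᵀ * D.X) * ((D.Q σ)⁻¹ * (D.Xᵀ * D.whit σ)) := by
    simp only [whK, Matrix.mul_assoc]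
  rw [h1, trace_mul_comm, Matrix.mul_assoc, D.Q_eq_whitened hσ hX, PosDef.inv_mul_self (D.posDef_Q hX hσ)]; simp

lemma whK_compl_psd : (1 - D.whK σ).PosSemidef := by
  have := psd_tr_mul_mul_same (PosSemidef.one) (1 - D.whK σ)
  rw [transpose_sub, D.whK_tr hσ hX, transpose_one, Matrix.mul_one,
    Matrix.sub_mul, Matrix.one_mul, Matrix.mul_sub, Matrix.mul_one, D.whK_mul_self hσ hX, sub_self, sub_zero] at this
  exact this

lemma opNorm_whK_le : ‖D.whK σ‖ ≤ 1 := by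
  refine opNorm_le_of_psd (D.whK_psd hσ hX) zero_le_one fun x => ?_
  have := psd_dot_nonneg (D.whK_compl_psd hσ hX) x
  rw [sub_mulVec, one_mulVec, dotProduct_sub] at this; linarith

lemma opNorm_whK_compl_le : ‖1 - D.whK σ‖ ≤ 1 := by
  refine opNorm_le_of_psd (D.whK_compl_psd hσ hX) zero_le_one fun x => ?_
  have := psd_dot_nonneg (D.whK_psd hσ hX) x
  rw [sub_mulVec, one_mulVec, dotProduct_sub]; linarith

lemma whK_mulVec_eq_zero {v : Fin D.n → ℝ} (hv : D.Xᵀ *ᵥ D.whit σ *ᵥ v = 0) : D.whK σ *ᵥ v = 0 := by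
  rw [whK, ← mulVec_mulVec, ← mulVec_mulVec, ← mulVec_mulVec, hv, mulVec_zero, mulVec_zero]

lemma trace_P_mul (A B : Matrix (Fin D.n) (Fin D.n) ℝ) : (D.P σ * A * D.P σ * B).trace
    = ((1 - D.whK σ) * ((D.whit σ)ᵀ * A * D.whit σ) * (1 - D.whK σ) *
      ((D.whit σ)ᵀ * B * D.whit σ)).trace := by
  rw [← D.whitened_P hσ hX]
  have : D.whit σ * (1 - D.whK σ) * (D.whit σ)ᵀ * A * (D.whit σ * (1 - D.whK σ) * (D.whit σ)ᵀ) * B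
      = D.whit σ * ((1 - D.whK σ) * (D.whit σ)ᵀ * A *
      (D.whit σ * (1 - D.whK σ) * (D.whit σ)ᵀ) * B) := by grind
  rw [this, trace_mul_comm]; simp only [Matrix.mul_assoc]

lemma trace_Sig_inv_mul (A B : Matrix (Fin D.n) (Fin D.n) ℝ) : ((D.Sig σ)⁻¹ * A * (D.Sig σ)⁻¹ * B).trace
    = (((D.whit σ)ᵀ * A * D.whit σ) * ((D.whit σ)ᵀ * B * D.whit σ)).trace := by
  rw [← (D.whit_spec hσ).2.2]
  have : D.whit σ * (D.whit σ)ᵀ * A * (D.whit σ * (D.whit σ)ᵀ) * B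
      = D.whit σ * ((D.whit σ)ᵀ * A * (D.whit σ * (D.whit σ)ᵀ) * B) := by
    grind
  rw [this, trace_mul_comm]; simp only [Matrix.mul_assoc]

/-- The information lost by estimating the fixed effects. -/
lemma abs_trace_sub_trace_le (hpos : ∀ i, 0 < σ i) (i j : Fin (q + 1)) :
    |((D.Sig σ)⁻¹ * D.V i * (D.Sig σ)⁻¹ * D.V j).trace - (D.P σ * D.V i * D.P σ * D.V j).trace|
      ≤ 2 * D.p * ((σ i)⁻¹ * (σ j)⁻¹) := by
  rw [D.trace_P_mul hσ hX, D.trace_Sig_inv_mul hσ hX]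
  change |(D.whV σ i * D.whV σ j).trace - ((1 - D.whK σ) * D.whV σ i * (1 - D.whK σ) * D.whV σ j).trace| ≤ _
  set K := D.whK σ
  have e : (D.whV σ i * D.whV σ j).trace - ((1 - K) * D.whV σ i * (1 - K) * D.whV σ j).trace
      = (K * (D.whV σ i * D.whV σ j)).trace + (K * (D.whV σ j * (1 - K) * D.whV σ i)).trace := by
    have : D.whV σ i * D.whV σ j - (1 - K) * D.whV σ i * (1 - K) * D.whV σ j
        = K * (D.whV σ i * D.whV σ j) + (1 - K) * D.whV σ i * K * D.whV σ j := by noncomm_ring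
    rw [← trace_sub, this, trace_add]; congr 1; rw [Matrix.mul_assoc _ K, trace_mul_comm, mul_assoc, mul_assoc]
  have hi := D.opNorm_whV_le hσ hpos i
  have hj := D.opNorm_whV_le hσ hpos j
  have hK := D.whK_psd hσ hX
  have hp : (0 : ℝ) ≤ D.p := Nat.cast_nonneg _
  have h1 := abs_trace_mul_le_of_psd hK (D.whV σ i * D.whV σ j)
  have h2 := abs_trace_mul_le_of_psd hK (D.whV σ j * (1 - K) * D.whV σ i)
  have n1 := (l2_opNorm_mul _ _).trans (mul_le_mul hi hj (norm_nonneg _) ((norm_nonneg _).trans hi))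
  have n2 : ‖D.whV σ j * (1 - K) * D.whV σ i‖ ≤ (σ i)⁻¹ * (σ j)⁻¹ := by
    refine (l2_opNorm_mul _ _).trans ?_
    rw [mul_comm (σ i)⁻¹]; refine mul_le_mul ?_ hi (norm_nonneg _) ((norm_nonneg _).trans hj)
    refine (l2_opNorm_mul _ _).trans ?_
    calc _ ≤ (σ j)⁻¹ * 1 := mul_le_mul hj (D.opNorm_whK_compl_le hσ hX) (norm_nonneg _) ((norm_nonneg _).trans hj)
      _ = _ := mul_one _
  rw [e]; rw [D.trace_whK hσ hX] at h1 h2; have h3 := mul_le_mul_of_nonneg_left n1 hp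
  have h4 := mul_le_mul_of_nonneg_left n2 hp
  refine (abs_add_le _ _).trans ?_
  linarith

lemma abs_gM0_le (hpos : ∀ i, 0 < σ i) (i : Fin (q + 1)) : |D.gM0 σ i| ≤ D.p * (σ i)⁻¹ := by
  have e : (((D.Sig σ)⁻¹ - D.P σ) * D.V i).trace = (D.whK σ * D.whV σ i).trace := by
    have e1 : (D.Sig σ)⁻¹ - D.P σ = D.whit σ * (D.whK σ * (D.whit σ)ᵀ) := by
      rw [← D.whitened_P hσ hX, ← (D.whit_spec hσ).2.2, Matrix.mul_sub, Matrix.sub_mul,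
        Matrix.mul_one, sub_sub_cancel, Matrix.mul_assoc]
    rw [e1, Matrix.mul_assoc, trace_mul_comm, whV]; simp only [Matrix.mul_assoc]
  rw [gM0, e, abs_mul, abs_of_pos (by simp)]
  have h1 := abs_trace_mul_le_of_psd (D.whK_psd hσ hX) (D.whV σ i)
  rw [D.trace_whK hσ hX] at h1; have hp : (0 : ℝ) ≤ D.p := Nat.cast_nonneg _
  have h2 := mul_le_mul_of_nonneg_left (D.opNorm_whV_le hσ hpos i) hp
  grind

end FullRank

end Basic

/-- The vector `s(τ)` in coordinates whitened at `σ`. -/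
def whs (σ τ : VarComp q) : Fin D.n → ℝ := resolv (D.whV σ) (τ - σ) *ᵥ (D.whb m σ + ∑ i, (τ i - σ i) • D.whz m σ i)

/-- The direction `sDir` in coordinates whitened at `σ`. -/
def whf (σ τ : VarComp q) (i : Fin (q + 1)) : Fin D.n → ℝ := D.whz m σ i - D.whV σ i *ᵥ D.whs m σ τ

/-- The Gram matrix of `∇s` in the metric `Σ`. -/
def sGram (τ : VarComp q) (i j : Fin (q + 1)) : ℝ := D.sDir m τ i ⬝ᵥ (D.Sig τ)⁻¹ *ᵥ D.sDir m τ j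

/-- The partial derivatives of `g₁`. -/
def g1Slope (τ : VarComp q) (i : Fin (q + 1)) : ℝ :=
  m ⬝ᵥ D.blockPart m i - 2 * D.s m τ ⬝ᵥ D.zvec m i + D.s m τ ⬝ᵥ D.V i *ᵥ D.s m τ

lemma whs_self : D.whs m σ σ = D.whb m σ := by simp [whs, resolv_zero]

section Basic
variable (hσ : (D.Sig σ).PosDef)
include hσ

lemma isUnit_det_whit : IsUnit (D.whit σ).det := (isUnit_iff_isUnit_det _).1 (D.whit_spec hσ).1

lemma whit_tr_Sig_whit (τ : VarComp q) :
    (D.whit σ)ᵀ * D.Sig τ * D.whit σ = 1 + pert (D.whV σ) (τ - σ) := by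
  rw [D.Sig_eq_add σ τ, Matrix.mul_add, Matrix.add_mul, (D.whit_spec hσ).2.1, Matrix.mul_sum, Matrix.sum_mul]
  simp [pert, whV]

lemma dot_whit (u v : Fin D.n → ℝ) : (D.whit σ *ᵥ u) ⬝ᵥ v = u ⬝ᵥ (D.whit σ)ᵀ *ᵥ v := by
  rw [mulVec_transpose, ← vecMul_transpose, ← dotProduct_mulVec, mulVec_transpose]

section Perturbed
variable (hτ : (D.Sig τ).PosDef)
include hτ

lemma isUnit_one_add_pert_whV : IsUnit (1 + pert (D.whV σ) (τ - σ)) := by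
  rw [← D.whit_tr_Sig_whit hσ τ]
  refine ((isUnit_iff_isUnit_det _).2 ?_).mul hτ.isUnit |>.mul (D.whit_spec hσ).1
  rw [det_transpose]; exact D.isUnit_det_whit hσ

lemma Sig_inv_eq_whitened : (D.Sig τ)⁻¹ = D.whit σ * resolv (D.whV σ) (τ - σ) * (D.whit σ)ᵀ := by
  have hd := D.isUnit_det_whit hσ
  have hdt : IsUnit ((D.whit σ)ᵀ).det := by rwa [det_transpose]
  have hM := (isUnit_iff_isUnit_det _).1 (D.isUnit_one_add_pert_whV hσ hτ)
  refine inv_eq_right_inv ?_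
  have e : D.Sig τ * D.whit σ = ((D.whit σ)ᵀ)⁻¹ * (1 + pert (D.whV σ) (τ - σ)) := by
    rw [← D.whit_tr_Sig_whit hσ τ, Matrix.mul_assoc, ← Matrix.mul_assoc _ (D.whit σ)ᵀ,
      nonsing_inv_mul _ hdt, Matrix.one_mul]
  rw [← Matrix.mul_assoc, ← Matrix.mul_assoc, e, resolv, Matrix.mul_assoc _ _ (1 + _)⁻¹,
    mul_nonsing_inv _ hM, Matrix.mul_one, nonsing_inv_mul _ hdt]

lemma s_eq_whitened : D.s m τ = D.whit σ *ᵥ D.whs m σ τ := by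
  have e : (D.whit σ)ᵀ *ᵥ D.covVec m τ = D.whb m σ + ∑ i, (τ i - σ i) • D.whz m σ i := by
    rw [D.covVec_eq_add m σ τ, mulVec_add, mulVec_sum]; simp [whb, whz, mulVec_smul]
  rw [s_eq, D.Sig_inv_eq_whitened hσ hτ, whs, ← e, mulVec_mulVec, mulVec_mulVec]; rfl

lemma whit_tr_mulVec_sDir (i : Fin (q + 1)) : (D.whit σ)ᵀ *ᵥ D.sDir m τ i = D.whf m σ τ i := by
  rw [sDir, D.s_eq_whitened m hσ hτ, mulVec_sub, mulVec_mulVec, mulVec_mulVec, whf, whz, whV, Matrix.mul_assoc]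

lemma sGram_eq_whitened (i j : Fin (q + 1)) : D.sGram m τ i j
    = D.whf m σ τ i ⬝ᵥ resolv (D.whV σ) (τ - σ) *ᵥ D.whf m σ τ j := by
  rw [sGram, D.Sig_inv_eq_whitened hσ hτ, ← mulVec_mulVec, ← mulVec_mulVec,
    dotProduct_comm, D.dot_whit hσ, D.whit_tr_mulVec_sDir m hσ hτ,
    D.whit_tr_mulVec_sDir m hσ hτ, dotProduct_comm]

lemma g1Slope_eq_whitened (i : Fin (q + 1)) : D.g1Slope m τ i = m ⬝ᵥ D.blockPart m i
    - 2 * D.whs m σ τ ⬝ᵥ D.whz m σ i + D.whs m σ τ ⬝ᵥ D.whV σ i *ᵥ D.whs m σ τ := by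
  rw [g1Slope, D.s_eq_whitened m hσ hτ, D.dot_whit hσ, D.dot_whV hσ]; rfl

end Perturbed

omit hσ in
lemma pderiv_g1 (hτ : (D.Sig τ).PosDef) (i : Fin (q + 1)) : pderiv i (D.g1 m) τ = D.g1Slope m τ i :=
  pderiv_eq_of_hasDerivAt (D.hasDerivAt_g1 m hτ i)

omit hσ in
lemma g3_eq (hτ : (D.Sig τ).PosDef) (A : VarComp q → Matrix (Fin (q + 1)) (Fin (q + 1)) ℝ) :
    D.g3 A m τ = ∑ i, ∑ j, D.sGram m τ i j * (-(A τ))⁻¹ j i := by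
  have e : ∀ i j, ((D.gradS m τ)ᵀ * D.Sig τ * D.gradS m τ) i j = D.sGram m τ i j := fun i j => by
    have h1 : D.gradS m τ = of fun a i => ((D.Sig τ)⁻¹ *ᵥ D.sDir m τ i) a := by ext a i; exact D.gradS_apply m hτ a i
    have h2 : ((D.gradS m τ)ᵀ * D.Sig τ * D.gradS m τ) i j
        = (D.Sig τ)⁻¹ *ᵥ D.sDir m τ i ⬝ᵥ D.Sig τ *ᵥ (D.Sig τ)⁻¹ *ᵥ D.sDir m τ j := by
      rw [h1, Matrix.mul_assoc]; rfl
    rw [h2, mulVec_mulVec, PosDef.mul_inv_self hτ, one_mulVec, sGram, dot_symm (PosDef.inv_tr hτ)]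
  rw [g3, Matrix.trace]; refine sum_congr rfl fun i _ => ?_
  rw [diag_apply, Matrix.mul_apply]; exact sum_congr rfl fun j _ => by rw [e]

lemma whit_mulVec_whb_add_whfix : D.whit σ *ᵥ (D.whb m σ + D.whfix l m σ) = D.blupCoef l m σ := by
  rw [mulVec_add, D.whit_mulVec_whb m hσ, D.whit_mulVec_whfix l m hσ, blupCoef]

lemma mseSlope_eq_whitened (i : Fin (q + 1)) : D.mseSlope l m σ i = m ⬝ᵥ D.blockPart m i
    - 2 * (D.whb m σ + D.whfix l m σ) ⬝ᵥ D.whz m σ i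
    + (D.whb m σ + D.whfix l m σ) ⬝ᵥ D.whV σ i *ᵥ (D.whb m σ + D.whfix l m σ) := by
  rw [mseSlope, ← D.whit_mulVec_whb_add_whfix l m hσ, D.dot_whit hσ, D.dot_whV hσ]; rfl

lemma whit_tr_mulVec_blupDir (i : Fin (q + 1)) :
    (D.whit σ)ᵀ *ᵥ D.blupDir l m σ i = D.whV σ i *ᵥ D.whfix l m σ - D.whf m σ σ i := by
  rw [blupDir, ← D.whit_mulVec_whb_add_whfix l m hσ, mulVec_sub, mulVec_mulVec, mulVec_mulVec, whf, whs_self, whz]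
  rw [← whV, mulVec_add]; abel

section FullRank
variable (hX : Function.Injective D.X.mulVec)
include hX

lemma blupDir_P_blupDir (i j : Fin (q + 1)) : D.blupDir l m σ i ⬝ᵥ D.P σ *ᵥ D.blupDir l m σ j
      = (D.whV σ i *ᵥ D.whfix l m σ - D.whf m σ σ i) ⬝ᵥ
        (1 - D.whK σ) *ᵥ (D.whV σ j *ᵥ D.whfix l m σ - D.whf m σ σ j) := by
  rw [← D.whit_tr_mulVec_blupDir l m hσ, ← D.whit_tr_mulVec_blupDir l m hσ,
    ← D.whitened_P hσ hX, ← mulVec_mulVec, ← mulVec_mulVec, dotProduct_comm, D.dot_whit hσ, dotProduct_comm]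

/-- The sensitivity of `s` is nearly free of the column space of `X` when `g₂` is small. -/
lemma vnorm_whK_whf_le (hpos : ∀ i, 0 < σ i) {t : ℝ} (ht : 0 < t) (i : Fin (q + 1)) (hti : t * (σ i)⁻¹ ≤ 1 / 2) :
    vnorm (D.whK σ *ᵥ D.whf m σ σ i) ≤ (sqrt (D.g2 l m (Function.update σ i (σ i + t))) + sqrt (D.g2 l m σ)) / t
        + 2 * (t * (σ i)⁻¹) * vnorm (D.whf m σ σ i) := by
  set τ := Function.update σ i (σ i + t) with hτdef
  have hτ0 : ∀ j, σ j ≤ τ j := fun j => by grind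
  have hτ := D.posDef_Sig ((hpos 0).trans_le (hτ0 0)) fun j => (hpos j).le.trans (hτ0 j)
  have hdiff : ∀ f : Fin (q + 1) → Fin D.n → ℝ, ∑ j, (τ j - σ j) • f j = t • f i := fun f => by
    rw [sum_eq_single i]
    · simp [hτdef]
    · intro j _ hj; simp [hτdef, hj]
    · simp
  have hpert : pert (D.whV σ) (τ - σ) = t • D.whV σ i := by
    rw [pert, sum_eq_single i]
    · simp [hτdef]
    · intro j _ hj; simp [hτdef, hj]
    · simp
  have hnorm : ‖t • D.whV σ i‖ ≤ t * (σ i)⁻¹ := by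
    rw [norm_smul, norm_of_nonneg ht.le]; exact mul_le_mul_of_nonneg_left (D.opNorm_whV_le hσ hpos i) ht.le
  set f := D.whf m σ σ i with hf
  set Rv := resolv (D.whV σ) (τ - σ) with hRv
  have hs : D.whs m σ τ - D.whb m σ = t • (Rv *ᵥ f) := by
    have h1 : (1 + pert (D.whV σ) (τ - σ)) *ᵥ D.whb m σ = D.whb m σ + t • (D.whV σ i *ᵥ D.whb m σ) := by
      rw [hpert, add_mulVec, one_mulVec, smul_mulVec]
    have h2 : Rv *ᵥ (1 + pert (D.whV σ) (τ - σ)) *ᵥ D.whb m σ = D.whb m σ := by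
      rw [mulVec_mulVec, hRv, resolv, nonsing_inv_mul _
        ((isUnit_iff_isUnit_det _).1 (D.isUnit_one_add_pert_whV hσ hτ)), one_mulVec]
    rw [whs, hdiff, ← hRv]; nth_rewrite 2 [← h2]; rw [h1, ← mulVec_sub, hf, whf, whs_self, ← mulVec_smul Rv]
    rw [smul_sub]; abel
  have hK : D.whK σ *ᵥ (t • (Rv *ᵥ f)) = -(D.whK σ *ᵥ ((D.whit σ)⁻¹ *ᵥ D.fixPart l m τ - D.whfix l m σ)) := by
    rw [eq_neg_iff_add_eq_zero, ← mulVec_add]; refine D.whK_mulVec_eq_zero hσ hX ?_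
    rw [← hs, mulVec_add, mulVec_sub, mulVec_sub, ← D.s_eq_whitened m hσ hτ,
      D.whit_mulVec_whb m hσ, D.whit_mulVec_whfix l m hσ, mulVec_mulVec _ (D.whit σ),
      mul_nonsing_inv _ (D.isUnit_det_whit hσ), one_mulVec, mulVec_add, mulVec_sub,
      mulVec_sub, D.X_tr_mulVec_fixPart l m hX hτ, D.X_tr_mulVec_fixPart l m hX hσ]
    abel
  have hK1 v := (vnorm_mulVec_le _ v).trans (mul_le_of_le_one_left (vnorm_nonneg _) (D.opNorm_whK_le hσ hX))
  have n1 : vnorm ((D.whit σ)⁻¹ *ᵥ D.fixPart l m τ) ≤ sqrt (D.g2 l m τ) := by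
    refine le_sqrt_of_sq_le ?_
    rw [D.vnorm_whit_inv_sq hσ, D.g2_eq l m hX hτ, dot_Sig, dot_Sig]
    exact sum_le_sum fun j _ => mul_le_mul_of_nonneg_right (hτ0 j) (psd_dot_nonneg (D.V_psd j) _)
  have n2 : vnorm (D.whfix l m σ) = sqrt (D.g2 l m σ) := by
    rw [← D.vnorm_whfix_sq l m hσ hX, sqrt_sq (vnorm_nonneg _)]
  have n3 : t * vnorm (D.whK σ *ᵥ Rv *ᵥ f) ≤ sqrt (D.g2 l m τ) + sqrt (D.g2 l m σ) := by
    rw [← abs_of_pos ht, ← vnorm_smul, ← mulVec_smul, hK, vnorm_neg]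
    refine (hK1 _).trans ((vnorm_sub_le _ _).trans ?_)
    rw [n2]; gcongr
  have n4 : vnorm (Rv *ᵥ f - f) ≤ 2 * (t * (σ i)⁻¹) * vnorm f := by
    have h1 : Rv *ᵥ f - f = (Rv - 1) *ᵥ f := by rw [sub_mulVec, one_mulVec]
    rw [h1]; refine (vnorm_mulVec_le _ _).trans (mul_le_mul_of_nonneg_right ?_ (vnorm_nonneg _))
    rw [hRv, resolv, hpert]; refine (opNorm_inv_one_add_sub_one_le (hnorm.trans hti)).trans ?_
    linarith
  have e : D.whK σ *ᵥ f = D.whK σ *ᵥ Rv *ᵥ f - D.whK σ *ᵥ (Rv *ᵥ f - f) := by rw [← mulVec_sub, sub_sub_cancel]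
  rw [e]; refine (vnorm_sub_le _ _).trans (add_le_add ?_ ((hK1 _).trans n4))
  rw [le_div_iff₀ ht]; linarith

end FullRank
end Basic

lemma posDef_of_pos (hpos : ∀ i, 0 < σ i) : (D.Sig σ).PosDef :=
  D.posDef_Sig (hpos 0) fun i => (hpos i).le

lemma dot_blockPart (i : Fin (q + 1)) :
    |m ⬝ᵥ D.blockPart m i| ≤ ∑ a, m a ^ 2 := by
  refine (abs_sum_le_sum_abs _ _).trans (sum_le_sum fun a _ => ?_)
  simp only [blockPart]
  split_ifs with h
  · grind
  · simp [sq_nonneg]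

section Limits
variable {α : Type*} {F : Filter α} {D : α → AnovaDesign q} {τ : α → VarComp q}
  {l : ∀ a, Fin (D a).p → ℝ} {m : ∀ a, (D a).RE → ℝ}

variable (hpos : ∀ i, 0 < σ i) (hm : ∃ C : ℝ, ∀ a, ∑ b, m a b ^ 2 ≤ C)
include hpos

lemma matBdd_whV (i : Fin (q + 1)) : MatBdd F fun a => (D a).whV σ i :=
  ⟨(σ i)⁻¹, inv_nonneg.2 (hpos i).le, Eventually.of_forall fun a =>
    (D a).opNorm_whV_le ((D a).posDef_of_pos hpos) hpos i⟩

include hm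

lemma vecBdd_whz (i : Fin (q + 1)) : VecBdd F fun a => (D a).whz (m a) σ i := by
  obtain ⟨C, hC⟩ := hm
  refine ⟨sqrt (C * (σ i)⁻¹), sqrt_nonneg _, Eventually.of_forall fun a => ?_⟩
  refine le_sqrt_of_sq_le (((D a).vnorm_whz_sq_le (m a) ((D a).posDef_of_pos hpos) hpos i).trans ?_)
  exact mul_le_mul_of_nonneg_right (hC a) (inv_nonneg.2 (hpos i).le)

lemma vecBdd_whb : VecBdd F fun a => (D a).whb (m a) σ := by
  have : ∀ a, (D a).whb (m a) σ = ∑ i, σ i • (D a).whz (m a) σ i := fun a =>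
    (D a).whb_eq (m a) ((D a).posDef_of_pos hpos)
  simp_rw [this]; exact VecBdd.sum _ fun i => (vecBdd_whz hpos hm i).const_smul _

section Near
variable (hτ : ∀ i, Tendsto (fun a => τ a i) F (𝓝 (σ i)))
include hτ

omit hm hpos in
lemma tendsto_sub_zero (i : Fin (q + 1)) : Tendsto (fun a => (τ a - σ) i) F (𝓝 0) := by
  simpa using (hτ i).sub_const (σ i)

omit hm in
lemma eventually_pos : ∀ᶠ a in F, ∀ i, 0 < τ a i := eventually_all.2 fun i => (hτ i).eventually (lt_mem_nhds (hpos i))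

lemma vecNull_whs_sub : VecNull F fun a => (D a).whs (m a) σ (τ a) - (D a).whb (m a) σ := by
  have hd := tendsto_sub_zero hτ
  have h0 : VecNull F fun a => ∑ i, (τ a i - σ i) • (D a).whz (m a) σ i :=
    VecNull.sum _ fun i => VecNull.smul (hd i) (vecBdd_whz hpos hm i)
  have h1 := vecNull_resolv_mulVec_sub (fun i => matBdd_whV hpos i) hd
    ((vecBdd_whb hpos hm).add h0.bdd)
  have := h1.add h0
  simp only [whs]
  convert this using 2 with a
  abel

lemma vecNull_whf_sub (i : Fin (q + 1)) : VecNull F fun a => (D a).whf (m a) σ (τ a) i - (D a).whf (m a) σ σ i := by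
  have h3 : VecNull F fun a => (0 : Fin (D a).n → ℝ) := by simp only [VecNull, vnorm_zero]; exact tendsto_const_nhds
  convert h3.sub ((matBdd_whV hpos i).mulVec_null (vecNull_whs_sub hpos hm hτ)) using 2 with a
  rw [whf, whf, whs_self, mulVec_sub]; abel

end Near

lemma vecBdd_whf (i : Fin (q + 1)) : VecBdd F fun a => (D a).whf (m a) σ σ i := by
  simp only [whf, whs_self]; exact (vecBdd_whz hpos hm i).sub ((matBdd_whV hpos i).mulVec (vecBdd_whb hpos hm))

lemma tendsto_sGram_sub (hτ : ∀ i, Tendsto (fun a => τ a i) F (𝓝 (σ i))) (i j : Fin (q + 1)) :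
    Tendsto (fun a => (D a).sGram (m a) (τ a) i j - (D a).whf (m a) σ σ i ⬝ᵥ (D a).whf (m a) σ σ j) F (𝓝 0) := by
  have hb := fun i => VecBdd.of_sub (vecNull_whf_sub hpos hm hτ i) (vecBdd_whf hpos hm i)
  have h1 := (vecNull_resolv_mulVec_sub (fun i => matBdd_whV hpos i)
    (tendsto_sub_zero hτ) (hb j)).add (vecNull_whf_sub hpos hm hτ j)
  simp only [sub_add_sub_cancel] at h1
  refine (VecNull.dotProduct_sub (vecNull_whf_sub hpos hm hτ i) h1 (hb i) (vecBdd_whf hpos hm j)).congr' ?_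
  filter_upwards [eventually_pos hpos hτ] with a ha
  rw [(D a).sGram_eq_whitened (m a) ((D a).posDef_of_pos hpos) ((D a).posDef_of_pos ha)]

lemma exists_abs_sGram_le (i j : Fin (q + 1)) : ∃ C : ℝ, ∀ᶠ a in F, |(D a).sGram (m a) σ i j| ≤ C := by
  obtain ⟨C, hC⟩ := (vecBdd_whf hpos hm i).dotProduct (vecBdd_whf hpos hm j)
  refine ⟨C, hC.mono fun a ha => ?_⟩
  have hp := (D a).posDef_of_pos hpos
  rw [(D a).sGram_eq_whitened (m a) hp hp, sub_self, resolv_zero, one_mulVec]; exact ha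

lemma exists_abs_g1_le : ∃ C : ℝ, ∀ᶠ a in F, |(D a).g1 (m a) σ| ≤ C := by
  obtain ⟨C, hC⟩ := (vecBdd_whb hpos hm).dotProduct (vecBdd_whb hpos hm)
  obtain ⟨C', hC'⟩ := hm
  refine ⟨∑ i, σ i * C' + C, hC.mono fun a ha => ?_⟩
  rw [g1_eq]; refine (abs_sub _ _).trans (add_le_add ((abs_sum_le_sum_abs _ _).trans (sum_le_sum fun i _ => ?_)) ?_)
  · rw [abs_mul, abs_of_pos (hpos i)]
    exact mul_le_mul_of_nonneg_left (((D a).dot_blockPart (m a) i).trans (hC' a)) (hpos i).le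
  · rw [whb, (D a).dot_whit_tr ((D a).posDef_of_pos hpos)] at ha; exact ha

section FixedEffects
variable (hX : ∀ a, Function.Injective (D a).X.mulVec)
  (hg2 : ∀ τ ∈ interior (paramSpace q), Tendsto (fun a => (D a).g2 (l a) (m a) τ) F (𝓝 0))
include hX hg2

omit hm in
lemma vecNull_whfix : VecNull F fun a => (D a).whfix (l a) (m a) σ := by
  have h1 := (hg2 σ (mem_interior_paramSpace.2 hpos)).sqrt
  rw [sqrt_zero] at h1; refine VecNull.of_le (Eventually.of_forall fun a => ?_) h1
  rw [← (D a).vnorm_whfix_sq (l a) (m a) ((D a).posDef_of_pos hpos) (hX a), sqrt_sq (vnorm_nonneg _)]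

lemma vecNull_whK_whf (i : Fin (q + 1)) : VecNull F fun a => (D a).whK σ *ᵥ (D a).whf (m a) σ σ i := by
  obtain ⟨C, hC0, hC⟩ := vecBdd_whf hpos hm i
  refine Metric.tendsto_nhds.2 fun e he => ?_
  set t := min (σ i / 2) (e * σ i / (8 * (C + 1)))
  have hσi := hpos i
  have ht0 : 0 < t := lt_min (by positivity) (by positivity)
  have ht1 : t * (σ i)⁻¹ ≤ 1 / 2 := by
    rw [← div_eq_mul_inv, div_le_iff₀ hσi]; have := min_le_left (σ i / 2) (e * σ i / (8 * (C + 1))); linarith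
  have ht2 : t * (σ i)⁻¹ * (C + 1) ≤ e / 8 := by
    have h1 : t ≤ e * σ i / (8 * (C + 1)) := min_le_right _ _
    rw [le_div_iff₀ (by positivity)] at h1; rw [← div_eq_mul_inv, div_mul_eq_mul_div, div_le_iff₀ hσi]; linarith
  have hin : Function.update σ i (σ i + t) ∈ interior (paramSpace q) := by
    refine mem_interior_paramSpace.2 fun j => ?_
    by_cases h : j = i
    · subst h; simp; linarith
    · simp [h, hpos j]
  have hlim : Tendsto (fun a => (sqrt ((D a).g2 (l a) (m a) (Function.update σ i (σ i + t)))
      + sqrt ((D a).g2 (l a) (m a) σ)) / t) F (𝓝 0) := by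
    have := ((hg2 _ hin).sqrt.add (hg2 σ (mem_interior_paramSpace.2 hpos)).sqrt).div_const t
    simpa using this
  filter_upwards [hC, hlim.eventually (gt_mem_nhds (half_pos he))] with a h1 h2
  have h3 := (D a).vnorm_whK_whf_le (l a) (m a) ((D a).posDef_of_pos hpos) (hX a) hpos ht0 i ht1
  rw [dist_eq, sub_zero, abs_of_nonneg (vnorm_nonneg _)]; have h4 : 0 ≤ t * (σ i)⁻¹ := by positivity
  nlinarith

lemma tendsto_blupDir_sub (i j : Fin (q + 1)) :
    Tendsto (fun a => (D a).blupDir (l a) (m a) σ i ⬝ᵥ (D a).P σ *ᵥ (D a).blupDir (l a) (m a) σ j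
      - (D a).whf (m a) σ σ i ⬝ᵥ (D a).whf (m a) σ σ j) F (𝓝 0) := by
  have hVfix := fun i => (matBdd_whV hpos i).mulVec_null (vecNull_whfix hpos hX hg2)
  have hf := fun i => vecBdd_whf (F := F) hpos hm i
  have hK : MatBdd F fun a => (D a).whK σ := ⟨1, zero_le_one, Eventually.of_forall fun a =>
    (D a).opNorm_whK_le ((D a).posDef_of_pos hpos) (hX a)⟩
  have n1 : VecNull F fun a => ((D a).whf (m a) σ σ i - (D a).whV σ i *ᵥ (D a).whfix (l a) (m a) σ)
      - (D a).whf (m a) σ σ i := by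
    have := (hVfix i)
    simp only [VecNull, sub_sub_cancel_left, vnorm_neg]; exact this
  have n2 : VecNull F fun a => (1 - (D a).whK σ) *ᵥ
      ((D a).whf (m a) σ σ j - (D a).whV σ j *ᵥ (D a).whfix (l a) (m a) σ) - (D a).whf (m a) σ σ j := by
    convert (((hK.mulVec_null (hVfix j)).sub (hVfix j)).sub (vecNull_whK_whf hpos hm hX hg2 j)) using 2 with a
    rw [sub_mulVec, one_mulVec, mulVec_sub]; abel
  refine (VecNull.dotProduct_sub n1 n2 ((hf i).sub (hVfix i).bdd) (hf j)).congr fun a => ?_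
  rw [(D a).blupDir_P_blupDir (l a) (m a) ((D a).posDef_of_pos hpos) (hX a)]
  rw [← neg_sub ((D a).whf (m a) σ σ i), ← neg_sub ((D a).whf (m a) σ σ j), mulVec_neg, neg_dotProduct_neg]

/-- The Gram matrix of `∇s` agrees to first order with that of the BLUP sensitivities. -/
lemma tendsto_sGram_sub_blupDir (hτ : ∀ i, Tendsto (fun a => τ a i) F (𝓝 (σ i))) (i j : Fin (q + 1)) :
    Tendsto (fun a => (D a).sGram (m a) (τ a) i j
      - (D a).blupDir (l a) (m a) σ i ⬝ᵥ (D a).P σ *ᵥ (D a).blupDir (l a) (m a) σ j) F (𝓝 0) := by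
  have := (tendsto_sGram_sub hpos hm hτ i j).sub (tendsto_blupDir_sub hpos hm hX hg2 i j)
  grind

lemma exists_abs_blupDir_le (i : Fin (q + 1)) : ∃ C : ℝ, 0 ≤ C ∧ ∀ᶠ a in F,
    (D a).blupDir (l a) (m a) σ i ⬝ᵥ (D a).P σ *ᵥ (D a).blupDir (l a) (m a) σ i ≤ C := by
  obtain ⟨C, hC⟩ := (vecBdd_whf hpos hm i).dotProduct (vecBdd_whf hpos hm i)
  refine ⟨|C| + 1, by positivity, ?_⟩
  filter_upwards [hC, (tendsto_blupDir_sub hpos hm hX hg2 i i).eventually (gt_mem_nhds one_pos)] with a h1 h2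
  grind

lemma tendsto_g1Slope_sub (hτ : ∀ i, Tendsto (fun a => τ a i) F (𝓝 (σ i))) (i : Fin (q + 1)) :
    Tendsto (fun a => (D a).g1Slope (m a) (τ a) i - (D a).mseSlope (l a) (m a) σ i) F (𝓝 0) := by
  have hfix := vecNull_whfix hpos hX hg2
  have hV := matBdd_whV (F := F) (D := D) hpos i
  have n1 : VecNull F fun a => (D a).whs (m a) σ (τ a) - ((D a).whb (m a) σ + (D a).whfix (l a) (m a) σ) := by
    convert (vecNull_whs_sub hpos hm hτ).sub hfix using 2 with a
    abel
  have b1 := ((vecBdd_whb hpos hm)).add hfix.bdd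
  have b2 := VecBdd.of_sub n1 b1
  have n0 : VecNull F fun a => (D a).whz (m a) σ i - (D a).whz (m a) σ i := by
    simp only [VecNull, sub_self, vnorm_zero]; exact tendsto_const_nhds
  have t1 := (VecNull.dotProduct_sub n1 n0 b2 (vecBdd_whz hpos hm i)).const_mul 2
  have n2 := hV.mulVec_null n1
  simp only [mulVec_sub] at n2; have t2 := (VecNull.dotProduct_sub n1 n2 b2 (hV.mulVec b1)).sub t1
  rw [mul_zero, sub_zero] at t2; refine t2.congr' ?_
  filter_upwards [eventually_pos hpos hτ] with a ha
  have hp := (D a).posDef_of_pos hpos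
  rw [(D a).g1Slope_eq_whitened (m a) hp ((D a).posDef_of_pos ha), (D a).mseSlope_eq_whitened (l a) (m a) hp]
  ring

lemma exists_abs_mseSlope_le (i : Fin (q + 1)) : ∃ C : ℝ, ∀ᶠ a in F, |(D a).mseSlope (l a) (m a) σ i| ≤ C := by
  have b1 := (vecBdd_whb hpos hm).add (vecNull_whfix hpos hX hg2).bdd
  obtain ⟨C1, h1⟩ := b1.dotProduct (vecBdd_whz hpos hm i)
  obtain ⟨C2, h2⟩ := b1.dotProduct ((matBdd_whV hpos i).mulVec b1)
  obtain ⟨C, hC⟩ := hm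
  refine ⟨C + 2 * C1 + C2, ?_⟩
  filter_upwards [h1, h2] with a h1 h2
  rw [(D a).mseSlope_eq_whitened (l a) (m a) ((D a).posDef_of_pos hpos)]
  have h3 := ((D a).dot_blockPart (m a) i).trans (hC a)
  refine (abs_add_le _ _).trans (add_le_add ((abs_sub _ _).trans (add_le_add h3 ?_)) h2)
  rw [abs_mul, abs_two]; linarith

end FixedEffects

end Limits

section Measurability
variable {Ω : Type*} [MeasurableSpace Ω] {τ : Ω → VarComp q} (hτ : Measurable τ)
include hτ

lemma meas_Sig (i j : Fin D.n) : Measurable fun ω => D.Sig (τ ω) i j := by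
  simp only [Sig, Matrix.sum_apply, Matrix.smul_apply, smul_eq_mul]
  exact Finset.measurable_fun_sum _ fun a _ => ((measurable_pi_apply a).comp hτ).mul_const _

lemma meas_Sig_inv (i j : Fin D.n) : Measurable fun ω => (D.Sig (τ ω))⁻¹ i j :=
  meas_matrix_inv (D.meas_Sig hτ) i j

lemma meas_Q_inv (i j : Fin D.p) : Measurable fun ω => (D.Xᵀ * (D.Sig (τ ω))⁻¹ * D.X)⁻¹ i j :=
  meas_matrix_inv
    (meas_matrix_mul
      (meas_matrix_mul (by simp)
        (D.meas_Sig_inv hτ)) (by simp)) i j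

lemma meas_P (i j : Fin D.n) : Measurable fun ω => D.P (τ ω) i j := by
  refine (D.meas_Sig_inv hτ i j).sub ?_
  have h1 := meas_matrix_mul (B := fun _ => D.X) (D.meas_Sig_inv hτ) (by simp)
  have h2 := meas_matrix_mul h1 (D.meas_Q_inv hτ)
  have h3 := meas_matrix_mul (B := fun _ => D.Xᵀ) h2 (by simp)
  exact meas_matrix_mul h3 (D.meas_Sig_inv hτ) i j

lemma meas_G (i j : D.RE) : Measurable fun ω => D.G (τ ω) i j := by
  simp only [G, diagonal_apply]
  split_ifs
  · exact (measurable_pi_apply _).comp hτ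
  · simp

lemma meas_s (a : Fin D.n) : Measurable fun ω => D.s m (τ ω) a := by
  have h1 := meas_matrix_mul (B := fun _ => D.Z) (D.meas_Sig_inv hτ) (by simp)
  have h2 := meas_matrix_mul h1 (D.meas_G hτ)
  exact meas_matrix_mulVec (v := fun _ => m) h2 (fun _ => measurable_const) a

lemma meas_g1 : Measurable fun ω => D.g1 m (τ ω) := by
  have h1 := meas_matrix_mul (B := fun _ => D.Zᵀ) (D.meas_G hτ) (by simp)
  have h2 := meas_matrix_mul h1 (D.meas_Sig_inv hτ)
  have h3 := meas_matrix_mul (B := fun _ => D.Z) h2 (by simp)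
  have h4 := meas_matrix_mul h3 (D.meas_G hτ)
  have h5 := meas_matrix_mulVec
    (v := fun _ => m) (fun i j => (D.meas_G hτ i j).sub (h4 i j)) fun _ => measurable_const
  exact meas_dot (fun _ => measurable_const) h5

lemma meas_unbiasedness (i : Fin D.p) : Measurable fun ω => (l - D.Xᵀ *ᵥ D.s m (τ ω)) i :=
  (meas_const_coord l i).sub
    (meas_matrix_mulVec (by simp) (D.meas_s m hτ) i)

lemma meas_g2 : Measurable fun ω => D.g2 l m (τ ω) := meas_dot (D.meas_unbiasedness l m hτ)
    (meas_matrix_mulVec (D.meas_Q_inv hτ) (D.meas_unbiasedness l m hτ))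

lemma meas_sDir (i : Fin (q + 1)) (a : Fin D.n) : Measurable fun ω => D.sDir m (τ ω) i a :=
  Measurable.sub measurable_const
    (meas_matrix_mulVec (by simp) (D.meas_s m hτ) a)

lemma meas_sGram (i j : Fin (q + 1)) : Measurable fun ω => D.sGram m (τ ω) i j :=
  meas_dot (D.meas_sDir m hτ i)
    (meas_matrix_mulVec (D.meas_Sig_inv hτ) (D.meas_sDir m hτ j))

omit hτ in
lemma meas_trace_mul {M : Ω → Matrix (Fin D.n) (Fin D.n) ℝ} (hM : ∀ i j, Measurable fun ω => M ω i j)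
    (i : Fin (q + 1)) : Measurable fun ω => (M ω * D.V i).trace := Finset.measurable_fun_sum _ fun a _ =>
    meas_matrix_mul hM (by simp) a a

lemma meas_gM0 (i : Fin (q + 1)) : Measurable fun ω => D.gM0 (τ ω) i :=
  (D.meas_trace_mul
    (fun a b => (D.meas_Sig_inv hτ a b).sub (D.meas_P hτ a b)) i).const_mul (1 / 2)

lemma meas_trace_P (i j : Fin (q + 1)) : Measurable fun ω => (D.P (τ ω) * D.V i * D.P (τ ω) * D.V j).trace := by
  have h1 := meas_matrix_mul (B := fun _ => D.V i) (D.meas_P hτ) (by simp)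
  exact D.meas_trace_mul (meas_matrix_mul h1 (D.meas_P hτ)) j

lemma meas_trace_Sig_inv (i j : Fin (q + 1)) :
    Measurable fun ω => ((D.Sig (τ ω))⁻¹ * D.V i * (D.Sig (τ ω))⁻¹ * D.V j).trace := by
  have h1 := meas_matrix_mul (B := fun _ => D.V i) (D.meas_Sig_inv hτ) (by simp)
  exact D.meas_trace_mul (meas_matrix_mul h1 (D.meas_Sig_inv hτ)) j

lemma meas_blup {y : Ω → Fin D.n → ℝ} (hy : Measurable y) : Measurable fun ω => D.blup l m (τ ω) (y ω) := by
  have hy' a := (measurable_pi_apply a).comp hy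
  have h1 := meas_matrix_mul (B := fun _ => D.Xᵀ) (D.meas_Q_inv hτ) (by simp)
  have hb := meas_matrix_mulVec (meas_matrix_mul h1 (D.meas_Sig_inv hτ)) hy'
  have h2 := meas_matrix_mulVec (A := fun _ => D.X) (by simp) hb
  have h4 := meas_dot
    (D.meas_s m hτ) fun a => (hy' a).sub (h2 a)
  exact (meas_dot (u := fun _ => l) (fun _ => measurable_const) hb).add h4

lemma meas_g1Slope (i : Fin (q + 1)) : Measurable fun ω => D.g1Slope m (τ ω) i := by
  have hs := D.meas_s m hτ
  have h0 := meas_dot (v := fun _ => D.zvec m i) hs fun _ => measurable_const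
  have h2 := meas_dot hs (meas_matrix_mulVec (A := fun _ => D.V i) (by simp) hs)
  exact ((h0.const_mul 2).const_sub (m ⬝ᵥ D.blockPart m i)).add h2

end Measurability

section Normalized
variable (T : Matrix (Fin D.n) (Fin (D.n - D.p)) ℝ)

open Classical in
/-- A full set of error contrasts with identity covariance matrix at `σ`. -/
def stdCtr (σ : VarComp q) : Matrix (Fin D.n) (Fin (D.n - D.p)) ℝ :=
  T * (if h : (Tᵀ * D.Sig σ * T).PosDef then (PosDef.exists_tr_mul_mul_eq_one h).choose else 1)

/-- The normalized variance matrices of the standardized contrasts. -/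
def normV (σ : VarComp q) (i : Fin (q + 1)) : Matrix (Fin (D.n - D.p)) (Fin (D.n - D.p)) ℝ :=
  (D.d σ i)⁻¹ • ((D.stdCtr T σ)ᵀ * D.V i * D.stdCtr T σ)

/-- The standardized contrasts of the observation. -/
def normErr (σ : VarComp q) (ω : (D.RE → ℝ) × (Fin D.n → ℝ)) : Fin (D.n - D.p) → ℝ := (D.stdCtr T σ)ᵀ *ᵥ D.resid ω

/-- The normalized parameter. -/
def normParam (σ τ : VarComp q) (i : Fin (q + 1)) : ℝ := D.d σ i * (τ i - σ i)

/-- The normalized sensitivities of the BLUP. -/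
def normDir (σ : VarComp q) (i : Fin (q + 1)) : Fin (D.n - D.p) → ℝ :=
  (D.d σ i)⁻¹ • ((D.stdCtr T σ)ᵀ *ᵥ D.blupDir l m σ i)

/-- The observation with given standardized contrasts and without fixed effects. -/
def contrastLift (σ : VarComp q) (z : Fin (D.n - D.p) → ℝ) : Fin D.n → ℝ := D.Sig σ *ᵥ D.stdCtr T σ *ᵥ z

lemma meas_contrastLift (σ : VarComp q) : Measurable (D.contrastLift T σ) :=
  (meas_mulVec _).comp (meas_mulVec _)

lemma d_nonneg (σ : VarComp q) (i : Fin (q + 1)) : 0 ≤ D.d σ i := by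
  refine Fin.cases ?_ (fun j => ?_) i <;> exact fro_nonneg _

lemma dstar_le (σ : VarComp q) (i : Fin (q + 1)) : D.dstar σ ≤ D.d σ i := ciInf_le (Set.finite_range _).bddBelow i

lemma dstar_nonneg (σ : VarComp q) : 0 ≤ D.dstar σ := le_ciInf fun i => D.d_nonneg σ i

variable {T} (h : D.IsContrast T)
include h

section
variable (hσ : (D.Sig σ).PosDef)
include hσ

lemma stdCtr_spec : D.IsContrast (D.stdCtr T σ) ∧ (D.stdCtr T σ)ᵀ * D.Sig σ * D.stdCtr T σ = 1 := by
  have hp := D.posDef_contrast h hσ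
  have hs := (PosDef.exists_tr_mul_mul_eq_one hp).choose_spec
  have he : D.stdCtr T σ = T * (PosDef.exists_tr_mul_mul_eq_one hp).choose := by
    rw [stdCtr, dif_pos hp]
  set B := (PosDef.exists_tr_mul_mul_eq_one hp).choose
  rw [he]; refine ⟨⟨h.injX, ?_, ?_, h.card⟩, ?_⟩
  · have : (T * B).mulVec = T.mulVec ∘ B.mulVec := by funext v; simp [mulVec_mulVec]
    rw [this]; exact h.injT.comp (mulVec_injective_of_isUnit hs.1)
  · rw [transpose_mul, Matrix.mul_assoc, h.mul_X, Matrix.mul_zero]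
  · rw [← hs.2.1, transpose_mul]; simp only [Matrix.mul_assoc]

lemma d_sq (i : Fin (q + 1)) : D.d σ i ^ 2 = (D.P σ * D.V i * D.P σ * D.V i).trace := by
  have sP := D.P_tr h.injX hσ
  refine Fin.cases ?_ (fun j => ?_) i
  · change traceNormTwo (D.P σ) ^ 2 = _
    rw [fro_sq, V_zero, Matrix.mul_one, Matrix.mul_one, sP]
  · change traceNormTwo ((D.Zblock j)ᵀ * D.P σ * D.Zblock j) ^ 2 = _
    rw [fro_sq, V_succ]; simp only [transpose_mul, transpose_transpose, sP]
    have : D.P σ * (D.Zblock j * (D.Zblock j)ᵀ) * D.P σ * (D.Zblock j * (D.Zblock j)ᵀ)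
        = (D.P σ * D.Zblock j * (D.Zblock j)ᵀ * D.P σ * D.Zblock j) * (D.Zblock j)ᵀ := by
      simp only [Matrix.mul_assoc]
    rw [this, trace_mul_comm _ (D.Zblock j)ᵀ]; simp only [Matrix.mul_assoc]

lemma P_eq_stdCtr : D.P σ = D.stdCtr T σ * (D.stdCtr T σ)ᵀ := by
  obtain ⟨h1, h2⟩ := D.stdCtr_spec h hσ
  rw [D.P_eq_contrasts h.injX hσ h1.injT h1.mul_X h1.card, h2, inv_one, Matrix.mul_one]

lemma normV_tr (i : Fin (q + 1)) : (D.normV T σ i)ᵀ = D.normV T σ i := by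
  rw [normV, transpose_smul]; simp only [transpose_mul, transpose_transpose, D.V_tr, Matrix.mul_assoc]

lemma trace_normV_mul (i j : Fin (q + 1)) : (D.normV T σ i * D.normV T σ j).trace
    = (D.d σ i)⁻¹ * (D.d σ j)⁻¹ * (D.P σ * D.V i * D.P σ * D.V j).trace := by
  have e : D.P σ * D.V i * D.P σ * D.V j = D.stdCtr T σ * ((D.stdCtr T σ)ᵀ * D.V i *
      D.stdCtr T σ * (D.stdCtr T σ)ᵀ * D.V j) := by
    rw [D.P_eq_stdCtr h hσ]; simp only [Matrix.mul_assoc]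
  rw [e, trace_mul_comm (D.stdCtr T σ), normV, normV, smul_mul, Matrix.mul_smul, smul_smul,
    trace_smul, smul_eq_mul]
  simp only [Matrix.mul_assoc]

lemma fro_normV_le (i : Fin (q + 1)) : traceNormTwo (D.normV T σ i) ≤ 1 := by
  rw [← sq_le_one_iff₀ (fro_nonneg _), fro_sq, D.normV_tr h hσ,
    D.trace_normV_mul h hσ, ← D.d_sq h hσ, ← mul_inv, ← pow_two]
  exact inv_mul_le_one

lemma opNorm_normV_le (hpos : ∀ i, 0 < σ i) (i : Fin (q + 1)) : ‖D.normV T σ i‖ ≤ (D.d σ i)⁻¹ * (σ i)⁻¹ := by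
  rw [normV, norm_smul, norm_of_nonneg (inv_nonneg.2 (D.d_nonneg σ i))]
  refine mul_le_mul_of_nonneg_left ?_ (inv_nonneg.2 (D.d_nonneg σ i))
  refine opNorm_le_of_psd (psd_tr_mul_mul_same (D.V_psd i) _)
    (inv_nonneg.2 (hpos i).le) fun x => ?_
  have e : ∀ M : Matrix (Fin D.n) (Fin D.n) ℝ, x ⬝ᵥ ((D.stdCtr T σ)ᵀ * M * D.stdCtr T σ) *ᵥ x
      = D.stdCtr T σ *ᵥ x ⬝ᵥ M *ᵥ D.stdCtr T σ *ᵥ x := fun M => by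
    rw [Matrix.mul_assoc, ← mulVec_mulVec, dotProduct_mulVec, vecMul_transpose, mulVec_mulVec]
  have h1 := D.mul_dot_V_le hσ (fun i => (hpos i).le) i (D.stdCtr T σ *ᵥ x)
  rw [e, le_inv_mul_iff₀ (hpos i)]; rwa [← e (D.Sig σ), (D.stdCtr_spec h hσ).2, one_mulVec] at h1

lemma infoMat_normV (hσ' : σ ∈ paramSpace q) : infoMat (D.normV T σ)
    = -(diagonal (fun i => (D.d σ i)⁻¹) * D.AR T σ * diagonal (fun i => (D.d σ i)⁻¹)) := by
  ext i j
  rw [Matrix.neg_apply, mul_diagonal, diagonal_mul, D.AR_apply h ⟨hσ', hσ⟩, infoMat, of_apply, D.trace_normV_mul h hσ]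
  ring

lemma vnorm_normDir_sq (i : Fin (q + 1)) : vnorm (D.normDir l m T σ i) ^ 2
    = ((D.d σ i)⁻¹) ^ 2 * D.blupDir l m σ i ⬝ᵥ D.P σ *ᵥ D.blupDir l m σ i := by
  rw [normDir, vnorm_smul, mul_pow, sq_abs, vnorm_sq, D.P_eq_stdCtr h hσ, ← mulVec_mulVec,
    dotProduct_mulVec _ (D.stdCtr T σ), mulVec_transpose]

lemma normDir_dot (i j : Fin (q + 1)) : D.normDir l m T σ i ⬝ᵥ D.normDir l m T σ j
    = (D.d σ i)⁻¹ * (D.d σ j)⁻¹ * D.blupDir l m σ i ⬝ᵥ D.P σ *ᵥ D.blupDir l m σ j := by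
  rw [normDir, normDir, D.P_eq_stdCtr h hσ, ← mulVec_mulVec,
    dotProduct_mulVec _ (D.stdCtr T σ), smul_dotProduct, dotProduct_smul,
    ← mulVec_transpose, smul_eq_mul, smul_eq_mul]
  ring

lemma meas_normErr : Measurable (D.normErr T σ) := (meas_mulVec _).comp D.meas_resid

lemma dot_normErr (c : Fin (D.n - D.p) → ℝ) (ω) : c ⬝ᵥ D.normErr T σ ω
    = D.noiseForm (D.Zᵀ *ᵥ D.stdCtr T σ *ᵥ c) (D.stdCtr T σ *ᵥ c) ω := by
  rw [← dot_resid, normErr, dotProduct_mulVec, vecMul_transpose]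

lemma noiseCov_stdCtr (c : Fin (D.n - D.p) → ℝ) :
    D.noiseCov σ (D.Zᵀ *ᵥ D.stdCtr T σ *ᵥ c) (D.Zᵀ *ᵥ D.stdCtr T σ *ᵥ c)
      (D.stdCtr T σ *ᵥ c) (D.stdCtr T σ *ᵥ c) = c ⬝ᵥ c := by
  rw [noiseCov_resid_resid, ← vecMul_transpose, ← dotProduct_mulVec, mulVec_mulVec, vecMul_transpose, mulVec_mulVec,
    (D.stdCtr_spec h hσ).2, one_mulVec]

lemma X_tr_mulVec_stdCtr (c : Fin (D.n - D.p) → ℝ) : D.Xᵀ *ᵥ D.stdCtr T σ *ᵥ c = 0 := by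
  have h1 := (D.stdCtr_spec h hσ).1.mul_X
  have : D.Xᵀ * D.stdCtr T σ = 0 := by
    rw [← transpose_transpose (D.Xᵀ * _), transpose_mul, transpose_transpose, h1, transpose_zero]
  rw [mulVec_mulVec, this, zero_mulVec]

lemma map_normErr (hσ' : σ ∈ paramSpace q) : (D.noise σ).map (D.normErr T σ) = stdNormal (Fin (D.n - D.p)) := by
  refine map_eq_stdGauss_of_linear (D.meas_normErr h hσ) fun c => ?_
  simp_rw [D.dot_normErr h hσ]; rw [D.map_noiseForm hσ', D.noiseCov_stdCtr h hσ]

/-- The prediction error at the true parameters is independent of the error contrasts. -/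
lemma indepFun_error (hσ' : σ ∈ paramSpace q) : IndepFun
    (D.noiseForm (D.Zᵀ *ᵥ D.blupCoef l m σ - m) (D.blupCoef l m σ)) (D.normErr T σ) (D.noise σ) := by
  refine indepFun_of_linear (D.meas_noiseForm _ _) (D.meas_normErr h hσ)
    (v := D.noiseCov σ (D.Zᵀ *ᵥ D.blupCoef l m σ - m) (D.Zᵀ *ᵥ D.blupCoef l m σ - m)
      (D.blupCoef l m σ) (D.blupCoef l m σ)) (D.noiseCov_self_nonneg hσ' _ _) fun a c => ?_
  simp_rw [D.dot_normErr h hσ, ← D.noiseForm_smul a, ← D.noiseForm_add]; rw [D.map_noiseForm hσ']; congr 2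
  rw [D.noiseCov_add_self, D.noiseCov_stdCtr h hσ]
  have h1 : D.noiseCov σ (a • (D.Zᵀ *ᵥ D.blupCoef l m σ - m)) (D.Zᵀ *ᵥ D.stdCtr T σ *ᵥ c)
      (a • D.blupCoef l m σ) (D.stdCtr T σ *ᵥ c)
      = a * D.noiseCov σ (D.Zᵀ *ᵥ D.stdCtr T σ *ᵥ c) (D.Zᵀ *ᵥ D.blupCoef l m σ - m)
      (D.stdCtr T σ *ᵥ c) (D.blupCoef l m σ) := by
    rw [noiseCov_comm]; simp only [noiseCov, mulVec_smul, dotProduct_smul, smul_eq_mul]; ring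
  rw [h1, D.noiseCov_error_contrast l m h.injX hσ (D.X_tr_mulVec_stdCtr h hσ c)]
  simp only [noiseCov, mulVec_smul, dotProduct_smul, smul_dotProduct, smul_eq_mul]; ring

lemma stdCtr_obs (β : Fin D.p → ℝ) (ω) : (D.stdCtr T σ)ᵀ *ᵥ D.obs β ω = D.normErr T σ ω := by
  rw [obs_eq, mulVec_add, mulVec_mulVec, (D.stdCtr_spec h hσ).1.mul_X, zero_mulVec, zero_add, normErr]

section Shifted
variable (hd : ∀ i, 0 < D.d σ i)
include hd

lemma pert_normV (τ : VarComp q) : 1 + pert (D.normV T σ) (D.normParam σ τ)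
    = (D.stdCtr T σ)ᵀ * D.Sig τ * D.stdCtr T σ := by
  rw [D.Sig_eq_add σ τ, Matrix.mul_add, Matrix.add_mul, (D.stdCtr_spec h hσ).2, Matrix.mul_sum,
    Matrix.sum_mul, pert]
  congr 1; refine sum_congr rfl fun i _ => ?_
  rw [normV, normParam, smul_smul, Matrix.mul_smul, smul_mul]; have := (hd i).ne'; field_simp

variable (hτ : (D.Sig τ).PosDef)
include hτ

lemma P_eq_resolv : D.P τ = D.stdCtr T σ * resolv (D.normV T σ) (D.normParam σ τ) * (D.stdCtr T σ)ᵀ := by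
  obtain ⟨h1, -⟩ := D.stdCtr_spec h hσ
  rw [D.P_eq_contrasts h.injX hτ h1.injT h1.mul_X h1.card, resolv, D.pert_normV h hσ hd]

lemma score_eq_stdScore (y : Fin D.n → ℝ) (i : Fin (q + 1)) :
    1 / 2 * (y ⬝ᵥ (D.P τ * D.V i * D.P τ) *ᵥ y - (D.P τ * D.V i).trace)
      = D.d σ i * stdScore (D.normV T σ) (D.normParam σ τ) ((D.stdCtr T σ)ᵀ *ᵥ y) i := by
  set U := D.stdCtr T σ with hU
  set W := resolv (D.normV T σ) (D.normParam σ τ) with hW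
  have hP := D.P_eq_resolv h hσ hd hτ
  rw [← hU, ← hW] at hP
  have hV : Uᵀ * D.V i * U = D.d σ i • D.normV T σ i := by rw [normV, smul_smul, mul_inv_cancel₀ (hd i).ne', one_smul]
  have e1 : D.P τ * D.V i * D.P τ = U * (W * (Uᵀ * D.V i * U) * W * Uᵀ) := by rw [hP]; simp only [Matrix.mul_assoc]
  have e2 : (D.P τ * D.V i).trace = (W * (Uᵀ * D.V i * U)).trace := by
    rw [hP, Matrix.mul_assoc, Matrix.mul_assoc, trace_mul_comm]; simp only [Matrix.mul_assoc]
  rw [e1, e2, hV, stdScore, ← mulVec_mulVec, dotProduct_mulVec y U, ← mulVec_transpose, ← mulVec_mulVec, ← hW]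
  simp only [Matrix.mul_smul, smul_mul, smul_mulVec, dotProduct_smul, trace_smul, smul_eq_mul]; ring

lemma trace_P_eq (i j : Fin (q + 1)) : (D.d σ i)⁻¹ * (D.d σ j)⁻¹ * (D.P τ * D.V i * D.P τ * D.V j).trace
    = (resolv (D.normV T σ) (D.normParam σ τ) * D.normV T σ i *
      resolv (D.normV T σ) (D.normParam σ τ) * D.normV T σ j).trace := by
  set U := D.stdCtr T σ with hU
  set W := resolv (D.normV T σ) (D.normParam σ τ) with hW
  have hP := D.P_eq_resolv h hσ hd hτ
  rw [← hU, ← hW] at hP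
  have e1 : D.P τ * D.V i * D.P τ * D.V j = U * (W * (Uᵀ * D.V i * U) * W * Uᵀ * D.V j) := by
    rw [hP]; simp only [Matrix.mul_assoc]
  rw [e1, trace_mul_comm, normV, normV, ← hU]
  simp only [Matrix.mul_smul, smul_mul, trace_smul, smul_eq_mul, Matrix.mul_assoc]; ring

lemma sum_smul_normDir : (D.stdCtr T σ)ᵀ *ᵥ ∑ i, (τ i - σ i) • D.blupDir l m σ i
    = ∑ i, D.normParam σ τ i • D.normDir l m T σ i := by
  rw [mulVec_sum]; refine sum_congr rfl fun i _ => ?_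
  rw [mulVec_smul, normDir, normParam, smul_smul]; have := (hd i).ne'; field_simp

lemma blup_sub_blup_obs (β : Fin D.p → ℝ) (ω) : D.blup l m τ (D.obs β ω) - D.blup l m σ (D.obs β ω)
      = -∑ i, D.normParam σ τ i * (D.normDir l m T σ i ⬝ᵥ
          (resolv (D.normV T σ) (D.normParam σ τ) *ᵥ D.normErr T σ ω)) := by
  rw [D.blup_sub_blup l m h.injX hτ hσ, D.P_eq_resolv h hσ hd hτ, dotProduct_comm, ← mulVec_mulVec,
    ← mulVec_mulVec, D.sum_smul_normDir l m h hσ hd hτ, dotProduct_mulVec,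
    ← mulVec_transpose, D.stdCtr_obs h hσ,
    dot_symm (resolv_tr (D.normV_tr h hσ) _), dotProduct_comm, sum_dotProduct]
  simp

lemma g1_add_g2_eq_norm : D.g1 m τ + D.g2 l m τ = D.g1 m σ + D.g2 l m σ
    + ∑ i, D.normParam σ τ i * ((D.d σ i)⁻¹ * D.mseSlope l m σ i)
    - (∑ i, D.normParam σ τ i • D.normDir l m T σ i) ⬝ᵥ (resolv (D.normV T σ) (D.normParam σ τ) *ᵥ
        ∑ i, D.normParam σ τ i • D.normDir l m T σ i) := by
  rw [D.g1_add_g2_eq l m h.injX hτ hσ, D.P_eq_resolv h hσ hd hτ, ← mulVec_mulVec,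
    ← mulVec_mulVec, dotProduct_mulVec _ (D.stdCtr T σ), ← mulVec_transpose, D.sum_smul_normDir l m h hσ hd hτ]
  congr 2
  refine sum_congr rfl fun i _ => ?_
  have := (hd i).ne'
  rw [normParam]; field_simp

end Shifted

end

lemma exists_eq_contrastLift (hσ : (D.Sig σ).PosDef) (y : Fin D.n → ℝ) :
    ∃ b, y = D.contrastLift T σ ((D.stdCtr T σ)ᵀ *ᵥ y) + D.X *ᵥ b := by
  refine ⟨((D.Xᵀ * (D.Sig σ)⁻¹ * D.X)⁻¹ * D.Xᵀ * (D.Sig σ)⁻¹) *ᵥ y, ?_⟩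
  have h1 := mul_nonsing_inv _ ((isUnit_iff_isUnit_det _).1 hσ.isUnit)
  have e : D.Sig σ * D.P σ + D.X * ((D.Xᵀ * (D.Sig σ)⁻¹ * D.X)⁻¹ * D.Xᵀ * (D.Sig σ)⁻¹) = 1 := by
    rw [P, Matrix.mul_sub, h1]
    have : D.Sig σ * ((D.Sig σ)⁻¹ * D.X * (D.Xᵀ * (D.Sig σ)⁻¹ * D.X)⁻¹ * D.Xᵀ * (D.Sig σ)⁻¹)
        = (D.Sig σ * (D.Sig σ)⁻¹) * (D.X * ((D.Xᵀ * (D.Sig σ)⁻¹ * D.X)⁻¹ * D.Xᵀ * (D.Sig σ)⁻¹)) := by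
      simp only [Matrix.mul_assoc]
    rw [this, h1, Matrix.one_mul, sub_add_cancel]
  rw [contrastLift, mulVec_mulVec, mulVec_mulVec, mulVec_mulVec, ← add_mulVec,
    Matrix.mul_assoc, ← D.P_eq_stdCtr h hσ, e, one_mulVec]

lemma apply_obs_of_invariant (hσ : (D.Sig σ).PosDef) {α : Type*} {f : (Fin D.n → ℝ) → α}
    (hf : ∀ y (b : Fin D.p → ℝ), f (y + D.X *ᵥ b) = f y) (β : Fin D.p → ℝ) (ω) :
    f (D.obs β ω) = f (D.contrastLift T σ (D.normErr T σ ω)) := by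
  obtain ⟨b, hb⟩ := D.exists_eq_contrastLift h hσ (D.obs β ω)
  rw [hb, hf, D.stdCtr_obs h hσ]

lemma g1_add_g2_nonneg (hτ : τ ∈ D.admissible) : 0 ≤ D.g1 m τ + D.g2 l m τ := by
  rw [← D.noiseCov_error l m h.injX hτ.2]; exact D.noiseCov_self_nonneg hτ.1 _ _

lemma g1_add_g2_le (hσ : (D.Sig σ).PosDef) (hτ : (D.Sig τ).PosDef) :
    D.g1 m τ + D.g2 l m τ ≤ D.g1 m σ + D.g2 l m σ + ∑ i, (τ i - σ i) * D.mseSlope l m σ i := by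
  rw [D.g1_add_g2_eq l m h.injX hτ hσ, D.P_eq_stdCtr h hτ, ← mulVec_mulVec, dotProduct_mulVec, ← mulVec_transpose]
  exact sub_le_self _ (dot_self_nonneg_real _)

/-- The derivative of `g_{M0}` along a line. -/
lemma hasDerivAt_gM0_line {τ δ : VarComp q} {t : ℝ} (ht : ∀ i, 0 < (τ + t • δ) i) (i : Fin (q + 1)) :
    HasDerivAt (fun x => D.gM0 (τ + x • δ) i) (-(1 / 2) * ∑ j, δ j *
      (((D.Sig (τ + t • δ))⁻¹ * D.V j * (D.Sig (τ + t • δ))⁻¹ * D.V i).trace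
        - (D.P (τ + t • δ) * D.V j * D.P (τ + t • δ) * D.V i).trace)) t := by
  set ρ := τ + t • δ with hρ
  set B := ∑ j, δ j • D.V j with hB
  have hp := D.posDef_of_pos ht
  have e : ∀ x : ℝ, D.Sig (τ + x • δ) = D.Sig ρ + (x - t) • B := fun x => by
    rw [D.Sig_eq_add ρ, hB, smul_sum]; congr 1; refine sum_congr rfl fun j _ => ?_
    rw [smul_smul]; congr 1; simp only [hρ, Pi.add_apply, Pi.smul_apply, smul_eq_mul]; ring
  have h2 := hasDerivAt_matrix_inv (D.posDef_contrast h hp).isUnit (Tᵀ * B * T) t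
    (traceFunctional (D.V i) ∘ₗ sandwich T Tᵀ)
  have hev : ∀ᶠ x in 𝓝 t, ∀ j, 0 < (τ + x • δ) j := by
    refine eventually_all.2 fun j => ?_
    have hc : ContinuousAt (fun x : ℝ => (τ + x • δ) j) t := by fun_prop
    exact hc.eventually (lt_mem_nhds (ht j))
  have h3 := ((hasDerivAt_matrix_inv hp.isUnit B t (traceFunctional (D.V i))).sub h2).const_mul (1 / 2)
  have htr : ∀ M : Matrix (Fin D.n) (Fin D.n) ℝ, (M * B * M * D.V i).trace
      = ∑ j, δ j * (M * D.V j * M * D.V i).trace := fun M => by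
    simp only [hB, Matrix.mul_sum, Matrix.sum_mul, Matrix.mul_smul, smul_mul, trace_sum, trace_smul, smul_eq_mul]
  refine (h3.congr_deriv ?_).congr_of_eventuallyEq ?_
  · have e2 : (traceFunctional (D.V i) ∘ₗ sandwich T Tᵀ) ((Tᵀ * D.Sig ρ * T)⁻¹ * (Tᵀ * B * T) *
        (Tᵀ * D.Sig ρ * T)⁻¹) = (D.P ρ * B * D.P ρ * D.V i).trace := by
      rw [D.P_eq_contrasts h.injX hp h.injT h.mul_X h.card]
      simp only [traceFunctional, sandwich, LinearMap.coe_comp, LinearMap.coe_mk, AddHom.coe_mk,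
        Function.comp_apply, Matrix.mul_assoc]
    rw [e2]; simp only [traceFunctional, LinearMap.coe_mk, AddHom.coe_mk]; rw [htr, htr]
    simp only [mul_sub, sum_sub_distrib]; ring
  · filter_upwards [hev] with x hx
    rw [gM0, Matrix.sub_mul, trace_sub, D.P_eq_contrasts h.injX (D.posDef_of_pos hx) h.injT h.mul_X h.card, e]
    simp only [Matrix.mul_add, Matrix.add_mul, Matrix.mul_smul, smul_mul]; rfl

lemma abs_gM0_sub_le {σ τ τ' : VarComp q} (hσ : ∀ i, 0 < σ i) (hτ : ∀ i, σ i / 2 < τ i)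
    (hτ' : ∀ i, σ i / 2 < τ' i) (i : Fin (q + 1)) :
    |D.gM0 τ' i - D.gM0 τ i| ≤ ∑ j, |τ' j - τ j| * (4 * D.p * ((σ j)⁻¹ * (σ i)⁻¹)) := by
  set δ := τ' - τ with hδ
  have hline : ∀ x ∈ Set.Icc (0 : ℝ) 1, ∀ j, σ j / 2 < (τ + x • δ) j := fun x hx j => by
    simp only [hδ, Pi.add_apply, Pi.smul_apply, Pi.sub_apply, smul_eq_mul]; have h1 := hτ j; have h2 := hτ' j
    rcases hx.1.eq_or_lt with h0 | h0
    · rw [← h0]; linarith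
    · nlinarith [hx.2]
  have hder : ∀ x ∈ Set.Icc (0 : ℝ) 1, HasDerivWithinAt (fun x => D.gM0 (τ + x • δ) i) _ (Set.Icc 0 1) x :=
    fun x hx => (D.hasDerivAt_gM0_line h (fun j => (half_pos (hσ j)).trans (hline x hx j)) i).hasDerivWithinAt
  have := norm_image_sub_le_of_norm_deriv_le_segment_01' hder
    (C := ∑ j, |τ' j - τ j| * (4 * D.p * ((σ j)⁻¹ * (σ i)⁻¹))) fun x hx => ?_
  · simpa [hδ] using this
  have hx' := hline x ⟨hx.1, hx.2.le⟩
  have hpos j := (half_pos (hσ j)).trans (hx' j)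
  rw [norm_mul, norm_eq_abs, abs_neg, abs_of_pos (by simp)]
  refine (mul_le_mul_of_nonneg_left (norm_sum_le _ _) (by norm_num)).trans ?_
  rw [mul_sum]; refine sum_le_sum fun j _ => ?_
  have h1 := D.abs_trace_sub_trace_le (D.posDef_of_pos hpos) h.injX hpos j i
  have hinv : ∀ j, ((τ + x • δ) j)⁻¹ ≤ 2 * (σ j)⁻¹ := fun j => by
    have := inv_anti₀ (half_pos (hσ j)) (hx' j).le
    rwa [inv_div, div_eq_mul_inv] at this
  have h2 := mul_le_mul (hinv j) (hinv i) (inv_nonneg.2 (hpos i).le) (by have := inv_pos.2 (hσ j); linarith)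
  have hp : (0 : ℝ) ≤ 2 * D.p := by positivity
  have h3 := mul_le_mul_of_nonneg_left h2 hp
  rw [norm_mul, norm_eq_abs, norm_eq_abs, mul_left_comm]; refine mul_le_mul_of_nonneg_left ?_ (abs_nonneg _)
  linarith

/-- The restricted information at a second parameter value is at least comparable. -/
lemma sum_trace_P_ge {σ τ : VarComp q} (hσ : ∀ i, 0 < σ i) (hτ : ∀ i, 0 < τ i) (hd : ∀ i, 0 < D.d σ i)
    {c : ℝ} (hc : 0 < c) (hcle : ∀ i, τ i ≤ c * σ i) (x : VarComp q) :
    c⁻¹ ^ 2 * (fun i => D.d σ i * x i) ⬝ᵥ (infoMat (D.normV T σ) *ᵥ fun i => D.d σ i * x i)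
      ≤ ∑ i, ∑ j, x i * x j * (1 / 2 * (D.P τ * D.V i * D.P τ * D.V j).trace) := by
  have pτ := D.posDef_of_pos hτ
  obtain ⟨hU, hU1⟩ := D.stdCtr_spec h (D.posDef_of_pos hσ)
  set U := D.stdCtr T σ
  set B := ∑ i, x i • D.V i with hB
  have hBt : Bᵀ = B := by rw [hB, transpose_sum]; simp only [transpose_smul, D.V_tr]
  have e1 : ∑ i, ∑ j, x i * x j * (1 / 2 * (D.P τ * D.V i * D.P τ * D.V j).trace)
      = 1 / 2 * (D.P τ * B * D.P τ * B).trace := by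
    simp only [hB, Matrix.sum_mul, Matrix.mul_smul, smul_mul, trace_sum, trace_smul, smul_eq_mul, mul_sum]
    rw [sum_comm]; refine sum_congr rfl fun i _ => sum_congr rfl fun j _ => by ring
  have e2 : (fun i => D.d σ i * x i) ⬝ᵥ (infoMat (D.normV T σ) *ᵥ fun i => D.d σ i * x i)
      = 1 / 2 * ((Uᵀ * B * U) * (Uᵀ * B * U)).trace := by
    have : Uᵀ * B * U = ∑ i, (D.d σ i * x i) • D.normV T σ i := by
      rw [hB, Matrix.mul_sum, Matrix.sum_mul]; refine sum_congr rfl fun i _ => ?_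
      rw [normV, smul_smul, Matrix.mul_smul, smul_mul]; congr 1; have := (hd i).ne'; field_simp
    rw [this]
    simp only [Matrix.sum_mul, Matrix.mul_smul, smul_mul, trace_sum,
      trace_smul, smul_eq_mul, dotProduct, mulVec, infoMat, of_apply, mul_sum]
    refine sum_congr rfl fun i _ => sum_congr rfl fun j _ => ?_
    rw [trace_mul_comm]; ring
  have e3 : (D.P τ * B * D.P τ * B).trace = ((Uᵀ * D.Sig τ * U)⁻¹ * (Uᵀ * B * U) *
      (Uᵀ * D.Sig τ * U)⁻¹ * (Uᵀ * B * U)).trace := by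
    have : D.P τ * B * D.P τ * B = U * ((Uᵀ * D.Sig τ * U)⁻¹ * (Uᵀ * B * U) * (Uᵀ * D.Sig τ * U)⁻¹ * Uᵀ * B) := by
      rw [D.P_eq_contrasts h.injX pτ hU.injT hU.mul_X hU.card]; simp only [Matrix.mul_assoc]
    rw [this, trace_mul_comm U]; simp only [Matrix.mul_assoc]
  have hM : (Uᵀ * B * U)ᵀ = Uᵀ * B * U := by simp only [transpose_mul, transpose_transpose, hBt, Matrix.mul_assoc]
  have e4 : ∀ (M : Matrix (Fin D.n) (Fin D.n) ℝ) (y : Fin (D.n - D.p) → ℝ),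
      y ⬝ᵥ (Uᵀ * M * U) *ᵥ y = U *ᵥ y ⬝ᵥ M *ᵥ U *ᵥ y := fun M y => by
    rw [Matrix.mul_assoc, ← mulVec_mulVec, dotProduct_mulVec, vecMul_transpose, mulVec_mulVec]
  have h1 := trace_inv_mul_ge (D.posDef_contrast hU pτ) hM hc fun y => by
    have h2 : y ⬝ᵥ y = U *ᵥ y ⬝ᵥ D.Sig σ *ᵥ U *ᵥ y := by rw [← e4, hU1, one_mulVec]
    rw [h2, e4, dot_Sig, dot_Sig, mul_sum]; refine sum_le_sum fun i _ => ?_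
    rw [← mul_assoc]; exact mul_le_mul_of_nonneg_right (hcle i) (psd_dot_nonneg (D.V_psd i) _)
  rw [e1, e2, e3]; linarith

lemma blup_sub_blup_add (hσ : (D.Sig σ).PosDef) (hτ : (D.Sig τ).PosDef) (y : Fin D.n → ℝ)
    (b : Fin D.p → ℝ) : D.blup l m τ (y + D.X *ᵥ b) - D.blup l m σ (y + D.X *ᵥ b)
      = D.blup l m τ y - D.blup l m σ y := by
  have h0 : ∀ v, D.P τ *ᵥ v ⬝ᵥ D.X *ᵥ b = 0 := fun v => by
    rw [dotProduct_comm, dot_symm (D.P_tr h.injX hτ), mulVec_mulVec,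
      D.P_mul_X h.injX hτ, zero_mulVec, zero_dotProduct]
  rw [D.blup_sub_blup l m h.injX hτ hσ, D.blup_sub_blup l m h.injX hτ hσ, dotProduct_add, h0, add_zero]

/-- The MSE of a predictor with estimated parameters, for an estimator based on the error contrasts. -/
lemma mse_eq_add (hσ : σ ∈ D.admissible) {est : (Fin D.n → ℝ) → VarComp q} (hm : Measurable est)
    (hadm : ∀ y, est y ∈ D.admissible) (hinv : ∀ y (b : Fin D.p → ℝ), est (y + D.X *ᵥ b) = est y) (β : Fin D.p → ℝ)
    (hL : MemLp (fun ω => D.blup l m (est (D.obs β ω)) (D.obs β ω) - D.blup l m σ (D.obs β ω)) 2 (D.noise σ)) :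
    Integrable (fun ω => (D.blup l m (est (D.obs β ω)) (D.obs β ω) - D.target l m β ω) ^ 2) (D.noise σ) ∧
    D.mse l m β σ est = D.g1 m σ + D.g2 l m σ
      + ∫ ω, (D.blup l m (est (D.obs β ω)) (D.obs β ω) - D.blup l m σ (D.obs β ω)) ^ 2 ∂(D.noise σ) := by
  set F := D.noiseForm (D.Zᵀ *ᵥ D.blupCoef l m σ - m) (D.blupCoef l m σ) with hF
  set Δ := fun ω => D.blup l m (est (D.obs β ω)) (D.obs β ω) - D.blup l m σ (D.obs β ω) with hΔ
  have hF2 : MemLp F 2 (D.noise σ) := D.memLp_noiseForm hσ.1 _ _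
  have e : ∀ ω, D.blup l m (est (D.obs β ω)) (D.obs β ω) - D.target l m β ω = F ω + Δ ω := fun ω => by
    rw [hF, ← D.blup_sub_target l m h.injX hσ.2 β ω, hΔ]; ring
  set f : (Fin (D.n - D.p) → ℝ) → ℝ := fun z =>
    D.blup l m (est (D.contrastLift T σ z)) (D.contrastLift T σ z) - D.blup l m σ (D.contrastLift T σ z) with hf
  have hfm : Measurable f := by
    have hl := D.meas_contrastLift T σ
    exact (D.meas_blup l m (hm.comp hl) hl).sub (D.meas_blup l m measurable_const hl)
  have hΔf : Δ = f ∘ D.normErr T σ := by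
    funext ω
    exact D.apply_obs_of_invariant h hσ.2 (f := fun y => D.blup l m (est y) y - D.blup l m σ y) (fun y b => by
      simp only [hinv]; exact D.blup_sub_blup_add l m h hσ.2 (hadm y).2 y b) β ω
  have hind : IndepFun F Δ (D.noise σ) := by rw [hΔf]; exact (D.indepFun_error l m h hσ.2 hσ.1).comp measurable_id hfm
  have h0 : ∫ ω, F ω * Δ ω ∂(D.noise σ) = 0 := by
    rw [hind.integral_fun_mul_eq_mul_integral hF2.1 hL.1, D.integral_noiseForm hσ.1, zero_mul]
  have i1 := hF2.integrable_sq
  have i2 := hL.integrable_sq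
  have i3 : Integrable (fun ω => F ω * Δ ω) (D.noise σ) := hF2.integrable_mul hL
  have i4 : Integrable (fun ω => F ω ^ 2 + Δ ω ^ 2) (D.noise σ) := i1.add i2
  have e2 : ∀ ω, (D.blup l m (est (D.obs β ω)) (D.obs β ω) - D.target l m β ω) ^ 2
      = F ω ^ 2 + Δ ω ^ 2 + 2 * (F ω * Δ ω) := fun ω => by rw [e]; ring
  simp_rw [mse, e2]; refine ⟨i4.add (i3.const_mul 2), ?_⟩
  rw [integral_add i4 (i3.const_mul 2), integral_add i1 i2, integral_const_mul, h0, mul_zero, add_zero,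
    D.integral_noiseForm_sq hσ.1, D.noiseCov_error l m h.injX hσ.2]

end Normalized

lemma isContrast_of_rank {T : Matrix (Fin D.n) (Fin (D.n - D.p)) ℝ}
    (hX : D.X.rank = D.p) (hpn : D.p < D.n) (hT : T.rank = D.n - D.p) (hTX : Tᵀ * D.X = 0) :
    D.IsContrast T where
  injX := mulVec_injective_of_rank (hX.trans (Fintype.card_fin _).symm)
  injT := mulVec_injective_of_rank (hT.trans (Fintype.card_fin _).symm)
  mul_X := hTX
  card := by simp only [Fintype.card_fin]; omega

end AnovaDesign

section Regime
variable (D : ℕ → AnovaDesign q) (T : ∀ k, Matrix (Fin (D k).n) (Fin ((D k).n - (D k).p)) ℝ)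
  (σ : VarComp q) (l : ∀ k, Fin (D k).p → ℝ) (m : ∀ k, (D k).RE → ℝ)
  (lik : ∀ k, VarComp q → (Fin (D k).n → ℝ) → ℝ) (bias : ℕ → VarComp q → VarComp q)
  (β : ∀ k, Fin (D k).p → ℝ) (est : ∀ k, (Fin (D k).n → ℝ) → VarComp q)
  (A : ℕ → VarComp q → Matrix (Fin (q + 1)) (Fin (q + 1)) ℝ) (H : ∀ k, ((D k).RE → ℝ) × (Fin (D k).n → ℝ) → ℝ)
  (N : ℕ → VarComp q → ℝ) (c : ℕ → ℝ)

/-- Mixed ANOVA models with increasing information in which the fixed effects are negligible. -/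
structure AnovaRegime : Prop where
  contrast : ∀ k, (D k).IsContrast (T k)
  pos : ∀ i, 0 < σ i
  scale : Tendsto (fun k => (D k).dstar σ) atTop atTop
  info : ∃ κ : ℝ, 0 < κ ∧ ∀ᶠ k in atTop, ∀ x, κ * x ⬝ᵥ x ≤ x ⬝ᵥ infoMat ((D k).normV (T k) σ) *ᵥ x
  random : ∃ C : ℝ, ∀ k, ∑ a, m k a ^ 2 ≤ C
  fixed : ∀ τ ∈ interior (paramSpace q), Tendsto (fun k => (D k).g2 (l k) (m k) τ) atTop (𝓝 0)

namespace AnovaRegime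

/-- The order of the normalized matrices. -/
def rate (k : ℕ) : ℝ := ((D k).dstar σ)⁻¹

/-- The inverse of the normalized information matrix. -/
def invInfo (k : ℕ) : Matrix (Fin (q + 1)) (Fin (q + 1)) ℝ := (infoMat ((D k).normV (T k) σ))⁻¹

/-- The shrinking neighbourhoods of the true parameter. -/
def near : Filter (ℕ × VarComp q) :=
  atTop.bind fun k => map (Prod.mk k) (𝓟 {τ | ‖(D k).normParam σ τ‖ ≤ rate D σ k ^ (-(1 / 4) : ℝ)})

/-- A sequence of expected Hessians asymptotically equivalent to the restricted one. -/
structure NormInfo : Prop where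
  near : ∀ i j, Tendsto (fun a : ℕ × VarComp q =>
    ((D a.1).d σ i)⁻¹ * ((D a.1).d σ j)⁻¹ * -(A a.1 a.2 i j) - infoMat ((D a.1).normV (T a.1) σ) i j)
    (near D σ) (𝓝 0)
  inv_bdd : ∀ τ : VarComp q, (∀ i, 0 < τ i) → ∃ C : ℝ, ∀ᶠ k in atTop, ∀ i j, |(-(A k τ))⁻¹ i j| ≤ C
  meas : ∀ k i j, ∃ f : VarComp q → ℝ, Measurable f ∧ ∀ τ ∈ (D k).admissible, A k τ i j = f τ

/-- A sequence of criterion functions whose scores differ from the restricted scores by a bounded bias. -/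
structure ScoreBias : Prop where
  score : ∀ k τ, ((D k).Sig τ).PosDef → ∀ y i, pderiv i (fun τ => lik k τ y) τ
    = 1 / 2 * (y ⬝ᵥ ((D k).P τ * (D k).V i * (D k).P τ) *ᵥ y - ((D k).P τ * (D k).V i).trace) - bias k τ i
  bdd : ∃ C : ℝ, 0 ≤ C ∧ ∀ᶠ k in atTop, ∀ i, |bias k σ i| ≤ C
  lip : ∃ C : ℝ, 0 ≤ C ∧ ∀ᶠ k in atTop, ∀ τ τ' : VarComp q, (∀ i, σ i / 2 < τ i) → (∀ i, σ i / 2 < τ' i) →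
    ∀ i, |bias k τ i - bias k τ' i| ≤ C * ∑ j, |τ j - τ' j|

/-- The leading term of `g₃`. -/
def quadTerm (k : ℕ) : ℝ :=
  ∑ i, ∑ j, (D k).normDir (l k) (m k) (T k) σ i ⬝ᵥ (D k).normDir (l k) (m k) (T k) σ j * invInfo D T σ k i j

/-- The leading term of the bias caused by a biased score. -/
def linTerm (b : ℕ → VarComp q) (k : ℕ) : ℝ :=
  ∑ i, (((D k).d σ i)⁻¹ * (D k).mseSlope (l k) (m k) σ i) * (invInfo D T σ k *ᵥ b k) i

/-- The normalized estimation error as a function of the standardized contrasts. -/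
def localParam (k : ℕ) (z : Fin ((D k).n - (D k).p) → ℝ) :
    VarComp q := (D k).normParam σ (est k ((D k).contrastLift (T k) σ z))

/-- The contrasts at which the estimator is a small approximate root of the score equations. -/
def goodSet
    (k : ℕ) : Set (Fin ((D k).n - (D k).p) → ℝ) :=
  {z | (∀ i, |stdScore ((D k).normV (T k) σ) (localParam D T σ est k z) z i - ((D k).d σ i)⁻¹ * bias k σ i|
      ≤ rate D σ k ^ (3 / 2 : ℝ)) ∧ ∀ i, |localParam D T σ est k z i| ≤ rate D σ k ^ (-(1 / 40) : ℝ)}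

open Classical in
/-- The normalized estimation error, set to zero at exceptional contrasts. -/
def trimmedParam
    (k : ℕ) (z : Fin ((D k).n - (D k).p) → ℝ) : VarComp q :=
  if z ∈ goodSet D T σ bias est k then localParam D T σ est k z else 0

/-- A square integrable envelope of the predictors which is negligible on rare events. -/
structure BlupEnvelope : Prop where
  memLp : ∀ k, MemLp (H k) 2 ((D k).noise σ)
  bound : ∀ k, ∀ τ ∈ (D k).admissible, ∀ ω, |(D k).blup (l k) (m k) τ ((D k).obs (β k) ω)| ≤ H k ω
  rare : ∀ B : ∀ k, Set (((D k).RE → ℝ) × (Fin (D k).n → ℝ)), (∀ k, MeasurableSet (B k)) →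
    (∀ g : ℝ, 0 < g → ∃ c : ℝ, ∀ᶠ k in atTop, ((D k).noise σ).real (B k) ≤ c * rate D σ k ^ g) →
    (fun k => ∫ ω in B k, H k ω ^ 2 ∂((D k).noise σ)) =o[atTop] fun k => rate D σ k ^ 2

/-- The second order expansion of `g₁ + g₂ + 2 g₃ - c` at the estimate, as a function of the data. -/
def plugIn (k : ℕ) (x : VarComp q) : ℝ :=
  (D k).g1 (m k) σ + (D k).g2 (l k) (m k) σ + 2 * quadTerm D T σ l m k - c k
    + ∑ i, ((D k).d σ i)⁻¹ * (D k).mseSlope (l k) (m k) σ i * x i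
    - (∑ i, x i • (D k).normDir (l k) (m k) (T k) σ i) ⬝ᵥ (resolv ((D k).normV (T k) σ) x *ᵥ
        ∑ i, x i • (D k).normDir (l k) (m k) (T k) σ i)

/-- The parameter with given normalized deviation from the true one. -/
def shiftParam (k : ℕ) (x : VarComp q) : VarComp q :=
  fun i => σ i + ((D k).d σ i)⁻¹ * x i

/-- A quasi-Newton step for the score equations in normalized coordinates. -/
def newtonStep (k : ℕ) (z : Fin ((D k).n - (D k).p) → ℝ)
    (x : VarComp q) : VarComp q := x + invInfo D T σ k *ᵥ fun i => stdScore ((D k).normV (T k) σ) x z i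
    - ((D k).d σ i)⁻¹ * bias k (shiftParam D σ k x) i

/-- The limit of the quasi-Newton iterates started at the true parameter. -/
def newtonLimit (k : ℕ) (z : Fin ((D k).n - (D k).p) → ℝ) :
    VarComp q := limUnder atTop fun j => (newtonStep D T σ bias k z)^[j] 0

open Classical in
/-- An estimator solving the score equations with high probability. -/
def rootEst (k : ℕ) (y : Fin (D k).n → ℝ) : VarComp q :=
  if ∀ i, σ i / 2 ≤ shiftParam D σ k (newtonLimit D T σ bias k (((D k).stdCtr (T k) σ)ᵀ *ᵥ y)) i
  then shiftParam D σ k (newtonLimit D T σ bias k (((D k).stdCtr (T k) σ)ᵀ *ᵥ y)) else σ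

variable {D T σ l m lik bias β est A H N c}

lemma eventually_near {p : ℕ × VarComp q → Prop} : (∀ᶠ a in near D σ, p a) ↔
    ∀ᶠ k in atTop, ∀ τ, ‖(D k).normParam σ τ‖ ≤ rate D σ k ^ (-(1 / 4) : ℝ) → p (k, τ) := by
  rw [near, eventually_bind]; simp only [eventually_map, eventually_principal, Set.mem_ofPred_eq]

lemma tendsto_fst_near : Tendsto Prod.fst (near D σ) atTop := by
  refine fun s hs => eventually_near.2 ?_
  filter_upwards [hs] with k hk τ _ using hk

lemma meas_localParam (he : ∀ k, Measurable (est k)) (k : ℕ) : Measurable (localParam D T σ est k) := by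
  refine measurable_pi_lambda _ fun i => ?_
  exact (((measurable_pi_apply i).comp ((he k).comp ((D k).meas_contrastLift (T k) σ))).sub_const _).const_mul _

lemma measSet_goodSet (he : ∀ k, Measurable (est k)) (k : ℕ) : MeasurableSet (goodSet D T σ bias est k) := by
  have h1 := meas_localParam (T := T) (σ := σ) he k
  have e : goodSet D T σ bias est k = (⋂ i, {z | |stdScore ((D k).normV (T k) σ) (localParam D T σ est k z) z i
      - ((D k).d σ i)⁻¹ * bias k σ i| ≤ rate D σ k ^ (3 / 2 : ℝ)}) ∩
      ⋂ i, {z | |localParam D T σ est k z i| ≤ rate D σ k ^ (-(1 / 40) : ℝ)} := by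
    ext z; simp [goodSet]
  rw [e]
  exact (MeasurableSet.iInter fun i => measurableSet_le
    (((meas_stdScore _ h1 measurable_id i).sub_const _).norm) measurable_const).inter
    (MeasurableSet.iInter fun i => measurableSet_le ((measurable_pi_apply i).comp h1).norm measurable_const)

lemma trimmedParam_of_mem {k : ℕ} {z} (hz : z ∈ goodSet D T σ bias est k) :
    trimmedParam D T σ bias est k z = localParam D T σ est k z := if_pos hz

lemma trimmedParam_of_notMem {k : ℕ} {z} (hz : z ∉ goodSet D T σ bias est k) :
    trimmedParam D T σ bias est k z = 0 := if_neg hz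

lemma meas_trimmedParam (he : ∀ k, Measurable (est k)) (k : ℕ) : Measurable (trimmedParam D T σ bias est k) :=
  Measurable.ite (measSet_goodSet he k) (meas_localParam he k) measurable_const

lemma integrable_truncateAt (he : IsScoreRoot D β σ lik est) {k : ℕ}
    (hN : ∃ f : VarComp q → ℝ, Measurable f ∧ ∀ τ ∈ (D k).admissible, N k τ = f τ) (b f : ℝ) :
    Integrable (fun ω => truncateAt b f (N k (est k ((D k).obs (β k) ω)))) ((D k).noise σ) := by
  obtain ⟨g, hg, hgN⟩ := hN
  have e : ∀ ω, N k (est k ((D k).obs (β k) ω)) = g (est k ((D k).obs (β k) ω)) := fun ω => hgN _ (he.mem k _)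
  simp_rw [e]
  refine Integrable.of_bound ((meas_truncateAt b f).comp (hg.comp ((he.measurable k).comp
    ((D k).meas_obs (β k))))).aestronglyMeasurable (|b| + |f|) (ae_of_all _ fun ω => abs_truncateAt_le _ _ _)

/-- A matrix function with measurable modifications of its entries. -/
lemma exists_meas_matrix (hA : NormInfo D T σ A) (k : ℕ) :
    ∃ F : VarComp q → Matrix (Fin (q + 1)) (Fin (q + 1)) ℝ, (∀ i j, Measurable fun τ => F τ i j) ∧
      ∀ τ ∈ (D k).admissible, A k τ = F τ := by
  choose f hf hfA using hA.meas k
  exact ⟨fun τ => of fun i j => f i j τ, hf, fun τ hτ => Matrix.ext fun i j => hfA i j τ hτ⟩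

lemma exists_meas_etaTwo (hA : NormInfo D T σ A) (k : ℕ) : ∃ f : VarComp q → ℝ, Measurable f ∧
    ∀ τ ∈ (D k).admissible, (D k).etaTwo (A k) (l k) (m k) τ = f τ := by
  obtain ⟨F, hF, hFA⟩ := exists_meas_matrix hA k
  have hinv := meas_matrix_inv fun i j => (hF i j).neg
  have hg3 : Measurable fun τ => ∑ i, ∑ j, (D k).sGram (m k) τ i j * (-(F τ))⁻¹ j i :=
    Finset.measurable_fun_sum _ fun i _ => Finset.measurable_fun_sum _ fun j _ =>
      ((D k).meas_sGram (m k) measurable_id i j).mul (hinv j i)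
  refine ⟨_, (((D k).meas_g1 (m k) measurable_id).add ((D k).meas_g2 (l k) (m k) measurable_id)).add
    (hg3.const_mul 2), fun τ hτ => ?_⟩
  rw [AnovaDesign.etaTwo, (D k).g3_eq (m k) hτ.2, hFA τ hτ]; rfl

lemma exists_meas_g10 (hA : NormInfo D T σ fun k => (D k).AM) (k : ℕ) : ∃ f : VarComp q → ℝ, Measurable f ∧
    ∀ τ ∈ (D k).admissible, (D k).g10 (m k) τ = f τ := by
  obtain ⟨F, hF, hFA⟩ := exists_meas_matrix hA k
  refine ⟨_, meas_dot ((D k).meas_g1Slope (m k) measurable_id) (meas_matrix_mulVec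
    (meas_matrix_inv hF) ((D k).meas_gM0 measurable_id)), fun τ hτ => ?_⟩
  have e : (fun i => pderiv i ((D k).g1 (m k)) τ) = (D k).g1Slope (m k) τ :=
    funext fun i => (D k).pderiv_g1 (m k) hτ.2 i
  rw [AnovaDesign.g10, hFA τ hτ, e]; rfl

lemma tendsto_near_true : Tendsto (fun k => (k, σ)) atTop (near D σ) := by
  intro s hs; rw [Filter.mem_map]
  filter_upwards [eventually_near.1 hs] with k hk
  refine hk σ ?_
  have : (D k).normParam σ σ = 0 := by funext i; simp [AnovaDesign.normParam]
  rw [this, norm_zero]; exact rpow_nonneg (inv_nonneg.2 ((D k).dstar_nonneg σ)) _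

section Measurability

lemma meas_shiftParam (k : ℕ) : Measurable (shiftParam D σ k) :=
  measurable_pi_lambda _ fun i => ((measurable_pi_apply i).const_mul _).const_add _

variable (hb : ∀ k i, Measurable fun τ => bias k τ i)
include hb

lemma meas_newtonIterate (k j : ℕ) : Measurable fun z => (newtonStep D T σ bias k z)^[j] 0 := by
  induction j with
  | zero => exact measurable_const
  | succ j ih =>
    simp only [Function.iterate_succ_apply']; refine ih.add (measurable_pi_lambda _ fun i => ?_)
    exact meas_matrix_mulVec (by simp) (fun i => ((meas_stdScore _ ih measurable_id i).sub
      (((hb k i).comp ((meas_shiftParam k).comp ih)).const_mul _))) i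

lemma meas_newtonLimit (k : ℕ) : Measurable (newtonLimit D T σ bias k) :=
  (StronglyMeasurable.limUnder fun j => (meas_newtonIterate hb k j).stronglyMeasurable).measurable

lemma meas_rootEst (k : ℕ) : Measurable (rootEst D T σ bias k) := by
  have h1 : Measurable fun y => shiftParam D σ k (newtonLimit D T σ bias k (((D k).stdCtr (T k) σ)ᵀ *ᵥ y)) :=
    (meas_shiftParam k).comp ((meas_newtonLimit hb k).comp (meas_mulVec _))
  refine Measurable.ite ?_ h1 measurable_const
  have : MeasurableSet (⋂ i, {y | σ i / 2 ≤ shiftParam D σ k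
      (newtonLimit D T σ bias k (((D k).stdCtr (T k) σ)ᵀ *ᵥ y)) i}) :=
    MeasurableSet.iInter fun i => measurableSet_le measurable_const ((measurable_pi_apply i).comp h1)
  convert this using 1
  ext y; simp

end Measurability

lemma newtonLimit_neg (k : ℕ) (z) : newtonLimit D T σ bias k (-z) = newtonLimit D T σ bias k z := by
  have : newtonStep D T σ bias k (-z) = newtonStep D T σ bias k z := by
    funext x; rw [newtonStep, newtonStep, stdScore_neg]
  rw [newtonLimit, newtonLimit, this]

lemma normParam_shiftParam {k : ℕ} (hd : ∀ i, 0 < (D k).d σ i) (x : VarComp q) :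
    (D k).normParam σ (shiftParam D σ k x) = x := by
  funext i; rw [AnovaDesign.normParam, shiftParam, add_sub_cancel_left, mul_inv_cancel_left₀ (hd i).ne']

lemma of_rank (hrank : ∀ k, (D k).X.rank = (D k).p) (hpn : ∀ k, (D k).p < (D k).n)
    (hTrank : ∀ k, (T k).rank = (D k).n - (D k).p) (hTX : ∀ k, (T k)ᵀ * (D k).X = 0)
    (hσ : σ ∈ interior (paramSpace q)) (hd : Tendsto (fun k => (D k).dstar σ) atTop atTop)
    (hA : ∃ κ : ℝ, 0 < κ ∧ ∀ᶠ k in atTop,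
      (-(Matrix.diagonal (fun i => ((D k).d σ i)⁻¹) * (D k).AR (T k) σ *
          Matrix.diagonal (fun i => ((D k).d σ i)⁻¹)) -
        κ • (1 : Matrix (Fin (q + 1)) (Fin (q + 1)) ℝ)).PosSemidef)
    (hm : ∃ C : ℝ, ∀ k, ∑ a, m k a ^ 2 ≤ C)
    (hg2 : ∀ τ ∈ interior (paramSpace q), Tendsto (fun k => (D k).g2 (l k) (m k) τ) atTop (𝓝 0)) :
    AnovaRegime D T σ l m := by
  have hc k := (D k).isContrast_of_rank (hrank k) (hpn k) (hTrank k) (hTX k)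
  have hpos := mem_interior_paramSpace.1 hσ
  refine ⟨hc, hpos, hd, ?_, hm, hg2⟩
  obtain ⟨κ, hκ, hk⟩ := hA
  refine ⟨κ, hκ, hk.mono fun k hk x => ?_⟩
  rw [(D k).infoMat_normV (hc k) ((D k).posDef_of_pos hpos) (interior_subset hσ)]
  exact coercive_of_psd_sub hk x

lemma linTerm_zero (k : ℕ) : linTerm D T σ l m (fun k i => ((D k).d σ i)⁻¹ * 0) k = 0 := by
  simp only [linTerm, mul_zero]
  exact Finset.sum_eq_zero fun i _ => by
    rw [show (fun _ : Fin (q + 1) => (0 : ℝ)) = 0 from rfl, Matrix.mulVec_zero, Pi.zero_apply, mul_zero]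

variable (h : AnovaRegime D T σ l m)
include h

lemma posDef (k : ℕ) : ((D k).Sig σ).PosDef := (D k).posDef_of_pos h.pos

lemma mem_paramSpace : σ ∈ paramSpace q := fun i => (h.pos i).le

lemma mem_admissible (k : ℕ) : σ ∈ (D k).admissible := ⟨h.mem_paramSpace, h.posDef k⟩

lemma injX (k : ℕ) : Function.Injective (D k).X.mulVec := (h.contrast k).injX

lemma smallScale : SmallScale (rate D σ) where
  pos := by filter_upwards [h.scale.eventually_gt_atTop 0] with k hk using inv_pos.2 hk
  tendsto := tendsto_inv_atTop_zero.comp h.scale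

lemma d_pos : ∀ᶠ k in atTop, ∀ i, 0 < (D k).d σ i := by
  filter_upwards [h.scale.eventually_gt_atTop 0] with k hk i using hk.trans_le ((D k).dstar_le σ i)

lemma d_inv_le : ∀ᶠ k in atTop, ∀ i, ((D k).d σ i)⁻¹ ≤ rate D σ k := by
  filter_upwards [h.scale.eventually_gt_atTop 0] with k hk i
  exact inv_anti₀ hk ((D k).dstar_le σ i)

lemma exists_abs_normDir_le : ∃ B : ℝ, ∀ᶠ k in atTop, ∀ i,
    vnorm ((D k).normDir (l k) (m k) (T k) σ i) ≤ B * rate D σ k := by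
  choose C hC0 hC using fun i => AnovaDesign.exists_abs_blupDir_le
    h.pos h.random h.injX h.fixed i
  refine ⟨sqrt (∑ i, C i), ?_⟩
  filter_upwards [eventually_all.2 hC, h.d_inv_le, h.smallScale.pos] with k h1 h2 h3 i
  refine abs_le_of_sq_le_sq' ?_ (by positivity) |>.2
  rw [(D k).vnorm_normDir_sq (l k) (m k) (h.contrast k) (h.posDef k), mul_pow,
    sq_sqrt (sum_nonneg fun i _ => hC0 i), mul_comm]
  refine mul_le_mul ((h1 i).trans (single_le_sum (fun i _ => hC0 i) (mem_univ i)))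
    (pow_le_pow_left₀ (inv_nonneg.2 ((D k).d_nonneg σ i)) (h2 i) 2) (by positivity) (sum_nonneg fun i _ => hC0 i)

/-- Standardized contrasts form a canonical Gaussian model. -/
lemma canonicalModel : ∃ C : ℝ, CanonicalModel (fun k => (D k).noise σ) (rate D σ)
    (fun k => (D k).normErr (T k) σ) (fun k => (D k).normV (T k) σ) (invInfo D T σ) C := by
  obtain ⟨κ, hκ, hinfo⟩ := h.info
  have hs0 i := inv_nonneg.2 (h.pos i).le
  have hS0 : 0 ≤ ∑ i, (σ i)⁻¹ := sum_nonneg fun i _ => hs0 i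
  refine ⟨∑ i, (σ i)⁻¹ + κ⁻¹, h.smallScale, ⟨fun k => (D k).meas_normErr (h.contrast k) (h.posDef k),
    fun k => (D k).map_normErr (h.contrast k) (h.posDef k) h.mem_paramSpace⟩, by positivity,
    fun k => (D k).normV_tr (h.contrast k) (h.posDef k), ?_, ?_, ?_, ?_⟩
  · filter_upwards [h.d_inv_le, h.smallScale.pos] with k h1 h2 i
    refine ((D k).opNorm_normV_le (h.contrast k) (h.posDef k) h.pos i).trans ?_
    rw [mul_comm]; refine mul_le_mul ?_ (h1 i) (inv_nonneg.2 ((D k).d_nonneg σ i)) (by positivity)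
    have := single_le_sum (fun i _ => hs0 i) (mem_univ i)
    have := inv_pos.2 hκ
    linarith
  · exact Eventually.of_forall fun k i => (D k).fro_normV_le (h.contrast k) (h.posDef k) i
  · filter_upwards [hinfo] with k hk
    exact nonsing_inv_mul _ ((isUnit_iff_isUnit_det _).1 (coercive_inv hκ hk).1)
  · filter_upwards [hinfo] with k hk i j
    exact ((coercive_inv hκ hk).2 i j).trans (by linarith)

lemma tendsto_near_param (i : Fin (q + 1)) : Tendsto (fun a : ℕ × VarComp q => a.2 i) (near D σ) (𝓝 (σ i)) := by
  rw [tendsto_iff_norm_sub_tendsto_zero]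
  have h1 := (h.smallScale.rpow_tendsto (r := 3 / 4) (by norm_num)).comp (tendsto_fst_near (D := D) (σ := σ))
  refine squeeze_zero' (by simp) ?_ h1
  refine eventually_near.2 ?_
  filter_upwards [h.d_pos, h.d_inv_le, h.smallScale.pos] with k h1 h2 h3 τ hτ
  have h4 := (norm_le_pi_norm _ i).trans hτ
  rw [AnovaDesign.normParam, norm_mul, norm_of_nonneg (h1 i).le, ← le_div_iff₀' (h1 i)] at h4; refine h4.trans ?_
  calc _ ≤ rate D σ k ^ (-(1 / 4) : ℝ) * rate D σ k := mul_le_mul_of_nonneg_left (h2 i) (by positivity)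
    _ = rate D σ k ^ (3 / 4 : ℝ) := by nth_rewrite 2 [← rpow_one (rate D σ k)]; rw [← rpow_add h3]; norm_num

lemma eventually_near_pos : ∀ᶠ a in near D σ, ∀ i, σ i / 2 < a.2 i :=
  eventually_all.2 fun i => (h.tendsto_near_param i).eventually (lt_mem_nhds (half_lt_self (h.pos i)))

lemma tendsto_near_resolv : Tendsto (fun a : ℕ × VarComp q =>
    ‖resolv ((D a.1).normV (T a.1) σ) ((D a.1).normParam σ a.2) - 1‖) (near D σ) (𝓝 0) := by
  have e : ∀ a : ℕ × VarComp q, resolv ((D a.1).normV (T a.1) σ) ((D a.1).normParam σ a.2)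
      = resolv (fun i => (D a.1).d σ i • (D a.1).normV (T a.1) σ i) (a.2 - σ) := fun a => by
    rw [resolv, resolv, pert, pert]; simp only [smul_smul, AnovaDesign.normParam, Pi.sub_apply]; congr 2
    exact sum_congr rfl fun i _ => by rw [mul_comm]
  simp_rw [e]
  refine tendsto_norm_resolv_sub_one (fun i => ⟨(σ i)⁻¹, inv_nonneg.2 (h.pos i).le,
    Eventually.of_forall fun a => ?_⟩) fun i => ?_
  · rw [norm_smul, norm_of_nonneg ((D a.1).d_nonneg σ i)]
    refine (mul_le_mul_of_nonneg_left ((D a.1).opNorm_normV_le (h.contrast a.1) (h.posDef a.1) h.pos i)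
      ((D a.1).d_nonneg σ i)).trans ?_
    rw [← mul_assoc]; exact mul_le_of_le_one_left (inv_nonneg.2 (h.pos i).le) mul_inv_le_one
  · simpa using (h.tendsto_near_param i).sub_const (σ i)

/-- Uniform convergence of the normalized restricted information. -/
lemma tendsto_near_trace (i j : Fin (q + 1)) : Tendsto (fun a : ℕ × VarComp q =>
    ((D a.1).d σ i)⁻¹ * ((D a.1).d σ j)⁻¹ * (1 / 2 * ((D a.1).P a.2 * (D a.1).V i * (D a.1).P a.2 * (D a.1).V j).trace)
      - infoMat ((D a.1).normV (T a.1) σ) i j) (near D σ) (𝓝 0) := by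
  have h1 := h.tendsto_near_resolv
  have h2 := (h1.add ((h1.add_const 1).mul h1)).const_mul (1 / 2)
  simp only [zero_add, mul_zero] at h2; refine squeeze_zero_norm' ?_ h2
  filter_upwards [h.eventually_near_pos, tendsto_fst_near.eventually h.d_pos] with a h3 h4
  have hτ := (D a.1).posDef_of_pos fun i => (half_pos (h.pos i)).trans (h3 i)
  have hf := (D a.1).fro_normV_le (h.contrast a.1) (h.posDef a.1)
  set R := (D a.1).normV (T a.1) σ
  set W := resolv R ((D a.1).normParam σ a.2)
  have hW1 : ‖W‖ ≤ ‖W - 1‖ + 1 := by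
    have := norm_add_le (W - 1) 1
    rw [sub_add_cancel] at this; exact this.trans (add_le_add_right opNorm_one_le _)
  have e : ((D a.1).d σ i)⁻¹ * ((D a.1).d σ j)⁻¹ *
      (1 / 2 * ((D a.1).P a.2 * (D a.1).V i * (D a.1).P a.2 * (D a.1).V j).trace) - infoMat R i j
      = 1 / 2 * ((R i * ((W - 1) * R j)).trace + ((W * R j) * ((W - 1) * R i)).trace) := by
    have e1 : (W * R i * W * R j).trace = (R i * R j).trace + (R i * ((W - 1) * R j)).trace
        + ((W * R j) * ((W - 1) * R i)).trace := by
      rw [trace_mul_comm (W * R j), ← trace_add, ← trace_add]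
      noncomm_ring
    rw [infoMat, of_apply, ← mul_left_comm, (D a.1).trace_P_eq (h.contrast a.1) (h.posDef a.1) h4 hτ i j, e1]; ring
  rw [e, norm_mul, norm_of_nonneg (by simp)]
  refine mul_le_mul_of_nonneg_left ((norm_add_le _ _).trans (add_le_add ?_ ?_)) (by norm_num)
  · have := abs_trace_mul_le_of_le (hf i) (traceNormTwo_mul_le_of_le (le_refl ‖W - 1‖) (hf j))
    simpa using this
  · have := abs_trace_mul_le_of_le (traceNormTwo_mul_le_of_le hW1 (hf j))
      (traceNormTwo_mul_le_of_le (le_refl ‖W - 1‖) (hf i))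
    simpa using this

lemma isUnit_infoMat : ∀ᶠ k in atTop, IsUnit (infoMat ((D k).normV (T k) σ)) := by
  obtain ⟨κ, hκ, hinfo⟩ := h.info
  filter_upwards [hinfo] with k hk using (coercive_inv hκ hk).1

lemma exists_abs_invInfo_le : ∃ C : ℝ, 0 ≤ C ∧ ∀ᶠ k in atTop, ∀ i j, |invInfo D T σ k i j| ≤ C := by
  obtain ⟨κ, hκ, hinfo⟩ := h.info
  exact ⟨κ⁻¹, inv_nonneg.2 hκ.le, hinfo.mono fun k hk => (coercive_inv hκ hk).2⟩

lemma exists_norm_invInfo_le : ∃ C : ℝ, ∀ᶠ k in atTop, ‖invInfo D T σ k‖ ≤ C := by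
  obtain ⟨C, hC0, hC⟩ := h.exists_abs_invInfo_le
  refine ⟨sqrt (∑ _i : Fin (q + 1), ∑ _j : Fin (q + 1), C ^ 2), hC.mono fun k hk => ?_⟩
  refine (opNorm_le_fro _).trans (le_sqrt_of_sq_le ?_)
  rw [fro_sq_eq_sum_sq]; refine sum_le_sum fun i _ => sum_le_sum fun j _ => ?_
  rw [← sq_abs]; exact pow_le_pow_left₀ (abs_nonneg _) (hk _ _) 2

lemma invInfo_symm (k : ℕ) (i j : Fin (q + 1)) : invInfo D T σ k i j = invInfo D T σ k j i := by
  have := tr_inv_of_symm (infoMat_tr ((D k).normV (T k) σ))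
  exact congrFun (congrFun this j) i

lemma isLittleO_weight {e : ℕ × VarComp q → ℝ} (he : Tendsto e (near D σ) (𝓝 0)) (i j : Fin (q + 1)) :
    (fun a => ((D a.1).d σ i)⁻¹ * ((D a.1).d σ j)⁻¹ * e a) =o[near D σ] fun a => rate D σ a.1 ^ 2 := by
  have h1 : (fun a : ℕ × VarComp q => ((D a.1).d σ i)⁻¹ * ((D a.1).d σ j)⁻¹)
      =O[near D σ] fun a => rate D σ a.1 ^ 2 := by
    refine IsBigO.of_bound 1 ?_
    filter_upwards [tendsto_fst_near.eventually h.d_inv_le] with a ha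
    have h0 := fun i => inv_nonneg.2 ((D a.1).d_nonneg σ i)
    rw [one_mul, norm_of_nonneg (mul_nonneg (h0 i) (h0 j)), norm_of_nonneg (sq_nonneg _), pow_two]
    exact mul_le_mul (ha i) (ha j) (h0 j) ((h0 i).trans (ha i))
  simpa using h1.mul_isLittleO ((isLittleO_one_iff ℝ).2 he)

lemma tendsto_near_inv (hA : NormInfo D T σ A) (i j : Fin (q + 1)) :
    Tendsto (fun a : ℕ × VarComp q => (D a.1).d σ i * (D a.1).d σ j * (-(A a.1 a.2))⁻¹ i j
      - invInfo D T σ a.1 i j) (near D σ) (𝓝 0) := by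
  obtain ⟨C, hC⟩ := h.exists_norm_invInfo_le
  set Λ : ℕ → Matrix (Fin (q + 1)) (Fin (q + 1)) ℝ := fun k => diagonal fun i => ((D k).d σ i)⁻¹
  have h1 := tendsto_inv_sub_inv (F := near D σ) (M := fun a => Λ a.1 * -(A a.1 a.2) * Λ a.1)
    (fun i j => ?_)
    (tendsto_fst_near.eventually h.isUnit_infoMat) (tendsto_fst_near.eventually hC) i j
  · refine h1.congr' ?_
    filter_upwards [tendsto_fst_near.eventually h.d_pos] with a ha
    have hΛ : (Λ a.1)⁻¹ = diagonal fun i => (D a.1).d σ i := by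
      refine inv_eq_right_inv ?_
      rw [diagonal_mul_diagonal, ← diagonal_one]; congr 1; funext i; exact inv_mul_cancel₀ (ha i).ne'
    rw [invInfo, Matrix.mul_inv_rev, Matrix.mul_inv_rev, hΛ, ← Matrix.mul_assoc, mul_diagonal, diagonal_mul]; ring
  · refine (hA.near i j).congr fun a => ?_
    rw [mul_diagonal, diagonal_mul, Matrix.neg_apply]; ring

lemma isLittleO_g3 (hA : NormInfo D T σ A) :
    (fun a : ℕ × VarComp q => (D a.1).g3 (A a.1) (m a.1) a.2 - quadTerm D T σ l m a.1)
      =o[near D σ] fun a => rate D σ a.1 ^ 2 := by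
  obtain ⟨C, hC0, hC⟩ := h.exists_abs_invInfo_le
  have hfix : ∀ τ ∈ interior (paramSpace q), Tendsto (fun a : ℕ × VarComp q =>
      (D a.1).g2 (l a.1) (m a.1) τ) (near D σ) (𝓝 0) := fun τ hτ => (h.fixed τ hτ).comp tendsto_fst_near
  obtain ⟨Cm, hCm⟩ := h.random
  have hG := fun i j => AnovaDesign.tendsto_sGram_sub_blupDir (F := near D σ)
    h.pos ⟨Cm, fun a => hCm a.1⟩
    (fun a => h.injX a.1) hfix h.tendsto_near_param i j
  have hterm : ∀ i j, Tendsto (fun a : ℕ × VarComp q => (D a.1).sGram (m a.1) a.2 i j *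
      ((D a.1).d σ j * (D a.1).d σ i * (-(A a.1 a.2))⁻¹ j i)
      - (D a.1).blupDir (l a.1) (m a.1) σ i ⬝ᵥ (D a.1).P σ *ᵥ (D a.1).blupDir (l a.1) (m a.1) σ j
        * invInfo D T σ a.1 j i) (near D σ) (𝓝 0) := fun i j => by
    obtain ⟨Cs, hCs⟩ := AnovaDesign.exists_abs_sGram_le (F := near D σ)
      h.pos ⟨Cm, fun a => hCm a.1⟩ i j
    have hGσ := AnovaDesign.tendsto_sGram_sub (F := near D σ)
      h.pos ⟨Cm, fun a => hCm a.1⟩ h.tendsto_near_param i j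
    have hGσ' := AnovaDesign.tendsto_sGram_sub (F := near D σ)
      h.pos ⟨Cm, fun a => hCm a.1⟩ (fun _ => tendsto_const_nhds) i j
    have hb : (fun a : ℕ × VarComp q => (D a.1).sGram (m a.1) a.2 i j) =O[near D σ] fun _ => (1 : ℝ) := by
      have h3 := hGσ.sub hGσ'
      simp only [sub_sub_sub_cancel_right, sub_zero] at h3
      have h4 := ((isLittleO_one_iff ℝ).2 h3).isBigO.add (IsBigO.of_bound Cs
        (by simpa using hCs))
      grind
    have hJ : (fun a : ℕ × VarComp q => invInfo D T σ a.1 j i) =O[near D σ] fun _ => (1 : ℝ) :=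
      IsBigO.of_bound C (by simpa using (tendsto_fst_near.eventually hC).mono fun a ha => ha j i)
    have t1 := hb.mul_isLittleO ((isLittleO_one_iff ℝ).2 ((fun i j => h.tendsto_near_inv hA i j) j i))
    have t2 := ((isLittleO_one_iff ℝ).2 (hG i j)).mul_isBigO hJ
    simp only [mul_one] at t1 t2; refine ((isLittleO_one_iff ℝ).1 (t1.add t2)).congr fun a => ?_
    ring
  have hsum := IsLittleO.fun_sum fun i (_ : i ∈ univ) => IsLittleO.fun_sum fun j (_ : j ∈ univ) =>
    h.isLittleO_weight (hterm i j) i j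
  refine hsum.congr' ?_ EventuallyEq.rfl
  filter_upwards [h.eventually_near_pos, tendsto_fst_near.eventually h.d_pos] with a h3 h4
  have hτ := (D a.1).posDef_of_pos fun i => (half_pos (h.pos i)).trans (h3 i)
  rw [(D a.1).g3_eq (m a.1) hτ, quadTerm, ← sum_sub_distrib]; refine sum_congr rfl fun i _ => ?_
  rw [← sum_sub_distrib]; refine sum_congr rfl fun j _ => ?_
  rw [(D a.1).normDir_dot (l a.1) (m a.1) (h.contrast a.1) (h.posDef a.1), h.invInfo_symm a.1 j i]
  grind

lemma exists_abs_mseSlope_le : ∃ C : ℝ, 0 ≤ C ∧ ∀ᶠ k in atTop, ∀ i,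
    |(D k).mseSlope (l k) (m k) σ i| ≤ C := by
  choose C hC using fun i => AnovaDesign.exists_abs_mseSlope_le
    h.pos h.random h.injX h.fixed i
  refine ⟨∑ i, |C i|, sum_nonneg fun _ _ => abs_nonneg _, ?_⟩
  filter_upwards [eventually_all.2 hC] with k hk i
  exact (hk i).trans ((le_abs_self _).trans
    (single_le_sum (f := fun i => |C i|) (fun _ _ => abs_nonneg _) (mem_univ i)))

/-- Uniform expansion of a bilinear correction with the slopes of `g₁`. -/
lemma isLittleO_slope_inv (hA : NormInfo D T σ A) {bias : ℕ → VarComp q → VarComp q}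
    (hb : ∃ C : ℝ, 0 ≤ C ∧ ∀ᶠ k in atTop, ∀ i, |bias k σ i| ≤ C)
    (hb' : ∀ i, Tendsto (fun a : ℕ × VarComp q => bias a.1 a.2 i - bias a.1 σ i) (near D σ) (𝓝 0)) :
    (fun a : ℕ × VarComp q => (fun i => pderiv i ((D a.1).g1 (m a.1)) a.2) ⬝ᵥ (-(A a.1 a.2))⁻¹ *ᵥ bias a.1 a.2
      - linTerm D T σ l m (fun k i => ((D k).d σ i)⁻¹ * bias k σ i) a.1) =o[near D σ] fun a => rate D σ a.1 ^ 2 := by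
  obtain ⟨C, hC0, hC⟩ := h.exists_abs_invInfo_le
  obtain ⟨Cl, hCl0, hCl⟩ := h.exists_abs_mseSlope_le
  obtain ⟨Cb, hCb0, hCb⟩ := hb
  have hfix : ∀ τ ∈ interior (paramSpace q), Tendsto (fun a : ℕ × VarComp q =>
      (D a.1).g2 (l a.1) (m a.1) τ) (near D σ) (𝓝 0) := fun τ hτ => (h.fixed τ hτ).comp tendsto_fst_near
  obtain ⟨Cm, hCm⟩ := h.random
  have hS := fun i => AnovaDesign.tendsto_g1Slope_sub (F := near D σ)
    h.pos ⟨Cm, fun a => hCm a.1⟩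
    (fun a => h.injX a.1) hfix h.tendsto_near_param i
  have oI := fun i j => (isLittleO_one_iff ℝ).2 ((fun i j => h.tendsto_near_inv hA i j) i j)
  have ob := fun i => (isLittleO_one_iff ℝ).2 (hb' i)
  have bS : ∀ i, (fun a : ℕ × VarComp q => (D a.1).mseSlope (l a.1) (m a.1) σ i) =O[near D σ] fun _ => (1 : ℝ) :=
    fun i => IsBigO.of_bound Cl (by simpa using (tendsto_fst_near.eventually hCl).mono fun a ha => ha i)
  have bJ : ∀ i j, (fun a : ℕ × VarComp q => invInfo D T σ a.1 i j) =O[near D σ] fun _ => (1 : ℝ) :=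
    fun i j => IsBigO.of_bound C (by simpa using (tendsto_fst_near.eventually hC).mono fun a ha => ha i j)
  have bb : ∀ i, (fun a : ℕ × VarComp q => bias a.1 σ i) =O[near D σ] fun _ => (1 : ℝ) :=
    fun i => IsBigO.of_bound Cb (by simpa using (tendsto_fst_near.eventually hCb).mono fun a ha => ha i)
  have hterm : ∀ i j, Tendsto (fun a : ℕ × VarComp q => (D a.1).g1Slope (m a.1) a.2 i *
      ((D a.1).d σ i * (D a.1).d σ j * (-(A a.1 a.2))⁻¹ i j) * bias a.1 a.2 j
      - (D a.1).mseSlope (l a.1) (m a.1) σ i * invInfo D T σ a.1 i j * bias a.1 σ j) (near D σ) (𝓝 0) := fun i j => by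
    have bI : (fun a : ℕ × VarComp q => (D a.1).d σ i * (D a.1).d σ j * (-(A a.1 a.2))⁻¹ i j)
        =O[near D σ] fun _ => (1 : ℝ) := by simpa using (oI i j).isBigO.add (bJ i j)
    have bb' : (fun a : ℕ × VarComp q => bias a.1 a.2 j) =O[near D σ] fun _ => (1 : ℝ) := by
      simpa using (ob j).isBigO.add (bb j)
    have t1 := (((fun i => (isLittleO_one_iff ℝ).2 (hS i)) i).mul_isBigO bI).mul_isBigO bb'
    have t2 := ((bS i).mul_isLittleO (oI i j)).mul_isBigO bb'
    have t3 := ((bS i).mul (bJ i j)).mul_isLittleO (ob j)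
    simp only [mul_one] at t1 t2 t3; refine ((isLittleO_one_iff ℝ).1 ((t1.add t2).add t3)).congr fun a => ?_
    ring
  have hsum := IsLittleO.fun_sum fun i (_ : i ∈ univ) => IsLittleO.fun_sum fun j (_ : j ∈ univ) =>
    h.isLittleO_weight (hterm i j) i j
  refine hsum.congr' ?_ EventuallyEq.rfl
  filter_upwards [h.eventually_near_pos, tendsto_fst_near.eventually h.d_pos] with a h3 h4
  have hτ := (D a.1).posDef_of_pos fun i => (half_pos (h.pos i)).trans (h3 i)
  rw [linTerm, dotProduct, ← sum_sub_distrib]; refine sum_congr rfl fun i _ => ?_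
  rw [(D a.1).pderiv_g1 (m a.1) hτ, mulVec, mulVec, dotProduct, dotProduct, mul_sum, mul_sum, ← sum_sub_distrib]
  grind

lemma exists_abs_eta_le (hA : NormInfo D T σ A) {τ : VarComp q} (hτ : ∀ i, 0 < τ i) :
    ∃ C : ℝ, ∀ᶠ k in atTop, |(D k).eta (A k) (l k) (m k) τ| ≤ C := by
  obtain ⟨C1, h1⟩ := AnovaDesign.exists_abs_g1_le hτ h.random
  choose C2 h2 using fun i j => AnovaDesign.exists_abs_sGram_le hτ h.random i j
  obtain ⟨C3, h3⟩ := hA.inv_bdd τ hτ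
  have h4 := (h.fixed τ (mem_interior_paramSpace.2 hτ)).eventually (Metric.ball_mem_nhds 0 one_pos)
  refine ⟨C1 + 1 + ∑ i, ∑ j, |C2 i j| * |C3|, ?_⟩
  filter_upwards [h1, eventually_all.2 fun i => eventually_all.2 (h2 i), h3, h4] with k h1 h2 h3 h4
  rw [dist_zero_right] at h4; rw [AnovaDesign.eta, (D k).g3_eq (m k) ((D k).posDef_of_pos hτ)]
  refine (abs_add_le _ _).trans (add_le_add ((abs_add_le _ _).trans (add_le_add h1 h4.le)) ?_)
  refine (abs_sum_le_sum_abs _ _).trans (sum_le_sum fun i _ =>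
    (abs_sum_le_sum_abs _ _).trans (sum_le_sum fun j _ => ?_))
  rw [abs_mul]
  exact mul_le_mul ((h2 i j).trans (le_abs_self _)) ((h3 j i).trans (le_abs_self _)) (abs_nonneg _) (abs_nonneg _)

section

lemma exists_trace_ge {τ : VarComp q} (hτ : ∀ i, 0 < τ i) : ∃ c : ℝ, 0 < c ∧ ∀ᶠ k in atTop,
    ∀ x : VarComp q, c * (D k).dstar σ ^ 2 * x ⬝ᵥ x ≤ ∑ i, ∑ j, x i * x j *
      (1 / 2 * ((D k).P τ * (D k).V i * (D k).P τ * (D k).V j).trace) := by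
  obtain ⟨κ, hκ, hinfo⟩ := h.info
  set c := ∑ i, τ i * (σ i)⁻¹
  have hterm i := mul_pos (hτ i) (inv_pos.2 (h.pos i))
  have hc0 := sum_pos (fun i _ => hterm i) univ_nonempty
  have hcle : ∀ i, τ i ≤ c * σ i := fun i => by
    have := single_le_sum (fun i _ => (hterm i).le) (mem_univ i)
    rwa [← div_eq_mul_inv, div_le_iff₀ (h.pos i)] at this
  refine ⟨c⁻¹ ^ 2 * κ, by positivity, ?_⟩
  filter_upwards [hinfo, h.d_pos] with k h1 h2 x
  refine le_trans ?_ ((D k).sum_trace_P_ge (h.contrast k) h.pos hτ h2 hc0 hcle x)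
  rw [mul_assoc, mul_assoc]
  refine mul_le_mul_of_nonneg_left (le_trans (mul_le_mul_of_nonneg_left ?_ hκ.le) (h1 _)) (by positivity)
  rw [dotProduct, dotProduct, mul_sum]; refine sum_le_sum fun i _ => ?_
  have h3 := pow_le_pow_left₀ ((D k).dstar_nonneg σ) ((D k).dstar_le σ i) 2
  nlinarith [mul_self_nonneg (x i)]

lemma normInfo_AR : NormInfo D T σ fun k => (D k).AR (T k) where
  near i j := by
    refine (h.tendsto_near_trace i j).congr' ?_
    filter_upwards [h.eventually_near_pos] with a ha
    have hp i := (half_pos (h.pos i)).trans (ha i)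
    rw [(D a.1).AR_apply (h.contrast a.1) ⟨fun i => (hp i).le, (D a.1).posDef_of_pos hp⟩, neg_neg]
  inv_bdd τ hτ := by
    obtain ⟨c, hc, hk⟩ := h.exists_trace_ge hτ
    refine ⟨c⁻¹, ?_⟩
    filter_upwards [hk, h.scale.eventually_ge_atTop 1] with k h1 h2
    refine (coercive_inv hc fun x => ?_).2
    have e : x ⬝ᵥ (-(D k).AR (T k) τ *ᵥ x) = ∑ i, ∑ j, x i * x j *
        (1 / 2 * ((D k).P τ * (D k).V i * (D k).P τ * (D k).V j).trace) := by
      simp only [dotProduct, mulVec, mul_sum]; refine sum_congr rfl fun i _ => sum_congr rfl fun j _ => ?_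
      rw [Matrix.neg_apply, (D k).AR_apply (h.contrast k) ⟨fun i => (hτ i).le, (D k).posDef_of_pos hτ⟩]; ring
    rw [e]; refine le_trans (mul_le_mul_of_nonneg_right ?_ (dot_self_nonneg_real x)) (h1 x)
    exact le_mul_of_one_le_right hc.le (one_le_pow₀ h2)
  meas k i j := ⟨_, ((((D k).meas_trace_P measurable_id i j).const_mul (1 / 2)).neg),
    fun τ hτ => (D k).AR_apply (h.contrast k) hτ i j⟩

lemma neg_AM_apply {τ : VarComp q} {k : ℕ} (hτ : τ ∈ (D k).admissible) (i j : Fin (q + 1)) :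
    -((D k).AM τ i j) = 1 / 2 * ((D k).P τ * (D k).V i * (D k).P τ * (D k).V j).trace
      - 1 / 2 * ((((D k).Sig τ)⁻¹ * (D k).V i * ((D k).Sig τ)⁻¹ * (D k).V j).trace
        - ((D k).P τ * (D k).V i * (D k).P τ * (D k).V j).trace) := by
  rw [(D k).AM_apply (h.contrast k) hτ]; ring

variable (hp : ∃ p₀ : ℕ, ∀ k, (D k).p ≤ p₀)
include hp

lemma exists_bracket_le {τ₀ : VarComp q} (hτ₀ : ∀ i, 0 < τ₀ i) : ∃ C : ℝ, 0 ≤ C ∧ ∀ k τ, (∀ i, τ₀ i ≤ τ i) →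
    ∀ i j, |(((D k).Sig τ)⁻¹ * (D k).V i * ((D k).Sig τ)⁻¹ * (D k).V j).trace
        - ((D k).P τ * (D k).V i * (D k).P τ * (D k).V j).trace| ≤ C := by
  obtain ⟨p₀, hp⟩ := hp
  have h0 i := inv_nonneg.2 (hτ₀ i).le
  set S := ∑ i, (τ₀ i)⁻¹
  have hS0 : 0 ≤ S := sum_nonneg fun i _ => h0 i
  refine ⟨2 * p₀ * (S * S), by positivity, fun k τ hτ i j => ?_⟩
  have hpos i := (hτ₀ i).trans_le (hτ i)
  have hle i := (inv_anti₀ (hτ₀ i) (hτ i)).trans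
    (single_le_sum (fun i _ => h0 i) (mem_univ i))
  refine ((D k).abs_trace_sub_trace_le ((D k).posDef_of_pos hpos) (h.injX k) hpos i j).trans ?_
  have hpk : ((D k).p : ℝ) ≤ p₀ := by exact_mod_cast hp k
  refine mul_le_mul (by linarith) (mul_le_mul (hle i) (hle j) (inv_nonneg.2 (hpos j).le) hS0)
    (mul_nonneg (inv_nonneg.2 (hpos i).le) (inv_nonneg.2 (hpos j).le)) (by positivity)

lemma normInfo_AM : NormInfo D T σ fun k => (D k).AM where
  near i j := by
    obtain ⟨C, hC0, hC⟩ := h.exists_bracket_le hp fun i => half_pos (h.pos i)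
    have h1 := ((h.smallScale.tendsto.pow 2).mul_const C).comp (tendsto_fst_near (D := D) (σ := σ))
    simp only [ne_eq, OfNat.ofNat_ne_zero, not_false_eq_true, zero_pow, zero_mul] at h1
    have h2 : Tendsto (fun a : ℕ × VarComp q => ((D a.1).d σ i)⁻¹ * ((D a.1).d σ j)⁻¹ *
        (1 / 2 * ((((D a.1).Sig a.2)⁻¹ * (D a.1).V i * ((D a.1).Sig a.2)⁻¹ * (D a.1).V j).trace
          - ((D a.1).P a.2 * (D a.1).V i * (D a.1).P a.2 * (D a.1).V j).trace))) (near D σ) (𝓝 0) := by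
      refine squeeze_zero_norm' ?_ h1
      filter_upwards [h.eventually_near_pos, tendsto_fst_near.eventually h.d_inv_le] with a h3 h4
      have h0 := fun i => inv_nonneg.2 ((D a.1).d_nonneg σ i)
      have h5 := hC a.1 a.2 (fun i => (h3 i).le) i j
      rw [norm_mul, norm_mul, norm_mul, norm_of_nonneg (h0 i), norm_of_nonneg (h0 j),
        norm_of_nonneg (by simp), norm_eq_abs, Function.comp_apply, pow_two]
      refine mul_le_mul (mul_le_mul (h4 i) (h4 j) (h0 j) ((h0 i).trans (h4 i))) ?_ (by positivity) (mul_self_nonneg _)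
      linarith [abs_nonneg ((((D a.1).Sig a.2)⁻¹ * (D a.1).V i * ((D a.1).Sig a.2)⁻¹ * (D a.1).V j).trace
          - ((D a.1).P a.2 * (D a.1).V i * (D a.1).P a.2 * (D a.1).V j).trace)]
    have h3 := (h.tendsto_near_trace i j).sub h2
    rw [sub_zero] at h3; refine h3.congr' ?_
    filter_upwards [h.eventually_near_pos] with a ha
    have hpos i := (half_pos (h.pos i)).trans (ha i)
    rw [h.neg_AM_apply ⟨fun i => (hpos i).le, (D a.1).posDef_of_pos hpos⟩]; ring
  inv_bdd τ hτ := by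
    obtain ⟨c, hc, hk⟩ := h.exists_trace_ge hτ
    obtain ⟨C, hC0, hC⟩ := h.exists_bracket_le hp hτ
    refine ⟨1⁻¹, ?_⟩
    have hsc : Tendsto (fun k => c * (D k).dstar σ ^ 2) atTop atTop :=
      ((tendsto_pow_atTop two_ne_zero).comp h.scale).const_mul_atTop hc
    filter_upwards [hk, hsc.eventually_ge_atTop (C * (q + 1) + 1)] with k h1 h2
    refine (coercive_inv one_pos fun x => ?_).2
    have h3 := h1 x
    set br : Fin (q + 1) → VarComp q := fun i j =>
      (((D k).Sig τ)⁻¹ * (D k).V i * ((D k).Sig τ)⁻¹ * (D k).V j).trace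
        - ((D k).P τ * (D k).V i * (D k).P τ * (D k).V j).trace with hbr
    have e : x ⬝ᵥ (-(D k).AM τ *ᵥ x) = ∑ i, ∑ j, x i * x j *
        (1 / 2 * ((D k).P τ * (D k).V i * (D k).P τ * (D k).V j).trace) - ∑ i, ∑ j, x i * x j * (1 / 2 * br i j) := by
      simp only [dotProduct, mulVec, mul_sum]; rw [← sum_sub_distrib]; refine sum_congr rfl fun i _ => ?_
      rw [← sum_sub_distrib]; refine sum_congr rfl fun j _ => ?_
      rw [Matrix.neg_apply, h.neg_AM_apply ⟨fun i => (hτ i).le, (D k).posDef_of_pos hτ⟩]; ring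
    have h4 : ∑ i, ∑ j, x i * x j * (1 / 2 * br i j) ≤ C * (q + 1) * x ⬝ᵥ x := by
      have h5 : ∑ i, ∑ j, x i * x j * (1 / 2 * br i j) ≤ ∑ i, ∑ j, |x i| * |x j| * C := by
        refine sum_le_sum fun i _ => sum_le_sum fun j _ => (le_abs_self _).trans ?_
        rw [abs_mul, abs_mul]; refine mul_le_mul_of_nonneg_left ?_ (by positivity)
        rw [abs_mul, abs_of_pos (by simp)]; have := hC k τ (fun i => le_rfl) i j; linarith
      refine h5.trans ?_
      have h6 : ∑ i, ∑ j, |x i| * |x j| * C = C * (∑ i, |x i|) ^ 2 := by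
        rw [pow_two, sum_mul_sum, mul_sum]; refine sum_congr rfl fun i _ => ?_
        rw [mul_sum]; exact sum_congr rfl fun j _ => by ring
      rw [h6, mul_assoc]; refine mul_le_mul_of_nonneg_left ?_ hC0
      have h7 := sq_sum_le_card_mul_sum_sq (s := univ) (f := fun i => |x i|)
      simp only [card_univ, Fintype.card_fin, sq_abs, Nat.cast_add, Nat.cast_one] at h7; refine h7.trans (le_of_eq ?_)
      congr 1; exact sum_congr rfl fun i _ => pow_two _
    have h8 := mul_le_mul_of_nonneg_right h2 (dot_self_nonneg_real x)
    linarith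
  meas k i j := ⟨_, ((((D k).meas_trace_Sig_inv measurable_id i j).const_mul (1 / 2)).sub
    ((D k).meas_trace_P measurable_id i j)), fun τ hτ => (D k).AM_apply (h.contrast k) hτ i j⟩

lemma scoreBias_logLikP : ScoreBias D σ (fun k => (D k).logLikP) fun k => (D k).gM0 where
  score k τ hτ y i := by
    rw [AnovaDesign.pderiv_eq_of_hasDerivAt ((D k).hasDerivAt_logLikP (h.contrast k) hτ i y),
      AnovaDesign.gM0, Matrix.sub_mul, trace_sub]
    ring
  bdd := by
    obtain ⟨p₀, hp⟩ := hp
    have h0 i := inv_nonneg.2 (h.pos i).le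
    refine ⟨p₀ * ∑ i, (σ i)⁻¹, mul_nonneg (Nat.cast_nonneg _) (sum_nonneg fun i _ => h0 i),
      Eventually.of_forall fun k i => ((D k).abs_gM0_le (h.posDef k) (h.injX k) h.pos i).trans ?_⟩
    exact mul_le_mul (by exact_mod_cast hp k)
      (single_le_sum (fun i _ => h0 i) (mem_univ i)) (h0 i) (Nat.cast_nonneg _)
  lip := by
    obtain ⟨p₀, hp⟩ := hp
    have h0 i := inv_nonneg.2 (h.pos i).le
    set S := ∑ i, (σ i)⁻¹
    have hS0 : 0 ≤ S := sum_nonneg fun i _ => h0 i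
    have hle i := single_le_sum (fun i _ => h0 i) (mem_univ i)
    refine ⟨4 * p₀ * (S * S), by positivity, Eventually.of_forall fun k τ τ' hτ hτ' i => ?_⟩
    refine ((D k).abs_gM0_sub_le (h.contrast k) h.pos hτ' hτ i).trans ?_
    rw [mul_sum]; refine sum_le_sum fun j _ => ?_
    rw [mul_comm]; refine mul_le_mul_of_nonneg_right ?_ (abs_nonneg _)
    have hpk : ((D k).p : ℝ) ≤ p₀ := by exact_mod_cast hp k
    exact mul_le_mul (by linarith) (mul_le_mul (hle j) (hle i) (h0 i) hS0) (mul_nonneg (h0 j) (h0 i)) (by positivity)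

omit hp in
lemma scoreBias_logLikR : ScoreBias D σ (fun k => (D k).logLikR (T k)) fun _ _ _ => 0 where
  score k τ hτ y i := by
    rw [AnovaDesign.pderiv_eq_of_hasDerivAt ((D k).hasDerivAt_logLikR (h.contrast k) hτ i y), sub_zero]
  bdd := ⟨0, le_rfl, Eventually.of_forall fun k i => by simp⟩
  lip := ⟨0, le_rfl, Eventually.of_forall fun k τ τ' _ _ i => by simp⟩

end

lemma rate_rpow_neg (k : ℕ) (r : ℝ) : rate D σ k ^ (-r) = (D k).dstar σ ^ r := by
  rw [rate, inv_rpow ((D k).dstar_nonneg σ), rpow_neg ((D k).dstar_nonneg σ), inv_inv]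

lemma abs_param_sub_le (τ : VarComp q) {k : ℕ} (hk : ∀ i, 0 < (D k).d σ i) (i : Fin (q + 1)) :
    |τ i - σ i| = ((D k).d σ i)⁻¹ * |(D k).normParam σ τ i| := by
  rw [AnovaDesign.normParam, abs_mul, abs_of_pos (hk i), inv_mul_cancel_left₀ (hk i).ne']

lemma isBig_bias (hs : ScoreBias D σ lik bias) : ∃ C : ℝ, ∀ᶠ k in atTop, ∀ i,
    |((D k).d σ i)⁻¹ * bias k σ i| ≤ C * rate D σ k := by
  obtain ⟨C, hC0, hC⟩ := hs.bdd
  refine ⟨C, ?_⟩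
  filter_upwards [hC, h.d_inv_le] with k h1 h2 i
  rw [abs_mul, abs_of_nonneg (inv_nonneg.2 ((D k).d_nonneg σ i)), mul_comm]
  exact mul_le_mul (h1 i) (h2 i) (inv_nonneg.2 ((D k).d_nonneg σ i)) hC0

/-- A root of the score equations close to the true parameter belongs to a good contrast vector. -/
lemma eventually_mem_goodSet (hs : ScoreBias D σ lik bias) (he : IsScoreRoot D β σ lik est) :
    ∀ᶠ k in atTop, ∀ ω, (∀ i, pderiv i (fun τ => lik k τ ((D k).obs (β k) ω)) (est k ((D k).obs (β k) ω)) = 0) →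
      sqrt (∑ i, ((D k).d σ i * (est k ((D k).obs (β k) ω) i - σ i)) ^ 2) < (D k).dstar σ ^ (1 - 39 / 40 : ℝ) →
      (D k).normErr (T k) σ ω ∈ goodSet D T σ bias est k := by
  obtain ⟨C, hC0, hC⟩ := hs.lip
  have hnear := eventually_near.1 h.eventually_near_pos
  have hsmall := h.smallScale.rpow_le (r := 1 / 2 - 1 / 40) (c := (C * (q + 1) + 1)⁻¹) (by norm_num) (by positivity)
  filter_upwards [hC, hnear, h.d_pos, h.d_inv_le, h.smallScale.pos, h.smallScale.le one_pos, hsmall] with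
    k hlip hn hd hdi hk hk1 hsm ω h1 h2
  have hloc : localParam D T σ est k ((D k).normErr (T k) σ ω) = (D k).normParam σ (est k ((D k).obs (β k) ω)) := by
    rw [localParam, (D k).apply_obs_of_invariant (h.contrast k) (h.posDef k) (he.invariant k) (β k) ω]
  set τ := est k ((D k).obs (β k) ω)
  have e40 : rate D σ k ^ (-(1 / 40) : ℝ) = (D k).dstar σ ^ (1 - 39 / 40 : ℝ) := by rw [h.rate_rpow_neg]; norm_num
  have hx : ∀ i, |(D k).normParam σ τ i| ≤ rate D σ k ^ (-(1 / 40) : ℝ) := fun i => by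
    rw [e40]; refine le_trans ?_ h2.le
    exact abs_le_sqrt (single_le_sum (fun _ _ => sq_nonneg _) (mem_univ i))
  have hnorm : ‖(D k).normParam σ τ‖ ≤ rate D σ k ^ (-(1 / 4) : ℝ) := by
    refine (pi_norm_le_iff_of_nonneg (rpow_nonneg hk.le _)).2 fun i => (hx i).trans ?_
    exact rpow_le_rpow_of_exponent_ge hk hk1 (by norm_num)
  have hτσ := hn τ hnorm
  have hpd := (D k).posDef_of_pos fun i => (half_pos (h.pos i)).trans (hτσ i)
  refine ⟨fun i => ?_, fun i => by rw [hloc]; exact hx i⟩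
  have h3 := h1 i
  rw [hs.score k τ hpd, (D k).score_eq_stdScore (h.contrast k) (h.posDef k) hd hpd,
    (D k).stdCtr_obs (h.contrast k) (h.posDef k)] at h3
  have h4 : stdScore ((D k).normV (T k) σ) ((D k).normParam σ τ) ((D k).normErr (T k) σ ω) i
      = ((D k).d σ i)⁻¹ * bias k τ i := by
    have := (hd i).ne'
    field_simp; linarith
  rw [hloc, h4, ← mul_sub, abs_mul, abs_of_pos (inv_pos.2 (hd i))]
  have h5 := hlip τ σ hτσ (fun i => half_lt_self (h.pos i)) i
  have h6 : ∑ j, |τ j - σ j| ≤ (q + 1) * (rate D σ k * rate D σ k ^ (-(1 / 40) : ℝ)) := by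
    refine (sum_le_card_nsmul univ _ (rate D σ k * rate D σ k ^ (-(1 / 40) : ℝ)) fun j _ => ?_).trans ?_
    · rw [h.abs_param_sub_le τ hd]; exact mul_le_mul (hdi j) (hx j) (abs_nonneg _) hk.le
    · simp
  have h7 : rate D σ k * (rate D σ k * rate D σ k ^ (-(1 / 40) : ℝ))
      = rate D σ k ^ (1 / 2 - 1 / 40 : ℝ) * rate D σ k ^ (3 / 2 : ℝ) := by
    nth_rewrite 1 [← rpow_one (rate D σ k)]; nth_rewrite 2 [← rpow_one (rate D σ k)]
    rw [← rpow_add hk, ← rpow_add hk, ← rpow_add hk]; norm_num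
  calc ((D k).d σ i)⁻¹ * |bias k τ i - bias k σ i|
      ≤ rate D σ k * (C * ((q + 1) * (rate D σ k * rate D σ k ^ (-(1 / 40) : ℝ)))) :=
        mul_le_mul (hdi i) (h5.trans (mul_le_mul_of_nonneg_left h6 hC0)) (abs_nonneg _) hk.le
    _ = (C * (q + 1)) * (rate D σ k * (rate D σ k * rate D σ k ^ (-(1 / 40) : ℝ))) := by ring
    _ = (C * (q + 1)) * rate D σ k ^ (1 / 2 - 1 / 40 : ℝ) * rate D σ k ^ (3 / 2 : ℝ) := by rw [h7]; ring
    _ ≤ 1 * rate D σ k ^ (3 / 2 : ℝ) := by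
        refine mul_le_mul_of_nonneg_right ?_ (rpow_nonneg hk.le _)
        refine (mul_le_mul_of_nonneg_left hsm (by positivity)).trans ?_
        rw [← div_eq_mul_inv, div_le_one (by positivity)]; linarith
    _ = _ := one_mul _

/-- Estimators solving the score equations are local roots in normalized coordinates. -/
lemma localRoot (hs : ScoreBias D σ lik bias) (he : IsScoreRoot D β σ lik est) : ∃ C : ℝ,
    LocalRoot (fun k => (D k).noise σ) (rate D σ) (fun k => (D k).normErr (T k) σ)
      (fun k => (D k).normV (T k) σ) C (fun k => (D k).normErr (T k) σ ⁻¹' goodSet D T σ bias est k)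
      (fun k ω => trimmedParam D T σ bias est k ((D k).normErr (T k) σ ω))
      (fun k i => ((D k).d σ i)⁻¹ * bias k σ i) := by
  have hm := fun k => (D k).meas_normErr (h.contrast k) (h.posDef k)
  obtain ⟨C, hC⟩ := h.isBig_bias hs
  refine ⟨C, fun k => (meas_trimmedParam he.measurable k).comp (hm k),
    fun k => hm k (measSet_goodSet he.measurable k), fun g hg => ?_, fun k ω hω => trimmedParam_of_notMem hω, ?_, hC, ?_⟩
  · obtain ⟨c, hc⟩ := he.root (39 / 40) (by norm_num) (by norm_num) g hg
    refine ⟨c, ?_⟩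
    filter_upwards [hc, h.eventually_mem_goodSet hs he] with k h1 h2
    rw [← neg_neg g, h.rate_rpow_neg]; refine (measureReal_mono fun ω hω => ?_).trans h1
    grind
  · refine Eventually.of_forall fun k ω hω i => ?_
    rw [trimmedParam_of_mem hω]; exact hω.2 i
  · intro δ hδ
    filter_upwards [h.smallScale.pos, h.smallScale.rpow_le (r := 1 / 2) (by norm_num) hδ] with k h1 h2 ω hω i
    rw [trimmedParam_of_mem hω]; refine (hω.1 i).trans ?_
    have : (3 / 2 : ℝ) = 1 / 2 + 1 := by norm_num
    rw [this, rpow_add h1, rpow_one]; exact mul_le_mul_of_nonneg_right h2 h1.le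

lemma exists_blupEnvelope (hexp : HasBlupExpansion D β σ l m) : ∃ H, BlupEnvelope D σ l m β H := by
  obtain ⟨K, coef, W, -, α, b, -, C, hα, hb, -, hK, hblup, hWm, hW, hcoef, -⟩ := hexp
  have hWm' k j := (hWm k j).comp ((D k).meas_obs (β k))
  have hL : ∀ k, MemLp (fun ω => ∑ j, |W k j ((D k).obs (β k) ω)|) 2 ((D k).noise σ) := fun k =>
    memLp_finsetSum _ fun j _ => (memLp_two_of_integrable_rpow hb (hWm' k j) (hW k j).1).norm
  refine ⟨fun k ω => |C| * ∑ j, |W k j ((D k).obs (β k) ω)|, fun k => (hL k).const_mul _, fun k τ hτ ω => ?_,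
    fun B _ hprob => ?_⟩
  · rw [hblup k τ hτ, mul_sum]; refine (abs_sum_le_sum_abs _ _).trans (sum_le_sum fun j _ => ?_)
    rw [abs_mul]; exact mul_le_mul_of_nonneg_right ((hcoef k j τ hτ).trans (le_abs_self C)) (abs_nonneg _)
  · set a := (3 + 2 * α) / (b - 2) with ha
    have hb2 : 0 < b - 2 := by linarith
    obtain ⟨c, hc⟩ := hprob (3 + 2 * α + 2 * a) (by positivity)
    obtain ⟨c₀, hc₀⟩ := hK.bound
    have hO : (fun k => ∫ ω in B k, (|C| * ∑ j, |W k j ((D k).obs (β k) ω)|) ^ 2 ∂((D k).noise σ))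
        =O[atTop] fun k => rate D σ k ^ (3 : ℝ) := by
      refine IsBigO.of_bound (|C| ^ 2 * (c₀ ^ 2 * (c + |C|))) ?_
      filter_upwards [hc, hc₀, h.smallScale.pos] with k h1 h2 hk
      have hθ := rpow_pos_of_pos hk
      have h3 := setIntegral_sq_sum_abs_le hb (hWm' k) (fun j => (hW k j).1)
        (fun j => (hW k j).2) (B := B k) (hθ (-a))
      rw [Fintype.card_fin] at h3
      have e1 : (rate D σ k ^ (-a)) ^ (2 - b) = rate D σ k ^ (3 + 2 * α) := by
        rw [← rpow_mul hk.le]; congr 1; rw [ha]; field_simp; ring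
      have e2 : (rate D σ k ^ (-a)) ^ 2 * rate D σ k ^ (3 + 2 * α + 2 * a) = rate D σ k ^ (3 + 2 * α) := by
        rw [← rpow_natCast, ← rpow_mul hk.le, ← rpow_add hk]; push_cast; ring
      have e3 : (rate D σ k ^ (-α)) ^ 2 * rate D σ k ^ (3 + 2 * α) = rate D σ k ^ (3 : ℝ) := by
        rw [← rpow_natCast, ← rpow_mul hk.le, ← rpow_add hk]; push_cast; ring
      rw [norm_of_nonneg (Nat.cast_nonneg _), norm_of_nonneg (rpow_nonneg ((D k).dstar_nonneg σ) _),
        ← h.rate_rpow_neg] at h2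
      simp only [mul_pow]
      rw [integral_const_mul, norm_mul, norm_of_nonneg (sq_nonneg _), norm_of_nonneg
        (integral_nonneg fun _ => sq_nonneg _), norm_of_nonneg (hθ _).le, mul_assoc]
      refine mul_le_mul_of_nonneg_left (h3.trans ?_) (sq_nonneg _)
      have h5 : (rate D σ k ^ (-a)) ^ 2 * ((D k).noise σ).real (B k) + |C| * (rate D σ k ^ (-a)) ^ (2 - b)
          ≤ (c + |C|) * rate D σ k ^ (3 + 2 * α) := by
        rw [e1, add_mul]; refine add_le_add ((mul_le_mul_of_nonneg_left h1 (sq_nonneg _)).trans (le_of_eq ?_)) le_rfl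
        rw [mul_left_comm, e2]
      have h6 : 0 ≤ (rate D σ k ^ (-a)) ^ 2 * ((D k).noise σ).real (B k)
          + |C| * (rate D σ k ^ (-a)) ^ (2 - b) := by
        positivity
      calc _ ≤ (c₀ * rate D σ k ^ (-α)) ^ 2 * ((c + |C|) * rate D σ k ^ (3 + 2 * α)) :=
            mul_le_mul (pow_le_pow_left₀ (Nat.cast_nonneg _) h2 2) h5 h6 (sq_nonneg _)
        _ = c₀ ^ 2 * (c + |C|) * ((rate D σ k ^ (-α)) ^ 2 * rate D σ k ^ (3 + 2 * α)) := by ring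
        _ = _ := by rw [e3]
    refine hO.trans_isLittleO ?_
    have := h.smallScale.rpow_tendsto one_pos
    refine ((isLittleO_one_iff ℝ).2 this).mul_isBigO (isBigO_refl (fun k => rate D σ k ^ 2) atTop) |>.congr' ?_ ?_
    · filter_upwards [h.smallScale.pos] with k hk
      rw [← rpow_two, ← rpow_add hk]; norm_num
    · exact Eventually.of_forall fun k => one_mul _

lemma memLp_blup_sub (hH : BlupEnvelope D σ l m β H) (he : IsScoreRoot D β σ lik est) (k : ℕ) :
    MemLp (fun ω => (D k).blup (l k) (m k) (est k ((D k).obs (β k) ω)) ((D k).obs (β k) ω)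
      - (D k).blup (l k) (m k) σ ((D k).obs (β k) ω)) 2 ((D k).noise σ) := by
  have ho := (D k).meas_obs (β k)
  refine MemLp.mono ((hH.memLp k).const_mul 2) (((D k).meas_blup (l k) (m k)
    ((he.measurable k).comp ho) ho).sub ((D k).meas_blup (l k) (m k) measurable_const ho)).aestronglyMeasurable
    (ae_of_all _ fun ω => ?_)
  have h1 := hH.bound k _ (he.mem k ((D k).obs (β k) ω)) ω
  have h2 := hH.bound k _ (h.mem_admissible k) ω
  rw [norm_eq_abs, norm_of_nonneg (by grind)]; exact (abs_sub _ _).trans (by linarith)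

/-- The MSE of the predictor with estimated variance components, to second order. -/
lemma isLittleO_mse (hH : BlupEnvelope D σ l m β H) (hs : ScoreBias D σ lik bias) (he : IsScoreRoot D β σ lik est) :
    (fun k => (D k).mse (l k) (m k) (β k) σ (est k) - ((D k).g1 (m k) σ + (D k).g2 (l k) (m k) σ
      + quadTerm D T σ l m k)) =o[atTop] fun k => rate D σ k ^ 2 := by
  obtain ⟨C, hC⟩ := h.canonicalModel
  obtain ⟨C', hX⟩ := h.localRoot hs he
  obtain ⟨B, hB⟩ := h.exists_abs_normDir_le
  have h2 := hH.rare _ (fun k => (hX.measG k).compl) hX.prob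
  set G := fun k => (D k).normErr (T k) σ ⁻¹' goodSet D T σ bias est k
  set S : ∀ k, ((D k).RE → ℝ) × (Fin (D k).n → ℝ) → ℝ := fun k ω =>
    ∑ i, trimmedParam D T σ bias est k ((D k).normErr (T k) σ ω) i * ((D k).normDir (l k) (m k) (T k) σ i ⬝ᵥ
      (resolv ((D k).normV (T k) σ) (trimmedParam D T σ bias est k ((D k).normErr (T k) σ ω)) *ᵥ
        (D k).normErr (T k) σ ω)) with hS
  set Δ : ∀ k, ((D k).RE → ℝ) × (Fin (D k).n → ℝ) → ℝ := fun k ω =>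
    (D k).blup (l k) (m k) (est k ((D k).obs (β k) ω)) ((D k).obs (β k) ω)
      - (D k).blup (l k) (m k) σ ((D k).obs (β k) ω) with hΔ
  have hrem : (fun k => ∫ ω in (G k)ᶜ, Δ k ω ^ 2 ∂((D k).noise σ)) =o[atTop] fun k => rate D σ k ^ 2 := by
    refine IsBigO.trans_isLittleO (IsBigO.of_bound 4 (Eventually.of_forall fun k => ?_)) h2
    rw [norm_of_nonneg (by positivity),
      norm_of_nonneg (integral_nonneg fun _ => sq_nonneg _), ← integral_const_mul]
    refine integral_mono_of_nonneg (ae_of_all _ fun ω => sq_nonneg _)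
      ((hH.memLp k).integrable_sq.const_mul 4).integrableOn (ae_of_all _ fun ω => ?_)
    have h3 := hH.bound k _ (he.mem k ((D k).obs (β k) ω)) ω
    have h4 := hH.bound k _ (h.mem_admissible k) ω
    have h5 : |Δ k ω| ≤ 2 * H k ω := (abs_sub _ _).trans (by linarith)
    have h6 := pow_le_pow_left₀ (abs_nonneg _) h5 2
    rw [sq_abs, mul_pow] at h6; simpa using h6.trans (by norm_num)
  refine ((LocalRoot.integral_shift_sq hC hX hB).add hrem).congr' ?_ EventuallyEq.rfl
  filter_upwards [h.d_pos] with k hd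
  have hL := h.memLp_blup_sub hH he k
  have hmse := ((D k).mse_eq_add (l k) (m k) (h.contrast k) (h.mem_admissible k) (he.measurable k) (he.mem k)
    (he.invariant k) (β k) hL).2
  have e1 : ∫ ω in G k, Δ k ω ^ 2 ∂((D k).noise σ) = ∫ ω, S k ω ^ 2 ∂((D k).noise σ) := by
    rw [← integral_indicator (hX.measG k)]; refine integral_congr_ae (ae_of_all _ fun ω => ?_)
    by_cases hω : ω ∈ G k
    · rw [Set.indicator_of_mem hω]
      have hinv := (D k).apply_obs_of_invariant (h.contrast k) (h.posDef k) (he.invariant k) (β k) ω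
      have h3 := (D k).blup_sub_blup_obs (l k) (m k) (h.contrast k) (h.posDef k) hd
        (he.mem k ((D k).obs (β k) ω)).2 (β k) ω
      simp only [hΔ, hS]; rw [trimmedParam_of_mem hω, localParam, ← hinv, h3, neg_sq]
    · rw [Set.indicator_of_notMem hω]; simp only [hS]; rw [trimmedParam_of_notMem hω]; simp
  rw [hmse, ← integral_add_compl (hX.measG k) hL.integrable_sq, quadTerm, ← e1]; ring

lemma exists_abs_g1_add_g2_le : ∃ C : ℝ, 0 ≤ C ∧ ∀ᶠ k in atTop, |(D k).g1 (m k) σ + (D k).g2 (l k) (m k) σ| ≤ C := by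
  obtain ⟨C1, h1⟩ := AnovaDesign.exists_abs_g1_le h.pos h.random
  have h4 := (h.fixed σ (mem_interior_paramSpace.2 h.pos)).eventually (Metric.ball_mem_nhds 0 one_pos)
  refine ⟨|C1| + 1, by positivity, ?_⟩
  filter_upwards [h1, h4] with k h1 h4
  rw [dist_zero_right] at h4; exact (abs_add_le _ _).trans (add_le_add (h1.trans (le_abs_self _)) h4.le)

lemma exists_near_abs_g1_add_g2_le : ∃ C : ℝ, 0 ≤ C ∧ ∀ᶠ a in near D σ,
    |(D a.1).g1 (m a.1) a.2 + (D a.1).g2 (l a.1) (m a.1) a.2| ≤ C := by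
  obtain ⟨C, hC0, hC⟩ := h.exists_abs_g1_add_g2_le
  obtain ⟨C', hC0', hC'⟩ := h.exists_abs_mseSlope_le
  have hone := eventually_all.2 fun i => by
    have := (h.tendsto_near_param i).eventually (Metric.closedBall_mem_nhds _ one_pos)
    simpa [dist_eq] using this
  refine ⟨C + (q + 1) * C', by positivity, ?_⟩
  filter_upwards [tendsto_fst_near.eventually hC, tendsto_fst_near.eventually hC', hone, h.eventually_near_pos] with
    a h1 h2 h3 h4
  have hp i := (half_pos (h.pos i)).trans (h4 i)
  have hpd := (D a.1).posDef_of_pos hp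
  rw [abs_of_nonneg ((D a.1).g1_add_g2_nonneg (l a.1) (m a.1) (h.contrast a.1) ⟨fun i => (hp i).le, hpd⟩)]
  refine ((D a.1).g1_add_g2_le (l a.1) (m a.1) (h.contrast a.1) (h.posDef a.1) hpd).trans
    (add_le_add ((le_abs_self _).trans h1) ?_)
  refine (sum_le_card_nsmul univ _ C' fun i _ => (le_abs_self _).trans ?_).trans (by simp)
  rw [abs_mul]; exact (mul_le_mul (h3 i) (h2 i) (abs_nonneg _) zero_le_one).trans (one_mul _).le

lemma exists_abs_quadTerm_le : ∃ C : ℝ, 0 ≤ C ∧ ∀ᶠ k in atTop, |quadTerm D T σ l m k| ≤ C := by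
  obtain ⟨B, hB⟩ := h.exists_abs_normDir_le
  obtain ⟨C, hC0, hC⟩ := h.exists_abs_invInfo_le
  refine ⟨∑ _i : Fin (q + 1), ∑ _j : Fin (q + 1), |B| * |B| * C, by positivity, ?_⟩
  filter_upwards [hB, hC, h.smallScale.pos, h.smallScale.le one_pos] with k h1 h2 h3 h4
  refine (abs_sum_le_sum_abs _ _).trans (sum_le_sum fun i _ =>
    (abs_sum_le_sum_abs _ _).trans (sum_le_sum fun j _ => ?_))
  have h5 i := (h1 i).trans
    ((mul_le_mul_of_nonneg_right (le_abs_self B) h3.le).trans (mul_le_of_le_one_right (abs_nonneg _) h4))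
  rw [abs_mul]
  exact mul_le_mul ((abs_dot_le _ _).trans (mul_le_mul (h5 i) (h5 j) (vnorm_nonneg _) (abs_nonneg _)))
    (h2 i j) (abs_nonneg _) (by positivity)

lemma exists_abs_slope_le : ∃ C : ℝ, 0 ≤ C ∧ ∀ᶠ k in atTop, ∀ i,
    |((D k).d σ i)⁻¹ * (D k).mseSlope (l k) (m k) σ i| ≤ C * rate D σ k := by
  obtain ⟨C, hC0, hC⟩ := h.exists_abs_mseSlope_le
  refine ⟨C, hC0, ?_⟩
  filter_upwards [hC, h.d_inv_le] with k h1 h2 i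
  rw [abs_mul, abs_of_nonneg (inv_nonneg.2 ((D k).d_nonneg σ i)), mul_comm]
  exact mul_le_mul (h1 i) (h2 i) (inv_nonneg.2 ((D k).d_nonneg σ i)) hC0

lemma exists_abs_linTerm_le {b : ℕ → VarComp q} (hb : ∃ C : ℝ, ∀ᶠ k in atTop, ∀ i, |b k i| ≤ C * rate D σ k) :
    ∃ C : ℝ, 0 ≤ C ∧ ∀ᶠ k in atTop, |linTerm D T σ l m b k| ≤ C := by
  obtain ⟨C1, h10, h1⟩ := h.exists_abs_slope_le
  obtain ⟨C2, h20, h2⟩ := h.exists_abs_invInfo_le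
  obtain ⟨C3, h3⟩ := hb
  refine ⟨∑ _i : Fin (q + 1), C1 * ∑ _j : Fin (q + 1), C2 * |C3|, by positivity, ?_⟩
  filter_upwards [h1, h2, h3, h.smallScale.pos, h.smallScale.le one_pos] with k h1 h2 h3 h4 h5
  refine (abs_sum_le_sum_abs _ _).trans (sum_le_sum fun i _ => ?_)
  rw [abs_mul]; refine mul_le_mul ((h1 i).trans (mul_le_of_le_one_right h10 h5)) ?_ (abs_nonneg _) h10
  rw [mulVec, dotProduct]; refine (abs_sum_le_sum_abs _ _).trans (sum_le_sum fun j _ => ?_)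
  rw [abs_mul]; refine mul_le_mul (h2 i j) ((h3 j).trans ?_) (abs_nonneg _) h20
  exact (mul_le_mul_of_nonneg_right (le_abs_self C3) h4.le).trans (mul_le_of_le_one_right (abs_nonneg _) h5)

lemma isLittleO_integral_plugIn {C C' : ℝ} {b : ℕ → VarComp q} {G : ∀ k, Set (((D k).RE → ℝ) × (Fin (D k).n → ℝ))}
    {X : ∀ k, ((D k).RE → ℝ) × (Fin (D k).n → ℝ) → VarComp q}
    (hC : CanonicalModel (fun k => (D k).noise σ) (rate D σ)
      (fun k => (D k).normErr (T k) σ) (fun k => (D k).normV (T k) σ) (invInfo D T σ) C)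
    (hX : LocalRoot (fun k => (D k).noise σ) (rate D σ) (fun k => (D k).normErr (T k) σ)
      (fun k => (D k).normV (T k) σ) C' G X b) :
    (∀ᶠ k in atTop, Integrable (fun ω => plugIn D T σ l m c k (X k ω)) ((D k).noise σ)) ∧
    (fun k => (∫ ω, plugIn D T σ l m c k (X k ω) ∂((D k).noise σ)) - ((D k).g1 (m k) σ + (D k).g2 (l k) (m k) σ
      + quadTerm D T σ l m k - linTerm D T σ l m b k - c k)) =o[atTop] fun k => rate D σ k ^ 2 := by
  obtain ⟨B, hB⟩ := h.exists_abs_normDir_le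
  obtain ⟨Cs, hCs0, hCs⟩ := h.exists_abs_slope_le
  have hXi := fun i => (LocalRoot.stochOrder hC hX i).integrable
  have hXX := fun i j => ((LocalRoot.stochOrder hC hX i).mul h.smallScale (LocalRoot.stochOrder hC hX j)).integrable
  have hQ := (LocalRoot.order_quadratic_sub hC hX hB).integrable
  have hint : ∀ᶠ k in atTop, Integrable (fun ω => (∑ i, X k ω i • (D k).normDir (l k) (m k) (T k) σ i) ⬝ᵥ
      (resolv ((D k).normV (T k) σ) (X k ω) *ᵥ ∑ i, X k ω i • (D k).normDir (l k) (m k) (T k) σ i))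
      ((D k).noise σ) := by
    filter_upwards [hQ, eventually_all.2 fun i => eventually_all.2 (hXX i)] with k h1 h2
    have h3 : Integrable (fun ω => ∑ i, ∑ j, (D k).normDir (l k) (m k) (T k) σ i ⬝ᵥ
        (D k).normDir (l k) (m k) (T k) σ j * (X k ω i * X k ω j)) ((D k).noise σ) :=
      integrable_finsetSum _ fun i _ => integrable_finsetSum _ fun j _ => (h2 i j).const_mul _
    simpa using h1.fun_add h3
  have hsum : ∀ᶠ k in atTop, Integrable (fun ω => ∑ i, ((D k).d σ i)⁻¹ * (D k).mseSlope (l k) (m k) σ i * X k ω i)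
      ((D k).noise σ) := by
    filter_upwards [eventually_all.2 hXi] with k h1 using integrable_finsetSum _ fun i _ => (h1 i).const_mul _
  refine ⟨?_, ?_⟩
  · filter_upwards [hint, hsum] with k h1 h2 using ((integrable_const _).add h2).sub h1
  · have h1 := LocalRoot.integral_quadratic_correction hC hX hB
    have h2 : (fun k => ∑ i, ((D k).d σ i)⁻¹ * (D k).mseSlope (l k) (m k) σ i *
        ((∫ ω, X k ω i ∂((D k).noise σ)) + (invInfo D T σ k *ᵥ b k) i)) =o[atTop] fun k => rate D σ k ^ 2 := by
      refine IsLittleO.fun_sum fun i _ => ?_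
      have hO : (fun k => ((D k).d σ i)⁻¹ * (D k).mseSlope (l k) (m k) σ i) =O[atTop] rate D σ := by
        refine IsBigO.of_bound Cs ?_
        filter_upwards [hCs, h.smallScale.pos] with k h3 h4
        rw [norm_of_nonneg h4.le]; exact h3 i
      simpa only [pow_two] using hO.mul_isLittleO (LocalRoot.integral_apply hC hX i)
    refine (h2.sub h1).congr' ?_ EventuallyEq.rfl
    filter_upwards [hint, hsum, eventually_all.2 hXi] with k h3 h4 h5
    have h6 : Integrable (fun ω => (D k).g1 (m k) σ + (D k).g2 (l k) (m k) σ + 2 * quadTerm D T σ l m k - c k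
        + ∑ i, ((D k).d σ i)⁻¹ * (D k).mseSlope (l k) (m k) σ i * X k ω i) ((D k).noise σ) :=
      (integrable_const _).add h4
    simp only [plugIn]
    rw [integral_sub h6 h3, integral_add (integrable_const _) h4,
      integral_const, integral_finsetSum _ fun i _ => (h5 i).const_mul _, quadTerm, linTerm]
    simp only [integral_const_mul, mul_add, sum_add_distrib, probReal_univ, one_smul]; ring

/-- The expectation of a truncated plug-in estimator of the MSE, to second order. -/
lemma isLittleO_truncated (hs : ScoreBias D σ lik bias) (he : IsScoreRoot D β σ lik est)
    (hN : (fun a : ℕ × VarComp q => N a.1 a.2 - ((D a.1).g1 (m a.1) a.2 + (D a.1).g2 (l a.1) (m a.1) a.2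
      + 2 * quadTerm D T σ l m a.1 - c a.1)) =o[near D σ] fun a => rate D σ a.1 ^ 2)
    (hNm : ∀ k, ∃ f : VarComp q → ℝ, Measurable f ∧ ∀ τ ∈ (D k).admissible, N k τ = f τ)
    (hc : ∃ C : ℝ, 0 ≤ C ∧ ∀ᶠ k in atTop, |c k| ≤ C) {fb : ℕ → ℝ} (hfb : ∃ C : ℝ, ∀ᶠ k in atTop, |fb k| ≤ C)
    {c₀ lam : ℝ} (hc₀ : 0 < c₀) (hlam : 0 < lam) :
    (fun k => (∫ ω, truncateAt (c₀ * (D k).dstar σ ^ lam) (fb k) (N k (est k ((D k).obs (β k) ω))) ∂((D k).noise σ))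
      - ((D k).g1 (m k) σ + (D k).g2 (l k) (m k) σ + quadTerm D T σ l m k
        - linTerm D T σ l m (fun k i => ((D k).d σ i)⁻¹ * bias k σ i) k - c k)) =o[atTop] fun k => rate D σ k ^ 2 := by
  obtain ⟨C, hC⟩ := h.canonicalModel
  obtain ⟨C', hX⟩ := h.localRoot hs he
  obtain ⟨hLi, hL⟩ := h.isLittleO_integral_plugIn hC hX
  obtain ⟨Cc, hCc0, hCc⟩ := hc
  obtain ⟨Cf, hCf⟩ := hfb
  obtain ⟨Cg, hCg0, hCg⟩ := h.exists_abs_g1_add_g2_le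
  obtain ⟨Cn, hCn0, hCn⟩ := h.exists_near_abs_g1_add_g2_le
  obtain ⟨Cq, hCq0, hCq⟩ := h.exists_abs_quadTerm_le
  set L : ∀ k, ((D k).RE → ℝ) × (Fin (D k).n → ℝ) → ℝ := fun k ω =>
    plugIn D T σ l m c k (trimmedParam D T σ bias est k ((D k).normErr (T k) σ ω)) with hLdef
  set tr : ∀ k, ((D k).RE → ℝ) × (Fin (D k).n → ℝ) → ℝ := fun k ω =>
    truncateAt (c₀ * (D k).dstar σ ^ lam) (fb k) (N k (est k ((D k).obs (β k) ω))) with htr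
  set G := fun k => (D k).normErr (T k) σ ⁻¹' goodSet D T σ bias est k
  have hti : ∀ k, Integrable (tr k) ((D k).noise σ) := fun k => integrable_truncateAt he (hNm k) _ _
  obtain ⟨cp, hcp⟩ := hX.prob (3 + lam) (by linarith)
  have hbig := ((tendsto_rpow_atTop hlam).comp h.scale).const_mul_atTop hc₀
  have hgood : ∀ δ : ℝ, 0 < δ → ∀ᶠ k in atTop, ∀ ω ∈ G k, |tr k ω - L k ω| ≤ δ * rate D σ k ^ 2 := by
    intro δ hδ; have h1 := eventually_near.1 (hN.def hδ); have h2 := eventually_near.1 hCn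
    have h3 := eventually_near.1 h.eventually_near_pos
    filter_upwards [h1, h2, h3, hCc, hCq, h.smallScale.pos, h.smallScale.le one_pos, h.d_pos,
      hbig.eventually_ge_atTop (δ + (Cn + 2 * Cq + Cc))] with k h1 h2 h3 h4 h5 hk hk1 hd h6 ω hω
    have hinv := (D k).apply_obs_of_invariant (h.contrast k) (h.posDef k) (he.invariant k) (β k) ω
    simp only [htr, hLdef]; rw [trimmedParam_of_mem hω]; have hx := hω.2; set τ := est k ((D k).obs (β k) ω) with hτ
    have hloc : localParam D T σ est k ((D k).normErr (T k) σ ω) = (D k).normParam σ τ := by rw [localParam, ← hinv]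
    rw [hloc] at hx ⊢
    have hnorm : ‖(D k).normParam σ τ‖ ≤ rate D σ k ^ (-(1 / 4) : ℝ) := by
      refine (pi_norm_le_iff_of_nonneg (rpow_nonneg hk.le _)).2 fun i => (hx i).trans ?_
      exact rpow_le_rpow_of_exponent_ge hk hk1 (by norm_num)
    have hpd : ((D k).Sig τ).PosDef := (he.mem k _).2
    have h7 := h1 τ hnorm
    simp only [norm_eq_abs, abs_of_nonneg (sq_nonneg (rate D σ k))] at h7
    have e : plugIn D T σ l m c k ((D k).normParam σ τ) = (D k).g1 (m k) τ + (D k).g2 (l k) (m k) τ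
        + 2 * quadTerm D T σ l m k - c k := by
      rw [(D k).g1_add_g2_eq_norm (l k) (m k) (h.contrast k) (h.posDef k) hd hpd, plugIn]
      simp only [mul_comm ((D k).normParam σ τ _)]; ring
    have hsq : rate D σ k ^ 2 ≤ 1 := pow_le_one₀ hk.le hk1
    have hle : |N k τ| ≤ c₀ * (D k).dstar σ ^ lam := by
      refine le_trans ?_ h6
      have a1 := abs_le.1 h7
      have a2 := abs_le.1 (h2 τ hnorm)
      have a3 := abs_le.1 h4
      have a4 := abs_le.1 h5
      have a5 := mul_le_of_le_one_right hδ.le hsq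
      exact abs_le.2 ⟨by linarith, by linarith⟩
    rw [truncateAt, if_pos hle, e]; exact h7
  have hdiff : (fun k => ∫ ω, (tr k ω - L k ω) ∂((D k).noise σ)) =o[atTop] fun k => rate D σ k ^ 2 := by
    refine IsLittleO.of_bound fun δ hδ => ?_
    set M := (c₀ + (|Cf| + (Cg + 2 * Cq + Cc))) * |cp| with hM
    filter_upwards [hgood (δ / 2) (by positivity), hLi, hcp, hCf, hCg, hCq, hCc, h.smallScale.pos,
      h.smallScale.le one_pos, h.smallScale.rpow_le (c := δ / 2 / (M + 1)) one_pos (by positivity)] with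
      k h1 h2 h3 h4 h5 h6 h7 hk hk1 h8
    have hbad : ∀ ω ∉ G k, |tr k ω - L k ω| ≤ (c₀ + (|Cf| + (Cg + 2 * Cq + Cc))) * rate D σ k ^ (-lam) := by
      intro ω hω
      have e : L k ω = (D k).g1 (m k) σ + (D k).g2 (l k) (m k) σ + 2 * quadTerm D T σ l m k - c k := by
        simp only [hLdef]; rw [trimmedParam_of_notMem hω]; simp [plugIn]
      have b1 := abs_truncateAt_le (c₀ * (D k).dstar σ ^ lam) (fb k) (N k (est k ((D k).obs (β k) ω)))
      have b0 : |c₀ * (D k).dstar σ ^ lam| = c₀ * rate D σ k ^ (-lam) := by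
        rw [h.rate_rpow_neg, abs_of_nonneg (mul_nonneg hc₀.le (rpow_nonneg ((D k).dstar_nonneg σ) _))]
      rw [b0] at b1
      have b2 : |L k ω| ≤ Cg + 2 * Cq + Cc := by
        rw [e]; have a2 := abs_le.1 h5; have a3 := abs_le.1 h6; have a4 := abs_le.1 h7
        exact abs_le.2 ⟨by linarith, by linarith⟩
      have b3 : 1 ≤ rate D σ k ^ (-lam) := one_le_rpow_of_pos_of_le_one_of_nonpos hk hk1 (by linarith)
      have b4 : 0 ≤ |Cf| + (Cg + 2 * Cq + Cc) := by positivity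
      have b5 := h4.trans (le_abs_self Cf)
      have b6 := le_mul_of_one_le_right b4 b3
      refine (abs_sub _ _).trans ?_
      rw [add_mul]; simp only [htr]; linarith
    have hm : ∀ ω, ‖tr k ω - L k ω‖ ≤ δ / 2 * rate D σ k ^ 2 + (G k)ᶜ.indicator
        (fun _ => (c₀ + (|Cf| + (Cg + 2 * Cq + Cc))) * rate D σ k ^ (-lam)) ω := fun ω => by
      by_cases hω : ω ∈ G k
      · rw [Set.indicator_of_notMem (by simpa using hω), add_zero]; exact h1 ω hω
      · rw [Set.indicator_of_mem (by simpa using hω)]; have := hbad ω hω; rw [norm_eq_abs]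
        have : 0 ≤ δ / 2 * rate D σ k ^ 2 := by positivity
        linarith
    have hii : Integrable ((G k)ᶜ.indicator
        (fun _ => (c₀ + (|Cf| + (Cg + 2 * Cq + Cc))) * rate D σ k ^ (-lam))) ((D k).noise σ) :=
      (integrable_const _).indicator (hX.measG k).compl
    refine (norm_integral_le_integral_norm _).trans ((integral_mono ((hti k).sub h2).norm
      ((integrable_const _).add hii) hm).trans ?_)
    simp only [Pi.add_apply]
    rw [integral_add (integrable_const _) hii, integral_indicator (hX.measG k).compl, integral_const,
      setIntegral_const, probReal_univ, one_smul, smul_eq_mul, norm_of_nonneg (sq_nonneg _)]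
    have h9 : ((D k).noise σ).real (G k)ᶜ * ((c₀ + (|Cf| + (Cg + 2 * Cq + Cc))) * rate D σ k ^ (-lam))
        ≤ M * rate D σ k ^ (1 : ℝ) * rate D σ k ^ 2 := by
      have e3 : rate D σ k ^ (3 + lam) * rate D σ k ^ (-lam) = rate D σ k ^ (1 : ℝ) * rate D σ k ^ 2 := by
        rw [← rpow_two, ← rpow_add hk, ← rpow_add hk]; norm_num
      have hr := rpow_nonneg hk.le
      calc _ ≤ |cp| * rate D σ k ^ (3 + lam) * ((c₀ + (|Cf| + (Cg + 2 * Cq + Cc))) * rate D σ k ^ (-lam)) := by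
            refine mul_le_mul_of_nonneg_right (h3.trans (mul_le_mul_of_nonneg_right (le_abs_self _) (hr _))) ?_
            exact mul_nonneg (by positivity) (hr _)
        _ = M * (rate D σ k ^ (3 + lam) * rate D σ k ^ (-lam)) := by rw [hM]; ring
        _ = _ := by rw [e3]; ring
    have hM0 : 0 ≤ M := by positivity
    have h10 : M * rate D σ k ^ (1 : ℝ) ≤ δ / 2 := by
      refine (mul_le_mul_of_nonneg_left h8 hM0).trans ?_
      rw [mul_div_assoc', div_le_iff₀ (by positivity), mul_comm]
      exact mul_le_mul_of_nonneg_left (by linarith) (by positivity)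
    have h11 := mul_le_mul_of_nonneg_right h10 (sq_nonneg (rate D σ k))
    linarith
  refine (hdiff.add hL).congr' ?_ EventuallyEq.rfl
  filter_upwards [hLi] with k h1
  rw [integral_sub (hti k) h1]; ring

lemma tendsto_near_bias (hs : ScoreBias D σ lik bias) (i : Fin (q + 1)) :
    Tendsto (fun a : ℕ × VarComp q => bias a.1 a.2 i - bias a.1 σ i) (near D σ) (𝓝 0) := by
  obtain ⟨C, hC0, hC⟩ := hs.lip
  have h1 : Tendsto (fun a : ℕ × VarComp q => C * ∑ j, |a.2 j - σ j|) (near D σ) (𝓝 0) := by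
    have := (tendsto_finsetSum univ fun j _ =>
      ((h.tendsto_near_param j).sub_const (σ j)).abs).const_mul C
    simpa using this
  refine squeeze_zero_norm' ?_ h1
  filter_upwards [tendsto_fst_near.eventually hC, h.eventually_near_pos] with a h2 h3
  exact h2 a.2 σ h3 (fun i => half_lt_self (h.pos i)) i

lemma isLittleO_etaTwo (hA : NormInfo D T σ A) :
    (fun a : ℕ × VarComp q => (D a.1).etaTwo (A a.1) (l a.1) (m a.1) a.2 - ((D a.1).g1 (m a.1) a.2
      + (D a.1).g2 (l a.1) (m a.1) a.2 + 2 * quadTerm D T σ l m a.1)) =o[near D σ] fun a => rate D σ a.1 ^ 2 := by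
  refine ((h.isLittleO_g3 hA).const_mul_left 2).congr (fun a => ?_) fun _ => rfl
  rw [AnovaDesign.etaTwo]; ring

/-- The plug-in estimator of the MSE for an estimator with unbiased or biased score. -/
lemma isLittleO_etaTwo_sub_mse (hA : NormInfo D T σ A) (hs : ScoreBias D σ lik bias)
    (hexp : HasBlupExpansion D β σ l m) (he : IsScoreRoot D β σ lik est) {c₀ lam : ℝ} (hc₀ : 0 < c₀)
    (hlam : 0 < lam) {σs : VarComp q} (hσs : σs ∈ interior (paramSpace q)) :
    (fun k => (∫ ω, truncateAt (c₀ * (D k).dstar σ ^ lam) ((D k).eta (A k) (l k) (m k) σs)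
        ((D k).etaTwo (A k) (l k) (m k) (est k ((D k).obs (β k) ω))) ∂((D k).noise σ))
      - (D k).mse (l k) (m k) (β k) σ (est k)
      + linTerm D T σ l m (fun k i => ((D k).d σ i)⁻¹ * bias k σ i) k) =o[atTop] fun k => rate D σ k ^ 2 := by
  obtain ⟨H, hH⟩ := h.exists_blupEnvelope hexp
  have h1 := h.isLittleO_truncated (c := fun _ => 0) hs he
    (by simpa only [sub_zero] using h.isLittleO_etaTwo hA) (exists_meas_etaTwo hA) ⟨0, le_rfl, by simp⟩
    (h.exists_abs_eta_le hA (mem_interior_paramSpace.1 hσs)) hc₀ hlam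
  refine (h1.sub (h.isLittleO_mse hH hs he)).congr (fun k => ?_) fun _ => rfl
  ring

lemma integrable_sq_error (hexp : HasBlupExpansion D β σ l m) (he : IsScoreRoot D β σ lik est) (k : ℕ) :
    Integrable (fun ω => ((D k).blup (l k) (m k) (est k ((D k).obs (β k) ω)) ((D k).obs (β k) ω)
      - (D k).target (l k) (m k) (β k) ω) ^ 2) ((D k).noise σ) := by
  obtain ⟨H, hH⟩ := h.exists_blupEnvelope hexp
  exact ((D k).mse_eq_add (l k) (m k) (h.contrast k) (h.mem_admissible k) (he.measurable k) (he.mem k)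
    (he.invariant k) (β k) (h.memLp_blup_sub hH he k)).1

section MaximumLikelihood
variable (hp : ∃ p₀ : ℕ, ∀ k, (D k).p ≤ p₀)
include hp

lemma isLittleO_near_g10 : (fun a : ℕ × VarComp q => (D a.1).g10 (m a.1) a.2
    + linTerm D T σ l m (fun k i => ((D k).d σ i)⁻¹ * (D k).gM0 σ i) a.1) =o[near D σ] fun a => rate D σ a.1 ^ 2 := by
  have hs := h.scoreBias_logLikP hp
  have hb := h.tendsto_near_bias hs
  have h0 := h.isLittleO_slope_inv (h.normInfo_AM hp) hs.bdd hb
  refine h0.neg_left.congr (fun a => ?_) fun _ => rfl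
  rw [matrix_inv_neg, neg_mulVec, dotProduct_neg, AnovaDesign.g10]; ring

lemma isLittleO_g10 : (fun k => (D k).g10 (m k) σ
    + linTerm D T σ l m (fun k i => ((D k).d σ i)⁻¹ * (D k).gM0 σ i) k) =o[atTop] fun k => rate D σ k ^ 2 := by
  have := (h.isLittleO_near_g10 hp).comp_tendsto tendsto_near_true
  simpa only [Function.comp_def] using this

/-- The plug-in estimator of the MSE with the bias of the estimator taken into account. -/
lemma isLittleO_etaTwo_sub_g10_sub_mse (hexp : HasBlupExpansion D β σ l m)
    (he : IsScoreRoot D β σ (fun k => (D k).logLikP) est) {c₀ lam : ℝ} (hc₀ : 0 < c₀)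
    (hlam : 0 < lam) {σs : VarComp q} (hσs : σs ∈ interior (paramSpace q)) :
    (fun k => (∫ ω, truncateAt (c₀ * (D k).dstar σ ^ lam) ((D k).eta (D k).AM (l k) (m k) σs)
        ((D k).etaTwo (D k).AM (l k) (m k) (est k ((D k).obs (β k) ω))
          - (D k).g10 (m k) (est k ((D k).obs (β k) ω))) ∂((D k).noise σ))
      - (D k).mse (l k) (m k) (β k) σ (est k)) =o[atTop] fun k => rate D σ k ^ 2 := by
  obtain ⟨H, hH⟩ := h.exists_blupEnvelope hexp
  have hA := h.normInfo_AM hp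
  have hs := h.scoreBias_logLikP hp
  obtain ⟨C, hC0, hC⟩ := h.exists_abs_linTerm_le (h.isBig_bias hs)
  have h1 := h.isLittleO_truncated (N := fun k τ => (D k).etaTwo (D k).AM (l k) (m k) τ - (D k).g10 (m k) τ)
    (c := fun k => -linTerm D T σ l m (fun k i => ((D k).d σ i)⁻¹ * (D k).gM0 σ i) k) hs he
    (((h.isLittleO_etaTwo hA).sub (h.isLittleO_near_g10 hp)).congr (fun a => by ring) fun _ => rfl)
    (fun k => ?_) ⟨C, hC0, by grind⟩
    (h.exists_abs_eta_le hA (mem_interior_paramSpace.1 hσs)) hc₀ hlam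
  · refine (h1.sub (h.isLittleO_mse hH hs he)).congr (fun k => ?_) fun _ => rfl
    ring
  · obtain ⟨f, hf, hfe⟩ := exists_meas_etaTwo (l := l) (m := m) hA k
    obtain ⟨g, hg, hge⟩ := exists_meas_g10 (m := m) hA k
    exact ⟨_, hf.sub hg, fun τ hτ => by aesop⟩

end MaximumLikelihood

lemma rootEst_mem (k : ℕ) (y) : rootEst D T σ bias k y ∈ (D k).admissible := by
  rw [rootEst]
  split_ifs with h1
  · have h2 := fun i => (half_pos (h.pos i)).trans_le (h1 i)
    exact ⟨fun i => (h2 i).le, (D k).posDef_of_pos h2⟩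
  · exact h.mem_admissible k

/-- Consistent solutions of the score equations exist. -/
theorem exists_isScoreRoot (hs : ScoreBias D σ lik bias) (hb : ∀ k i, Measurable fun τ => bias k τ i) :
    ∃ est, IsScoreRoot D β σ lik est := by
  refine ⟨rootEst D T σ bias, meas_rootEst hb, h.rootEst_mem, fun k y => ?_, fun k y b => ?_,
    fun ρ hρ0 hρ1 g hg => ?_⟩
  · rw [rootEst, rootEst, mulVec_neg, newtonLimit_neg]
  · have := ((D k).stdCtr_spec (h.contrast k) (h.posDef k)).1.mul_X
    rw [rootEst, rootEst, mulVec_add, mulVec_mulVec, this, zero_mulVec, add_zero]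
  obtain ⟨C, hC⟩ := h.canonicalModel
  obtain ⟨C1, hC1⟩ := h.isBig_bias hs
  obtain ⟨C2, hC20, hC2⟩ := hs.lip
  have hpos := eventually_near.1 h.eventually_near_pos
  set b : ℕ → (VarComp q) → VarComp q := fun k x i =>
    ((D k).d σ i)⁻¹ * bias k (shiftParam D σ k x) i with hbdef
  have hb0 : ∀ᶠ k in atTop, ∀ i, |b k 0 i| ≤ (|C1| + C2 * (q + 1)) * rate D σ k := by
    filter_upwards [hC1, h.smallScale.pos] with k h1 h2 i
    have : shiftParam D σ k 0 = σ := by funext i; simp [shiftParam]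
    simp only [hbdef]; rw [this]; refine (h1 i).trans (mul_le_mul_of_nonneg_right ?_ h2.le)
    have := le_abs_self C1
    have : 0 ≤ C2 * (q + 1) := by positivity
    linarith
  have hbl : ∀ᶠ k in atTop, ∀ x x' : VarComp q, ‖x‖ ≤ rate D σ k ^ (-(1 / 4) : ℝ) →
      ‖x'‖ ≤ rate D σ k ^ (-(1 / 4) : ℝ) → ∀ i, |b k x i - b k x' i|
        ≤ (|C1| + C2 * (q + 1)) * rate D σ k * ‖x - x'‖ := by
    filter_upwards [hC2, hpos, h.d_pos, h.d_inv_le, h.smallScale.pos, h.smallScale.le one_pos] with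
      k h1 h2 hd hdi hk hk1 x x' hx hx' i
    have h3 := h1 _ _ (h2 (shiftParam D σ k x) (by rwa [normParam_shiftParam hd]))
      (h2 (shiftParam D σ k x') (by rwa [normParam_shiftParam hd])) i
    have h4 : ∑ j, |shiftParam D σ k x j - shiftParam D σ k x' j| ≤ (q + 1) * ‖x - x'‖ := by
      refine (sum_le_card_nsmul univ _ ‖x - x'‖ fun j _ => ?_).trans (by simp)
      rw [shiftParam, shiftParam, add_sub_add_left_eq_sub, ← mul_sub, abs_mul, abs_of_pos (inv_pos.2 (hd j))]
      exact (mul_le_mul ((hdi j).trans hk1) (norm_le_pi_norm (x - x') j) (abs_nonneg _) zero_le_one).trans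
        (one_mul _).le
    simp only [hbdef]; rw [← mul_sub, abs_mul, abs_of_pos (inv_pos.2 (hd i))]
    calc _ ≤ rate D σ k * (C2 * ((q + 1) * ‖x - x'‖)) :=
          mul_le_mul (hdi i) (h3.trans (mul_le_mul_of_nonneg_left h4 hC20)) (abs_nonneg _) hk.le
      _ = (C2 * (q + 1)) * (rate D σ k * ‖x - x'‖) := by ring
      _ ≤ (|C1| + C2 * (q + 1)) * (rate D σ k * ‖x - x'‖) :=
          mul_le_mul_of_nonneg_right (by linarith [abs_nonneg C1]) (by positivity)
      _ = _ := by ring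
  set η := min ((1 - ρ) / 2) (1 / 4)
  have hη0 : 0 < η := lt_min (by linarith) (by norm_num)
  have hη1 : η ≤ (1 - ρ) / 2 := min_le_left _ _
  have hη2 : η ≤ 1 / 4 := min_le_right _ _
  obtain ⟨c, hc0, hc⟩ := hC.exists_root hb0 hbl hη0 g
  refine ⟨c, ?_⟩
  filter_upwards [hc, hpos, h.d_pos, h.smallScale.pos, h.smallScale.le one_pos,
    h.smallScale.rpow_le (r := (1 - ρ) / 2) (c := (sqrt (q + 1))⁻¹) (by linarith) (by positivity)] with
    k h1 hp hd hk hk1 hsm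
  have hg' : (D k).dstar σ ^ (-g) = rate D σ k ^ g := by rw [← h.rate_rpow_neg, neg_neg]
  rw [hg']; refine (measureReal_mono fun ω hω => ?_).trans h1
  simp only [Set.mem_ofPred_eq] at hω ⊢
  contrapose! hω
  obtain ⟨x, hx1, hx2, hx3⟩ := hω
  have hlim : newtonLimit D T σ bias k (((D k).stdCtr (T k) σ)ᵀ *ᵥ (D k).obs (β k) ω) = x := by
    rw [(D k).stdCtr_obs (h.contrast k) (h.posDef k)]; exact hx1.limUnder_eq
  have hx4 : ‖(D k).normParam σ (shiftParam D σ k x)‖ ≤ rate D σ k ^ (-(1 / 4) : ℝ) := by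
    rw [normParam_shiftParam hd]; exact hx3.le.trans (rpow_le_rpow_of_exponent_ge hk hk1 (by linarith))
  have hτ := hp _ hx4
  have hest : rootEst D T σ bias k ((D k).obs (β k) ω) = shiftParam D σ k x := by
    rw [rootEst, hlim, if_pos fun i => (hτ i).le]
  have hpd := (D k).posDef_of_pos fun i => (half_pos (h.pos i)).trans (hτ i)
  rw [hest]; refine ⟨fun i => ?_, ?_⟩
  · rw [hs.score k _ hpd, (D k).score_eq_stdScore (h.contrast k) (h.posDef k) hd hpd,
      (D k).stdCtr_obs (h.contrast k) (h.posDef k), normParam_shiftParam hd, hx2 i,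
      mul_inv_cancel_left₀ (hd i).ne', sub_self]
  · have h3 : ∀ i, (D k).d σ i * (shiftParam D σ k x i - σ i) = x i := fun i =>
      congrFun (normParam_shiftParam hd x) i
    simp_rw [h3]
    have h4 : ∑ i, x i ^ 2 ≤ (q + 1) * ‖x‖ ^ 2 := by
      refine (sum_le_card_nsmul univ _ (‖x‖ ^ 2) fun j _ => ?_).trans (by simp)
      rw [← sq_abs]; exact pow_le_pow_left₀ (abs_nonneg _) (norm_le_pi_norm x j) 2
    rw [← h.rate_rpow_neg]
    have h5 : rate D σ k ^ (-η) ≤ rate D σ k ^ (-((1 - ρ) / 2)) := rpow_le_rpow_of_exponent_ge hk hk1 (by linarith)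
    have h6 : sqrt (q + 1) * rate D σ k ^ ((1 - ρ) / 2) ≤ 1 := by
      exact (mul_le_mul_of_nonneg_left hsm (sqrt_nonneg _)).trans (le_of_eq (mul_inv_cancel₀ (by positivity)))
    have h7 : rate D σ k ^ (-((1 - ρ) / 2)) = rate D σ k ^ ((1 - ρ) / 2) * rate D σ k ^ (-(1 - ρ)) := by
      rw [← rpow_add hk]; congr 1; ring
    have hsq : 0 < sqrt (q + 1) := by positivity
    calc sqrt (∑ i, x i ^ 2) ≤ sqrt ((q + 1) * ‖x‖ ^ 2) := sqrt_le_sqrt h4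
      _ = sqrt (q + 1) * ‖x‖ := by rw [sqrt_mul (by positivity), sqrt_sq (norm_nonneg _)]
      _ < sqrt (q + 1) * rate D σ k ^ (-((1 - ρ) / 2)) := mul_lt_mul_of_pos_left (hx3.trans_le h5) hsq
      _ = (sqrt (q + 1) * rate D σ k ^ ((1 - ρ) / 2)) * rate D σ k ^ (-(1 - ρ)) := by rw [h7]; ring
      _ ≤ _ := mul_le_of_le_one_left (rpow_nonneg hk.le _) h6

end AnovaRegime
end Regime

end

theorem mainTheorem6 {q : ℕ} (D : ℕ → AnovaDesign q) (hrank : ∀ k, (D k).X.rank = (D k).p) (hpn : ∀ k, (D k).p < (D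
    k).n) (T : ∀ k, Matrix (Fin (D k).n) (Fin ((D k).n - (D k).p)) ℝ) (hTrank : ∀ k, (T k).rank = (D k).n - (D k).p)
    (hTX : ∀ k, (T k)ᵀ * (D k).X = 0) (β : ∀ k, Fin (D k).p → ℝ) (σ : VarComp q) (hσ : σ ∈ interior (paramSpace q))
    (hd : Tendsto (fun k => (D k).dstar σ) atTop atTop) (hA : ∃ κ : ℝ, 0 < κ ∧ ∀ᶠ k in atTop, (-(Matrix.diagonal (fun
    i => ((D k).d σ i)⁻¹) * (D k).AR (T k) σ * Matrix.diagonal (fun i => ((D k).d σ i)⁻¹)) - κ • (1 : Matrix (Fin (q +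
    1)) (Fin (q + 1)) ℝ)).PosSemidef) (l : ∀ k, Fin (D k).p → ℝ) (m : ∀ k, (D k).RE → ℝ) (hm : ∃ C : ℝ, ∀ k, ∑ a, m k
    a ^ 2 ≤ C) (hg2 : ∀ τ ∈ interior (paramSpace q), Tendsto (fun k => (D k).g2 (l k) (m k) τ) atTop (𝓝 0)) (hexp :
    HasBlupExpansion D β σ l m) : ((∀ k i, Integrable (fun ω => pderiv i (fun τ => (D k).logLikR (T k) τ ((D k).obs (β
    k) ω)) σ) ((D k).noise σ) ∧ ∫ ω, pderiv i (fun τ => (D k).logLikR (T k) τ ((D k).obs (β k) ω)) σ ∂((D k).noise σ)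
    = 0) ∧ (∃ est, IsScoreRoot D β σ (fun k => (D k).logLikR (T k)) est) ∧ ∀ est, IsScoreRoot D β σ (fun k => (D
    k).logLikR (T k)) est → (∀ k, Integrable (fun ω => ((D k).blup (l k) (m k) (est k ((D k).obs (β k) ω)) ((D k).obs
    (β k) ω) - (D k).target (l k) (m k) (β k) ω) ^ 2) ((D k).noise σ)) ∧ ∀ c₀ : ℝ, 0 < c₀ → ∀ lam : ℝ, 0 < lam → ∀ σs
    ∈ interior (paramSpace q), (∀ k, Integrable (fun ω => truncateAt (c₀ * (D k).dstar σ ^ lam) ((D k).eta ((D k).AR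
    (T k)) (l k) (m k) σs) ((D k).etaTwo ((D k).AR (T k)) (l k) (m k) (est k ((D k).obs (β k) ω)))) ((D k).noise σ)) ∧
    (fun k => (∫ ω, truncateAt (c₀ * (D k).dstar σ ^ lam) ((D k).eta ((D k).AR (T k)) (l k) (m k) σs) ((D k).etaTwo
    ((D k).AR (T k)) (l k) (m k) (est k ((D k).obs (β k) ω))) ∂((D k).noise σ)) - (D k).mse (l k) (m k) (β k) σ (est
    k)) =o[atTop] fun k => ((D k).dstar σ ^ 2)⁻¹) ∧ ((∃ p₀ : ℕ, ∀ k, (D k).p ≤ p₀) → (∀ k i, Integrable (fun ω =>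
    pderiv i (fun τ => (D k).logLikP τ ((D k).obs (β k) ω)) σ) ((D k).noise σ) ∧ ∫ ω, pderiv i (fun τ => (D k).logLikP
    τ ((D k).obs (β k) ω)) σ ∂((D k).noise σ) = -(D k).gM0 σ i) ∧ (∃ est, IsScoreRoot D β σ (fun k => (D k).logLikP)
    est) ∧ ∀ est, IsScoreRoot D β σ (fun k => (D k).logLikP) est → (∀ k, Integrable (fun ω => ((D k).blup (l k) (m k)
    (est k ((D k).obs (β k) ω)) ((D k).obs (β k) ω) - (D k).target (l k) (m k) (β k) ω) ^ 2) ((D k).noise σ)) ∧ ∀ c₀ :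
    ℝ, 0 < c₀ → ∀ lam : ℝ, 0 < lam → ∀ σs ∈ interior (paramSpace q), (∀ k, Integrable (fun ω => truncateAt (c₀ * (D
    k).dstar σ ^ lam) ((D k).eta (D k).AM (l k) (m k) σs) ((D k).etaTwo (D k).AM (l k) (m k) (est k ((D k).obs (β k)
    ω)) - (D k).g10 (m k) (est k ((D k).obs (β k) ω)))) ((D k).noise σ)) ∧ (fun k => (∫ ω, truncateAt (c₀ * (D
    k).dstar σ ^ lam) ((D k).eta (D k).AM (l k) (m k) σs) ((D k).etaTwo (D k).AM (l k) (m k) (est k ((D k).obs (β k)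
    ω)) - (D k).g10 (m k) (est k ((D k).obs (β k) ω))) ∂((D k).noise σ)) - (D k).mse (l k) (m k) (β k) σ (est k))
    =o[atTop] (fun k => ((D k).dstar σ ^ 2)⁻¹) ∧ (fun k => (∫ ω, truncateAt (c₀ * (D k).dstar σ ^ lam) ((D k).eta (D
    k).AM (l k) (m k) σs) ((D k).etaTwo (D k).AM (l k) (m k) (est k ((D k).obs (β k) ω))) ∂((D k).noise σ)) - (D
    k).mse (l k) (m k) (β k) σ (est k) - (D k).g10 (m k) σ) =o[atTop] fun k => ((D k).dstar σ ^ 2)⁻¹) := by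
  have h := AnovaRegime.of_rank (T := T) (l := l) (m := m) hrank hpn hTrank hTX hσ hd hA hm hg2
  have hrate : (fun k => ((D k).dstar σ ^ 2)⁻¹) = fun k => AnovaRegime.rate D σ k ^ 2 :=
    funext fun k => (inv_pow _ 2).symm
  simp only [hrate]
  refine ⟨⟨fun k i => (D k).integral_scoreR (h.contrast k) (h.mem_admissible k) (β k) i,
    h.exists_isScoreRoot h.scoreBias_logLikR fun _ _ => measurable_const, fun est he =>
    ⟨h.integrable_sq_error hexp he, fun c₀ hc₀ lam hlam σs hσs => ⟨fun k =>
      AnovaRegime.integrable_truncateAt (N := fun k => (D k).etaTwo ((D k).AR (T k)) (l k) (m k)) he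
        (AnovaRegime.exists_meas_etaTwo h.normInfo_AR k) _ _, ?_⟩⟩⟩, fun hp =>
    ⟨fun k i => (D k).integral_scoreP (h.contrast k) (h.mem_admissible k) (β k) i,
    h.exists_isScoreRoot (h.scoreBias_logLikP hp) fun k i => (D k).meas_gM0 measurable_id i, fun est he =>
    ⟨h.integrable_sq_error hexp he, fun c₀ hc₀ lam hlam σs hσs => ⟨fun k =>
      AnovaRegime.integrable_truncateAt
        (N := fun k τ => (D k).etaTwo (D k).AM (l k) (m k) τ - (D k).g10 (m k) τ) he ?_ _ _,
      h.isLittleO_etaTwo_sub_g10_sub_mse hp hexp he hc₀ hlam hσs, ?_⟩⟩⟩⟩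
  · have h1 := h.isLittleO_etaTwo_sub_mse (A := fun k => (D k).AR (T k)) (bias := fun _ _ _ => 0)
      h.normInfo_AR h.scoreBias_logLikR hexp he hc₀ hlam hσs
    exact h1.congr_left fun k => by rw [AnovaRegime.linTerm_zero, add_zero]
  · obtain ⟨f, hf, hfe⟩ := AnovaRegime.exists_meas_etaTwo (l := l) (m := m) (h.normInfo_AM hp) k
    obtain ⟨g, hg, hge⟩ := AnovaRegime.exists_meas_g10 (m := m) (h.normInfo_AM hp) k
    exact ⟨_, hf.sub hg, fun τ hτ => by rw [hfe τ hτ, hge τ hτ]; rfl⟩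
  · have h1 := h.isLittleO_etaTwo_sub_mse (A := fun k => (D k).AM) (bias := fun k => (D k).gM0)
      (h.normInfo_AM hp) (h.scoreBias_logLikP hp) hexp he hc₀ hlam hσs
    exact (h1.sub (h.isLittleO_g10 hp)).congr_left fun k => by ring
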